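/- Let $\mathcal T>0$, $\mathbb T=\mathbb R/\mathcal T\mathbb Z$ with normalized Haar measure, $G=\mathbb T\times\mathbb R^3$ with the product of this measure and Lebesgue measure, and $\lambda>0$. For $g$ on $G$ let $\mathcal P g(x)=\int_{\mathbb T}g(t,x)\,dt$ and $\mathcal P_\perp g=g-\mathcal P g$. All derivatives $\partial_j,\nabla,\operatorname{curl},\operatorname{div}$ are weak and in the spatial variable only (unless $\partial_t$ is written), and $\wedge$ is the vector product in $\mathbb R^3$. **Fundamental solutions.** Let $s(x)=|x|+x_1$ and $$\Gamma_{0,j\ell}(x)=\frac1{4\pi\lambda}\big[\delta_{j\ell}\Delta-\partial_j\partial_\ell\big]\int_0^{s(\lambda x)/2}\frac{1-e^{-\tau}}{\tau}\,d\tau,\qquad \phi_0(x)=\frac1{4\pi|x|}e^{-s(\lambda x)/2}\qquad(x\ne0),$$ $$\Gamma_\perp=\mathscr F_G^{-1}\Big[\frac{1-\delta_{\mathbb Z}(k)}{|\xi|^2+i(\frac{2\pi}{\mathcal T}k-\lambda\xi_1)}\Big(I-\frac{\xi\otimes\xi}{|\xi|^2}\Big)\Big],\qquad \phi_\perp=\mathscr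 F_G^{-1}\Big[\frac{1-\delta_{\mathbb Z}(k)}{|\xi|^2+i(\frac{2\pi}{\mathcal T}k-\lambda\xi_1)}\Big],$$ where $\delta_{\mathbb Z}(k)=1$ if $k=0$ and $0$ otherwise, and $\mathscr F_G^{-1}$ is the inverse, in the sense of distributions, of the Fourier transform $\mathscr F_G[g](k,\xi)=\int_G g(t,x)e^{-i\frac{2\pi}{\mathcal T}kt-ix\cdot\xi}\,d(t,x)$, $(k,\xi)\in\mathbb Z\times\mathbb R^3$. Set $\Gamma^\lambda(t,x)=\Gamma_0(x)+\Gamma_\perp(t,x)$ and $\phi^\lambda(t,x)=\phi_0(x)+\phi_\perp(t,x)$. **Hypotheses.** Let $f\in L^q(G)^3$ for all $q\in(1,\infty)$ with compact support. Let $u\in L^1_{loc}(G)^3$ be a weak solution of $$\partial_tu-\Delta u-\lambda\partial_1u+u\cdot\nabla u+\nabla\mathfrak p=f,\qquad \operatorname{div}u=0\qquad\text{in }\mathbb T\times\mathbb R^3,\qquad \lim_{|x|\to\infty}u(t,x)=0,$$ that is, $\nabla u\in L^2(G)^{3\times 3}$, $u\in L^2(\mathbb T;L^6(\mathbb R^3))^3$,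 $\operatorname{div}u=0$, $\mathcal P_\perp u\in L^\infty(\mathbb T;L^2(\mathbb R^3))^3$, and $$\int_G\big[-u\cdot\partial_t\varphi+\nabla u:\nabla\varphi-\lambda\partial_1u\cdot\varphi+(u\cdot\nabla u)\cdot\varphi\big]\,d(t,x)=\int_G f\cdot\varphi\,d(t,x)$$ for all $\varphi\in C_0^\infty(G)^3$ with $\operatorname{div}\varphi=0$. Assume moreover that $\mathcal P_\perp u\in L^r(G)^3$ for some $r\in(5,\infty)$. Put $v=\mathcal Pu$ and $w=\mathcal P_\perp u$. **Conclusion.** $\Gamma_\perp$ and $\phi_\perp$ are (represented by) locally integrable real functions on $G$; the functions $\Gamma_0,\Gamma_\perp,\Gamma^\lambda,\phi_0,\phi_\perp,\phi^\lambda,v,w$ are locally integrable with locally integrable first-order weak spatial derivatives; and the following identities hold almost everywhere, with absolutely convergent integrals. For all $\alpha\in\mathbb N_0^3$ with $|\alpha|\le1$, $$D_x^\alpha u=D_x^\alpha\Gamma^\lambda\ast_G\big[f-\operatorname{curl}u\wedge u\big],$$ $$D_x^\alpha v=D_x^\alpha\Gamma_0\ast_{\mathbb R^3}\big[\mathcal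 Pf-\operatorname{curl}v\wedge v-\mathcal P(\operatorname{curl}w\wedge w)\big],$$ $$D_x^\alpha w=D_x^\alpha\Gamma_\perp\ast_G\big[\mathcal P_\perp f-\operatorname{curl}v\wedge w-\operatorname{curl}w\wedge v-\mathcal P_\perp(\operatorname{curl}w\wedge w)\big].$$ Moreover, $$\operatorname{curl}u(t,x)=\int_G\nabla\phi^\lambda(t-s,x-y)\wedge\big[f-\operatorname{curl}u\wedge u\big](s,y)\,d(s,y),$$ $$\operatorname{curl}v(x)=\int_{\mathbb R^3}\nabla\phi_0(x-y)\wedge\big[\mathcal Pf-\operatorname{curl}v\wedge v-\mathcal P(\operatorname{curl}w\wedge w)\big](y)\,dy,$$ $$\operatorname{curl}w(t,x)=\int_G\nabla\phi_\perp(t-s,x-y)\wedge\big[\mathcal P_\perp f-\operatorname{curl}v\wedge w-\operatorname{curl}w\wedge v-\mathcal P_\perp(\operatorname{curl}w\wedge w)\big](s,y)\,d(s,y).$$ -/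

import Mathlib

open MeasureTheory
open scoped ContDiff

noncomputable section

namespace TPNS

/-- Three-dimensional Euclidean space. -/
abbrev E3 : Type := EuclideanSpace ℝ (Fin 3)

/-- The time-space group `G = 𝕋 × ℝ³`, where `𝕋 = ℝ / T ℤ`. -/
abbrev G (T : ℝ) : Type := AddCircle T × E3

/-- The product of the normalized Haar measure of `𝕋` and Lebesgue measure. -/
def muG (T : ℝ) [Fact (0 < T)] : Measure (G T) :=
  (AddCircle.haarAddCircle (T := T)).prod (volume : Measure E3)

/-- The `j`-th standard unit vector. -/
def unitVec (j : Fin 3) : E3 := EuclideanSpace.single j 1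

/-- The vector product. -/
def wedge (a b : E3) : E3 := WithLp.toLp 2 (crossProduct a.ofLp b.ofLp)

/-- The vector product of `ℝ³`-valued functions. -/
def wedgeFun {X : Type*} (a b : X → E3) : X → E3 := fun p => wedge (a p) (b p)

/-! ### Classical derivatives and test functions -/

/-- Classical partial derivative on `ℝ³`. -/
def pd (j : Fin 3) (F : E3 → ℝ) (x : E3) : ℝ := fderiv ℝ F x (unitVec j)

/-- Classical spatial partial derivative on `G`. -/
def pdx {T : ℝ} (j : Fin 3) (F : G T → ℝ) (p : G T) : ℝ := pd j (fun x => F (p.1, x)) p.2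

/-- Classical time derivative on `G`. -/
def pdt {T : ℝ} (F : G T → ℝ) (p : G T) : ℝ :=
  deriv (fun s : ℝ => F (p.1 + (s : AddCircle T), p.2)) 0

/-- Real test functions on `ℝ³`: smooth with compact support. -/
def IsTestE (φ : E3 → ℝ) : Prop := ContDiff ℝ ∞ φ ∧ HasCompactSupport φ

/-- Real test functions on `G`: compactly supported, and smooth, that is, the `T`-periodic lift to
`ℝ × ℝ³` is smooth. -/
def IsTestG (T : ℝ) (φ : G T → ℝ) : Prop :=
  ContDiff ℝ ∞ (fun q : ℝ × E3 => φ ((q.1 : AddCircle T), q.2)) ∧ HasCompactSupport φ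

/-- Solenoidal test fields on `G`. -/
def IsSolenoidalTest (T : ℝ) (φ : G T → E3) : Prop :=
  (∀ i, IsTestG T (fun p => φ p i)) ∧ ∀ p, ∑ j, pdx j (fun q => φ q j) p = 0

/-! ### Weak spatial derivatives -/

/-- `h` is the weak partial derivative `∂_j g` on `ℝ³`. -/
def IsWeakPartialE (j : Fin 3) (g h : E3 → ℝ) : Prop :=
  LocallyIntegrable g ∧ LocallyIntegrable h ∧
    ∀ φ, IsTestE φ → ∫ x, g x * pd j φ x = - ∫ x, h x * φ x

/-- `h` is the weak spatial partial derivative `∂_j g` on `G`. -/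
def IsWeakPartialG (T : ℝ) [Fact (0 < T)] (j : Fin 3) (g h : G T → ℝ) : Prop :=
  LocallyIntegrable g (muG T) ∧ LocallyIntegrable h (muG T) ∧
    ∀ φ, IsTestG T φ → ∫ p, g p * pdx j φ p ∂(muG T) = - ∫ p, h p * φ p ∂(muG T)

/-- `g` and all its first-order weak partial derivatives are locally integrable functions. -/
def WeaklyDiffE (g : E3 → ℝ) : Prop := ∀ j, ∃ h, IsWeakPartialE j g h

/-- `g` and all its first-order weak spatial partial derivatives are locally integrable
functions. -/
def WeaklyDiffG (T : ℝ) [Fact (0 < T)] (g : G T → ℝ) : Prop := ∀ j, ∃ h, IsWeakPartialG T j g h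

open Classical in
/-- The weak partial derivative on `ℝ³` (unique up to null sets; `0` if it does not exist). -/
def wpdE (j : Fin 3) (g : E3 → ℝ) : E3 → ℝ :=
  if h : ∃ k, IsWeakPartialE j g k then h.choose else 0

open Classical in
/-- The weak spatial partial derivative on `G` (unique up to null sets; `0` if it does not
exist). -/
def wpdG (T : ℝ) [Fact (0 < T)] (j : Fin 3) (g : G T → ℝ) : G T → ℝ :=
  if h : ∃ k, IsWeakPartialG T j g k then h.choose else 0

/-- `∂_j` of a vector field on `ℝ³`. -/
def wpdVecE (j : Fin 3) (v : E3 → E3) (x : E3) : E3 :=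
  WithLp.toLp 2 fun i => wpdE j (fun y => v y i) x

/-- `∂_j` of a vector field on `G`. -/
def wpdVecG (T : ℝ) [Fact (0 < T)] (j : Fin 3) (u : G T → E3) (p : G T) : E3 :=
  WithLp.toLp 2 fun i => wpdG T j (fun q => u q i) p

/-- `∂_j` of a matrix field on `ℝ³`. -/
def wpdMatE (j : Fin 3) (K : E3 → Matrix (Fin 3) (Fin 3) ℝ) (x : E3) : Matrix (Fin 3) (Fin 3) ℝ :=
  Matrix.of fun a b => wpdE j (fun y => K y a b) x

/-- `∂_j` of a matrix field on `G`. -/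
def wpdMatG (T : ℝ) [Fact (0 < T)] (j : Fin 3) (K : G T → Matrix (Fin 3) (Fin 3) ℝ) (p : G T) :
    Matrix (Fin 3) (Fin 3) ℝ :=
  Matrix.of fun a b => wpdG T j (fun q => K q a b) p

/-- The gradient of a scalar function on `ℝ³`. -/
def gradE (g : E3 → ℝ) (x : E3) : E3 := WithLp.toLp 2 fun j => wpdE j g x

/-- The spatial gradient of a scalar function on `G`. -/
def gradG (T : ℝ) [Fact (0 < T)] (g : G T → ℝ) (p : G T) : E3 :=
  WithLp.toLp 2 fun j => wpdG T j g p

/-- The curl of a vector field on `ℝ³`. -/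
def curlE (v : E3 → E3) (x : E3) : E3 :=
  WithLp.toLp 2 ![wpdVecE 1 v x 2 - wpdVecE 2 v x 1,
    wpdVecE 2 v x 0 - wpdVecE 0 v x 2,
    wpdVecE 0 v x 1 - wpdVecE 1 v x 0]

/-- The spatial curl of a vector field on `G`. -/
def curlG (T : ℝ) [Fact (0 < T)] (u : G T → E3) (p : G T) : E3 :=
  WithLp.toLp 2 ![wpdVecG T 1 u p 2 - wpdVecG T 2 u p 1,
    wpdVecG T 2 u p 0 - wpdVecG T 0 u p 2,
    wpdVecG T 0 u p 1 - wpdVecG T 1 u p 0]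

/-! ### Steady-state and purely periodic parts -/

/-- The time average `𝒫 g`. -/
def steady (T : ℝ) [Fact (0 < T)] (g : G T → E3) (x : E3) : E3 :=
  ∫ t, g (t, x) ∂(AddCircle.haarAddCircle (T := T))

/-- The purely periodic part `𝒫_⊥ g = g - 𝒫 g`. -/
def periodic (T : ℝ) [Fact (0 < T)] (g : G T → E3) (p : G T) : E3 := g p - steady T g p.2

/-! ### Weak solutions of the time-periodic Navier-Stokes problem in the whole space -/

/-- Weak solutions of `∂_t u - Δ u - lam ∂₁ u + u·∇u + ∇p = f`, `div u = 0` in `𝕋 × ℝ³`. -/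
structure IsWeakSolution (T : ℝ) [Fact (0 < T)] (lam : ℝ) (f u : G T → E3) : Prop where
  locallyIntegrable_force : LocallyIntegrable f (muG T)
  locallyIntegrable : LocallyIntegrable u (muG T)
  weaklyDiff : ∀ i, WeaklyDiffG T (fun p => u p i)
  /-- `∇u ∈ L²(𝕋 × ℝ³)`. -/
  memLp_grad : ∀ j, MemLp (wpdVecG T j u) 2 (muG T)
  /-- `u ∈ L²(𝕋; L⁶(ℝ³))`. -/
  memLp_L2L6 : ∫⁻ t, (eLpNorm (fun x => u (t, x)) 6 volume) ^ 2
    ∂(AddCircle.haarAddCircle (T := T)) < ⊤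
  div_eq_zero : ∀ᵐ p ∂(muG T), ∑ j, wpdVecG T j u p j = 0
  /-- `𝒫_⊥ u ∈ L^∞(𝕋; L²(ℝ³))`. -/
  memLp_LinftyL2 : essSup (fun t => eLpNorm (fun x => periodic T u (t, x)) 2 volume)
    (AddCircle.haarAddCircle (T := T)) < ⊤
  weak_formulation : ∀ φ : G T → E3, IsSolenoidalTest T φ →
    ∫ p, (-(∑ i, u p i * pdt (fun q => φ q i) p)
        + (∑ i, ∑ j, wpdVecG T j u p i * pdx j (fun q => φ q i) p)
        - lam * (∑ i, wpdVecG T 0 u p i * φ p i)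
        + ∑ i, (∑ j, u p j * wpdVecG T j u p i) * φ p i) ∂(muG T)
      = ∫ p, ∑ i, f p i * φ p i ∂(muG T)

/-! ### Inverse Fourier transform on `G` in the sense of distributions -/

/-- The Fourier transform on `G`,
`(k, ξ) ↦ ∫_G φ(t,x) exp(-i (2π/T) k t - i x·ξ) d(t,x)`. -/
def fourierG (T : ℝ) [Fact (0 < T)] (φ : G T → ℝ) (k : ℤ) (ξ : E3) : ℂ :=
  ∫ p, (φ p : ℂ) * (fourier (-k) p.1 * Complex.exp (-(Complex.I * (inner ℝ p.2 ξ : ℝ)))) ∂(muG T)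

/-- The distribution `𝓕_G⁻¹[m]` is given by the locally integrable real function `K`. By duality,
`⟨𝓕_G⁻¹[m], φ⟩ = ∑_k ∫ m(k,ξ) 𝓕_G[φ](-k,-ξ) dξ`, where `dξ` is Lebesgue measure
divided by `(2π)³`. -/
def IsInvFourierG (T : ℝ) [Fact (0 < T)] (m : ℤ → E3 → ℂ) (K : G T → ℝ) : Prop :=
  LocallyIntegrable K (muG T) ∧
    ∀ φ, IsTestG T φ →
      (∀ k, Integrable fun ξ => m k ξ * fourierG T φ (-k) (-ξ)) ∧
      HasSum (fun k : ℤ => ((2 * Real.pi : ℝ) ^ 3 : ℂ)⁻¹ * ∫ ξ, m k ξ * fourierG T φ (-k) (-ξ))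
        ((∫ p, K p * φ p ∂(muG T) : ℝ) : ℂ)

open Classical in
/-- The locally integrable real function that represents `𝓕_G⁻¹[m]`
(unique up to null sets; `0` if there is none). -/
def invFourierG (T : ℝ) [Fact (0 < T)] (m : ℤ → E3 → ℂ) : G T → ℝ :=
  if h : ∃ K, IsInvFourierG T m K then h.choose else 0

/-! ### Fundamental solutions -/

/-- The wake function `s(x) = |x| + x₁`. -/
def wake (x : E3) : ℝ := ‖x‖ + x 0

/-- The function `x ↦ ∫_0^{s(lam x)/2} (1 - e^{-τ}) / τ dτ`. -/
def oseenPotential (lam : ℝ) (x : E3) : ℝ :=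
  ∫ τ in (0 : ℝ)..(wake (lam • x) / 2), (1 - Real.exp (-τ)) / τ

/-- The steady-state velocity fundamental solution `Γ₀`. -/
def velSteady (lam : ℝ) (x : E3) : Matrix (Fin 3) (Fin 3) ℝ :=
  Matrix.of fun j l => 1 / (4 * Real.pi * lam) *
    ((if j = l then ∑ m, pd m (pd m (oseenPotential lam)) x else 0)
      - pd j (pd l (oseenPotential lam)) x)

/-- The multiplier `(1 - δ(k)) / (|ξ|² - i lam ξ₁ + i (2π/T) k)`. -/
def vortSymbol (T lam : ℝ) (k : ℤ) (ξ : E3) : ℂ :=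
  (if k = 0 then 0 else 1) /
    (((‖ξ‖ ^ 2 : ℝ) : ℂ) + Complex.I * ((2 * Real.pi / T * k - lam * ξ 0 : ℝ) : ℂ))

/-- The `(j, l)` entry of the multiplier
`(1 - δ(k)) / (|ξ|² + i ((2π/T) k - lam ξ₁)) (I - ξ ⊗ ξ / |ξ|²)`. -/
def velSymbol (T lam : ℝ) (j l : Fin 3) (k : ℤ) (ξ : E3) : ℂ :=
  vortSymbol T lam k ξ * (((if j = l then 1 else 0) - ξ j * ξ l / ‖ξ‖ ^ 2 : ℝ) : ℂ)

/-- The purely periodic velocity fundamental solution `Γ_⊥`. -/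
def velPeriodic (T : ℝ) [Fact (0 < T)] (lam : ℝ) (p : G T) : Matrix (Fin 3) (Fin 3) ℝ :=
  Matrix.of fun j l => invFourierG T (velSymbol T lam j l) p

/-- The velocity fundamental solution `Γ^lam = Γ₀ ⊗ 1 + Γ_⊥`. -/
def velFund (T : ℝ) [Fact (0 < T)] (lam : ℝ) (p : G T) : Matrix (Fin 3) (Fin 3) ℝ :=
  velSteady lam p.2 + velPeriodic T lam p

/-- The steady-state vorticity fundamental solution `φ₀`. -/
def vortSteady (lam : ℝ) (x : E3) : ℝ :=
  1 / (4 * Real.pi * ‖x‖) * Real.exp (-(wake (lam • x) / 2))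

/-- The purely periodic vorticity fundamental solution `φ_⊥`. -/
def vortPeriodic (T : ℝ) [Fact (0 < T)] (lam : ℝ) : G T → ℝ := invFourierG T (vortSymbol T lam)

/-- The vorticity fundamental solution `φ^lam = φ₀ ⊗ 1 + φ_⊥`. -/
def vortFund (T : ℝ) [Fact (0 < T)] (lam : ℝ) (p : G T) : ℝ :=
  vortSteady lam p.2 + vortPeriodic T lam p

/-- The fundamental solutions are locally integrable functions with locally integrable first-order
weak spatial derivatives, and the purely periodic ones represent the respective inverse Fourier
transforms. -/
def FundSolWellDefined (T : ℝ) [Fact (0 < T)] (lam : ℝ) : Prop :=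
  (∀ j l, IsInvFourierG T (velSymbol T lam j l) (fun p => velPeriodic T lam p j l)) ∧
  IsInvFourierG T (vortSymbol T lam) (vortPeriodic T lam) ∧
  (∀ j l, WeaklyDiffE (fun x => velSteady lam x j l)) ∧
  (∀ j l, WeaklyDiffG T (fun p => velPeriodic T lam p j l)) ∧
  (∀ j l, WeaklyDiffG T (fun p => velFund T lam p j l)) ∧
  WeaklyDiffE (vortSteady lam) ∧
  WeaklyDiffG T (vortPeriodic T lam) ∧
  WeaklyDiffG T (vortFund T lam)

/-! ### Convolution identities -/

/-- `h = K ∗ g` almost everywhere on the group `X`, for a matrix-valued kernel `K`, with absolutely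
convergent integrals. -/
def EqConv {X : Type*} [AddGroup X] [MeasurableSpace X] (μ : Measure X)
    (h : X → E3) (K : X → Matrix (Fin 3) (Fin 3) ℝ) (g : X → E3) : Prop :=
  ∀ᵐ p ∂μ, (∀ j l, Integrable (fun q => K (p - q) j l * g q l) μ) ∧
    h p = ∫ q, (WithLp.toLp 2 ((K (p - q)).mulVec (g q).ofLp) : E3) ∂μ

/-- `h(p) = ∫ k(p - q) ∧ g(q) dq` for almost every `p` in the group `X`, for a vector-valued
kernel `k`, with absolutely convergent integrals. -/
def EqCrossConv {X : Type*} [AddGroup X] [MeasurableSpace X] (μ : Measure X)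
    (h : X → E3) (k : X → E3) (g : X → E3) : Prop :=
  ∀ᵐ p ∂μ, Integrable (fun q => wedge (k (p - q)) (g q)) μ ∧
    h p = ∫ q, wedge (k (p - q)) (g q) ∂μ

/-! ### The right-hand sides -/

/-- `f - curl u ∧ u`. -/
def rhs (T : ℝ) [Fact (0 < T)] (f u : G T → E3) : G T → E3 :=
  fun p => f p - wedge (curlG T u p) (u p)

/-- `𝒫f - curl v ∧ v - 𝒫(curl w ∧ w)`. -/
def rhsSteady (T : ℝ) [Fact (0 < T)] (f : G T → E3) (v : E3 → E3) (w : G T → E3) : E3 → E3 :=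
  fun x => steady T f x - wedge (curlE v x) (v x) - steady T (wedgeFun (curlG T w) w) x

/-- `𝒫_⊥f - curl v ∧ w - curl w ∧ v - 𝒫_⊥(curl w ∧ w)`. -/
def rhsPeriodic (T : ℝ) [Fact (0 < T)] (f : G T → E3) (v : E3 → E3) (w : G T → E3) : G T → E3 :=
  fun p => periodic T f p - wedge (curlE v p.2) (w p) - wedge (curlG T w p) (v p.2)
    - periodic T (wedgeFun (curlG T w) w) p

end TPNS

end

open TPNS

open MeasureTheory Set Filter Topology
open scoped ContDiff ENNReal NNReal
noncomputable section
set_option linter.unusedSectionVars false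

namespace TPNS

/-! ### The heat kernel and its derivatives -/

/-! Let A = ∂_t - Δ - λ∂_1 and let A* be its formal adjoint (`adjOp`). The steady and the purely
periodic problem are not treated separately: one kernel on G represents the whole time-periodic
field, and the representation is split afterwards.

The kernel is explicit. With H the heat kernel, `velKern j l` is δ_jl H + ∫_t^∞ ∂_j∂_l H ds, that
is, H composed with the Helmholtz projection: in Fourier variables the tail turns -ξ_jξ_l e^{-s|ξ|²}
into -(ξ_jξ_l/|ξ|²) e^{-t|ξ|²}, without any singular integral. Transporting by the drift λt e_1 and
summing over the times congruent modulo T gives `per T lam (velKern j l)`, with Fourier multiplier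
(δ_jl - ξ_jξ_l/|ξ|²)/`sig`, mode k = 0 included (`integral_per_vel_mul`). Gaussian bounds dominate
the time mean of the modulus of this kernel and of its first spatial derivatives by a multiple of
`maj`, which is |x|^{-2} near the origin and cubically integrable at infinity (`lintegral_qform_le`,
`lintegral_majFar_cube`).

For a weak solution, u·∇u differs from curl u ∧ u by the gradient of |u|²/2, which solenoidal test
fields do not see (`WeakField.sum_integral_transport`, resting on a product rule for weak
derivatives). Put F = f - curl u ∧ u. Testing with the solenoidal fields (δ_il Δ - ∂_i∂_l)g yields ∫
u_i ΔA*g = Σ_l ∫ F_l (δ_il Δ - ∂_i∂_l)g (`WeakField.integral_lapG_adjOp`). The convolution of the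
kernel with F satisfies the same identity (`integral_conv_vel`). Since u lies in L⁶(ℝ³; L²(𝕋)) and
∇u in L², F lies in L^{3/2}(ℝ³; L¹(𝕋)); hence both u and the convolution have weighted averages that
vanish at large scales (`VanishAvg`).

Their difference is zero by a Liouville theorem (`liouville`, `liouvilleG`). Each time mode is
annihilated by an operator whose symbol vanishes only at ξ = 0. Its pairing with a low-frequency
truncation of a test function therefore does not depend on the truncation radius; shrinking the
radius to zero makes the pairing vanish by the averages, and enlarging it recovers the test
function. Derivatives then fall on the kernel, and in the curl the tail integrals cancel by symmetry
of third derivatives, so only ∇H remains.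

It remains to recognize the kernels. Subtracting the time mean deletes the mode k = 0, which gives
Γ_⊥ and φ_⊥ (`isInvFourierG_sub_mean`). The time mean is an integral over the half-line (`stat`):
for H it is computed in closed form (`vortSteady_eq_stat`), and for `velKern` it is compared with
the Oseen formula by the Liouville theorem once more (`velSteady_ae_eq_stat`). Weak derivatives and
inverse transforms are unique almost everywhere, so the chosen representatives agree with these
kernels. Finally, convolution respects the splitting into mean and purely periodic part, so one
identity on G yields all three (`eqConv_of_split`). -/

/-- The heat kernel on `ℝ³`. -/
def heat (s : ℝ) (y : E3) : ℝ := (4 * Real.pi * s) ^ (-(3 / 2) : ℝ) * Real.exp (-(‖y‖ ^ 2 / (4 * s)))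

/-- The Kronecker symbol. -/
def kron (j l : Fin 3) : ℝ := if j = l then 1 else 0

/-- First derivatives of the heat kernel. -/
def heatD1 (j : Fin 3) (s : ℝ) (y : E3) : ℝ := -(y j / (2 * s)) * heat s y

/-- Second derivatives of the heat kernel. -/
def heatD2 (j l : Fin 3) (s : ℝ) (y : E3) : ℝ :=
  (y j * y l / (4 * s ^ 2) - kron j l / (2 * s)) * heat s y

/-- Third derivatives of the heat kernel. -/
def heatD3 (a j l : Fin 3) (s : ℝ) (y : E3) : ℝ :=
  (-(y a * y j * y l / (8 * s ^ 3))
    + (kron a j * y l + kron a l * y j + kron j l * y a) / (4 * s ^ 2)) * heat s y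

lemma kron_comm (j l : Fin 3) : kron j l = kron l j := by simp [kron, eq_comm]

lemma abs_kron_le (j l : Fin 3) : |kron j l| ≤ 1 := by unfold kron; split_ifs <;> simp

lemma unitVec_apply (j l : Fin 3) : unitVec j l = kron j l := by
  simp [unitVec, kron, eq_comm]

lemma hasFDerivAt_coord (j : Fin 3) (y : E3) :
    HasFDerivAt (fun y : E3 => y j) (EuclideanSpace.proj (𝕜 := ℝ) j) y :=
  (EuclideanSpace.proj j : E3 →L[ℝ] ℝ).hasFDerivAt

lemma hasLineDerivAt_coord (j l : Fin 3) (y : E3) :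
    HasLineDerivAt ℝ (fun y : E3 => y j) (kron j l) y (unitVec l) := by
  have := (hasFDerivAt_coord j y).hasLineDerivAt (unitVec l)
  simpa [unitVec_apply, kron_comm] using this

lemma hasLineDerivAt_normSq (l : Fin 3) (y : E3) :
    HasLineDerivAt ℝ (fun y : E3 => ‖y‖ ^ 2) (2 * y l) y (unitVec l) := by
  have := (hasStrictFDerivAt_norm_sq y).hasFDerivAt.hasLineDerivAt (unitVec l)
  simpa [unitVec, EuclideanSpace.inner_single_right] using this

lemma hasLineDerivAt_heat (j : Fin 3) {s : ℝ} (hs : 0 < s) (y : E3) :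
    HasLineDerivAt ℝ (heat s) (heatD1 j s y) y (unitVec j) := by
  have h := hasLineDerivAt_normSq j y
  unfold HasLineDerivAt at *
  have h2 := (((h.div_const (4 * s)).neg.exp).const_mul ((4 * Real.pi * s) ^ (-(3 / 2) : ℝ)))
  refine h2.congr_deriv ?_
  simp only [heatD1, heat, zero_smul, add_zero, Pi.neg_apply]
  field_simp
  ring

lemma hasLineDerivAt_heatD1 (j l : Fin 3) {s : ℝ} (hs : 0 < s) (y : E3) :
    HasLineDerivAt ℝ (heatD1 l s) (heatD2 j l s y) y (unitVec j) := by
  have h := hasLineDerivAt_heat j hs y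
  have h1 := hasLineDerivAt_coord l j y
  unfold HasLineDerivAt at *
  have h2 := ((h1.div_const (2 * s)).neg).mul h
  refine h2.congr_deriv ?_
  simp only [heatD1, heatD2, zero_smul, add_zero, kron_comm l j, Pi.neg_apply]
  field_simp
  ring

lemma hasLineDerivAt_heatD2 (a j l : Fin 3) {s : ℝ} (hs : 0 < s) (y : E3) :
    HasLineDerivAt ℝ (heatD2 j l s) (heatD3 a j l s y) y (unitVec a) := by
  have h := hasLineDerivAt_heat a hs y
  have h1 := hasLineDerivAt_coord j a y
  have h3 := hasLineDerivAt_coord l a y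
  unfold HasLineDerivAt at *
  have h2 := (((h1.mul h3).div_const (4 * s ^ 2)).sub_const (kron j l / (2 * s))).mul h
  refine h2.congr_deriv ?_
  simp only [heatD1, heatD3, zero_smul, add_zero, kron_comm l a, kron_comm j a,
    Pi.mul_apply]
  field_simp
  ring

lemma heat_nonneg {s : ℝ} (hs : 0 ≤ s) (y : E3) : 0 ≤ heat s y := by
  unfold heat; positivity

/-- With z = |y|²/s this says that (1 + z)^{N + 3/2} is absorbed by e^{z/4}; it follows from 1 +
z/20 ≤ e^{z/20}, raised to the fifth power. The factor (s/(|y|² + s))^N is there to pay for the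
negative powers of s that differentiation produces. -/
lemma heat_le {s : ℝ} (hs : 0 < s) (y : E3) {N : ℕ} (hN : N ≤ 3) :
    heat s y ≤ 20 ^ 5 * ((s / (‖y‖ ^ 2 + s)) ^ N * (‖y‖ ^ 2 + s) ^ (-(3 / 2) : ℝ)) := by
  set z := ‖y‖ ^ 2 / s with hz
  set q := ‖y‖ ^ 2 + s with hq
  have hq0 : 0 < q := by positivity
  have hz0 : 0 ≤ z := by positivity
  have hqs : q / s = 1 + z := by rw [hq, hz]; field_simp; ring
  have e1 : (1 + z) ^ 5 ≤ 20 ^ 5 * Real.exp (z / 4) := by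
    have h1 : 1 + z / 20 ≤ Real.exp (z / 20) := by linarith [Real.add_one_le_exp (z / 20)]
    have h2 : (1 + z / 20) ^ 5 ≤ Real.exp (z / 20) ^ 5 := pow_le_pow_left₀ (by positivity) h1 5
    rw [← Real.exp_nat_mul] at h2
    have h3 : ((5 : ℕ) : ℝ) * (z / 20) = z / 4 := by push_cast; ring
    rw [h3] at h2
    calc (1 + z) ^ 5 ≤ (20 * (1 + z / 20)) ^ 5 := pow_le_pow_left₀ (by positivity) (by linarith) 5
      _ = 20 ^ 5 * (1 + z / 20) ^ 5 := by ring
      _ ≤ _ := by gcongr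
  have e2 : s ^ (-(3 / 2) : ℝ) = q ^ (-(3 / 2) : ℝ) * (q / s) ^ (3 / 2 : ℝ) := by
    rw [Real.div_rpow hq0.le hs.le, Real.rpow_neg hq0.le, Real.rpow_neg hs.le]
    have := (Real.rpow_pos_of_pos hq0 (3 / 2)).ne'
    field_simp
  have e3 : (q / s) ^ (3 / 2 : ℝ) ≤ (1 + z) ^ 2 := by
    rw [hqs, ← Real.rpow_natCast]
    exact Real.rpow_le_rpow_of_exponent_le (by linarith) (by norm_num)
  have e4 : (4 * Real.pi * s) ^ (-(3 / 2) : ℝ) ≤ s ^ (-(3 / 2) : ℝ) := by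
    apply Real.rpow_le_rpow_of_nonpos hs _ (by norm_num)
    nlinarith [Real.pi_gt_three]
  have e5 : s / q = (1 + z)⁻¹ := by rw [← hqs, inv_div]
  have e6 : Real.exp (-(‖y‖ ^ 2 / (4 * s))) = (Real.exp (z / 4))⁻¹ := by
    rw [← Real.exp_neg]; congr 1; rw [hz]; field_simp
  have hqp := Real.rpow_pos_of_pos hq0 (-(3 / 2))
  unfold heat
  rw [e6, e5]
  have hE := Real.exp_pos (z / 4)
  calc _ ≤ (q ^ (-(3 / 2) : ℝ) * (1 + z) ^ 2) * (Real.exp (z / 4))⁻¹ := by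
        rw [e2] at e4
        gcongr
        exact e4.trans (by gcongr)
    _ ≤ _ := by
        have : (1 + z) ^ 2 * (Real.exp (z / 4))⁻¹ ≤ 20 ^ 5 * (1 + z)⁻¹ ^ N := by
          rw [inv_pow, ← div_eq_mul_inv, ← div_eq_mul_inv, div_le_div_iff₀ hE (by positivity)]
          refine le_trans ?_ e1
          rw [← pow_add]
          exact pow_le_pow_right₀ (by linarith) (by omega)
        calc _ = q ^ (-(3 / 2) : ℝ) * ((1 + z) ^ 2 * (Real.exp (z / 4))⁻¹) := by ring
          _ ≤ q ^ (-(3 / 2) : ℝ) * (20 ^ 5 * (1 + z)⁻¹ ^ N) := by gcongr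
          _ = _ := by ring

lemma abs_coord_le_sqrt {s : ℝ} (hs : 0 < s) (y : E3) (j : Fin 3) :
    |y j| ≤ (‖y‖ ^ 2 + s) ^ (1 / 2 : ℝ) := by
  rw [← Real.sqrt_eq_rpow]
  apply Real.le_sqrt_of_sq_le
  rw [sq_abs]
  have : |y j| ≤ ‖y‖ := by simpa using PiLp.norm_apply_le y j
  nlinarith [sq_abs (y j), abs_nonneg (y j)]

lemma abs_heat_le {s : ℝ} (hs : 0 < s) (y : E3) :
    |heat s y| ≤ 20 ^ 5 * (‖y‖ ^ 2 + s) ^ (-(3 / 2) : ℝ) := by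
  rw [abs_of_nonneg (heat_nonneg hs.le y)]
  simpa using heat_le hs y (N := 0) (by norm_num)

/-- Write q = |y|² + s. A coordinate is at most q^{1/2}, and each 1/s is exchanged for 1/q by one
factor s/q of `heat_le`; so every derivative gains q^{-1/2}. The bounds on the second and third
derivatives have the same source. -/
lemma abs_heatD1_le (j : Fin 3) {s : ℝ} (hs : 0 < s) (y : E3) :
    |heatD1 j s y| ≤ 20 ^ 5 * (‖y‖ ^ 2 + s) ^ (-2 : ℝ) := by
  have h1 := heat_le hs y (N := 1) (by norm_num)
  have h2 := abs_coord_le_sqrt hs y j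
  set q := ‖y‖ ^ 2 + s with hq
  have hq0 : 0 < q := by positivity
  have hh := heat_nonneg hs.le y
  unfold heatD1
  rw [abs_mul, abs_neg, abs_div, abs_of_nonneg hh, abs_of_pos (by positivity : (0 : ℝ) < 2 * s)]
  have e : q ^ (-2 : ℝ) = q ^ (1 / 2 : ℝ) * q⁻¹ * q ^ (-(3 / 2) : ℝ) := by
    rw [← Real.rpow_neg_one, ← Real.rpow_add hq0, ← Real.rpow_add hq0]; norm_num
  calc _ ≤ q ^ (1 / 2 : ℝ) / (1 * s) * (20 ^ 5 * ((s / q) ^ 1 * q ^ (-(3 / 2) : ℝ))) := by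
        gcongr; norm_num
    _ = _ := by rw [e]; field_simp

lemma abs_heatD2_le (j l : Fin 3) {s : ℝ} (hs : 0 < s) (y : E3) :
    |heatD2 j l s y| ≤ 20 ^ 6 * (‖y‖ ^ 2 + s) ^ (-(5 / 2) : ℝ) := by
  have h1 := heat_le hs y (N := 1) (by norm_num)
  have h4 := heat_le hs y (N := 2) (by norm_num)
  have h2 := abs_coord_le_sqrt hs y j
  have h3 := abs_coord_le_sqrt hs y l
  set q := ‖y‖ ^ 2 + s with hq
  have hq0 : 0 < q := by positivity
  have hh := heat_nonneg hs.le y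
  unfold heatD2
  rw [abs_mul, abs_of_nonneg hh]
  have e : q ^ (-(5 / 2) : ℝ) = q⁻¹ * q ^ (-(3 / 2) : ℝ) := by
    rw [← Real.rpow_neg_one, ← Real.rpow_add hq0]; norm_num
  have e2 : q ^ (1 / 2 : ℝ) * q ^ (1 / 2 : ℝ) = q := by
    rw [← Real.rpow_add hq0]; norm_num
  have hk := abs_kron_le j l
  have b1 : |y j * y l / (4 * s ^ 2) - kron j l / (2 * s)| ≤ q / s ^ 2 + 1 / s := by
    refine (abs_sub _ _).trans (add_le_add ?_ ?_)
    · rw [abs_div, abs_mul, abs_of_pos (by positivity : (0 : ℝ) < 4 * s ^ 2)]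
      have : |y j| * |y l| ≤ q := by rw [← e2]; gcongr
      gcongr
      nlinarith [sq_nonneg s]
    · rw [abs_div, abs_of_pos (by positivity : (0 : ℝ) < 2 * s)]
      gcongr
      linarith
  calc _ ≤ (q / s ^ 2 + 1 / s) * heat s y := by gcongr
    _ = q / s ^ 2 * heat s y + 1 / s * heat s y := by ring
    _ ≤ q / s ^ 2 * (20 ^ 5 * ((s / q) ^ 2 * q ^ (-(3 / 2) : ℝ)))
        + 1 / s * (20 ^ 5 * ((s / q) ^ 1 * q ^ (-(3 / 2) : ℝ))) := by gcongr
    _ = 2 * 20 ^ 5 * (q⁻¹ * q ^ (-(3 / 2) : ℝ)) := by field_simp; ring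
    _ ≤ _ := by
      rw [e]; gcongr
      norm_num

lemma abs_heatD3_le (a j l : Fin 3) {s : ℝ} (hs : 0 < s) (y : E3) :
    |heatD3 a j l s y| ≤ 20 ^ 6 * (‖y‖ ^ 2 + s) ^ (-3 : ℝ) := by
  have h1 := heat_le hs y (N := 2) (by norm_num)
  have h4 := heat_le hs y (N := 3) (by norm_num)
  have h2 := abs_coord_le_sqrt hs y j
  have h3 := abs_coord_le_sqrt hs y l
  have h5 := abs_coord_le_sqrt hs y a
  set q := ‖y‖ ^ 2 + s with hq
  set r := q ^ (1 / 2 : ℝ) with hr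
  have hq0 : 0 < q := by positivity
  have hr0 : 0 < r := Real.rpow_pos_of_pos hq0 _
  have hh := heat_nonneg hs.le y
  unfold heatD3
  rw [abs_mul, abs_of_nonneg hh]
  have e2 : r * r = q := by
    rw [← Real.rpow_add hq0]; norm_num
  have e : q ^ (-3 : ℝ) = r * q⁻¹ * q⁻¹ * q ^ (-(3 / 2) : ℝ) := by
    rw [← Real.rpow_neg_one, hr, ← Real.rpow_add hq0, ← Real.rpow_add hq0, ← Real.rpow_add hq0]
    norm_num
  have c1 : |kron a j * y l| ≤ r := by
    rw [abs_mul]; nlinarith [abs_kron_le a j, abs_nonneg (y l)]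
  have c2 : |kron a l * y j| ≤ r := by
    rw [abs_mul]; nlinarith [abs_kron_le a l, abs_nonneg (y j)]
  have c3 : |kron j l * y a| ≤ r := by
    rw [abs_mul]; nlinarith [abs_kron_le j l, abs_nonneg (y a)]
  have b1 : |-(y a * y j * y l / (8 * s ^ 3))
    + (kron a j * y l + kron a l * y j + kron j l * y a) / (4 * s ^ 2)|
      ≤ q * r / s ^ 3 + r / s ^ 2 := by
    refine (abs_add_le _ _).trans (add_le_add ?_ ?_)
    · rw [abs_neg, abs_div, abs_mul, abs_mul, abs_of_pos (by positivity : (0 : ℝ) < 8 * s ^ 3)]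
      have : |y a| * |y j| * |y l| ≤ q * r := by rw [← e2]; gcongr
      gcongr
      nlinarith [pow_pos hs 3]
    · rw [abs_div, abs_of_pos (by positivity : (0 : ℝ) < 4 * s ^ 2)]
      rw [div_le_div_iff₀ (by positivity) (by positivity)]
      have := (abs_add_three (kron a j * y l) (kron a l * y j) (kron j l * y a))
      have h6 : |kron a j * y l + kron a l * y j + kron j l * y a| ≤ 4 * r := by linarith
      nlinarith [pow_pos hs 2]
  calc _ ≤ (q * r / s ^ 3 + r / s ^ 2) * heat s y := by gcongr
    _ = q * r / s ^ 3 * heat s y + r / s ^ 2 * heat s y := by ring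
    _ ≤ q * r / s ^ 3 * (20 ^ 5 * ((s / q) ^ 3 * q ^ (-(3 / 2) : ℝ)))
        + r / s ^ 2 * (20 ^ 5 * ((s / q) ^ 2 * q ^ (-(3 / 2) : ℝ))) := by gcongr
    _ = 2 * 20 ^ 5 * (r * q⁻¹ * q⁻¹ * q ^ (-(3 / 2) : ℝ)) := by field_simp; ring
    _ ≤ _ := by
      rw [e]; gcongr
      norm_num

/-! ### Time integrals of the kernels -/

lemma integral_Ioi_add_rpow {a c m : ℝ} (ha : 1 < a) (hc : 0 < c + m) :
    ∫⁻ s in Ioi c, ENNReal.ofReal ((m + s) ^ (-a)) = ENNReal.ofReal ((m + c) ^ (1 - a) / (a - 1)) := by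
  have hint : IntegrableOn (fun s => (s + m) ^ (-a)) (Ioi c) :=
    integrableOn_add_rpow_Ioi_of_lt (by linarith) (by linarith)
  have hder : ∀ s ∈ Ici c, HasDerivAt (fun s => -((s + m) ^ (1 - a) / (a - 1))) ((s + m) ^ (-a)) s := by
    intro s hs
    have hs' : s + m ≠ 0 := by have : c ≤ s := hs; linarith
    have h := (((hasDerivAt_id s).add_const m).rpow_const (p := 1 - a) (Or.inl hs')).div_const (a - 1)
    refine h.neg.congr_deriv ?_
    have : a - 1 ≠ 0 := by linarith
    simp only [id]
    rw [show 1 - a - 1 = -a by ring]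
    field_simp
    ring
  have hlim : Tendsto (fun s => -((s + m) ^ (1 - a) / (a - 1))) atTop (𝓝 (-(0 / (a - 1)))) := by
    apply Tendsto.neg
    apply Tendsto.div_const
    have h1 : Tendsto (fun s : ℝ => s ^ (-(a - 1))) atTop (𝓝 0) :=
      tendsto_rpow_neg_atTop (by linarith)
    have := h1.comp (tendsto_atTop_add_const_right atTop m tendsto_id)
    simpa [Function.comp_def] using this
  have hI := integral_Ioi_of_hasDerivAt_of_tendsto' hder hint hlim
  simp_rw [add_comm m]
  rw [← ofReal_integral_eq_lintegral_ofReal hint, hI]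
  · congr 1; ring
  · filter_upwards [ae_restrict_mem measurableSet_Ioi] with s hs
    have : c < s := hs
    exact Real.rpow_nonneg (by linarith) _

/-- The integrand has the antiderivative (b + λt)(A + (b + λt)²)^{-1/2}/(λA), which is monotone and
bounded in modulus by 1/(λA), whatever b is. Integrating through the wake thus costs a power of A
that does not depend on where the wake is entered. -/
lemma integral_Ioi_add_sq_rpow_le {A lam : ℝ} (hA : 0 < A) (hlam : 0 < lam) (b : ℝ) :
    ∫⁻ t in Ioi (0 : ℝ), ENNReal.ofReal ((A + (b + lam * t) ^ 2) ^ (-(3 / 2) : ℝ))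
      ≤ ENNReal.ofReal (2 / (lam * A)) := by
  set g : ℝ → ℝ := fun t => (b + lam * t) * (A + (b + lam * t) ^ 2) ^ (-(1 / 2) : ℝ) / (lam * A) with hg
  have hpos : ∀ t : ℝ, 0 < A + (b + lam * t) ^ 2 := fun t => by positivity
  have hder : ∀ t, HasDerivAt g ((A + (b + lam * t) ^ 2) ^ (-(3 / 2) : ℝ)) t := by
    intro t
    have h1 : HasDerivAt (fun t => b + lam * t) lam t := by
      simpa using ((hasDerivAt_id t).const_mul lam).const_add b
    have h2 := ((h1.pow 2).const_add A).rpow_const (p := -(1 / 2)) (Or.inl (hpos t).ne')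
    have h3 := (h1.mul h2).div_const (lam * A)
    refine h3.congr_deriv ?_
    have e : (A + (b + lam * t) ^ 2) ^ (-(1 / 2) : ℝ)
        = (A + (b + lam * t) ^ 2) ^ (-(3 / 2) : ℝ) * (A + (b + lam * t) ^ 2) := by
      rw [← Real.rpow_add_one (hpos t).ne']; norm_num
    rw [show (-(1 / 2) - 1 : ℝ) = -(3 / 2) by norm_num]
    simp only [Pi.pow_apply]
    rw [e]
    field_simp
    ring
  have hbd : ∀ t, |(b + lam * t) * (A + (b + lam * t) ^ 2) ^ (-(1 / 2) : ℝ)| ≤ 1 := by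
    intro t
    rw [Real.rpow_neg (hpos t).le, ← Real.sqrt_eq_rpow, abs_mul, abs_inv,
      abs_of_nonneg (Real.sqrt_nonneg _), ← div_eq_mul_inv, div_le_one (Real.sqrt_pos.2 (hpos t))]
    exact Real.abs_le_sqrt (by linarith)
  have hmono : Monotone g := by
    exact monotone_of_hasDerivAt_nonneg hder fun t => Real.rpow_nonneg (hpos t).le _
  have hgb : ∀ t, |g t| ≤ 1 / (lam * A) := by
    intro t
    simp only [hg]
    rw [abs_div, abs_of_pos (by positivity : 0 < lam * A)]
    gcongr
    exact hbd t
  obtain ⟨l, hl⟩ : ∃ l, Tendsto g atTop (𝓝 l) :=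
    ⟨_, tendsto_atTop_ciSup hmono ⟨1 / (lam * A), by rintro _ ⟨t, rfl⟩; exact (abs_le.1 (hgb t)).2⟩⟩
  have hl1 : l ≤ 1 / (lam * A) := le_of_tendsto' hl fun t => (abs_le.1 (hgb t)).2
  have hnn : ∀ t ∈ Ioi (0 : ℝ), 0 ≤ (A + (b + lam * t) ^ 2) ^ (-(3 / 2) : ℝ) :=
    fun t _ => Real.rpow_nonneg (hpos t).le _
  have hint := integrableOn_Ioi_deriv_of_nonneg' (fun t _ => hder t) hnn hl
  rw [← ofReal_integral_eq_lintegral_ofReal hint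
    ((ae_restrict_mem measurableSet_Ioi).mono fun t ht => hnn t ht),
    integral_Ioi_of_hasDerivAt_of_nonneg' (fun t _ => hder t) hnn hl]
  apply ENNReal.ofReal_le_ofReal
  have := (abs_le.1 (hgb 0)).1
  have e2 : 2 / (lam * A) = 1 / (lam * A) + 1 / (lam * A) := by ring
  linarith

/-- A majorant of the time integrals of all the kernels. -/
def maj (x : E3) : ℝ≥0∞ :=
  if ‖x‖ ≤ 1 then (ENNReal.ofReal (‖x‖ ^ 2))⁻¹
  else ENNReal.ofReal (1 + x 1 ^ 2 + x 2 ^ 2 + |x 0|)⁻¹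

/-- The quadratic form `|x + lam t e₁|² + t`. -/
def qform (lam t : ℝ) (x : E3) : ℝ := ‖x + (lam * t) • unitVec 0‖ ^ 2 + t

lemma normSq_eq (x : E3) : ‖x‖ ^ 2 = x 0 ^ 2 + x 1 ^ 2 + x 2 ^ 2 := by
  rw [EuclideanSpace.norm_sq_eq, Fin.sum_univ_three]; simp

lemma qform_eq (lam t : ℝ) (x : E3) :
    qform lam t x = (x 0 + lam * t) ^ 2 + x 1 ^ 2 + x 2 ^ 2 + t := by
  unfold qform; rw [normSq_eq]; simp [unitVec_apply, kron]

/-- While λt ≤ |x|/2 the drift cannot bring x closer to the origin than |x|/2. Afterwards |x|² ≤ |x|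
≤ 2λt, so the summand t alone controls |x|². -/
lemma qform_ge_near {lam : ℝ} (hlam : 0 < lam) :
    ∃ c : ℝ, 0 < c ∧ ∀ x : E3, ‖x‖ ≤ 1 → ∀ t : ℝ, 0 < t → c * (‖x‖ ^ 2 + t) ≤ qform lam t x := by
  refine ⟨min (1 / 4) (1 / (4 * lam)), by positivity, fun x hx t ht => ?_⟩
  set c := min (1 / 4) (1 / (4 * lam))
  have c1 : c ≤ 1 / 4 := min_le_left _ _
  have c2 : c * (4 * lam) ≤ 1 := by
    rw [← le_div_iff₀ (by positivity)]; exact min_le_right _ _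
  have hx0 := norm_nonneg x
  by_cases h : lam * t ≤ ‖x‖ / 2
  · have h1 : ‖x‖ / 2 ≤ ‖x + (lam * t) • unitVec 0‖ := by
      have : ‖x‖ ≤ ‖x + (lam * t) • unitVec 0‖ + ‖(lam * t) • unitVec 0‖ := by
        simpa using norm_sub_le (x + (lam * t) • unitVec 0) ((lam * t) • unitVec 0)
      have h2 : ‖(lam * t) • unitVec 0‖ = lam * t := by
        rw [norm_smul, Real.norm_of_nonneg (by positivity)]; simp [unitVec]
      linarith
    have h3 : (‖x‖ / 2) ^ 2 ≤ ‖x + (lam * t) • unitVec 0‖ ^ 2 := pow_le_pow_left₀ (by positivity) h1 2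
    unfold qform
    nlinarith [sq_nonneg ‖x‖]
  · push Not at h
    have h3 : ‖x‖ ^ 2 ≤ 2 * lam * t := by nlinarith
    have h4 : c * ‖x‖ ^ 2 ≤ t / 2 := by
      have : 0 < c := by positivity
      nlinarith
    unfold qform
    nlinarith [sq_nonneg ‖x + (lam * t) • unitVec 0‖]

/-- With y = x_0 + λt one has t ≥ (|x_0| - |y|)/λ, and |y|/λ is absorbed into y²/2 at the cost of
the constant 1/(2λ²). Outside the unit ball the form itself is bounded below by `c0`, which absorbs
that constant. The growth is linear in |x_0| and quadratic across the wake. -/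
lemma qform_ge_far {lam : ℝ} (hlam : 0 < lam) :
    ∃ c : ℝ, 0 < c ∧ ∀ x : E3, ¬ ‖x‖ ≤ 1 → ∀ t : ℝ, 0 < t →
      c * ((1 + x 1 ^ 2 + x 2 ^ 2 + |x 0|) + (x 0 + lam * t) ^ 2) ≤ qform lam t x := by
  set c0 := min (1 / 4) (1 / (2 * lam)) with hc0
  have c0pos : 0 < c0 := by positivity
  set L := 1 + 1 / (2 * lam ^ 2 * c0) + 1 / c0 with hL
  have Lpos : 0 < L := by positivity
  refine ⟨min (1 / 2) (1 / lam) / L, by positivity, fun x hx t ht => ?_⟩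
  set d := min (1 / 2) (1 / lam)
  have dpos : 0 < d := by positivity
  have d1 : d ≤ 1 / 2 := min_le_left _ _
  have d2 : d ≤ 1 / lam := min_le_right _ _
  push Not at hx
  have hq0 : c0 ≤ qform lam t x := by
    by_cases h : lam * t ≤ ‖x‖ / 2
    · have h1 : ‖x‖ / 2 ≤ ‖x + (lam * t) • unitVec 0‖ := by
        have : ‖x‖ ≤ ‖x + (lam * t) • unitVec 0‖ + ‖(lam * t) • unitVec 0‖ := by
          simpa using norm_sub_le (x + (lam * t) • unitVec 0) ((lam * t) • unitVec 0)
        have h2 : ‖(lam * t) • unitVec 0‖ = lam * t := by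
          rw [norm_smul, Real.norm_of_nonneg (by positivity)]; simp [unitVec]
        linarith
      have : c0 ≤ 1 / 4 := min_le_left _ _
      unfold qform
      nlinarith
    · push Not at h
      have h3 : c0 ≤ 1 / (2 * lam) := min_le_right _ _
      have h4 : 1 / (2 * lam) ≤ t := by rw [div_le_iff₀ (by positivity)]; nlinarith
      unfold qform
      nlinarith [sq_nonneg ‖x + (lam * t) • unitVec 0‖]
  have hq := qform_eq lam t x
  set q := qform lam t x
  set y := x 0 + lam * t with hy
  have e1 : |x 0| / lam - |y| / lam ≤ t := by
    have : |x 0| ≤ |y| + lam * t := by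
      have := abs_sub y (lam * t)
      rw [abs_of_pos (by positivity : 0 < lam * t)] at this
      simpa [hy] using this
    rw [← sub_div, div_le_iff₀ hlam]; linarith
  have e2 : y ^ 2 / 2 - 1 / (2 * lam ^ 2) ≤ y ^ 2 - |y| / lam := by
    have := sq_nonneg (|y| - 1 / lam)
    have e : (|y| - 1 / lam) ^ 2 = y ^ 2 - 2 * (|y| / lam) + 1 / lam ^ 2 := by
      rw [sub_sq, sq_abs]; field_simp
    rw [e] at this
    have e3 : 1 / (2 * lam ^ 2) = 1 / lam ^ 2 / 2 := by field_simp
    rw [e3]; linarith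
  have e3 : y ^ 2 / 2 + x 1 ^ 2 + x 2 ^ 2 + |x 0| / lam ≤ q + 1 / (2 * lam ^ 2) := by linarith
  have e4 : 1 / (2 * lam ^ 2) ≤ 1 / (2 * lam ^ 2 * c0) * q := by
    calc 1 / (2 * lam ^ 2) = 1 / (2 * lam ^ 2 * c0) * c0 := by field_simp
      _ ≤ _ := by gcongr
  have e5 : 1 ≤ 1 / c0 * q := by rw [div_mul_eq_mul_div, le_div_iff₀ c0pos]; linarith
  rw [div_mul_eq_mul_div, div_le_iff₀ Lpos]
  have e6 : q * L = q + 1 / (2 * lam ^ 2 * c0) * q + 1 / c0 * q := by rw [hL]; ring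
  rw [e6]
  have e7 : d * |x 0| ≤ |x 0| / lam := by
    calc d * |x 0| ≤ 1 / lam * |x 0| := by gcongr
      _ = _ := by ring
  nlinarith [sq_nonneg y, sq_nonneg (x 1), sq_nonneg (x 2), abs_nonneg (x 0)]

/-- The exponents 3/2 and 2 are those of the kernels and of their first derivatives. Near the origin
the time integral is of order |x|^{2-2a}, at most |x|^{-2} as a ≤ 2. Far away the form is bounded
below, so the exponent 2 is reduced to 3/2. -/
lemma lintegral_qform_le {lam : ℝ} (hlam : 0 < lam) : ∃ C : ℝ≥0, ∀ x : E3,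
    (∫⁻ t in Ioi (0 : ℝ), ENNReal.ofReal (qform lam t x ^ (-(3 / 2) : ℝ)) ≤ C * maj x) ∧
    (∫⁻ t in Ioi (0 : ℝ), ENNReal.ofReal (qform lam t x ^ (-2 : ℝ)) ≤ C * maj x) := by
  obtain ⟨c, hc, hnear⟩ := qform_ge_near hlam
  obtain ⟨c', hc', hfar⟩ := qform_ge_far hlam
  have near : ∀ a : ℝ, 1 < a → a ≤ 2 → ∀ x : E3, ‖x‖ ≤ 1 → x ≠ 0 →
      ∫⁻ t in Ioi (0 : ℝ), ENNReal.ofReal (qform lam t x ^ (-a))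
        ≤ ENNReal.ofReal (c ^ (-a) / (a - 1)) * maj x := by
    intro a ha ha2 x hx hx0
    have hxn : 0 < ‖x‖ := norm_pos_iff.2 hx0
    calc _ ≤ ∫⁻ t in Ioi (0 : ℝ), ENNReal.ofReal (c ^ (-a)) * ENNReal.ofReal ((‖x‖ ^ 2 + t) ^ (-a)) := by
          refine setLIntegral_mono' measurableSet_Ioi fun t ht => ?_
          have ht' : 0 < t := ht
          rw [← ENNReal.ofReal_mul (by positivity), ← Real.mul_rpow hc.le (by positivity)]
          exact ENNReal.ofReal_le_ofReal
            (Real.rpow_le_rpow_of_nonpos (by positivity) (hnear x hx t ht) (by linarith))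
      _ = ENNReal.ofReal (c ^ (-a)) * ENNReal.ofReal ((‖x‖ ^ 2 + 0) ^ (1 - a) / (a - 1)) := by
          rw [lintegral_const_mul' _ _ ENNReal.ofReal_ne_top, integral_Ioi_add_rpow ha (by positivity)]
      _ ≤ _ := by
          have ha1 : 0 < a - 1 := by linarith
          rw [add_zero, maj, if_pos hx, ← ENNReal.ofReal_inv_of_pos (by positivity),
            ← ENNReal.ofReal_mul (by positivity), ← ENNReal.ofReal_mul (by positivity)]
          apply ENNReal.ofReal_le_ofReal
          have : (‖x‖ ^ 2) ^ (1 - a) ≤ (‖x‖ ^ 2)⁻¹ := by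
            rw [← Real.rpow_neg_one]
            exact Real.rpow_le_rpow_of_exponent_ge (by positivity)
              (pow_le_one₀ (norm_nonneg x) hx) (by linarith)
          calc _ ≤ c ^ (-a) * ((‖x‖ ^ 2)⁻¹ / (a - 1)) := by gcongr
            _ = _ := by ring
  have far : ∀ x : E3, ¬ ‖x‖ ≤ 1 →
      ∫⁻ t in Ioi (0 : ℝ), ENNReal.ofReal (qform lam t x ^ (-(3 / 2) : ℝ))
        ≤ ENNReal.ofReal (c' ^ (-(3 / 2) : ℝ) * (2 / lam)) * maj x := by
    intro x hx
    set A := 1 + x 1 ^ 2 + x 2 ^ 2 + |x 0| with hA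
    have hA0 : 0 < A := by positivity
    calc _ ≤ ∫⁻ t in Ioi (0 : ℝ), ENNReal.ofReal (c' ^ (-(3 / 2) : ℝ))
            * ENNReal.ofReal ((A + (x 0 + lam * t) ^ 2) ^ (-(3 / 2) : ℝ)) := by
          refine setLIntegral_mono' measurableSet_Ioi fun t ht => ?_
          have ht' : 0 < t := ht
          rw [← ENNReal.ofReal_mul (by positivity), ← Real.mul_rpow hc'.le (by positivity)]
          exact ENNReal.ofReal_le_ofReal
            (Real.rpow_le_rpow_of_nonpos (by positivity) (hfar x hx t ht) (by norm_num))
      _ ≤ ENNReal.ofReal (c' ^ (-(3 / 2) : ℝ)) * ENNReal.ofReal (2 / (lam * A)) := by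
          rw [lintegral_const_mul' _ _ ENNReal.ofReal_ne_top]
          gcongr
          exact integral_Ioi_add_sq_rpow_le hA0 hlam _
      _ = _ := by
          rw [maj, if_neg hx, ← ENNReal.ofReal_mul (by positivity),
            ← ENNReal.ofReal_mul (by positivity)]
          congr 1
          rw [← hA]; field_simp
  have far2 : ∀ x : E3, ¬ ‖x‖ ≤ 1 →
      ∫⁻ t in Ioi (0 : ℝ), ENNReal.ofReal (qform lam t x ^ (-2 : ℝ))
        ≤ ENNReal.ofReal (c' ^ (-(1 / 2) : ℝ)) * (ENNReal.ofReal (c' ^ (-(3 / 2) : ℝ) * (2 / lam)) * maj x) := by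
    intro x hx
    refine le_trans ?_ (mul_le_mul_right (far x hx) _)
    rw [← lintegral_const_mul' _ _ ENNReal.ofReal_ne_top]
    refine setLIntegral_mono' measurableSet_Ioi fun t ht => ?_
    have ht' : 0 < t := ht
    have h1 := hfar x hx t ht
    have h2 : c' ≤ qform lam t x := by
      refine le_trans ?_ h1
      have : 1 ≤ (1 + x 1 ^ 2 + x 2 ^ 2 + |x 0|) + (x 0 + lam * t) ^ 2 := by
        nlinarith [sq_nonneg (x 1), sq_nonneg (x 2), sq_nonneg (x 0 + lam * t), abs_nonneg (x 0)]
      nlinarith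
    have hq : 0 < qform lam t x := hc'.trans_le h2
    rw [← ENNReal.ofReal_mul (by positivity)]
    apply ENNReal.ofReal_le_ofReal
    rw [show (-2 : ℝ) = -(1 / 2) + -(3 / 2) by norm_num, Real.rpow_add hq]
    gcongr ?_ * _
    exact Real.rpow_le_rpow_of_nonpos hc' h2 (by norm_num)
  set D1 := c ^ (-(3 / 2) : ℝ) / (3 / 2 - 1)
  set D2 := c ^ (-2 : ℝ) / (2 - 1)
  set D3 := c' ^ (-(3 / 2) : ℝ) * (2 / lam)
  set D4 := c' ^ (-(1 / 2) : ℝ) * D3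
  have p1 : 0 ≤ D1 := by positivity
  have p2 : 0 ≤ D2 := by simp only [D2]; norm_num; positivity
  have p3 : 0 ≤ D3 := by positivity
  have p4 : 0 ≤ D4 := by positivity
  have hC : ∀ D, D ≤ D1 + D2 + D3 + D4 + 1 → ENNReal.ofReal D ≤ ((D1 + D2 + D3 + D4 + 1).toNNReal : ℝ≥0∞) :=
    fun D hD => ENNReal.ofReal_le_ofReal hD
  -- The added 1 makes the constant positive, so that at x = 0, where `maj` is infinite, the right
  -- side is infinite as well.
  refine ⟨(D1 + D2 + D3 + D4 + 1).toNNReal, fun x => ?_⟩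
  by_cases hx : ‖x‖ ≤ 1
  · by_cases hx0 : x = 0
    · have : maj x = ⊤ := by simp [maj, hx0]
      rw [this, ENNReal.mul_top]
      · simp
      · simp only [ne_eq, ENNReal.coe_eq_zero, Real.toNNReal_eq_zero]; linarith
    · refine ⟨(near (3 / 2) (by norm_num) (by norm_num) x hx hx0).trans ?_,
        (near 2 (by norm_num) (by norm_num) x hx hx0).trans ?_⟩
      · gcongr; exact hC _ (by simp only [D1] at *; linarith)
      · gcongr; exact hC _ (by simp only [D2] at *; linarith)
  · refine ⟨(far x hx).trans ?_, (far2 x hx).trans ?_⟩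
    · gcongr; exact hC _ (by linarith)
    · rw [← mul_assoc, ← ENNReal.ofReal_mul (by positivity)]
      gcongr; exact hC _ (by simp only [D4] at *; linarith)


/-! ### Weighted averages that vanish at infinity -/

/-- Averaging weight at scale `R`. -/
def wt (R : ℝ) (x : E3) : ℝ≥0∞ := ENNReal.ofReal ((R ^ 3)⁻¹ * (1 + ‖R⁻¹ • x‖) ^ (-4 : ℝ))

/-- The averages of `d` at scale `R` tend to zero as `R → ∞`. -/
def VanishAvg (d : E3 → ℝ≥0∞) : Prop :=
  Tendsto (fun R : ℝ => ∫⁻ x, wt R x * d x) atTop (𝓝 0)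

lemma measurable_wt (R : ℝ) : Measurable (wt R) := by unfold wt; fun_prop

lemma lintegral_comp_inv_smul {R : ℝ} (hR : 0 < R) (g : E3 → ℝ≥0∞) :
    ∫⁻ x : E3, g (R⁻¹ • x) = ENNReal.ofReal (R ^ 3) * ∫⁻ x, g x := by
  have h := Measure.map_addHaar_smul (volume : Measure E3) (inv_ne_zero hR.ne')
  have hm : MeasurableEmbedding (fun x : E3 => R⁻¹ • x) :=
    (Homeomorph.smulOfNeZero R⁻¹ (inv_ne_zero hR.ne')).measurableEmbedding
  rw [← hm.lintegral_map, h, lintegral_smul_measure]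
  simp [abs_of_pos hR]

lemma lintegral_wt_rpow {q : ℝ} (hq : 1 ≤ q) {R : ℝ} (hR : 0 < R) :
    ∫⁻ x, wt R x ^ q = ENNReal.ofReal (R ^ (3 - 3 * q)) *
      ∫⁻ x : E3, ENNReal.ofReal ((1 + ‖x‖) ^ (-4 * q)) := by
  have h : ∀ x, wt R x ^ q = ENNReal.ofReal (R ^ (-3 * q)) *
      ENNReal.ofReal ((1 + ‖R⁻¹ • x‖) ^ (-4 * q)) := by
    intro x
    have h1 : 0 < 1 + ‖R⁻¹ • x‖ := by positivity
    rw [wt, ENNReal.ofReal_rpow_of_nonneg (by positivity) (by linarith),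
      Real.mul_rpow (by positivity) (by positivity), ← ENNReal.ofReal_mul (by positivity)]
    congr 2
    · rw [← Real.rpow_natCast, ← Real.rpow_neg hR.le, ← Real.rpow_mul hR.le]; norm_num
    · rw [← Real.rpow_mul h1.le]
  simp_rw [h]
  rw [lintegral_const_mul' _ _ ENNReal.ofReal_ne_top,
    lintegral_comp_inv_smul hR (fun x : E3 => ENNReal.ofReal ((1 + ‖x‖) ^ (-4 * q))), ← mul_assoc,
    ← ENNReal.ofReal_mul (by positivity)]
  congr 2
  rw [← Real.rpow_natCast, ← Real.rpow_add hR]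
  congr 1; push_cast; ring

lemma lintegral_one_add_norm_lt_top {a : ℝ} (ha : 3 < a) :
    ∫⁻ x : E3, ENNReal.ofReal ((1 + ‖x‖) ^ (-a)) < ⊤ :=
  finite_integral_one_add_norm (by simpa using ha)

/-- By scaling the integral is a constant times R^{3-3q}: it decays as soon as q > 1, whereas for q
= 1 it only stays bounded. -/
lemma tendsto_lintegral_wt_rpow {q : ℝ} (hq : 1 < q) :
    Tendsto (fun R : ℝ => ∫⁻ x, wt R x ^ q) atTop (𝓝 0) := by
  have hfin : ∫⁻ x : E3, ENNReal.ofReal ((1 + ‖x‖) ^ (-4 * q)) < ⊤ := by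
    have := lintegral_one_add_norm_lt_top (a := 4 * q) (by linarith)
    simpa [neg_mul] using this
  have h1 : Tendsto (fun R : ℝ => R ^ (-(3 * q - 3))) atTop (𝓝 0) :=
    tendsto_rpow_neg_atTop (by linarith)
  have h2 := ENNReal.Tendsto.mul_const (ENNReal.tendsto_ofReal h1)
    (b := ∫⁻ x : E3, ENNReal.ofReal ((1 + ‖x‖) ^ (-4 * q))) (Or.inr hfin.ne)
  rw [ENNReal.ofReal_zero, zero_mul] at h2
  refine h2.congr' ?_
  filter_upwards [eventually_gt_atTop 0] with R hR
  rw [lintegral_wt_rpow hq.le hR]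
  congr 3; ring

lemma lintegral_wt_lt_top : ∃ W : ℝ≥0, ∀ R : ℝ, 0 < R → ∫⁻ x, wt R x ≤ W := by
  refine ⟨(∫⁻ x : E3, ENNReal.ofReal ((1 + ‖x‖) ^ (-4 : ℝ))).toNNReal, fun R hR => ?_⟩
  have := lintegral_wt_rpow le_rfl hR
  rw [ENNReal.coe_toNNReal (lintegral_one_add_norm_lt_top (by norm_num)).ne]
  simp only [ENNReal.rpow_one, mul_one, sub_self, Real.rpow_zero, ENNReal.ofReal_one, one_mul] at this
  rw [this]

lemma VanishAvg.mono {d e : E3 → ℝ≥0∞} (he : VanishAvg e) (h : ∀ᵐ x, d x ≤ e x) : VanishAvg d :=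
  tendsto_of_tendsto_of_tendsto_of_le_of_le tendsto_const_nhds he (fun _ => zero_le)
    fun R => lintegral_mono_ae (h.mono fun x hx => by gcongr)

lemma VanishAvg.add {d e : E3 → ℝ≥0∞} (hd : VanishAvg d) (he : VanishAvg e)
    (hm : AEMeasurable d) : VanishAvg (fun x => d x + e x) := by
  have := Tendsto.add hd he
  rw [add_zero] at this
  refine this.congr fun R => ?_
  simp_rw [mul_add]
  exact (lintegral_add_left' ((measurable_wt R).aemeasurable.mul hm) _).symm

lemma VanishAvg.const_mul {d : E3 → ℝ≥0∞} (hd : VanishAvg d) (C : ℝ≥0) :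
    VanishAvg (fun x => C * d x) := by
  have := ENNReal.Tendsto.const_mul hd (a := C) (Or.inr ENNReal.coe_ne_top)
  rw [mul_zero] at this
  refine this.congr fun R => ?_
  rw [← lintegral_const_mul' _ _ ENNReal.coe_ne_top]
  exact lintegral_congr fun x => by ring

/-- Hölder's inequality against the weight, whose conjugate norm tends to zero. This is how decay at
infinity, known only through integrability, enters the uniqueness argument. -/
lemma VanishAvg.of_rpow {d : E3 → ℝ≥0∞} {p : ℝ} (hp : 1 < p) (hm : AEMeasurable d)
    (hd : ∫⁻ x, d x ^ p < ⊤) : VanishAvg d := by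
  have hpq := Real.HolderConjugate.conjExponent hp
  set q := p.conjExponent
  have hq : 1 < q := hpq.symm.lt
  have h1 : Tendsto (fun R : ℝ => (∫⁻ x, wt R x ^ q) ^ (1 / q)) atTop (𝓝 0) := by
    have := (tendsto_lintegral_wt_rpow hq).ennrpow_const (1 / q)
    rwa [ENNReal.zero_rpow_of_pos (by positivity)] at this
  have h2 := ENNReal.Tendsto.mul_const h1 (b := (∫⁻ x, d x ^ p) ^ (1 / p))
    (Or.inr (ENNReal.rpow_ne_top_of_nonneg (by positivity) hd.ne))
  rw [zero_mul] at h2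
  refine tendsto_of_tendsto_of_tendsto_of_le_of_le tendsto_const_nhds h2 (fun _ => zero_le) fun R => ?_
  exact ENNReal.lintegral_mul_le_Lp_mul_Lq _ hpq.symm (measurable_wt R).aemeasurable hm

/-- By Tonelli the average of the convolution is a superposition of averages of translates of f.
Hölder bounds each of these uniformly, since the p-norm is translation invariant. -/
lemma VanishAvg.conv_of_L1 {k f : E3 → ℝ≥0∞} {p : ℝ} (hp : 1 < p) (hk : Measurable k)
    (hf : Measurable f) (hk1 : ∫⁻ x, k x < ⊤) (hfp : ∫⁻ x, f x ^ p < ⊤) :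
    VanishAvg (fun x => ∫⁻ y, k y * f (x - y)) := by
  have hpq := Real.HolderConjugate.conjExponent hp
  set q := p.conjExponent
  have hq : 1 < q := hpq.symm.lt
  have h1 : Tendsto (fun R : ℝ => (∫⁻ x, wt R x ^ q) ^ (1 / q)) atTop (𝓝 0) := by
    have := (tendsto_lintegral_wt_rpow hq).ennrpow_const (1 / q)
    rwa [ENNReal.zero_rpow_of_pos (by positivity)] at this
  have h2 := ENNReal.Tendsto.mul_const h1 (b := (∫⁻ x, f x ^ p) ^ (1 / p))
    (Or.inr (ENNReal.rpow_ne_top_of_nonneg (by positivity) hfp.ne))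
  have h3 := ENNReal.Tendsto.const_mul h2 (a := ∫⁻ x, k x) (Or.inr hk1.ne)
  rw [zero_mul, mul_zero] at h3
  refine tendsto_of_tendsto_of_tendsto_of_le_of_le tendsto_const_nhds h3 (fun _ => zero_le) fun R => ?_
  have hw := measurable_wt R
  calc ∫⁻ x, wt R x * ∫⁻ y, k y * f (x - y)
      = ∫⁻ x, ∫⁻ y, wt R x * (k y * f (x - y)) := by
        refine lintegral_congr fun x => ?_
        rw [lintegral_const_mul _ (by fun_prop)]
    _ = ∫⁻ y, ∫⁻ x, wt R x * (k y * f (x - y)) := by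
        rw [lintegral_lintegral_swap]
        exact Measurable.aemeasurable (by fun_prop)
    _ = ∫⁻ y, k y * ∫⁻ x, wt R x * f (x - y) := by
        refine lintegral_congr fun y => ?_
        rw [← lintegral_const_mul _ (by fun_prop)]
        exact lintegral_congr fun x => by ring
    _ ≤ ∫⁻ y, k y * ((∫⁻ x, wt R x ^ q) ^ (1 / q) * (∫⁻ x, f x ^ p) ^ (1 / p)) := by
        refine lintegral_mono fun y => ?_
        gcongr
        refine (ENNReal.lintegral_mul_le_Lp_mul_Lq _ hpq.symm hw.aemeasurable
          (g := fun x => f (x - y)) (by fun_prop)).trans ?_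
        rw [lintegral_sub_right_eq_self (fun x => f x ^ p) y]
    _ = _ := by rw [lintegral_mul_const _ hk]

/-! ### The majorant -/

lemma measurable_maj : Measurable maj := by
  unfold maj
  exact Measurable.ite (measurableSet_le measurable_norm measurable_const) (by fun_prop) (by fun_prop)

/-- The singular part of the majorant. -/
def majNear (x : E3) : ℝ≥0∞ := (Metric.closedBall (0 : E3) 1).indicator maj x

/-- The part of the majorant at infinity. -/
def majFar (x : E3) : ℝ≥0∞ := (Metric.closedBall (0 : E3) 1)ᶜ.indicator maj x

lemma measurable_majNear : Measurable majNear := measurable_maj.indicator measurableSet_closedBall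
lemma measurable_majFar : Measurable majFar := measurable_maj.indicator measurableSet_closedBall.compl

lemma maj_eq (x : E3) : maj x = majNear x + majFar x := by
  unfold majNear majFar
  by_cases h : x ∈ Metric.closedBall (0 : E3) 1 <;> simp [h]

lemma integrableOn_norm_rpow {a : ℝ} (ha : -3 < a) (r : ℝ) :
    IntegrableOn (fun x : E3 => ‖x‖ ^ a) (Metric.ball 0 r) := by
  rw [integrableOn_fun_norm_addHaar (μ := (volume : Measure E3)) (f := fun y : ℝ => y ^ a) (r := r)]
  have h : IntegrableOn (fun y : ℝ => y ^ (2 + a)) (Ioo 0 r) := by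
    have := intervalIntegral.intervalIntegrable_rpow' (a := 0) (b := r) (r := 2 + a) (by linarith)
    by_cases hr : 0 ≤ r
    · rw [intervalIntegrable_iff_integrableOn_Ioo_of_le hr] at this; exact this
    · rw [Ioo_eq_empty (by linarith)]; exact integrableOn_empty
  refine h.congr_fun ?_ measurableSet_Ioo
  intro y hy
  have : Module.finrank ℝ E3 - 1 = 2 := by simp
  simp only [this, smul_eq_mul]
  rw [Real.rpow_add hy.1]; norm_num

lemma lintegral_majNear : ∫⁻ x, majNear x < ⊤ := by
  have h := (integrableOn_norm_rpow (a := -2) (by norm_num) 2).lintegral_lt_top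
  refine lt_of_le_of_lt ?_ h
  rw [← lintegral_indicator measurableSet_ball]
  refine lintegral_mono_ae ?_
  have h0 : ∀ᵐ x : E3, x ≠ 0 := by simp [ae_iff]
  filter_upwards [h0] with x hx
  have hx' : 0 < ‖x‖ := norm_pos_iff.2 hx
  unfold majNear
  by_cases hm : x ∈ Metric.closedBall (0 : E3) 1
  · have hm1 : ‖x‖ ≤ 1 := by simpa using hm
    rw [indicator_of_mem hm, indicator_of_mem (by simp; linarith), maj, if_pos hm1,
      ← ENNReal.ofReal_inv_of_pos (by positivity)]
    apply ENNReal.ofReal_le_ofReal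
    rw [Real.rpow_neg hx'.le]; norm_num
  · rw [indicator_of_notMem hm]; exact zero_le

/-- With A the denominator of `maj`, A^{-3} = (A²)^{-3/4} A^{-3/4} A^{-3/4}. Since A² ≥ 1 + x_0², A
≥ 1 + x_1² and A ≥ 1 + x_2², this is at most a product of three one-dimensional functions (1 +
x_i²)^{-3/4}, each integrable. The anisotropy of the wake is what makes the exponent 3, dual to 3/2,
possible. -/
lemma lintegral_majFar_cube : ∫⁻ x, majFar x ^ (3 : ℝ) < ⊤ := by
  have h1 : Integrable (fun y : ℝ => (1 + ‖y‖ ^ 2) ^ (-(3 / 2 : ℝ) / 2)) :=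
    integrable_rpow_neg_one_add_norm_sq (by simp; norm_num)
  have h2 : Integrable (fun x : Fin 3 → ℝ => ∏ i, (1 + ‖x i‖ ^ 2) ^ (-(3 / 2 : ℝ) / 2)) :=
    Integrable.fintype_prod (f := fun _ => fun y : ℝ => (1 + ‖y‖ ^ 2) ^ (-(3 / 2 : ℝ) / 2)) fun _ => h1
  have h3 := (EuclideanSpace.volume_preserving_symm_measurableEquiv_toLp (Fin 3)).integrable_comp_emb
    (MeasurableEquiv.measurableEmbedding _) |>.2 h2
  refine lt_of_le_of_lt (lintegral_mono fun x => ?_) h3.lintegral_lt_top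
  unfold majFar
  by_cases hm : x ∈ Metric.closedBall (0 : E3) 1
  · simp [hm]
  have hm1 : ¬ ‖x‖ ≤ 1 := by simpa using hm
  rw [indicator_of_mem (by simpa using hm), maj, if_neg hm1]
  set A := 1 + x 1 ^ 2 + x 2 ^ 2 + |x 0| with hA
  have hA0 : 0 < A := by positivity
  rw [ENNReal.ofReal_rpow_of_nonneg (by positivity) (by norm_num)]
  apply ENNReal.ofReal_le_ofReal
  have e : A⁻¹ ^ (3 : ℝ) = (A ^ 2) ^ (-(3 / 2 : ℝ) / 2) * A ^ (-(3 / 2 : ℝ) / 2) * A ^ (-(3 / 2 : ℝ) / 2) := by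
    rw [← Real.rpow_natCast, ← Real.rpow_mul hA0.le, ← Real.rpow_add hA0, ← Real.rpow_add hA0,
      Real.inv_rpow hA0.le, ← Real.rpow_neg hA0.le]
    norm_num
  rw [e]
  simp only [Function.comp_apply, Fin.prod_univ_three, Real.norm_eq_abs, sq_abs]
  have b0 : (A ^ 2) ^ (-(3 / 2 : ℝ) / 2) ≤ (1 + x 0 ^ 2) ^ (-(3 / 2 : ℝ) / 2) := by
    refine Real.rpow_le_rpow_of_nonpos (by positivity) ?_ (by norm_num)
    nlinarith [abs_nonneg (x 0), sq_abs (x 0), sq_nonneg (x 1), sq_nonneg (x 2)]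
  have b1 : A ^ (-(3 / 2 : ℝ) / 2) ≤ (1 + x 1 ^ 2) ^ (-(3 / 2 : ℝ) / 2) := by
    refine Real.rpow_le_rpow_of_nonpos (by positivity) ?_ (by norm_num)
    nlinarith [abs_nonneg (x 0), sq_nonneg (x 2)]
  have b2 : A ^ (-(3 / 2 : ℝ) / 2) ≤ (1 + x 2 ^ 2) ^ (-(3 / 2 : ℝ) / 2) := by
    refine Real.rpow_le_rpow_of_nonpos (by positivity) ?_ (by norm_num)
    nlinarith [abs_nonneg (x 0), sq_nonneg (x 1)]
  exact mul_le_mul (mul_le_mul b0 b1 (by positivity) (by positivity)) b2 (by positivity) (by positivity)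

/-- Any exponent in (1, 3/2) would do, since |x|^{-2p} is integrable near the origin for p < 3/2;
some exponent above 1 is needed for `VanishAvg.of_rpow`. -/
lemma lintegral_majNear_rpow : ∫⁻ x, majNear x ^ (5 / 4 : ℝ) < ⊤ := by
  have h := (integrableOn_norm_rpow (a := -(5 / 2)) (by norm_num) 2).lintegral_lt_top
  refine lt_of_le_of_lt ?_ h
  rw [← lintegral_indicator measurableSet_ball]
  refine lintegral_mono_ae ?_
  have h0 : ∀ᵐ x : E3, x ≠ 0 := by simp [ae_iff]
  filter_upwards [h0] with x hx
  have hx' : 0 < ‖x‖ := norm_pos_iff.2 hx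
  unfold majNear
  by_cases hm : x ∈ Metric.closedBall (0 : E3) 1
  · have hm1 : ‖x‖ ≤ 1 := by simpa using hm
    rw [indicator_of_mem hm, indicator_of_mem (by simp; linarith), maj, if_pos hm1,
      ← ENNReal.ofReal_inv_of_pos (by positivity),
      ENNReal.ofReal_rpow_of_nonneg (by positivity) (by norm_num)]
    apply ENNReal.ofReal_le_ofReal
    rw [Real.inv_rpow (by positivity), ← Real.rpow_natCast, ← Real.rpow_mul hx'.le,
      ← Real.rpow_neg hx'.le]
    norm_num
  · rw [indicator_of_notMem hm]; simp

lemma vanishAvg_maj : VanishAvg maj :=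
  ((VanishAvg.of_rpow (by norm_num) measurable_majNear.aemeasurable lintegral_majNear_rpow).add
    (VanishAvg.of_rpow (by norm_num) measurable_majFar.aemeasurable lintegral_majFar_cube)
    measurable_majNear.aemeasurable).mono (Eventually.of_forall fun x => (maj_eq x).le)

/-- Inside the unit ball |x|^{-1} ≤ |x|^{-2}, and outside it is at most 2/(1 + |x|), whose fourth
power is integrable. Used for the Oseen tensor, which is bounded by a multiple of |x|^{-1}. -/
lemma vanishAvg_inv_norm : VanishAvg (fun x => ENNReal.ofReal ‖x‖⁻¹) := by
  have h4 : ∫⁻ x : E3, ENNReal.ofReal ((1 + ‖x‖) ^ (-1 : ℝ)) ^ (4 : ℝ) < ⊤ := by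
    refine lt_of_le_of_lt (lintegral_mono fun x => le_of_eq ?_)
      (lintegral_one_add_norm_lt_top (a := 4) (by norm_num))
    rw [ENNReal.ofReal_rpow_of_nonneg (by positivity) (by norm_num), ← Real.rpow_mul (by positivity)]
    norm_num
  have h2 := (VanishAvg.of_rpow (by norm_num) (by fun_prop) h4).const_mul 2
  refine ((VanishAvg.of_rpow (by norm_num) measurable_majNear.aemeasurable
    lintegral_majNear_rpow).add h2 measurable_majNear.aemeasurable).mono ?_
  have h0 : ∀ᵐ x : E3, x ≠ 0 := by simp [ae_iff]
  filter_upwards [h0] with x hx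
  have hx' : 0 < ‖x‖ := norm_pos_iff.2 hx
  by_cases hm : x ∈ Metric.closedBall (0 : E3) 1
  · have hm1 : ‖x‖ ≤ 1 := by simpa using hm
    refine le_trans ?_ le_self_add
    rw [majNear, indicator_of_mem hm, maj, if_pos hm1, ← ENNReal.ofReal_inv_of_pos (by positivity)]
    apply ENNReal.ofReal_le_ofReal
    gcongr
    nlinarith
  · have hm1 : 1 < ‖x‖ := by simpa using hm
    refine le_trans ?_ le_add_self
    rw [show ((2 : ℝ≥0) : ℝ≥0∞) = ENNReal.ofReal 2 by simp, ← ENNReal.ofReal_mul (by norm_num)]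
    apply ENNReal.ofReal_le_ofReal
    rw [Real.rpow_neg_one, ← div_eq_mul_inv, inv_eq_one_div, div_le_div_iff₀ hx' (by positivity)]
    linarith

/-- The near part is integrable, so `VanishAvg.conv_of_L1` applies. For the far part the exponents 3
and 3/2 are exactly conjugate and yield only a bounded function. Hence f is cut at a large ball:
inside it f is integrable and the convolution vanishes on average, while the remainder has small
3/2-norm and so a uniformly small convolution. -/
lemma vanishAvg_maj_conv {f : E3 → ℝ≥0∞} (hf : Measurable f) (hf1 : ∫⁻ x, f x ^ (3 / 2 : ℝ) < ⊤) :
    VanishAvg (fun x => ∫⁻ y, maj (x - y) * f y) := by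
  have hnear : VanishAvg (fun x => ∫⁻ y, majNear (x - y) * f y) := by
    refine (VanishAvg.conv_of_L1 (by norm_num) measurable_majNear hf lintegral_majNear hf1).mono
      (Eventually.of_forall fun x => le_of_eq ?_)
    simpa using (lintegral_sub_left_eq_self (fun y => majNear (x - y) * f y) x).symm
  have hmn := measurable_majNear
  have hmf := measurable_majFar
  have hfar : VanishAvg (fun x => ∫⁻ y, majFar (x - y) * f y) := by
    obtain ⟨W, hW⟩ := lintegral_wt_lt_top
    have hcut : Tendsto (fun n : ℕ => ∫⁻ x, (Metric.closedBall (0 : E3) n)ᶜ.indicator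
        (fun x => f x ^ (3 / 2 : ℝ)) x) atTop (𝓝 0) := by
      have : Tendsto (fun n : ℕ => ∫⁻ x, (Metric.closedBall (0 : E3) n)ᶜ.indicator
        (fun x => f x ^ (3 / 2 : ℝ)) x) atTop (𝓝 (∫⁻ _ : E3, 0)) := by
        refine tendsto_lintegral_of_dominated_convergence (fun x => f x ^ (3 / 2 : ℝ))
          (fun n => Measurable.indicator (by fun_prop) measurableSet_closedBall.compl)
          (fun n => Eventually.of_forall fun x => indicator_le_self _ _ x) hf1.ne
          (Eventually.of_forall fun x => ?_)
        refine tendsto_const_nhds.congr' ?_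
        filter_upwards [eventually_ge_atTop ⌈‖x‖⌉₊] with n hn
        rw [indicator_of_notMem]
        simpa using (Nat.le_ceil ‖x‖).trans (by exact_mod_cast hn)
      simpa using this
    rw [VanishAvg, ENNReal.tendsto_nhds_zero]
    intro ε hε
    set B := (∫⁻ x, majFar x ^ (3 : ℝ)) ^ (1 / (3 : ℝ)) with hB
    have hBt : B ≠ ⊤ := ENNReal.rpow_ne_top_of_nonneg (by norm_num) lintegral_majFar_cube.ne
    have hsm : Tendsto (fun n : ℕ => (W : ℝ≥0∞) * (B * (∫⁻ x, (Metric.closedBall (0 : E3) n)ᶜ.indicator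
        (fun x => f x ^ (3 / 2 : ℝ)) x) ^ (1 / (3 / 2 : ℝ)))) atTop (𝓝 0) := by
      have := ENNReal.Tendsto.const_mul (ENNReal.Tendsto.const_mul (hcut.ennrpow_const (1 / (3 / 2 : ℝ)))
        (a := B) (Or.inr hBt)) (a := (W : ℝ≥0∞)) (Or.inr ENNReal.coe_ne_top)
      simpa using this
    have hε2 : 0 < ε / 2 := ENNReal.half_pos hε.ne'
    obtain ⟨n, hn⟩ := (ENNReal.tendsto_nhds_zero.1 hsm (ε / 2) hε2).exists
    set S := Metric.closedBall (0 : E3) (n : ℝ)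
    have hS : MeasurableSet S := measurableSet_closedBall
    set f1 : E3 → ℝ≥0∞ := S.indicator f
    set f2 : E3 → ℝ≥0∞ := Sᶜ.indicator f
    have hf1m : Measurable f1 := hf.indicator hS
    have hf2m : Measurable f2 := hf.indicator hS.compl
    have hL1 : ∫⁻ x, f1 x < ⊤ := by
      -- On a set of finite measure, f ≤ 1 + f^{3/2} gives integrability.
      have hb : ∀ x, f1 x ≤ S.indicator 1 x + f x ^ (3 / 2 : ℝ) := by
        intro x
        by_cases hx : x ∈ S
        · simp only [f1, indicator_of_mem hx, Pi.one_apply]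
          by_cases h1 : f x ≤ 1
          · exact h1.trans le_self_add
          · push Not at h1
            refine le_trans ?_ le_add_self
            simpa using ENNReal.rpow_le_rpow_of_exponent_le h1.le (by norm_num : (1 : ℝ) ≤ 3 / 2)
        · simp [f1, hx]
      refine (lintegral_mono hb).trans_lt ?_
      rw [lintegral_add_left (measurable_one.indicator hS), lintegral_indicator_one hS]
      exact ENNReal.add_lt_top.2 ⟨measure_closedBall_lt_top, hf1⟩
    have hv1 : VanishAvg (fun x => ∫⁻ y, f1 y * majFar (x - y)) :=
      VanishAvg.conv_of_L1 (by norm_num) hf1m hmf hL1 lintegral_majFar_cube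
    have hb2 : ∀ x, ∫⁻ y, majFar (x - y) * f2 y ≤ B * (∫⁻ x, Sᶜ.indicator
        (fun x => f x ^ (3 / 2 : ℝ)) x) ^ (1 / (3 / 2 : ℝ)) := by
      intro x
      have hpq : Real.HolderConjugate 3 (3 / 2) := by rw [Real.holderConjugate_iff]; norm_num
      refine (ENNReal.lintegral_mul_le_Lp_mul_Lq _ hpq (f := fun y => majFar (x - y)) (by fun_prop)
        hf2m.aemeasurable).trans (le_of_eq ?_)
      rw [lintegral_sub_left_eq_self (fun y => majFar y ^ (3 : ℝ)) x]
      congr 2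
      refine lintegral_congr fun y => ?_
      by_cases hy : y ∈ Sᶜ
      · simp only [f2, indicator_of_mem hy]
      · simp only [f2, indicator_of_notMem hy]; simp
    filter_upwards [eventually_gt_atTop 0, ENNReal.tendsto_nhds_zero.1 hv1 (ε / 2) hε2] with R hR h1
    have hsplit : ∀ x, ∫⁻ y, majFar (x - y) * f y
        = (∫⁻ y, f1 y * majFar (x - y)) + ∫⁻ y, majFar (x - y) * f2 y := by
      intro x
      rw [← lintegral_add_left (by fun_prop)]
      refine lintegral_congr fun y => ?_
      by_cases hy : y ∈ S <;> simp [f1, f2, hy, mul_comm]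
    have hw := measurable_wt R
    calc _ = (∫⁻ x, wt R x * ∫⁻ y, f1 y * majFar (x - y)) + ∫⁻ x, wt R x * ∫⁻ y, majFar (x - y) * f2 y := by
          simp_rw [hsplit, mul_add]
          rw [lintegral_add_left]
          exact hw.mul (Measurable.lintegral_prod_right' (f := fun z : E3 × E3 => f1 z.2 * majFar (z.1 - z.2)) (by fun_prop))
      _ ≤ ε / 2 + ∫⁻ x, wt R x * (B * (∫⁻ x, Sᶜ.indicator
            (fun x => f x ^ (3 / 2 : ℝ)) x) ^ (1 / (3 / 2 : ℝ))) := by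
          gcongr with x
          exact hb2 x
      _ ≤ ε / 2 + ε / 2 := by
          gcongr
          rw [lintegral_mul_const _ hw]
          exact le_trans (by gcongr; exact hW R hR) hn
      _ = ε := ENNReal.add_halves ε
  refine (hnear.add hfar ?_).mono (Eventually.of_forall fun x => le_of_eq ?_)
  · exact (Measurable.lintegral_prod_right' (f := fun z : E3 × E3 => majNear (z.1 - z.2) * f z.2)
      (by fun_prop)).aemeasurable
  · rw [← lintegral_add_left (by fun_prop)]
    exact lintegral_congr fun y => by rw [maj_eq, add_mul]


/-! ### Test functions on `G` -/

section TestFunctions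

variable {T : ℝ}

instance [Fact (0 < T)] : SigmaFinite (muG T) := by unfold muG; infer_instance
instance [Fact (0 < T)] : IsFiniteMeasureOnCompacts (muG T) := by unfold muG; infer_instance
instance [Fact (0 < T)] : (muG T).IsAddHaarMeasure := by unfold muG; infer_instance

/-- The periodic lift of a function on `G` to `ℝ × ℝ³`. -/
def lft {T : ℝ} {X : Type*} (φ : G T → X) (q : ℝ × E3) : X := φ ((q.1 : AddCircle T), q.2)

/-- Because the covering map is an open quotient map, continuity on G and identities between
functions on G can be checked on periodic lifts. -/
lemma isOpenQuotientMap_cover (T : ℝ) :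
    IsOpenQuotientMap (fun q : ℝ × E3 => (((q.1 : AddCircle T), q.2) : G T)) :=
  (QuotientAddGroup.isOpenQuotientMap_mk (N := AddSubgroup.zmultiples T)).prodMap .id

lemma exists_cover (p : G T) : ∃ q : ℝ × E3, (((q.1 : AddCircle T), q.2) : G T) = p :=
  (isOpenQuotientMap_cover T).surjective p

lemma IsTestG.contDiff {φ : G T → ℝ} (h : IsTestG T φ) : ContDiff ℝ ∞ (lft φ) := h.1

lemma IsTestG.continuous {φ : G T → ℝ} (h : IsTestG T φ) : Continuous φ :=
  (isOpenQuotientMap_cover T).continuous_comp_iff.1 h.1.continuous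

lemma IsTestG.integrable [Fact (0 < T)] {φ : G T → ℝ} (h : IsTestG T φ) : Integrable φ (muG T) :=
  h.continuous.integrable_of_hasCompactSupport h.2

/-- On the lift, spatial and time derivatives both become a Fréchet derivative applied to a fixed
vector. Linearity, smoothness and the commutation of derivatives on G are all inherited from there.
-/
lemma lft_pdx {φ : G T → ℝ} (h : ContDiff ℝ ∞ (lft φ)) (j : Fin 3) (q : ℝ × E3) :
    lft (pdx j φ) q = fderiv ℝ (lft φ) q (0, unitVec j) := by
  have hd : DifferentiableAt ℝ (lft φ) q := (h.differentiable (by simp)) q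
  have h1 : HasFDerivAt (fun x : E3 => (q.1, x)) (ContinuousLinearMap.inr ℝ ℝ E3) q.2 :=
    hasFDerivAt_prodMk_right q.1 q.2
  have h2 := HasFDerivAt.comp q.2 (show HasFDerivAt (lft φ) (fderiv ℝ (lft φ) q) (q.1, q.2) from
    hd.hasFDerivAt) h1
  change fderiv ℝ (fun x => lft φ (q.1, x)) q.2 (unitVec j) = _
  rw [HasFDerivAt.fderiv (f := fun x => lft φ (q.1, x)) h2]
  simp

lemma lft_pdt {φ : G T → ℝ} (h : ContDiff ℝ ∞ (lft φ)) (q : ℝ × E3) :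
    lft (pdt φ) q = fderiv ℝ (lft φ) q (1, 0) := by
  have hd : DifferentiableAt ℝ (lft φ) q := (h.differentiable (by simp)) q
  have h1 : HasDerivAt (fun s : ℝ => (q.1 + s, q.2)) ((1 : ℝ), (0 : E3)) 0 :=
    ((hasDerivAt_id (0 : ℝ)).const_add q.1).prodMk (hasDerivAt_const _ _)
  have h2 := HasFDerivAt.comp_hasDerivAt (0 : ℝ) (show HasFDerivAt (lft φ) (fderiv ℝ (lft φ) q)
    (q.1 + 0, q.2) by simpa using hd.hasFDerivAt) h1
  unfold pdt
  have : (fun s : ℝ => φ ((q.1 : AddCircle T) + (s : AddCircle T), q.2)) =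
      lft φ ∘ (fun s : ℝ => (q.1 + s, q.2)) := by ext s; simp [lft]
  change deriv (fun s : ℝ => φ ((q.1 : AddCircle T) + (s : AddCircle T), q.2)) 0 = _
  rw [this, h2.deriv]

lemma contDiff_lft_pdx {φ : G T → ℝ} (h : ContDiff ℝ ∞ (lft φ)) (j : Fin 3) :
    ContDiff ℝ ∞ (lft (pdx j φ)) := by
  rw [funext (lft_pdx h j)]
  exact (h.fderiv_right (m := ∞) (by simp)).clm_apply contDiff_const

lemma contDiff_lft_pdt {φ : G T → ℝ} (h : ContDiff ℝ ∞ (lft φ)) : ContDiff ℝ ∞ (lft (pdt φ)) := by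
  rw [funext (lft_pdt h)]
  exact (h.fderiv_right (m := ∞) (by simp)).clm_apply contDiff_const

lemma eq_zero_of_notMem_tsupport {φ : G T → ℝ} {p : G T} (hp : p ∉ tsupport φ) :
    φ =ᶠ[𝓝 p] 0 := notMem_tsupport_iff_eventuallyEq.1 hp

lemma pdx_eq_zero_of_notMem {φ : G T → ℝ} {p : G T} (hp : p ∉ tsupport φ) (j : Fin 3) :
    pdx j φ p = 0 := by
  have h1 : ∀ᶠ x in 𝓝 p.2, φ (p.1, x) = 0 := by
    have hc : Tendsto (fun x : E3 => (p.1, x)) (𝓝 p.2) (𝓝 p) := by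
      have : Continuous (fun x : E3 => (p.1, x)) := by fun_prop
      exact this.tendsto p.2
    exact hc.eventually (eq_zero_of_notMem_tsupport hp)
  unfold pdx pd
  rw [Filter.EventuallyEq.fderiv_eq (f₁ := fun x => φ (p.1, x)) (f := fun _ => (0 : ℝ)) h1]
  simp

lemma pdt_eq_zero_of_notMem {φ : G T → ℝ} {p : G T} (hp : p ∉ tsupport φ) :
    pdt φ p = 0 := by
  have h1 : ∀ᶠ s : ℝ in 𝓝 (0 : ℝ), φ (p.1 + (s : AddCircle T), p.2) = 0 := by
    have hc : Tendsto (fun s : ℝ => (p.1 + (s : AddCircle T), p.2)) (𝓝 0) (𝓝 p) := by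
      have : Continuous (fun s : ℝ => (p.1 + (s : AddCircle T), p.2)) := by
        have := AddCircle.continuous_mk' T
        fun_prop
      simpa using this.tendsto 0
    exact hc.eventually (eq_zero_of_notMem_tsupport hp)
  unfold pdt
  rw [Filter.EventuallyEq.deriv_eq (f := fun _ => (0 : ℝ)) h1]
  simp

lemma IsTestG.pdx {φ : G T → ℝ} (h : IsTestG T φ) (j : Fin 3) : IsTestG T (pdx j φ) :=
  ⟨contDiff_lft_pdx h.1 j, HasCompactSupport.intro h.2 fun _ hp => pdx_eq_zero_of_notMem hp j⟩

lemma IsTestG.pdt {φ : G T → ℝ} (h : IsTestG T φ) : IsTestG T (pdt φ) :=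
  ⟨contDiff_lft_pdt h.1, HasCompactSupport.intro h.2 fun _ hp => pdt_eq_zero_of_notMem hp⟩

lemma IsTestG.add {φ ψ : G T → ℝ} (h : IsTestG T φ) (h' : IsTestG T ψ) :
    IsTestG T (fun p => φ p + ψ p) := ⟨h.1.add h'.1, h.2.add h'.2⟩

lemma IsTestG.const_mul {φ : G T → ℝ} (h : IsTestG T φ) (c : ℝ) :
    IsTestG T (fun p => c * φ p) := ⟨contDiff_const.mul h.1, h.2.mul_left⟩

lemma IsTestG.sub {φ ψ : G T → ℝ} (h : IsTestG T φ) (h' : IsTestG T ψ) :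
    IsTestG T (fun p => φ p - ψ p) := by
  simpa [sub_eq_add_neg] using h.add (h'.const_mul (-1))

lemma isTestG_zero : IsTestG T (fun _ => (0 : ℝ)) := ⟨contDiff_const, HasCompactSupport.zero⟩

lemma IsTestG.sum {ι : Type*} (s : Finset ι) {φ : ι → G T → ℝ} (h : ∀ i ∈ s, IsTestG T (φ i)) :
    IsTestG T (fun p => ∑ i ∈ s, φ i p) := by
  classical
  induction s using Finset.induction_on with
  | empty => simpa using isTestG_zero
  | insert a s ha ih =>
    simp_rw [Finset.sum_insert ha]
    exact (h a (Finset.mem_insert_self _ _)).add (ih fun i hi => h i (Finset.mem_insert_of_mem hi))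

lemma IsTestG.comp_add {φ : G T → ℝ} (h : IsTestG T φ) (q : G T) :
    IsTestG T (fun p => φ (p + q)) := by
  obtain ⟨⟨s, y⟩, rfl⟩ := exists_cover q
  refine ⟨?_, h.2.comp_homeomorph (Homeomorph.addRight _)⟩
  have h1 := h.1.comp ((contDiff_fst.add (contDiff_const (c := s))).prodMk
    (contDiff_snd.add (contDiff_const (c := y))) : ContDiff ℝ ∞ fun q : ℝ × E3 => (q.1 + s, q.2 + y))
  simpa [Function.comp_def] using h1

lemma isTestG_mul [Fact (0 < T)] {θ : AddCircle T → ℝ} (hθ : ContDiff ℝ ∞ (fun s : ℝ => θ s)) {χ : E3 → ℝ}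
    (hχ : IsTestE χ) : IsTestG T (fun p => θ p.1 * χ p.2) := by
  refine ⟨(hθ.comp contDiff_fst).mul (hχ.1.comp contDiff_snd), ?_⟩
  refine HasCompactSupport.intro (K := univ ×ˢ tsupport χ) (isCompact_univ.prod hχ.2) fun p hp => ?_
  have : p.2 ∉ tsupport χ := fun h => hp ⟨trivial, h⟩
  rw [image_eq_zero_of_notMem_tsupport this, mul_zero]

lemma IsTestE.isTestG [Fact (0 < T)] {χ : E3 → ℝ} (hχ : IsTestE χ) : IsTestG T (fun p => χ p.2) := by
  simpa using isTestG_mul (T := T) (θ := fun _ => 1) contDiff_const hχ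

/-! ### Linearity, commutation and translation rules for derivatives of test functions. -/

section calculus
variable {φ ψ : G T → ℝ}

lemma lft_injective {φ ψ : G T → ℝ} (h : ∀ q, lft φ q = lft ψ q) : φ = ψ := by
  ext p
  obtain ⟨q, rfl⟩ := exists_cover p
  exact h q

lemma fderiv_fderiv_comm {F : ℝ × E3 → ℝ} (h : ContDiff ℝ ∞ F) (v w : ℝ × E3) (q : ℝ × E3) :
    fderiv ℝ (fun q => fderiv ℝ F q v) q w = fderiv ℝ (fun q => fderiv ℝ F q w) q v := by
  have hd : DifferentiableAt ℝ (fderiv ℝ F) q :=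
    ((h.fderiv_right (m := ∞) (by simp)).differentiable (by simp)) q
  have hs : IsSymmSndFDerivAt ℝ F q := h.contDiffAt.isSymmSndFDerivAt (by simpa using ENat.LEInfty.out)
  rw [fderiv_clm_apply hd (by fun_prop), fderiv_clm_apply hd (by fun_prop)]
  simpa using hs w v

lemma pdx_comm (h : IsTestG T φ) (j l : Fin 3) : pdx j (pdx l φ) = pdx l (pdx j φ) := by
  refine lft_injective fun q => ?_
  rw [lft_pdx (contDiff_lft_pdx h.1 l), lft_pdx (contDiff_lft_pdx h.1 j), funext (lft_pdx h.1 l),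
    funext (lft_pdx h.1 j)]
  exact fderiv_fderiv_comm h.1 _ _ q

lemma pdt_pdx_comm (h : IsTestG T φ) (l : Fin 3) : pdt (pdx l φ) = pdx l (pdt φ) := by
  refine lft_injective fun q => ?_
  rw [lft_pdt (contDiff_lft_pdx h.1 l), lft_pdx (contDiff_lft_pdt h.1), funext (lft_pdx h.1 l),
    funext (lft_pdt h.1)]
  exact fderiv_fderiv_comm h.1 _ _ q

lemma pdx_add (h : IsTestG T φ) (h' : IsTestG T ψ) (j : Fin 3) :
    pdx j (fun p => φ p + ψ p) = fun p => pdx j φ p + pdx j ψ p := by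
  refine lft_injective fun q => ?_
  rw [lft_pdx (h.add h').contDiff]
  change _ = lft (pdx j φ) q + lft (pdx j ψ) q
  rw [lft_pdx h.1, lft_pdx h'.1]
  exact congrArg (fun L : ℝ × E3 →L[ℝ] ℝ => L ((0 : ℝ), unitVec j)) (fderiv_fun_add ((h.1.differentiable (by simp)) q)
    ((h'.1.differentiable (by simp)) q))

lemma pdt_add (h : IsTestG T φ) (h' : IsTestG T ψ) :
    pdt (fun p => φ p + ψ p) = fun p => pdt φ p + pdt ψ p := by
  refine lft_injective fun q => ?_
  rw [lft_pdt (h.add h').contDiff]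
  change _ = lft (pdt φ) q + lft (pdt ψ) q
  rw [lft_pdt h.1, lft_pdt h'.1]
  exact congrArg (fun L : ℝ × E3 →L[ℝ] ℝ => L ((1 : ℝ), (0 : E3))) (fderiv_fun_add ((h.1.differentiable (by simp)) q)
    ((h'.1.differentiable (by simp)) q))

lemma pdx_const_mul (h : IsTestG T φ) (c : ℝ) (j : Fin 3) :
    pdx j (fun p => c * φ p) = fun p => c * pdx j φ p := by
  refine lft_injective fun q => ?_
  rw [lft_pdx (h.const_mul c).contDiff]
  change _ = c * lft (pdx j φ) q
  rw [lft_pdx h.1]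
  exact congrArg (fun L : ℝ × E3 →L[ℝ] ℝ => L ((0 : ℝ), unitVec j)) (fderiv_const_mul ((h.1.differentiable (by simp)) q) c)

lemma pdt_const_mul (h : IsTestG T φ) (c : ℝ) :
    pdt (fun p => c * φ p) = fun p => c * pdt φ p := by
  refine lft_injective fun q => ?_
  rw [lft_pdt (h.const_mul c).contDiff]
  change _ = c * lft (pdt φ) q
  rw [lft_pdt h.1]
  exact congrArg (fun L : ℝ × E3 →L[ℝ] ℝ => L ((1 : ℝ), (0 : E3))) (fderiv_const_mul ((h.1.differentiable (by simp)) q) c)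

lemma pdx_sub (h : IsTestG T φ) (h' : IsTestG T ψ) (j : Fin 3) :
    pdx j (fun p => φ p - ψ p) = fun p => pdx j φ p - pdx j ψ p := by
  have := pdx_add h (h'.const_mul (-1)) j
  rw [pdx_const_mul h' (-1) j] at this
  simpa [sub_eq_add_neg] using this

lemma pdt_sub (h : IsTestG T φ) (h' : IsTestG T ψ) :
    pdt (fun p => φ p - ψ p) = fun p => pdt φ p - pdt ψ p := by
  have := pdt_add h (h'.const_mul (-1))
  rw [pdt_const_mul h' (-1)] at this
  simpa [sub_eq_add_neg] using this

lemma pdx_sum {ι : Type*} (s : Finset ι) {φ : ι → G T → ℝ} (h : ∀ i ∈ s, IsTestG T (φ i)) (j : Fin 3) :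
    pdx j (fun p => ∑ i ∈ s, φ i p) = fun p => ∑ i ∈ s, pdx j (φ i) p := by
  classical
  induction s using Finset.induction_on with
  | empty => ext p; simp [pdx, pd]
  | insert a s ha ih =>
    simp_rw [Finset.sum_insert ha]
    have hs : ∀ i ∈ s, IsTestG T (φ i) := fun i hi => h i (Finset.mem_insert_of_mem hi)
    rw [pdx_add (h a (Finset.mem_insert_self _ _)) (IsTestG.sum s hs), ih hs]

lemma pdt_sum {ι : Type*} (s : Finset ι) {φ : ι → G T → ℝ} (h : ∀ i ∈ s, IsTestG T (φ i)) :
    pdt (fun p => ∑ i ∈ s, φ i p) = fun p => ∑ i ∈ s, pdt (φ i) p := by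
  classical
  induction s using Finset.induction_on with
  | empty => ext p; simp [pdt]
  | insert a s ha ih =>
    simp_rw [Finset.sum_insert ha]
    have hs : ∀ i ∈ s, IsTestG T (φ i) := fun i hi => h i (Finset.mem_insert_of_mem hi)
    rw [pdt_add (h a (Finset.mem_insert_self _ _)) (IsTestG.sum s hs), ih hs]

lemma pdx_comp_add (φ : G T → ℝ) (q : G T) (j : Fin 3) :
    pdx j (fun p => φ (p + q)) = fun p => pdx j φ (p + q) := by
  ext p
  unfold pdx pd
  have := fderiv_comp_add_right (𝕜 := ℝ) (f := fun x => φ (p.1 + q.1, x)) (x := p.2) q.2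
  exact congrArg (fun L : E3 →L[ℝ] ℝ => L (unitVec j)) this

lemma pdt_comp_add (φ : G T → ℝ) (q : G T) :
    pdt (fun p => φ (p + q)) = fun p => pdt φ (p + q) := by
  ext p
  unfold pdt
  congr 1
  ext s
  exact congrArg φ (Prod.ext (add_right_comm _ _ _) rfl)

lemma pdx_mul_fst (θ : AddCircle T → ℝ) {χ : E3 → ℝ} (hχ : Differentiable ℝ χ) (j : Fin 3) :
    pdx j (fun p : G T => θ p.1 * χ p.2) = fun p => θ p.1 * pd j χ p.2 := by
  ext p
  unfold pdx pd
  simp [fderiv_const_mul (hχ p.2)]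

lemma IsTestE.pd {χ : E3 → ℝ} (h : IsTestE χ) (j : Fin 3) : IsTestE (pd j χ) := by
  refine ⟨(h.1.fderiv_right (m := ∞) (by simp)).clm_apply contDiff_const, ?_⟩
  exact (h.2.fderiv_apply (𝕜 := ℝ) (v := unitVec j))

end calculus

end TestFunctions


/-! ### The Fourier transform of test functions on `G` -/

section Fourier

variable {T : ℝ}

lemma IsTestG.slice {φ : G T → ℝ} (h : IsTestG T φ) (t : AddCircle T) :
    IsTestE (fun x => φ (t, x)) := by
  obtain ⟨s, rfl⟩ := QuotientAddGroup.mk_surjective t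
  refine ⟨h.contDiff.comp (contDiff_const (c := s) |>.prodMk contDiff_id), ?_⟩
  refine HasCompactSupport.intro (K := Prod.snd '' tsupport φ) (h.2.isCompact.image continuous_snd) fun x hx => ?_
  refine image_eq_zero_of_notMem_tsupport fun hm => hx ⟨_, hm, rfl⟩

lemma IsTestE.integrable {χ : E3 → ℝ} (h : IsTestE χ) : Integrable χ :=
  h.1.continuous.integrable_of_hasCompactSupport h.2

/-- The characters of `G`. -/
def charG (κ : ℤ × E3) (p : G T) : ℂ :=
  fourier κ.1 p.1 * Complex.exp (Complex.I * (inner ℝ p.2 κ.2 : ℝ))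

/-- The Fourier transform of a test function, with the sign of the frequencies reversed. -/
def ft [Fact (0 < T)] (φ : G T → ℝ) (κ : ℤ × E3) : ℂ := ∫ p, (φ p : ℂ) * charG κ p ∂(muG T)

lemma fourierG_neg [Fact (0 < T)] (φ : G T → ℝ) (k : ℤ) (ξ : E3) :
    fourierG T φ (-k) (-ξ) = ft φ (k, ξ) := by
  unfold fourierG ft charG
  simp

lemma continuous_charG (κ : ℤ × E3) : Continuous (charG κ : G T → ℂ) := by
  unfold charG
  refine ((fourier κ.1).continuous.comp continuous_fst).mul ?_
  fun_prop

@[simp] lemma norm_charG (κ : ℤ × E3) (p : G T) : ‖charG κ p‖ = 1 := by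
  unfold charG
  rw [norm_mul, Complex.norm_exp, fourier_apply, Circle.norm_coe]
  simp

/-- The spatial Laplacian on `G`. -/
def lapG (φ : G T → ℝ) (p : G T) : ℝ := ∑ j, pdx j (pdx j φ) p

lemma IsTestG.lapG {φ : G T → ℝ} (h : IsTestG T φ) : IsTestG T (lapG φ) :=
  IsTestG.sum _ fun j _ => (h.pdx j).pdx j

variable [Fact (0 < T)]

lemma integrable_mul_charG {φ : G T → ℝ} (h : Integrable φ (muG T)) (κ : ℤ × E3) :
    Integrable (fun p => (φ p : ℂ) * charG κ p) (muG T) :=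
  h.ofReal.mul_bdd (c := 1) (continuous_charG κ).aestronglyMeasurable
    (Eventually.of_forall fun p => by simp)

lemma norm_ft_le (φ : G T → ℝ) (κ : ℤ × E3) : ‖ft φ κ‖ ≤ ∫ p, |φ p| ∂(muG T) := by
  unfold ft
  refine (norm_integral_le_integral_norm _).trans (le_of_eq ?_)
  simp

lemma ft_sub {φ ψ : G T → ℝ} (h : Integrable φ (muG T)) (h' : Integrable ψ (muG T)) (κ : ℤ × E3) :
    ft (fun p => φ p - ψ p) κ = ft φ κ - ft ψ κ := by
  unfold ft
  rw [← integral_sub (integrable_mul_charG h κ) (integrable_mul_charG h' κ)]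
  congr 1; ext p; push_cast; ring

lemma ft_add {φ ψ : G T → ℝ} (h : Integrable φ (muG T)) (h' : Integrable ψ (muG T)) (κ : ℤ × E3) :
    ft (fun p => φ p + ψ p) κ = ft φ κ + ft ψ κ := by
  unfold ft
  rw [← integral_add (integrable_mul_charG h κ) (integrable_mul_charG h' κ)]
  congr 1; ext p; push_cast; ring

lemma ft_const_mul (c : ℝ) (φ : G T → ℝ) (κ : ℤ × E3) :
    ft (fun p => c * φ p) κ = c * ft φ κ := by
  unfold ft
  rw [← integral_const_mul]
  congr 1; ext p; push_cast; ring

lemma ft_sum {φ : Fin 3 → G T → ℝ} (h : ∀ i, Integrable (φ i) (muG T)) (κ : ℤ × E3) :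
    ft (fun p => ∑ i, φ i p) κ = ∑ i, ft (φ i) κ := by
  unfold ft
  rw [← integral_finsetSum _ fun i _ => integrable_mul_charG (h i) κ]
  congr 1; ext p; push_cast; rw [Finset.sum_mul]

lemma hasFDerivAt_expI (ξ x : E3) :
    HasFDerivAt (fun x : E3 => Complex.exp (Complex.I * ((inner ℝ x ξ : ℝ) : ℂ)))
      ((Complex.exp (Complex.I * ((inner ℝ x ξ : ℝ) : ℂ)) * Complex.I) •
        (Complex.ofRealCLM ∘L (innerSL ℝ ξ))) x := by
  have h1 : HasFDerivAt (fun x : E3 => ((inner ℝ x ξ : ℝ) : ℂ)) (Complex.ofRealCLM ∘L (innerSL ℝ ξ)) x := by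
    have hfun : (fun x : E3 => ((inner ℝ x ξ : ℝ) : ℂ)) = ⇑(Complex.ofRealCLM ∘L (innerSL ℝ ξ)) := by
      ext x; simp [real_inner_comm]
    rw [hfun]
    exact ContinuousLinearMap.hasFDerivAt _
  have h2 := (h1.const_mul Complex.I).cexp
  rw [smul_smul] at h2
  exact h2

lemma ft_pdx {φ : G T → ℝ} (h : IsTestG T φ) (j : Fin 3) (κ : ℤ × E3) :
    ft (pdx j φ) κ = -(Complex.I * (κ.2 j : ℂ)) * ft φ κ := by
  unfold ft
  have hi1 := integrable_mul_charG (h.pdx j).integrable κ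
  have hi2 := integrable_mul_charG h.integrable κ
  unfold muG at hi1 hi2 ⊢
  rw [integral_prod _ hi1, integral_prod _ hi2, ← integral_const_mul]
  congr 1
  ext t
  set e : E3 → ℂ := fun x => Complex.exp (Complex.I * ((inner ℝ x κ.2 : ℝ) : ℂ)) with he
  have hs := h.slice t
  have hsd := (h.pdx j).slice t
  have hg : ∀ x, HasFDerivAt (fun x : E3 => ((φ (t, x) : ℝ) : ℂ))
      (Complex.ofRealCLM ∘L fderiv ℝ (fun x => φ (t, x)) x) x := fun x =>
    Complex.ofRealCLM.hasFDerivAt.comp x ((hs.1.differentiable (by simp)) x).hasFDerivAt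
  have hgd : ∀ x, fderiv ℝ (fun x : E3 => ((φ (t, x) : ℝ) : ℂ)) x (unitVec j) = (pdx j φ (t, x) : ℂ) := by
    intro x; rw [(hg x).fderiv]; simp [pdx, pd]
  have hfd : ∀ x, fderiv ℝ e x (unitVec j) = e x * (Complex.I * (κ.2 j : ℂ)) := by
    intro x
    rw [(hasFDerivAt_expI κ.2 x).fderiv]
    simp [unitVec, EuclideanSpace.inner_single_right, he, mul_assoc]
  have hen : ∀ x, ‖e x‖ = 1 := fun x => by simp [he, Complex.norm_exp]
  have hec : Continuous e := by fun_prop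
  have I1 : Integrable (fun x => e x * ((φ (t, x) : ℝ) : ℂ)) :=
    hs.integrable.ofReal.bdd_mul (c := 1) hec.aestronglyMeasurable (Eventually.of_forall fun x => (hen x).le)
  have I2 : Integrable (fun x => e x * ((pdx j φ (t, x) : ℝ) : ℂ)) :=
    hsd.integrable.ofReal.bdd_mul (c := 1) hec.aestronglyMeasurable (Eventually.of_forall fun x => (hen x).le)
  have key := integral_mul_fderiv_eq_neg_fderiv_mul_of_integrable (μ := (volume : Measure E3)) (𝕜 := ℂ)
    (f := e) (g := fun x : E3 => ((φ (t, x) : ℝ) : ℂ)) (v := unitVec j)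
    (by simp_rw [hfd]; refine (I1.mul_const (Complex.I * (κ.2 j : ℂ))).congr (Eventually.of_forall fun x => ?_); ring)
    (by simp_rw [hgd]; exact I2) I1
    (fun x _ => (hasFDerivAt_expI κ.2 x).differentiableAt) (fun x _ => (hg x).differentiableAt)
  simp_rw [hgd, hfd] at key
  have e1 : ∀ x, ((pdx j φ (t, x) : ℝ) : ℂ) * charG κ (t, x) = fourier κ.1 t * (e x * (pdx j φ (t, x) : ℂ)) := by
    intro x; simp only [charG, he]; ring
  have e2 : ∀ x, ((φ (t, x) : ℝ) : ℂ) * charG κ (t, x) = fourier κ.1 t * (e x * (φ (t, x) : ℂ)) := by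
    intro x; simp only [charG, he]; ring
  simp_rw [e1, e2]
  rw [integral_const_mul, integral_const_mul, key, ← integral_neg, ← integral_const_mul,
    ← integral_const_mul, ← integral_const_mul]
  congr 1; ext x; ring

lemma integral_circle_deriv {h h' : ℝ → ℂ} {g : AddCircle T → ℂ} (hh : ∀ s, HasDerivAt h (h' s) s)
    (hc : Continuous h') (hg : ∀ s : ℝ, g s = h' s) (hper : h T = h 0) :
    ∫ t, g t ∂(AddCircle.haarAddCircle (T := T)) = 0 := by
  rw [AddCircle.integral_haarAddCircle, ← AddCircle.intervalIntegral_preimage T 0 g]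
  simp_rw [hg]
  rw [intervalIntegral.integral_eq_sub_of_hasDerivAt (fun s _ => hh s) (hc.intervalIntegrable _ _)]
  simp [hper]

/-- At fixed x the sum of the two terms is the time derivative of φ times a character. That product
is T-periodic, so its derivative integrates to zero over the circle. -/
lemma ft_pdt {φ : G T → ℝ} (h : IsTestG T φ) (κ : ℤ × E3) :
    ft (pdt φ) κ = -(Complex.I * (2 * Real.pi / T * κ.1 : ℝ)) * ft φ κ := by
  have hi1 := integrable_mul_charG h.pdt.integrable κ
  have hi2 := integrable_mul_charG h.integrable κ
  set c : ℂ := Complex.I * (2 * Real.pi / T * κ.1 : ℝ) with hc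
  suffices hsuf : ∫ p, (((pdt φ p : ℝ) : ℂ) * charG κ p + c * ((φ p : ℂ) * charG κ p)) ∂(muG T) = 0 by
    rw [integral_add hi1 (hi2.const_mul c), integral_const_mul] at hsuf
    unfold ft
    linear_combination hsuf
  have hi := hi1.add (hi2.const_mul c)
  unfold muG at hi ⊢
  refine (integral_prod_symm _ hi).trans ?_
  have : ∀ x : E3, ∫ t, (((pdt φ (t, x) : ℝ) : ℂ) * charG κ (t, x) + c * ((φ (t, x) : ℂ) * charG κ (t, x)))
      ∂(AddCircle.haarAddCircle (T := T)) = 0 := by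
    intro x
    set e := Complex.exp (Complex.I * ((inner ℝ x κ.2 : ℝ) : ℂ)) with he
    have hφ : ∀ s : ℝ, HasDerivAt (fun s : ℝ => lft φ (s, x)) (lft (pdt φ) (s, x)) s := by
      intro s
      rw [lft_pdt h.1]
      have hd : DifferentiableAt ℝ (lft φ) (s, x) := (h.contDiff.differentiable (by simp)) _
      exact hd.hasFDerivAt.comp_hasDerivAt s ((hasDerivAt_id s).prodMk (hasDerivAt_const s x))
    have hcont : Continuous (fun s : ℝ => lft φ (s, x)) := h.contDiff.continuous.comp (by fun_prop)
    have hcont' : Continuous (fun s : ℝ => lft (pdt φ) (s, x)) :=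
      (contDiff_lft_pdt h.1).continuous.comp (by fun_prop)
    have hfc : Continuous (fun s : ℝ => (fourier κ.1 (s : AddCircle T) : ℂ)) :=
      (fourier κ.1).continuous.comp (AddCircle.continuous_mk' T)
    refine integral_circle_deriv (T := T)
      (h := fun s : ℝ => ((lft φ (s, x) : ℝ) : ℂ) * (fourier κ.1 (s : AddCircle T) * e))
      (h' := fun s : ℝ => ((lft (pdt φ) (s, x) : ℝ) : ℂ) * (fourier κ.1 (s : AddCircle T) * e)
        + ((lft φ (s, x) : ℝ) : ℂ) * (2 * Real.pi * Complex.I * κ.1 / T * fourier κ.1 (s : AddCircle T) * e))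
      (fun s => (hφ s).ofReal_comp.mul ((hasDerivAt_fourier T κ.1 s).mul_const e)) (by fun_prop)
      (fun s => ?_) ?_
    · simp only [charG, lft, hc, ← he]
      push_cast
      ring
    · simp only [lft, AddCircle.coe_period, AddCircle.coe_zero]
  exact (integral_congr_ae (Eventually.of_forall this)).trans (by simp)

lemma ft_lapG {φ : G T → ℝ} (h : IsTestG T φ) (κ : ℤ × E3) :
    ft (lapG φ) κ = -((‖κ.2‖ ^ 2 : ℝ) : ℂ) * ft φ κ := by
  unfold lapG
  rw [ft_sum fun i => ((h.pdx i).pdx i).integrable]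
  simp_rw [ft_pdx (h.pdx _), ft_pdx h]
  rw [normSq_eq, Fin.sum_univ_three]
  push_cast
  linear_combination ((κ.2 0 : ℂ) ^ 2 + (κ.2 1 : ℂ) ^ 2 + (κ.2 2 : ℂ) ^ 2) * ft φ κ * Complex.I_sq

/-- The operator (1 - Δ)²((2π/T)² - ∂_t²) multiplies the transform by (2π/T)²(1 + k²)(1 + |ξ|²)²,
while the transform of its image is bounded by an L¹ norm. The decay is just enough to be summable
in k and integrable in ξ. -/
lemma ft_decay {φ : G T → ℝ} (h : IsTestG T φ) : ∃ C : ℝ, 0 ≤ C ∧ ∀ κ : ℤ × E3,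
    ‖ft φ κ‖ ≤ C * ((1 + (κ.1 : ℝ) ^ 2)⁻¹ * ((1 + ‖κ.2‖ ^ 2) ^ 2)⁻¹) := by
  set a := (2 * Real.pi / T) ^ 2 with ha
  have hT : 0 < T := Fact.out
  have ha0 : 0 < a := by positivity
  set φ1 : G T → ℝ := fun p => φ p - lapG φ p with hφ1
  have h1 : IsTestG T φ1 := h.sub h.lapG
  set φ2 : G T → ℝ := fun p => φ1 p - lapG φ1 p with hφ2
  have h2 : IsTestG T φ2 := h1.sub h1.lapG
  set φ3 : G T → ℝ := fun p => a * φ2 p - pdt (pdt φ2) p with hφ3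
  have h3 : IsTestG T φ3 := (h2.const_mul a).sub h2.pdt.pdt
  have e : ∀ κ, ft φ3 κ = ((a * (1 + (κ.1 : ℝ) ^ 2) * (1 + ‖κ.2‖ ^ 2) ^ 2 : ℝ) : ℂ) * ft φ κ := by
    intro κ
    rw [hφ3, ft_sub (h2.const_mul a).integrable h2.pdt.pdt.integrable, ft_const_mul,
      ft_pdt h2.pdt, ft_pdt h2, hφ2, ft_sub h1.integrable h1.lapG.integrable, ft_lapG h1, hφ1,
      ft_sub h.integrable h.lapG.integrable, ft_lapG h, ha]
    push_cast
    linear_combination (-(2 * Real.pi / T * κ.1 : ℂ) ^ 2 * (1 + (‖κ.2‖ : ℂ) ^ 2) ^ 2 * ft φ κ) * Complex.I_sq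
  refine ⟨a⁻¹ * ∫ p, |φ3 p| ∂(muG T), by positivity, fun κ => ?_⟩
  have hb := norm_ft_le φ3 κ
  rw [e, norm_mul, Complex.norm_real, Real.norm_of_nonneg (by positivity)] at hb
  rw [show a⁻¹ * (∫ p, |φ3 p| ∂(muG T)) * ((1 + (κ.1 : ℝ) ^ 2)⁻¹ * ((1 + ‖κ.2‖ ^ 2) ^ 2)⁻¹)
    = (∫ p, |φ3 p| ∂(muG T)) / (a * (1 + (κ.1 : ℝ) ^ 2) * (1 + ‖κ.2‖ ^ 2) ^ 2) by field_simp,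
    le_div_iff₀ (by positivity)]
  linarith

end Fourier


/-! ### Fourier inversion on `G` -/

section Inversion

/-- The measure on the dual group `ℤ × ℝ³`. -/
def kap : Measure (ℤ × E3) := (Measure.count : Measure ℤ).prod (volume : Measure E3)

instance : SigmaFinite kap := by unfold kap; infer_instance

lemma integrable_slice {g : ℤ × E3 → ℂ} (h : Integrable g kap) (k : ℤ) :
    Integrable (fun ξ => g (k, ξ)) := by
  have := Integrable.prod_right_ae h
  exact Measure.ae_count_iff.1 this k

lemma hasSum_integral_kap {g : ℤ × E3 → ℂ} (h : Integrable g kap) :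
    HasSum (fun k : ℤ => ∫ ξ, g (k, ξ)) (∫ κ, g κ ∂kap) := by
  have h1 := Integrable.integral_prod_left h
  have hs : Summable (fun k : ℤ => ∫ ξ, g (k, ξ)) := by
    have h2 := h1
    rw [integrable_count_iff] at h2
    exact h2.of_norm
  have : ∫ κ, g κ ∂kap = ∑' k : ℤ, ∫ ξ, g (k, ξ) := by
    unfold kap at h ⊢
    rw [integral_prod _ h, integral_countable h1]
    simp
  rw [this]; exact hs.hasSum

variable {T : ℝ}

lemma continuous_charG_uncurry : Continuous (fun z : (ℤ × E3) × G T => charG z.1 z.2) := by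
  unfold charG
  simp_rw [fourier_apply]
  have h1 : Continuous (fun z : (ℤ × E3) × G T => z.1.1 • z.2.1) := by fun_prop
  have h2 : Continuous (fun z : (ℤ × E3) × G T => ((z.1.1 • z.2.1).toCircle : ℂ)) :=
    continuous_subtype_val.comp (AddCircle.continuous_toCircle.comp h1)
  refine h2.mul ?_
  fun_prop

variable [Fact (0 < T)]

lemma stronglyMeasurable_ft {φ : G T → ℝ} (h : Continuous φ) : StronglyMeasurable (ft φ) := by
  have : Continuous (fun z : (ℤ × E3) × G T => (φ z.2 : ℂ) * charG z.1 z.2) := by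
    have := continuous_charG_uncurry (T := T)
    fun_prop
  exact (this.stronglyMeasurable).integral_prod_right

lemma integrable_count_bound : Integrable (fun k : ℤ => (1 + (k : ℝ) ^ 2)⁻¹) Measure.count := by
  rw [integrable_count_iff]
  have h : Summable (fun k : ℤ => |(k : ℝ)| ^ (-2 : ℝ)) := by
    have := Real.summable_abs_int_rpow (b := 2) (by norm_num)
    simpa using this
  refine Summable.of_norm_bounded_eventually h ?_
  have : ∀ᶠ k : ℤ in cofinite, k ≠ 0 := (Set.finite_singleton 0).compl_mem_cofinite
  filter_upwards [this] with k hk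
  have hk' : (0 : ℝ) < |(k : ℝ)| := by simpa using hk
  rw [norm_norm, Real.norm_of_nonneg (by positivity), Real.rpow_neg hk'.le]
  rw [show |(k : ℝ)| ^ (2 : ℝ) = (k : ℝ) ^ 2 by rw [Real.rpow_two, sq_abs]]
  have : (0 : ℝ) < (k : ℝ) ^ 2 := by positivity
  exact inv_anti₀ this (by linarith)

lemma integrable_space_bound : Integrable (fun ξ : E3 => ((1 + ‖ξ‖ ^ 2) ^ 2)⁻¹) := by
  have h : Integrable (fun ξ : E3 => (1 + ‖ξ‖ ^ 2) ^ (-(4 : ℝ) / 2)) :=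
    integrable_rpow_neg_one_add_norm_sq (by simp; norm_num)
  refine h.congr (Eventually.of_forall fun ξ => ?_)
  simp only
  rw [show (-(4 : ℝ) / 2) = -(2 : ℕ) by norm_num, Real.rpow_neg (by positivity), Real.rpow_natCast]

/-- The singularity |ξ|^{-2} is integrable in dimension three. Hence multipliers dominated by
|ξ|^{-2}, such as 1/`sig`, can be paired with transforms of test functions even at k = 0. -/
lemma integrable_space_bound_div :
    Integrable (fun ξ : E3 => ((1 + ‖ξ‖ ^ 2) ^ 2)⁻¹ * (‖ξ‖ ^ 2)⁻¹) := by
  have h1 : Integrable ((Metric.ball (0 : E3) 1).indicator (fun ξ => ‖ξ‖ ^ (-2 : ℝ))) :=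
    (integrableOn_norm_rpow (by norm_num) 1).integrable_indicator measurableSet_ball
  refine (h1.add integrable_space_bound).mono' (by fun_prop) (Eventually.of_forall fun ξ => ?_)
  rw [Real.norm_of_nonneg (by positivity)]
  by_cases hξ : ξ ∈ Metric.ball (0 : E3) 1
  · rw [Pi.add_apply, indicator_of_mem hξ]
    have e : ‖ξ‖ ^ (-2 : ℝ) = (‖ξ‖ ^ 2)⁻¹ := by
      rw [Real.rpow_neg (norm_nonneg _)]; norm_num
    rw [e]
    have : ((1 + ‖ξ‖ ^ 2) ^ 2)⁻¹ ≤ 1 := inv_le_one_of_one_le₀ (one_le_pow₀ (by nlinarith [sq_nonneg ‖ξ‖]))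
    have h0 : 0 ≤ ((1 + ‖ξ‖ ^ 2) ^ 2)⁻¹ := by positivity
    have h2 : 0 ≤ (‖ξ‖ ^ 2)⁻¹ := by positivity
    nlinarith
  · rw [Pi.add_apply, indicator_of_notMem hξ, zero_add]
    have h1 : 1 ≤ ‖ξ‖ := by simpa using hξ
    have : (‖ξ‖ ^ 2)⁻¹ ≤ 1 := inv_le_one_of_one_le₀ (one_le_pow₀ h1)
    have h0 : 0 ≤ ((1 + ‖ξ‖ ^ 2) ^ 2)⁻¹ := by positivity
    nlinarith

lemma integrable_ft {φ : G T → ℝ} (h : IsTestG T φ) : Integrable (ft φ) kap := by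
  obtain ⟨C, hC, hb⟩ := ft_decay h
  have := (integrable_count_bound.mul_prod integrable_space_bound).const_mul C
  exact this.mono' (stronglyMeasurable_ft h.continuous).aestronglyMeasurable (Eventually.of_forall hb)

lemma integrable_ft_div {φ : G T → ℝ} (h : IsTestG T φ) :
    Integrable (fun κ => ‖ft φ κ‖ * (‖κ.2‖ ^ 2)⁻¹) kap := by
  obtain ⟨C, hC, hb⟩ := ft_decay h
  have := (integrable_count_bound.mul_prod integrable_space_bound_div).const_mul C
  have hm : Measurable (fun κ : ℤ × E3 => (‖κ.2‖ ^ 2)⁻¹) := by fun_prop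
  refine this.mono' ((stronglyMeasurable_ft h.continuous).norm.aestronglyMeasurable.mul
    hm.aestronglyMeasurable) (Eventually.of_forall fun κ => ?_)
  rw [Real.norm_of_nonneg (by positivity)]
  calc _ ≤ (C * ((1 + (κ.1 : ℝ) ^ 2)⁻¹ * ((1 + ‖κ.2‖ ^ 2) ^ 2)⁻¹)) * (‖κ.2‖ ^ 2)⁻¹ := by
        gcongr; exact hb κ
    _ = _ := by ring

/-- The inversion constant `(2π)⁻³`. -/
def invConst : ℂ := ((2 * Real.pi : ℝ) ^ 3 : ℂ)⁻¹

/-- The conjugate characters. -/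
def charInv {T : ℝ} (κ : ℤ × E3) (p : G T) : ℂ :=
  fourier (-κ.1) p.1 * Complex.exp (-(Complex.I * (inner ℝ p.2 κ.2 : ℝ)))

lemma charInv_eq {T : ℝ} (κ : ℤ × E3) (p : G T) : charInv κ p = charG (-κ) p := by
  simp [charInv, charG]

lemma continuous_charInv_uncurry : Continuous (fun z : (ℤ × E3) × G T => charInv z.1 z.2) := by
  simp_rw [charInv_eq]
  exact continuous_charG_uncurry.comp (by fun_prop : Continuous fun z : (ℤ × E3) × G T => (-z.1, z.2))

lemma norm_charInv (κ : ℤ × E3) (p : G T) : ‖charInv κ p‖ = 1 := by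
  rw [charInv_eq, norm_charG]

/-- Fourier inversion on ℝ³ for the k-th time mode of φ. The substitution ξ = -2πη between the two
conventions produces the constant (2π)^{-3}. -/
lemma integral_modes {φ : G T → ℝ} (h : IsTestG T φ) (k : ℤ) (x : E3) :
    ∫ t, (φ (t, x) : ℂ) * fourier k t ∂(AddCircle.haarAddCircle (T := T)) =
      invConst * ∫ ξ, ft φ (k, ξ) * Complex.exp (-(Complex.I * (inner ℝ x ξ : ℝ))) := by
  set f : E3 → ℂ := fun x => ∫ t, (φ (t, x) : ℂ) * fourier k t ∂(AddCircle.haarAddCircle (T := T)) with hf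
  have hφc := h.continuous
  have hint : Integrable (fun p : G T => (φ p : ℂ) * fourier k p.1)
      ((AddCircle.haarAddCircle (T := T)).prod (volume : Measure E3)) := by
    have : Integrable (fun p : G T => (φ p : ℂ)) (muG T) := h.integrable.ofReal
    refine this.mul_bdd (c := 1) ((fourier k).continuous.comp continuous_fst).aestronglyMeasurable
      (Eventually.of_forall fun p => ?_)
    rw [fourier_apply, Circle.norm_coe]
  have hfc : Continuous f := by
    obtain ⟨M, hM⟩ := h.2.exists_bound_of_continuous hφc
    refine continuous_of_dominated (bound := fun _ => M) (fun x => ?_) (fun x => ?_) (by fun_prop) ?_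
    · have : Continuous fun t : AddCircle T => (φ (t, x) : ℂ) * fourier k t := by fun_prop
      exact this.aestronglyMeasurable
    · refine Eventually.of_forall fun t => ?_
      rw [norm_mul, fourier_apply, Circle.norm_coe, mul_one, Complex.norm_real]
      exact hM _
    · refine Eventually.of_forall fun t => ?_
      have := hφc
      fun_prop
  have hfi : Integrable f := hint.integral_prod_right
  have hfour : ∀ η : E3, FourierTransform.fourier f η = ft φ (k, (-(2 * Real.pi)) • η) := by
    intro η
    rw [Real.fourier_eq']
    unfold ft muG
    rw [integral_prod_symm _ (integrable_mul_charG h.integrable _)]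
    congr 1; ext y
    rw [smul_eq_mul, hf, ← integral_const_mul]
    congr 1; ext t
    simp only [charG, inner_smul_right]
    rw [show Complex.I * ((-(2 * Real.pi) * inner ℝ y η : ℝ) : ℂ) = ((-2 * Real.pi * inner ℝ y η : ℝ) : ℂ) * Complex.I by
      push_cast; ring]
    ring
  have hfti : Integrable (FourierTransform.fourier f) := by
    rw [funext hfour]
    exact (integrable_slice (integrable_ft h) k).comp_smul (by simp [Real.pi_ne_zero])
  have hinv := congrFun (hfc.fourierInv_fourier_eq hfi hfti) x
  change f x = _
  rw [← hinv, Real.fourierInv_eq']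
  simp_rw [hfour]
  have hscale := Measure.integral_comp_smul (volume : Measure E3)
    (fun ξ => ft φ (k, ξ) * Complex.exp (-(Complex.I * (inner ℝ x ξ : ℝ)))) (-(2 * Real.pi))
  rw [show |((-(2 * Real.pi)) ^ Module.finrank ℝ E3)⁻¹| = ((2 * Real.pi) ^ 3)⁻¹ by
    simp only [finrank_euclideanSpace, Fintype.card_fin]
    rw [abs_inv, abs_pow, abs_neg, abs_of_pos (by positivity)]] at hscale
  rw [invConst, ← Complex.ofReal_pow, ← Complex.ofReal_inv, ← Complex.real_smul, ← hscale]
  congr 1; ext η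
  rw [smul_eq_mul, mul_comm]
  congr 2
  rw [inner_smul_right, real_inner_comm]
  push_cast; ring

/-- Inversion in space is done mode by mode; in time it is the pointwise convergence of the Fourier
series, whose coefficients are summable because the transform is integrable on the dual group. -/
lemma ft_inversion {φ : G T → ℝ} (h : IsTestG T φ) (p : G T) :
    (φ p : ℂ) = invConst * ∫ κ, ft φ κ * charInv κ p ∂kap := by
  have hint : Integrable (fun κ => ft φ κ * charInv κ p) kap :=
    (integrable_ft h).mul_bdd (c := 1) (continuous_charInv_uncurry.comp
      (by fun_prop : Continuous fun κ : ℤ × E3 => (κ, p))).aestronglyMeasurable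
      (Eventually.of_forall fun κ => (norm_charInv κ p).le)
  have hs := (hasSum_integral_kap hint).mul_left invConst
  have hmode : ∀ k : ℤ, invConst * ∫ ξ, ft φ (k, ξ) * charInv (k, ξ) p =
      (∫ t, (φ (t, p.2) : ℂ) * fourier k t ∂(AddCircle.haarAddCircle (T := T))) * fourier (-k) p.1 := by
    intro k
    rw [integral_modes h k p.2, mul_assoc, ← integral_mul_const]
    congr 2; ext ξ
    simp only [charInv]; ring
  simp_rw [hmode] at hs
  set F : C(AddCircle T, ℂ) := ⟨fun t => (φ (t, p.2) : ℂ), by have := h.continuous; fun_prop⟩ with hF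
  have hco : ∀ k : ℤ, fourierCoeff F (-k) =
      ∫ t, (φ (t, p.2) : ℂ) * fourier k t ∂(AddCircle.haarAddCircle (T := T)) := by
    intro k
    unfold fourierCoeff
    congr 1; ext t
    simp [hF, mul_comm]
  have hsumm : Summable (fourierCoeff F) := by
    rw [← (Equiv.neg ℤ).summable_iff]
    have := hs.summable.norm
    refine Summable.of_norm (this.congr fun k => ?_)
    rw [norm_mul, fourier_apply, Circle.norm_coe, mul_one]
    simp [hco]
  have h2 := has_pointwise_sum_fourier_series_of_summable hsumm p.1
  rw [← (Equiv.neg ℤ).hasSum_iff] at h2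
  have h3 : HasSum (fun k : ℤ => (∫ t, (φ (t, p.2) : ℂ) * fourier k t ∂(AddCircle.haarAddCircle (T := T)))
      * fourier (-k) p.1) (φ p : ℂ) := by
    refine h2.congr_fun fun k => ?_
    simp [hco]
  exact h3.unique hs

/-! ### The heat kernel in Fourier variables -/

lemma continuous_heat (s : ℝ) : Continuous (heat s) := by unfold heat; fun_prop

lemma heat_ofReal {s : ℝ} (y : E3) :
    ((heat s y : ℝ) : ℂ) = (((4 * Real.pi * s) ^ (-(3 / 2) : ℝ) : ℝ) : ℂ) *
      Complex.exp (-((1 / (4 * s) : ℝ) : ℂ) * ‖y‖ ^ 2) := by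
  unfold heat
  push_cast
  congr 2
  ring

lemma integrable_heat {s : ℝ} (hs : 0 < s) : Integrable (heat s) := by
  have h := (GaussianFourier.integrable_cexp_neg_mul_sq_norm_add (V := E3) (b := ((1 / (4 * s) : ℝ) : ℂ))
    (by rw [Complex.ofReal_re]; positivity) 0 0).const_mul (((4 * Real.pi * s) ^ (-(3 / 2) : ℝ) : ℝ) : ℂ)
  have h2 : Integrable (fun y => ((heat s y : ℝ) : ℂ)) := by
    refine h.congr (Eventually.of_forall fun y => ?_)
    simp only [heat_ofReal]
    simp
  simpa using h2.re

lemma integral_heat_exp {s : ℝ} (hs : 0 < s) (ξ : E3) :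
    ∫ y, ((heat s y : ℝ) : ℂ) * Complex.exp (-(Complex.I * (inner ℝ y ξ : ℝ))) =
      Complex.exp (-((s * ‖ξ‖ ^ 2 : ℝ) : ℂ)) := by
  have h := GaussianFourier.integral_cexp_neg_mul_sq_norm_add (V := E3) (b := ((1 / (4 * s) : ℝ) : ℂ))
    (by rw [Complex.ofReal_re]; positivity) (-Complex.I) ξ
  have e : ∀ y : E3, ((heat s y : ℝ) : ℂ) * Complex.exp (-(Complex.I * (inner ℝ y ξ : ℝ))) =
      (((4 * Real.pi * s) ^ (-(3 / 2) : ℝ) : ℝ) : ℂ) *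
        Complex.exp (-((1 / (4 * s) : ℝ) : ℂ) * ‖y‖ ^ 2 + -Complex.I * (inner ℝ ξ y : ℝ)) := by
    intro y
    rw [heat_ofReal, Complex.exp_add, real_inner_comm]
    simp only [neg_mul]
    ring
  simp_rw [e]
  rw [integral_const_mul, h]
  have e2 : ((Real.pi : ℂ) / ((1 / (4 * s) : ℝ) : ℂ)) ^ ((Module.finrank ℝ E3 : ℂ) / 2) =
      (((4 * Real.pi * s) ^ (3 / 2 : ℝ) : ℝ) : ℂ) := by
    rw [Complex.ofReal_cpow (by positivity)]
    simp only [finrank_euclideanSpace, Fintype.card_fin]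
    congr 1
    · push_cast; field_simp
    · push_cast; ring
  rw [e2, ← mul_assoc, ← Complex.ofReal_mul, ← Real.rpow_add (by positivity)]
  norm_num
  congr 1
  have : (s : ℂ) ≠ 0 := by exact_mod_cast hs.ne'
  field_simp

/-- The multiplier of the heat kernel at time `s` transported for the time `t`. -/
def heatSymbol {T : ℝ} (lam : ℝ) (t : ℝ) (s : ℝ) (κ : ℤ × E3) : ℂ :=
  fourier (-κ.1) (t : AddCircle T) *
    Complex.exp (-((s * ‖κ.2‖ ^ 2 : ℝ) : ℂ) + Complex.I * ((lam * t * κ.2 0 : ℝ) : ℂ))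

lemma norm_heatSymbol (lam t s : ℝ) (κ : ℤ × E3) :
    ‖heatSymbol (T := T) lam t s κ‖ = Real.exp (-(s * ‖κ.2‖ ^ 2)) := by
  unfold heatSymbol
  rw [norm_mul, fourier_apply, Circle.norm_coe, one_mul, Complex.norm_exp]
  simp only [Complex.add_re, Complex.neg_re, Complex.ofReal_re, Complex.mul_re, Complex.I_re,
    Complex.ofReal_im, Complex.I_im]
  simp

/-- Insert the inversion formula for φ and exchange the integrals; the inner one is the transform of
a Gaussian translated by the drift. The kernel time s is kept apart from the drift time t because
the tails in `theta` integrate over s at fixed t. -/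
lemma integral_heat_mul_test {φ : G T → ℝ} (h : IsTestG T φ) (lam t : ℝ) {s : ℝ} (hs : 0 < s) :
    ((∫ x, heat s (x + (lam * t) • unitVec 0) * φ ((t : AddCircle T), x) : ℝ) : ℂ) =
      invConst * ∫ κ, ft φ κ * heatSymbol (T := T) lam t s κ ∂kap := by
  set a : E3 := (lam * t) • unitVec 0 with ha
  have hh : Integrable (fun x => ((heat s (x + a) : ℝ) : ℂ)) := ((integrable_heat hs).comp_add_right a).ofReal
  have hprod : Integrable (fun z : E3 × (ℤ × E3) =>
      (((heat s (z.1 + a) : ℝ) : ℂ) * ft φ z.2) * charInv z.2 ((t : AddCircle T), z.1))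
      ((volume : Measure E3).prod kap) := by
    refine (hh.mul_prod (integrable_ft h)).mul_bdd (c := 1) ?_ (Eventually.of_forall fun z => (norm_charInv _ _).le)
    exact (continuous_charInv_uncurry.comp (by fun_prop :
      Continuous fun z : E3 × (ℤ × E3) => (z.2, (((t : AddCircle T), z.1) : G T)))).aestronglyMeasurable
  calc ((∫ x, heat s (x + a) * φ ((t : AddCircle T), x) : ℝ) : ℂ)
      = ∫ x, ((heat s (x + a) : ℝ) : ℂ) * (φ ((t : AddCircle T), x) : ℂ) := by
        rw [← integral_complex_ofReal]; congr 1; ext x; push_cast; rfl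
    _ = ∫ x, invConst * ∫ κ, (((heat s (x + a) : ℝ) : ℂ) * ft φ κ) * charInv κ ((t : AddCircle T), x) ∂kap := by
        congr 1; ext x
        rw [ft_inversion h, mul_left_comm, ← integral_const_mul]
        congr 2; ext κ; ring
    _ = invConst * ∫ κ, (∫ x, (((heat s (x + a) : ℝ) : ℂ) * ft φ κ) * charInv κ ((t : AddCircle T), x)) ∂kap := by
        rw [integral_const_mul, integral_integral_swap hprod]
    _ = _ := by
        congr 2; ext κ
        have e : ∀ x : E3, (((heat s (x + a) : ℝ) : ℂ) * ft φ κ) * charInv κ ((t : AddCircle T), x) =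
            (ft φ κ * fourier (-κ.1) (t : AddCircle T) * Complex.exp (Complex.I * ((lam * t * κ.2 0 : ℝ) : ℂ))) *
              (((heat s (x + a) : ℝ) : ℂ) * Complex.exp (-(Complex.I * (inner ℝ (x + a) κ.2 : ℝ)))) := by
          intro x
          have : inner ℝ (x + a) κ.2 = inner ℝ x κ.2 + lam * t * κ.2 0 := by
            rw [inner_add_left, ha, inner_smul_left]
            simp [unitVec, EuclideanSpace.inner_single_left]
          rw [this, charInv]
          rw [show -(Complex.I * ((inner ℝ x κ.2 + lam * t * κ.2 0 : ℝ) : ℂ)) =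
            -(Complex.I * ((inner ℝ x κ.2 : ℝ) : ℂ)) + -(Complex.I * ((lam * t * κ.2 0 : ℝ) : ℂ)) by push_cast; ring,
            Complex.exp_add]
          have h1 : Complex.exp (Complex.I * ((lam * t * κ.2 0 : ℝ) : ℂ)) *
            Complex.exp (-(Complex.I * ((lam * t * κ.2 0 : ℝ) : ℂ))) = 1 := by
            rw [← Complex.exp_add]; simp
          linear_combination (-((heat s (x + a) : ℝ) : ℂ) * ft φ κ * fourier (-κ.1) (t : AddCircle T) *
            Complex.exp (-(Complex.I * ((inner ℝ x κ.2 : ℝ) : ℂ)))) * h1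
        simp_rw [e]
        rw [integral_const_mul, integral_add_right_eq_self (fun x =>
          ((heat s x : ℝ) : ℂ) * Complex.exp (-(Complex.I * (inner ℝ x κ.2 : ℝ)))) a, integral_heat_exp hs,
          heatSymbol, Complex.exp_add]
        ring

end Inversion


/-! ### Unrolling the circle -/

section Unroll

variable {T : ℝ} [hT : Fact (0 < T)]

/-- The point of `(nT, (n+1)T]` over a point of the circle. -/
def unroll (T : ℝ) [Fact (0 < T)] (z : ℕ × AddCircle T) : ℝ :=
  (AddCircle.equivIoc T 0 z.2 : ℝ) + z.1 * T

/-- `T` times the counting measure. -/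
def nu (T : ℝ) : Measure ℕ := Real.toNNReal T • Measure.count

instance : SigmaFinite (nu T) := by unfold nu; infer_instance

lemma measurable_unroll : Measurable (unroll T) := by
  have h : Measurable (AddCircle.equivIoc T 0) := (AddCircle.measurableEquivIoc T 0).measurable
  unfold unroll
  exact ((measurable_subtype_coe.comp h).comp measurable_snd).add
    ((measurable_from_top.comp measurable_fst).mul_const T)

lemma coe_unroll (z : ℕ × AddCircle T) : ((unroll T z : ℝ) : AddCircle T) = z.2 := by
  unfold unroll
  rw [AddCircle.coe_add, AddCircle.coe_equivIoc, ← nsmul_eq_mul, AddCircle.coe_nsmul, AddCircle.coe_period,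
    smul_zero, add_zero]

/-- The half-line is the disjoint union of the intervals (nT, (n+1)T], each a copy of the circle.
The weight T in `nu` compensates for the normalization of the measure on 𝕋. -/
lemma lintegral_Ioi_eq_unroll {F : ℝ → ℝ≥0∞} (hF : Measurable F) :
    ∫⁻ t in Ioi (0 : ℝ), F t = ∫⁻ n, ∫⁻ τ, F (unroll T (n, τ)) ∂AddCircle.haarAddCircle ∂(nu T) := by
  have hpos := hT.out
  have hmono : Monotone (fun n : ℕ => (n : ℝ) * T) := fun a b hab => by
    have : (a : ℝ) ≤ b := by exact_mod_cast hab
    simp only; gcongr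
  have hU : ⋃ n : ℕ, Ioc ((n : ℝ) * T) (((n + 1 : ℕ) : ℝ) * T) = Ioi 0 := by
    have := iUnion_Ioc_map_succ_eq_Ioi (f := fun n : ℕ => (n : ℝ) * T)
      (fun n => by simp; positivity) (by
        rw [not_bddAbove_iff]
        intro x
        obtain ⟨n, hn⟩ := exists_nat_gt (x / T)
        exact ⟨_, ⟨n, rfl⟩, by simpa [div_lt_iff₀ hpos] using hn⟩)
    simpa [Nat.succ_eq_add_one] using this
  have hd : Pairwise (Function.onFun Disjoint fun n : ℕ => Ioc ((n : ℝ) * T) (((n + 1 : ℕ) : ℝ) * T)) :=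
    hmono.pairwise_disjoint_on_Ioc_succ
  rw [← hU, lintegral_iUnion (fun _ => measurableSet_Ioc) hd, nu, lintegral_smul_measure, lintegral_count]
  rw [← ENNReal.tsum_const_smul]
  refine tsum_congr fun n => ?_
  have h1 : ∫⁻ t in Ioc ((n : ℝ) * T) (((n + 1 : ℕ) : ℝ) * T), F t = ∫⁻ t in Ioc 0 (0 + T), F (t + n * T) := by
    have := (measurePreserving_add_right (volume : Measure ℝ) ((n : ℝ) * T)).setLIntegral_comp_preimage
      (s := Ioc ((n : ℝ) * T) (((n + 1 : ℕ) : ℝ) * T)) measurableSet_Ioc hF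
    rw [← this]
    congr 2
    ext t
    simp [add_mul, add_comm]
  rw [h1]
  have h2 : ∫⁻ t in Ioc 0 (0 + T), F (t + n * T) =
      ∫⁻ t in Ioc 0 (0 + T), (fun τ : AddCircle T => F (unroll T (n, τ))) t := by
    refine setLIntegral_congr_fun measurableSet_Ioc fun t ht => ?_
    simp only [unroll, AddCircle.equivIoc_coe_of_mem ht]
  rw [h2, AddCircle.lintegral_preimage T 0 (fun τ : AddCircle T => F (unroll T (n, τ))), AddCircle.volume_eq_smul_haarAddCircle, lintegral_smul_measure]
  rfl

lemma measurePreserving_unroll : MeasurePreserving (unroll T)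
    ((nu T).prod AddCircle.haarAddCircle) (volume.restrict (Ioi 0)) := by
  refine ⟨measurable_unroll, ?_⟩
  ext s hs
  rw [Measure.map_apply measurable_unroll hs, ← lintegral_indicator_one hs,
    lintegral_Ioi_eq_unroll (T := T) (measurable_one.indicator hs),
    ← lintegral_indicator_one (measurable_unroll hs), lintegral_prod]
  · rfl
  · exact (measurable_one.indicator (measurable_unroll hs)).aemeasurable

/-- The unrolling of the time variable. -/
def unrollG (T : ℝ) [Fact (0 < T)] (z : ℕ × G T) : ℝ × E3 := (unroll T (z.1, z.2.1), z.2.2)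

lemma measurePreserving_unrollG : MeasurePreserving (unrollG T)
    ((nu T).prod (muG T)) ((volume.restrict (Ioi 0)).prod volume) := by
  have h1 : MeasurePreserving (Prod.map (unroll T) (id : E3 → E3))
      (((nu T).prod AddCircle.haarAddCircle).prod volume) ((volume.restrict (Ioi 0)).prod volume) :=
    measurePreserving_unroll.prod (MeasurePreserving.id _)
  have h2 : MeasurePreserving MeasurableEquiv.prodAssoc
      (((nu T).prod (AddCircle.haarAddCircle (T := T))).prod (volume : Measure E3)) ((nu T).prod (muG T)) :=
    measurePreserving_prodAssoc _ _ _
  exact h1.comp h2.symm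

/-! ### Local integrability on `G` from time averages -/

/-- Some average at a scale R ≥ 1 is finite, and the weight at that scale is bounded below on K.
Vanishing averages thus also encode local integrability. -/
lemma VanishAvg.setLIntegral_lt_top {d : E3 → ℝ≥0∞} (h : VanishAvg d) {K : Set E3} (hK : IsCompact K) :
    ∫⁻ x in K, d x < ⊤ := by
  obtain ⟨R, hR1, hR⟩ := ((eventually_ge_atTop (1 : ℝ)).and
    (h.eventually (gt_mem_nhds (show (0 : ℝ≥0∞) < 1 by simp)))).exists
  obtain ⟨B, hB⟩ := hK.isBounded.exists_norm_le
  have hR0 : 0 < R := by linarith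
  set B' := max B 0
  have hB0 : 0 ≤ B' := le_max_right _ _
  set c : ℝ := (R ^ 3)⁻¹ * (1 + B') ^ (-4 : ℝ)
  have hc : 0 < c := by positivity
  have hle : ∀ x ∈ K, ENNReal.ofReal c ≤ wt R x := by
    intro x hx
    unfold wt
    refine ENNReal.ofReal_le_ofReal ?_
    have h1 : ‖R⁻¹ • x‖ ≤ B' := by
      rw [norm_smul, norm_inv, Real.norm_of_nonneg hR0.le]
      calc R⁻¹ * ‖x‖ ≤ 1 * ‖x‖ := by gcongr; exact inv_le_one_of_one_le₀ hR1
        _ ≤ B' := by rw [one_mul]; exact (hB x hx).trans (le_max_left _ _)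
    refine mul_le_mul_of_nonneg_left ?_ (by positivity)
    exact Real.rpow_le_rpow_of_nonpos (by positivity) (by linarith) (by norm_num)
  have h2 : ENNReal.ofReal c * ∫⁻ x in K, d x < ⊤ := by
    rw [← lintegral_const_mul' _ _ ENNReal.ofReal_ne_top]
    calc _ ≤ ∫⁻ x in K, wt R x * d x := setLIntegral_mono' hK.measurableSet fun x hx => by
            gcongr; exact hle x hx
      _ ≤ ∫⁻ x, wt R x * d x := setLIntegral_le_lintegral _ _
      _ < ⊤ := hR.trans_le le_top
  exact ENNReal.lt_top_of_mul_ne_top_right h2.ne (by simpa using hc)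

lemma lintegral_muG {F : G T → ℝ≥0∞} (hF : AEMeasurable F (muG T)) :
    ∫⁻ p, F p ∂(muG T) = ∫⁻ x, ∫⁻ τ, F (τ, x) ∂AddCircle.haarAddCircle := by
  unfold muG at *
  exact lintegral_prod_symm _ hF

/-- A compact subset of G lies in the cylinder over its spatial projection, so a bound on the time
mean of the modulus is enough. -/
lemma locallyIntegrable_of_mean_le {g : G T → ℝ} (hg : AEStronglyMeasurable g (muG T)) {d : E3 → ℝ≥0∞}
    (hle : ∀ᵐ x, ∫⁻ τ, ‖g (τ, x)‖ₑ ∂AddCircle.haarAddCircle ≤ d x)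
    (hd : ∀ K : Set E3, IsCompact K → ∫⁻ x in K, d x < ⊤) : LocallyIntegrable g (muG T) := by
  rw [locallyIntegrable_iff]
  intro K hK
  have hK' : IsCompact (Prod.snd '' K) := hK.image continuous_snd
  refine ⟨hg.restrict, ?_⟩
  rw [hasFiniteIntegral_iff_enorm]
  calc ∫⁻ p in K, ‖g p‖ₑ ∂(muG T)
      ≤ ∫⁻ p in Prod.snd ⁻¹' (Prod.snd '' K), ‖g p‖ₑ ∂(muG T) :=
        lintegral_mono_set (subset_preimage_image _ _)
    _ = ∫⁻ p, (Prod.snd ⁻¹' (Prod.snd '' K)).indicator (fun p => ‖g p‖ₑ) p ∂(muG T) := by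
        rw [lintegral_indicator (hK'.measurableSet.preimage measurable_snd)]
    _ = ∫⁻ x, ∫⁻ τ, (Prod.snd ⁻¹' (Prod.snd '' K)).indicator (fun p => ‖g p‖ₑ) (τ, x)
          ∂(AddCircle.haarAddCircle (T := T)) :=
        lintegral_muG (hg.enorm.indicator (hK'.measurableSet.preimage measurable_snd))
    _ ≤ ∫⁻ x, (Prod.snd '' K).indicator d x := by
        refine lintegral_mono_ae (hle.mono fun x hx => ?_)
        by_cases h : x ∈ Prod.snd '' K
        · rw [indicator_of_mem h]
          refine le_trans (lintegral_mono fun τ => ?_) hx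
          exact indicator_le_self _ _ _
        · rw [indicator_of_notMem h]
          refine le_of_eq ?_
          have : ∀ τ : AddCircle T,
              (Prod.snd ⁻¹' (Prod.snd '' K)).indicator (fun p : G T => ‖g p‖ₑ) (τ, x) = 0 :=
            fun τ => indicator_of_notMem (by simpa using h) _
          simp [this]
    _ < ⊤ := by rw [lintegral_indicator hK'.measurableSet]; exact hd _ hK'

end Unroll

/-! ### Periodized and steady kernels -/

section Kernels

/-- A kernel transported by the drift. -/
def trn (lam : ℝ) (k : ℝ → E3 → ℝ) (t : ℝ) (x : E3) : ℝ := k t (x + (lam * t) • unitVec 0)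

/-- The time-periodic kernel generated by `k`. -/
def per (T : ℝ) [Fact (0 < T)] (lam : ℝ) (k : ℝ → E3 → ℝ) (p : G T) : ℝ :=
  ∫ n, trn lam k (unroll T (n, p.1)) p.2 ∂(nu T)

/-- The steady kernel generated by `k`. -/
def stat (lam : ℝ) (k : ℝ → E3 → ℝ) (x : E3) : ℝ := ∫ t in Ioi (0 : ℝ), trn lam k t x

/-- Measurable kernels with parabolic bounds. -/
structure Kern (k : ℝ → E3 → ℝ) : Prop where
  meas : Measurable (Function.uncurry k)
  bound : ∃ C : ℝ≥0, ∀ t, 0 < t → ∀ y, |k t y| ≤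
    C * ((‖y‖ ^ 2 + t) ^ (-(3 / 2) : ℝ) + (‖y‖ ^ 2 + t) ^ (-2 : ℝ))

variable {k k' : ℝ → E3 → ℝ} {T lam : ℝ} 

lemma Kern.add (h : Kern k) (h' : Kern k') : Kern (fun t y => k t y + k' t y) := by
  obtain ⟨C, hC⟩ := h.bound
  obtain ⟨C', hC'⟩ := h'.bound
  refine ⟨h.meas.add h'.meas, C + C', fun t ht y => ?_⟩
  have := (abs_add_le (k t y) (k' t y)).trans (add_le_add (hC t ht y) (hC' t ht y))
  push_cast
  linarith

lemma Kern.const_mul (h : Kern k) (c : ℝ) : Kern (fun t y => c * k t y) := by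
  obtain ⟨C, hC⟩ := h.bound
  refine ⟨h.meas.const_mul c, ‖c‖₊ * C, fun t ht y => ?_⟩
  rw [abs_mul]
  push_cast
  rw [mul_assoc]
  exact mul_le_mul_of_nonneg_left (hC t ht y) (abs_nonneg c)

lemma Kern.measurable_trn (h : Kern k) : Measurable (Function.uncurry (trn lam k)) := by
  have : Measurable (fun q : ℝ × E3 => (q.1, q.2 + (lam * q.1) • unitVec 0)) := by fun_prop
  exact h.meas.comp this

/-- Evaluated at x + λt e_1, the parabolic bounds of a kernel become powers of `qform`. -/
lemma Kern.lintegral_le (h : Kern k) (hlam : 0 < lam) : ∃ C : ℝ≥0, ∀ x,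
    ∫⁻ t in Ioi (0 : ℝ), ‖trn lam k t x‖ₑ ≤ C * maj x := by
  obtain ⟨C, hC⟩ := h.bound
  obtain ⟨C', hC'⟩ := lintegral_qform_le hlam
  refine ⟨C * (C' + C'), fun x => ?_⟩
  have hm : Measurable (fun t => qform lam t x) := by unfold qform; fun_prop
  calc ∫⁻ t in Ioi (0 : ℝ), ‖trn lam k t x‖ₑ
      ≤ ∫⁻ t in Ioi (0 : ℝ), C * (ENNReal.ofReal (qform lam t x ^ (-(3 / 2) : ℝ)) +
          ENNReal.ofReal (qform lam t x ^ (-2 : ℝ))) := by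
        refine setLIntegral_mono' measurableSet_Ioi fun t ht => ?_
        have ht : 0 < t := ht
        have hq : 0 < qform lam t x := by unfold qform; positivity
        have h1 := hC t ht (x + (lam * t) • unitVec 0)
        rw [← ENNReal.ofReal_add (by positivity) (by positivity), ← ENNReal.ofReal_coe_nnreal,
          ← ENNReal.ofReal_mul (by positivity), ← ofReal_norm]
        exact ENNReal.ofReal_le_ofReal h1
    _ = C * ((∫⁻ t in Ioi (0 : ℝ), ENNReal.ofReal (qform lam t x ^ (-(3 / 2) : ℝ))) +
          ∫⁻ t in Ioi (0 : ℝ), ENNReal.ofReal (qform lam t x ^ (-2 : ℝ))) := by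
        rw [lintegral_const_mul' _ _ ENNReal.coe_ne_top, lintegral_add_left (by fun_prop)]
    _ ≤ C * (C' * maj x + C' * maj x) := by gcongr; exacts [(hC' x).1, (hC' x).2]
    _ = _ := by push_cast; ring

variable [Fact (0 < T)]

lemma Kern.stronglyMeasurable_per (h : Kern k) : StronglyMeasurable (per T lam k) := by
  have h1 : Measurable (fun z : G T × ℕ => (unroll T (z.2, z.1.1), z.1.2)) :=
    (measurable_unroll.comp (by fun_prop : Measurable fun z : G T × ℕ => (z.2, z.1.1))).prodMk (by fun_prop)
  have h2 : StronglyMeasurable (Function.uncurry fun (p : G T) (n : ℕ) => trn lam k (unroll T (n, p.1)) p.2) :=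
    ((h.measurable_trn (lam := lam)).comp h1).stronglyMeasurable
  exact h2.integral_prod_right

lemma Kern.lintegral_per_le (h : Kern k) (hlam : 0 < lam) : ∃ C : ℝ≥0, ∀ x,
    ∫⁻ τ, ‖per T lam k (τ, x)‖ₑ ∂AddCircle.haarAddCircle ≤ C * maj x := by
  obtain ⟨C, hC⟩ := h.lintegral_le hlam
  refine ⟨C, fun x => le_trans ?_ (hC x)⟩
  have hm : Measurable (fun t => ‖trn lam k t x‖ₑ) :=
    ((h.measurable_trn (lam := lam)).comp (by fun_prop : Measurable fun t : ℝ => (t, x))).enorm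
  rw [lintegral_Ioi_eq_unroll (T := T) hm, lintegral_lintegral_swap]
  · exact lintegral_mono fun τ => enorm_integral_le_lintegral_enorm _
  · exact (hm.comp measurable_unroll).aemeasurable

lemma maj_lt_top {x : E3} (hx : x ≠ 0) : maj x < ⊤ := by
  unfold maj
  split_ifs
  · have : 0 < ‖x‖ := norm_pos_iff.2 hx
    rw [ENNReal.inv_lt_top, ENNReal.ofReal_pos]
    positivity
  · exact ENNReal.ofReal_lt_top

lemma setLIntegral_maj_lt_top (C : ℝ≥0) {K : Set E3} (hK : IsCompact K) : ∫⁻ x in K, C * maj x < ⊤ :=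
  (vanishAvg_maj.const_mul C).setLIntegral_lt_top hK

/-- Averaging the periodization over one period unrolls to the integral over the half-line. Away
from the origin `maj` is finite, so Fubini applies at every such x. -/
lemma Kern.integral_per (h : Kern k) (hlam : 0 < lam) {x : E3} (hx : x ≠ 0) :
    Integrable (fun τ => per T lam k (τ, x)) AddCircle.haarAddCircle ∧
    ∫ τ, per T lam k (τ, x) ∂AddCircle.haarAddCircle = stat lam k x := by
  obtain ⟨C, hC⟩ := h.lintegral_le hlam
  have hm : Measurable (fun t => trn lam k t x) :=
    (h.measurable_trn (lam := lam)).comp (by fun_prop : Measurable fun t : ℝ => (t, x))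
  have hi : Integrable (fun t => trn lam k t x) (volume.restrict (Ioi 0)) :=
    ⟨hm.aestronglyMeasurable, lt_of_le_of_lt (hC x) (ENNReal.mul_lt_top ENNReal.coe_lt_top (maj_lt_top hx))⟩
  have hmp := measurePreserving_unroll (T := T)
  have hi2 := hmp.integrable_comp_of_integrable hi
  refine ⟨hi2.integral_prod_right, ?_⟩
  rw [stat, ← hmp.map_eq, integral_map hmp.aemeasurable hm.aestronglyMeasurable]
  exact (integral_prod_symm _ hi2).symm

lemma Kern.locallyIntegrable_per (h : Kern k) (hlam : 0 < lam) :
    LocallyIntegrable (per T lam k) (muG T) := by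
  obtain ⟨C, hC⟩ := h.lintegral_per_le (T := T) hlam
  exact locallyIntegrable_of_mean_le h.stronglyMeasurable_per.aestronglyMeasurable
    (Eventually.of_forall hC) fun K hK => setLIntegral_maj_lt_top C hK

lemma exists_bound_of_compactSupport {ψ : G T → ℝ} (hc : Continuous ψ) (hs : HasCompactSupport ψ) :
    ∃ (M : ℝ≥0) (K : Set E3), IsCompact K ∧ ∀ p, ‖ψ p‖ₑ ≤ K.indicator (fun _ => (M : ℝ≥0∞)) p.2 := by
  obtain ⟨M, hM⟩ := hs.exists_bound_of_continuous hc
  refine ⟨Real.toNNReal M, Prod.snd '' tsupport ψ, hs.isCompact.image continuous_snd, fun p => ?_⟩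
  by_cases h : p ∈ tsupport ψ
  · rw [indicator_of_mem (mem_image_of_mem _ h), ← ofReal_norm]
    exact ENNReal.ofReal_le_ofReal (hM p)
  · rw [image_eq_zero_of_notMem_tsupport h]; simp

lemma Kern.integrable_unfold (h : Kern k) (hlam : 0 < lam) {ψ : G T → ℝ} (hc : Continuous ψ)
    (hs : HasCompactSupport ψ) :
    Integrable (fun q : ℝ × E3 => trn lam k q.1 q.2 * ψ ((q.1 : AddCircle T), q.2))
      ((volume.restrict (Ioi 0)).prod volume) := by
  obtain ⟨C, hC⟩ := h.lintegral_le hlam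
  obtain ⟨M, K, hK, hM⟩ := exists_bound_of_compactSupport hc hs
  have hcov : Continuous fun q : ℝ × E3 => ψ ((q.1 : AddCircle T), q.2) :=
    hc.comp (isOpenQuotientMap_cover T).continuous
  have hmt : Measurable (fun q : ℝ × E3 => trn lam k q.1 q.2) := h.measurable_trn
  have hm : Measurable (fun q : ℝ × E3 => trn lam k q.1 q.2 * ψ ((q.1 : AddCircle T), q.2)) :=
    hmt.mul hcov.measurable
  refine ⟨hm.aestronglyMeasurable, ?_⟩
  rw [hasFiniteIntegral_iff_enorm, lintegral_prod_symm _ hm.enorm.aemeasurable]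
  calc _ ≤ ∫⁻ x, K.indicator (fun x => M * (C * maj x)) x := by
        refine lintegral_mono fun x => ?_
        by_cases hx : x ∈ K
        · rw [indicator_of_mem hx]
          calc _ ≤ ∫⁻ t in Ioi (0 : ℝ), M * ‖trn lam k t x‖ₑ := by
                refine lintegral_mono fun t => ?_
                simp only [enorm_mul]
                rw [mul_comm]
                gcongr
                exact (hM _).trans (indicator_le_self' (by simp) _)
            _ ≤ _ := by
                rw [lintegral_const_mul' _ _ ENNReal.coe_ne_top]
                gcongr; exact hC x
        · rw [indicator_of_notMem hx]
          refine le_of_eq ?_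
          have : ∀ t : ℝ, ψ ((t : AddCircle T), x) = 0 := fun t => by
            have := hM ((t : AddCircle T), x)
            rw [indicator_of_notMem hx] at this
            simpa using this
          simp [this]
    _ < ⊤ := by
        rw [lintegral_indicator hK.measurableSet, lintegral_const_mul' _ _ ENNReal.coe_ne_top]
        exact ENNReal.mul_lt_top ENNReal.coe_lt_top (setLIntegral_maj_lt_top C hK)

/-- The unfolding principle: pairing a periodization with a periodic function is an integral of the
original kernel over all positive times. Every identity for a periodized kernel is then proved at a
fixed time t > 0 and integrated. -/
lemma Kern.integral_per_mul (h : Kern k) (hlam : 0 < lam) {ψ : G T → ℝ} (hc : Continuous ψ)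
    (hs : HasCompactSupport ψ) :
    ∫ p, per T lam k p * ψ p ∂(muG T) =
      ∫ t in Ioi (0 : ℝ), ∫ x, trn lam k t x * ψ ((t : AddCircle T), x) := by
  have hi := h.integrable_unfold hlam hc hs
  have hmp := measurePreserving_unrollG (T := T)
  have hi2 := hmp.integrable_comp_of_integrable hi
  rw [← integral_prod _ hi, ← hmp.map_eq, integral_map hmp.aemeasurable (by rw [hmp.map_eq]; exact hi.1)]
  have h3 := integral_prod_symm _ hi2
  refine Eq.trans ?_ h3.symm
  congr 1; ext p
  simp only [Function.comp, unrollG, coe_unroll, per]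
  rw [integral_mul_const]

end Kernels


/-! ### Time means -/

section Mean

variable {T : ℝ} [hT : Fact (0 < T)]

/-- The time mean of a scalar function. -/
def mean (g : G T → ℝ) (x : E3) : ℝ := ∫ τ, g (τ, x) ∂AddCircle.haarAddCircle

lemma LocallyIntegrable.mul_test {X : Type*} [TopologicalSpace X] [MeasurableSpace X] [T2Space X]
    [OpensMeasurableSpace X] {μ : Measure X} {g φ : X → ℝ} (hg : LocallyIntegrable g μ) (hc : Continuous φ)
    (hs : HasCompactSupport φ) : Integrable (fun p => g p * φ p) μ :=
  hg.integrable_smul_right_of_hasCompactSupport hc hs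

lemma integrableOn_univ_prod {g : G T → ℝ} (hg : LocallyIntegrable g (muG T)) {K : Set E3} (hK : IsCompact K) :
    Integrable g ((AddCircle.haarAddCircle (T := T)).prod (volume.restrict K)) := by
  have h := hg.integrableOn_isCompact (isCompact_univ.prod hK)
  rwa [IntegrableOn, muG, ← Measure.prod_restrict, Measure.restrict_univ] at h

lemma locallyIntegrable_mean {g : G T → ℝ} (hg : LocallyIntegrable g (muG T)) :
    LocallyIntegrable (mean g) := by
  rw [locallyIntegrable_iff]
  exact fun K hK => (integrableOn_univ_prod hg hK).integral_prod_right

lemma ae_integrable_time {g : G T → ℝ} (hg : LocallyIntegrable g (muG T)) :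
    ∀ᵐ x : E3, Integrable (fun τ => g (τ, x)) (AddCircle.haarAddCircle (T := T)) := by
  have h2 : ∀ᵐ x ∂(volume.restrict (⋃ n : ℕ, Metric.closedBall (0 : E3) n)),
      Integrable (fun τ => g (τ, x)) (AddCircle.haarAddCircle (T := T)) := by
    rw [ae_restrict_iUnion_iff]
    exact fun n => (integrableOn_univ_prod hg (isCompact_closedBall 0 (n : ℝ))).prod_left_ae
  rwa [Metric.iUnion_closedBall_nat, Measure.restrict_univ] at h2

lemma locallyIntegrable_comp_snd {g : E3 → ℝ} (hg : LocallyIntegrable g) :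
    LocallyIntegrable (fun p : G T => g p.2) (muG T) := by
  refine locallyIntegrable_of_mean_le (d := fun x => ‖g x‖ₑ) ?_ (Eventually.of_forall fun x => by simp)
    fun K hK => (hg.integrableOn_isCompact hK).2
  exact hg.aestronglyMeasurable.comp_snd

lemma integral_mul_comp_snd {g : G T → ℝ} (hg : LocallyIntegrable g (muG T)) {χ : E3 → ℝ}
    (hc : Continuous χ) (hs : HasCompactSupport χ) :
    ∫ p, g p * χ p.2 ∂(muG T) = ∫ x, mean g x * χ x := by
  have hs' : HasCompactSupport (fun p : G T => χ p.2) := by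
    refine HasCompactSupport.of_support_subset_isCompact (isCompact_univ.prod hs.isCompact) fun p hp => ?_
    exact ⟨trivial, subset_tsupport _ hp⟩
  have hi : Integrable (fun p => g p * χ p.2) (muG T) :=
    LocallyIntegrable.mul_test hg (hc.comp continuous_snd) hs'
  unfold muG at hi ⊢
  rw [integral_prod_symm _ hi]
  simp [mean, integral_mul_const]

lemma integral_comp_snd_mul {g : E3 → ℝ} (hg : LocallyIntegrable g) {φ : G T → ℝ}
    (hc : Continuous φ) (hs : HasCompactSupport φ) :
    ∫ p, g p.2 * φ p ∂(muG T) = ∫ τ, ∫ x, g x * φ (τ, x) ∂volume ∂(AddCircle.haarAddCircle (T := T)) := by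
  have hi := LocallyIntegrable.mul_test (locallyIntegrable_comp_snd (T := T) hg) hc hs
  unfold muG at hi ⊢
  exact integral_prod _ hi

lemma IsWeakPartialG.mean {g h : G T → ℝ} {j : Fin 3} (hw : IsWeakPartialG T j g h) :
    IsWeakPartialE j (mean g) (mean h) := by
  refine ⟨locallyIntegrable_mean hw.1, locallyIntegrable_mean hw.2.1, fun φ hφ => ?_⟩
  have := hw.2.2 _ (hφ.isTestG (T := T))
  rw [← integral_mul_comp_snd hw.2.1 hφ.1.continuous hφ.2, ← this,
    ← integral_mul_comp_snd hw.1 (hφ.pd j).1.continuous (hφ.pd j).2]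
  rfl

lemma IsWeakPartialE.comp_snd {g h : E3 → ℝ} {j : Fin 3} (hw : IsWeakPartialE j g h) :
    IsWeakPartialG T j (fun p => g p.2) (fun p => h p.2) := by
  refine ⟨locallyIntegrable_comp_snd hw.1, locallyIntegrable_comp_snd hw.2.1, fun φ hφ => ?_⟩
  rw [integral_comp_snd_mul hw.1 (hφ.pdx j).continuous (hφ.pdx j).2,
    integral_comp_snd_mul hw.2.1 hφ.continuous hφ.2, ← integral_neg]
  congr 1; ext τ
  exact hw.2.2 _ (hφ.slice τ)

end Mean

/-! ### Weak derivatives of kernels -/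

section WeakDer

variable {k k' : ℝ → E3 → ℝ} {T lam : ℝ} [hT : Fact (0 < T)]

lemma Kern.integrable_mul_test (h : Kern k) {t : ℝ} (ht : 0 < t) (a : E3) {χ : E3 → ℝ} (hχ : Continuous χ)
    (hs : HasCompactSupport χ) : Integrable (fun x => k t (x + a) * χ x) := by
  obtain ⟨C, hC⟩ := h.bound
  have hm : Measurable (fun x : E3 => k t (x + a)) :=
    h.meas.comp (by fun_prop : Measurable fun x : E3 => (t, x + a))
  have := (hχ.integrable_of_hasCompactSupport (μ := volume) hs).mul_bdd (f := χ) (g := fun x => k t (x + a))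
    (c := C * (t ^ (-(3 / 2) : ℝ) + t ^ (-2 : ℝ))) hm.aestronglyMeasurable (Eventually.of_forall fun x => by
      refine (hC t ht _).trans ?_
      gcongr ?_ * (?_ + ?_)
      · exact Real.rpow_le_rpow_of_nonpos ht (by nlinarith [sq_nonneg ‖x + a‖]) (by norm_num)
      · exact Real.rpow_le_rpow_of_nonpos ht (by nlinarith [sq_nonneg ‖x + a‖]) (by norm_num))
  exact this.congr (Eventually.of_forall fun x => mul_comm _ _)

lemma IsTestE.hasLineDerivAt {χ : E3 → ℝ} (h : IsTestE χ) (j : Fin 3) (x : E3) :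
    HasLineDerivAt ℝ χ (TPNS.pd j χ x) x (unitVec j) :=
  ((h.1.differentiable (by simp)) x).hasFDerivAt.hasLineDerivAt _

lemma Kern.integral_mul_pd (h : Kern k) (h' : Kern k') {j : Fin 3} {t : ℝ} (ht : 0 < t)
    (hd : ∀ y, HasLineDerivAt ℝ (k t) (k' t y) y (unitVec j)) (a : E3) {χ : E3 → ℝ} (hχ : IsTestE χ) :
    ∫ x, k t (x + a) * pd j χ x = - ∫ x, k' t (x + a) * χ x := by
  refine integral_bilinear_hasLineDerivAt_right_eq_neg_left_of_integrable (B := ContinuousLinearMap.mul ℝ ℝ)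
    (v := unitVec j) (h'.integrable_mul_test ht a hχ.1.continuous hχ.2)
    (h.integrable_mul_test ht a (hχ.pd j).1.continuous (hχ.pd j).2)
    (h.integrable_mul_test ht a hχ.1.continuous hχ.2) (fun x _ => ?_) (fun x _ => hχ.hasLineDerivAt j x)
  have := hd (x + a)
  unfold HasLineDerivAt at *
  simpa [add_right_comm] using this

/-- After unfolding, the integration by parts takes place at a fixed t > 0, where both kernels are
bounded. The singularity of the periodized kernel is never met. -/
lemma Kern.isWeakPartialG (h : Kern k) (h' : Kern k') (hlam : 0 < lam) {j : Fin 3}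
    (hd : ∀ t, 0 < t → ∀ y, HasLineDerivAt ℝ (k t) (k' t y) y (unitVec j)) :
    IsWeakPartialG T j (per T lam k) (per T lam k') := by
  refine ⟨h.locallyIntegrable_per hlam, h'.locallyIntegrable_per hlam, fun φ hφ => ?_⟩
  rw [h.integral_per_mul hlam (hφ.pdx j).continuous (hφ.pdx j).2,
    h'.integral_per_mul hlam hφ.continuous hφ.2, ← integral_neg]
  refine setIntegral_congr_fun measurableSet_Ioi fun t ht => ?_
  exact h.integral_mul_pd h' ht (hd t ht) _ (hφ.slice t)

lemma Kern.mean_per (h : Kern k) (hlam : 0 < lam) : mean (per T lam k) =ᵐ[volume] stat lam k := by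
  have : ∀ᵐ x : E3, x ≠ 0 := by simp [ae_iff]
  filter_upwards [this] with x hx using (h.integral_per hlam hx).2

lemma IsWeakPartialE.congr {g g' h h' : E3 → ℝ} {j : Fin 3} (hw : IsWeakPartialE j g h)
    (hg : g =ᵐ[volume] g') (hh : h =ᵐ[volume] h') : IsWeakPartialE j g' h' := by
  refine ⟨hw.1.congr hg, hw.2.1.congr hh, fun φ hφ => ?_⟩
  have e1 : (fun x => g' x * pd j φ x) =ᵐ[volume] fun x => g x * pd j φ x := hg.mono fun x hx => by simp only [hx]
  have e2 : (fun x => h' x * φ x) =ᵐ[volume] fun x => h x * φ x := hh.mono fun x hx => by simp only [hx]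
  rw [integral_congr_ae e1, integral_congr_ae e2, hw.2.2 φ hφ]

lemma IsWeakPartialG.congr {g g' h h' : G T → ℝ} {j : Fin 3} (hw : IsWeakPartialG T j g h)
    (hg : g =ᵐ[muG T] g') (hh : h =ᵐ[muG T] h') : IsWeakPartialG T j g' h' := by
  refine ⟨hw.1.congr hg, hw.2.1.congr hh, fun φ hφ => ?_⟩
  have e1 : (fun x => g' x * pdx j φ x) =ᵐ[muG T] fun x => g x * pdx j φ x := hg.mono fun x hx => by simp only [hx]
  have e2 : (fun x => h' x * φ x) =ᵐ[muG T] fun x => h x * φ x := hh.mono fun x hx => by simp only [hx]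
  rw [integral_congr_ae e1, integral_congr_ae e2, hw.2.2 φ hφ]

lemma IsWeakPartialG.add {g g' h h' : G T → ℝ} {j : Fin 3} (hw : IsWeakPartialG T j g h)
    (hw' : IsWeakPartialG T j g' h') : IsWeakPartialG T j (fun p => g p + g' p) (fun p => h p + h' p) := by
  refine ⟨hw.1.add hw'.1, hw.2.1.add hw'.2.1, fun φ hφ => ?_⟩
  simp_rw [add_mul]
  rw [integral_add (LocallyIntegrable.mul_test hw.1 (hφ.pdx j).continuous (hφ.pdx j).2)
    (LocallyIntegrable.mul_test hw'.1 (hφ.pdx j).continuous (hφ.pdx j).2),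
    integral_add (LocallyIntegrable.mul_test hw.2.1 hφ.continuous hφ.2)
    (LocallyIntegrable.mul_test hw'.2.1 hφ.continuous hφ.2), hw.2.2 φ hφ, hw'.2.2 φ hφ]
  ring

lemma IsWeakPartialG.const_mul {g h : G T → ℝ} {j : Fin 3} (hw : IsWeakPartialG T j g h) (c : ℝ) :
    IsWeakPartialG T j (fun p => c * g p) (fun p => c * h p) := by
  refine ⟨hw.1.smul c, hw.2.1.smul c, fun φ hφ => ?_⟩
  simp_rw [mul_assoc]
  rw [integral_const_mul, integral_const_mul, hw.2.2 φ hφ]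
  ring

lemma IsWeakPartialG.sub {g g' h h' : G T → ℝ} {j : Fin 3} (hw : IsWeakPartialG T j g h)
    (hw' : IsWeakPartialG T j g' h') : IsWeakPartialG T j (fun p => g p - g' p) (fun p => h p - h' p) := by
  simpa [sub_eq_add_neg] using hw.add (hw'.const_mul (-1))

end WeakDer

/-! ### The pressure-corrected kernels -/

section Theta

lemma measurable_heat : Measurable (Function.uncurry heat) := by
  unfold Function.uncurry heat; fun_prop

lemma measurable_heatD1 (j : Fin 3) : Measurable (Function.uncurry (heatD1 j)) := by
  unfold Function.uncurry heatD1 heat; fun_prop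

lemma measurable_heatD2 (j l : Fin 3) : Measurable (Function.uncurry (heatD2 j l)) := by
  unfold Function.uncurry heatD2 heat; fun_prop

lemma measurable_heatD3 (a j l : Fin 3) : Measurable (Function.uncurry (heatD3 a j l)) := by
  unfold Function.uncurry heatD3 heat; fun_prop

lemma kern_heat : Kern heat := by
  refine ⟨measurable_heat, 20 ^ 5, fun t ht y => (abs_heat_le ht y).trans ?_⟩
  push_cast
  have : 0 ≤ (‖y‖ ^ 2 + t) ^ (-2 : ℝ) := by positivity
  linarith

lemma kern_heatD1 (j : Fin 3) : Kern (heatD1 j) := by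
  refine ⟨measurable_heatD1 j, 20 ^ 5, fun t ht y => (abs_heatD1_le j ht y).trans ?_⟩
  push_cast
  have : 0 ≤ (‖y‖ ^ 2 + t) ^ (-(3 / 2) : ℝ) := by positivity
  linarith

/-- The tail integral of a kernel in time. -/
def tail (k : ℝ → E3 → ℝ) (t : ℝ) (y : E3) : ℝ := ∫ s in Ioi t, k s y

lemma measurable_tail {k : ℝ → E3 → ℝ} (hk : Measurable (Function.uncurry k)) :
    Measurable (Function.uncurry (tail k)) := by
  have h : StronglyMeasurable (Function.uncurry fun (q : ℝ × E3) (s : ℝ) => {z : (ℝ × E3) × ℝ | z.1.1 < z.2}.indicator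
      (fun z => k z.2 z.1.2) (q, s)) := by
    refine Measurable.stronglyMeasurable ?_
    refine Measurable.indicator ?_ (measurableSet_lt (by fun_prop) (by fun_prop))
    exact hk.comp (by fun_prop : Measurable fun z : (ℝ × E3) × ℝ => (z.2, z.1.2))
  have h2 := (h.integral_prod_right (ν := (volume : Measure ℝ))).measurable
  convert h2 using 1
  ext q
  simp only [Function.uncurry, tail]
  rw [← integral_indicator measurableSet_Ioi]
  rfl

lemma integrableOn_tail {k : ℝ → E3 → ℝ} (hk : Measurable (Function.uncurry k)) {C a : ℝ} (ha : 1 < a)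
    (hb : ∀ s, 0 < s → ∀ y, |k s y| ≤ C * (‖y‖ ^ 2 + s) ^ (-a)) {t : ℝ} (ht : 0 < t) (y : E3) :
    IntegrableOn (fun s => k s y) (Ioi t) := by
  have h1 : IntegrableOn (fun s => C * (s + ‖y‖ ^ 2) ^ (-a)) (Ioi t) :=
    (integrableOn_add_rpow_Ioi_of_lt (by linarith) (by nlinarith [sq_nonneg ‖y‖])).const_mul C
  refine Integrable.mono' h1 (hk.comp (by fun_prop : Measurable fun s : ℝ => (s, y))).aestronglyMeasurable
    ((ae_restrict_iff' measurableSet_Ioi).2 (Eventually.of_forall fun s hs => ?_))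
  rw [add_comm]; exact hb s (ht.trans hs) y

lemma abs_tail_le {k : ℝ → E3 → ℝ} {C a : ℝ} (ha : 1 < a) (hC : 0 ≤ C)
    (hb : ∀ s, 0 < s → ∀ y, |k s y| ≤ C * (‖y‖ ^ 2 + s) ^ (-a)) {t : ℝ} (ht : 0 < t) (y : E3) :
    |tail k t y| ≤ C / (a - 1) * (‖y‖ ^ 2 + t) ^ (1 - a) := by
  have h0 : 0 < ‖y‖ ^ 2 + t := by positivity
  have h1 : ‖tail k t y‖ₑ ≤ ENNReal.ofReal (C * ((‖y‖ ^ 2 + t) ^ (1 - a) / (a - 1))) := by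
    calc ‖tail k t y‖ₑ ≤ ∫⁻ s in Ioi t, ‖k s y‖ₑ := enorm_integral_le_lintegral_enorm _
      _ ≤ ∫⁻ s in Ioi t, ENNReal.ofReal C * ENNReal.ofReal ((‖y‖ ^ 2 + s) ^ (-a)) := by
          refine setLIntegral_mono' measurableSet_Ioi fun s hs => ?_
          rw [← ENNReal.ofReal_mul hC, ← ofReal_norm]
          exact ENNReal.ofReal_le_ofReal (hb s (ht.trans hs) y)
      _ = _ := by
          rw [lintegral_const_mul' _ _ ENNReal.ofReal_ne_top, integral_Ioi_add_rpow ha (by positivity),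
            ENNReal.ofReal_mul hC]
  rw [← ofReal_norm, ENNReal.ofReal_le_ofReal_iff (by
    have : 0 < a - 1 := by linarith
    positivity)] at h1
  calc |tail k t y| ≤ _ := h1
    _ = _ := by ring

/-- The kernels `∫_t^∞ ∂_j ∂_l H`. -/
def theta (j l : Fin 3) : ℝ → E3 → ℝ := tail (heatD2 j l)

/-- The kernels `∫_t^∞ ∂_a ∂_j ∂_l H`. -/
def thetaD (a j l : Fin 3) : ℝ → E3 → ℝ := tail (heatD3 a j l)

/-- Integrating (|y|² + s)^{-5/2} over s > t gives the power -3/2 of |y|² + t, the same homogeneity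
as the heat kernel; for `thetaD` the power -3 becomes -2. -/
lemma kern_theta (j l : Fin 3) : Kern (theta j l) := by
  refine ⟨measurable_tail (measurable_heatD2 j l), 20 ^ 6, fun t ht y =>
    (abs_tail_le (by norm_num) (by norm_num) (fun s hs y => abs_heatD2_le j l hs y) ht y).trans ?_⟩
  have h1 : 0 ≤ (‖y‖ ^ 2 + t) ^ (-2 : ℝ) := by positivity
  have h2 : 0 ≤ (‖y‖ ^ 2 + t) ^ (-(3 / 2) : ℝ) := by positivity
  rw [show (1 - 5 / 2 : ℝ) = -(3 / 2) by norm_num]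
  push_cast
  linarith

lemma kern_thetaD (a j l : Fin 3) : Kern (thetaD a j l) := by
  refine ⟨measurable_tail (measurable_heatD3 a j l), 20 ^ 6, fun t ht y =>
    (abs_tail_le (by norm_num) (by norm_num) (fun s hs y => abs_heatD3_le a j l hs y) ht y).trans ?_⟩
  have h1 : 0 ≤ (‖y‖ ^ 2 + t) ^ (-2 : ℝ) := by positivity
  have h2 : 0 ≤ (‖y‖ ^ 2 + t) ^ (-(3 / 2) : ℝ) := by positivity
  rw [show (1 - 3 : ℝ) = -2 by norm_num]
  push_cast
  linarith

/-- Differentiation under the tail integral, with the majorant 20⁶ s^{-3}, integrable on (t, ∞)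
since t > 0. -/
lemma hasLineDerivAt_theta (a j l : Fin 3) {t : ℝ} (ht : 0 < t) (y : E3) :
    HasLineDerivAt ℝ (theta j l t) (thetaD a j l t y) y (unitVec a) := by
  have hm2 : ∀ z : E3, Measurable fun s => heatD2 j l s z := fun z =>
    (measurable_heatD2 j l).comp (by fun_prop : Measurable fun s : ℝ => (s, z))
  have hm3 : ∀ z : E3, Measurable fun s => heatD3 a j l s z := fun z =>
    (measurable_heatD3 a j l).comp (by fun_prop : Measurable fun s : ℝ => (s, z))
  have hb : IntegrableOn (fun s : ℝ => (20 ^ 6 * s ^ (-3 : ℝ) : ℝ)) (Ioi t) :=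
    (integrableOn_Ioi_rpow_of_lt (by norm_num) ht).const_mul _
  have h := hasDerivAt_integral_of_dominated_loc_of_deriv_le (μ := volume.restrict (Ioi t)) (𝕜 := ℝ)
    (F := fun r s => heatD2 j l s (y + r • unitVec a)) (F' := fun r s => heatD3 a j l s (y + r • unitVec a))
    (x₀ := 0) (s := univ) (bound := fun s => 20 ^ 6 * s ^ (-3 : ℝ)) univ_mem
    (Eventually.of_forall fun r => (hm2 _).aestronglyMeasurable)
    (integrableOn_tail (measurable_heatD2 j l) (by norm_num) (fun s hs y => abs_heatD2_le j l hs y) ht _)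
    (hm3 _).aestronglyMeasurable
    ((ae_restrict_iff' measurableSet_Ioi).2 (Eventually.of_forall fun s hs r _ => ?_)) hb
    ((ae_restrict_iff' measurableSet_Ioi).2 (Eventually.of_forall fun s hs r _ => ?_))
  · have := h.2
    simpa [HasLineDerivAt, theta, thetaD, tail] using this
  · have hs : 0 < s := ht.trans hs
    refine (abs_heatD3_le a j l hs _).trans ?_
    gcongr ?_ * ?_
    exact Real.rpow_le_rpow_of_nonpos hs (by nlinarith [sq_nonneg ‖y + r • unitVec a‖]) (by norm_num)
  · have hs : 0 < s := ht.trans hs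
    have h1 := hasLineDerivAt_heatD2 a j l hs (y + r • unitVec a)
    unfold HasLineDerivAt at h1
    have h2 : HasDerivAt (fun t => heatD2 j l s (y + r • unitVec a + t • unitVec a))
      (heatD3 a j l s (y + r • unitVec a)) (r - r) := by rw [sub_self]; exact h1
    have h3 := h2.comp_sub_const r r
    refine h3.congr_of_eventuallyEq (Eventually.of_forall fun r' => ?_)
    simp only
    rw [add_assoc, ← add_smul, add_sub_cancel]

end Theta


/-! ### Fourier representation of the periodized kernels -/

section FourierKernels

lemma ae_kap_ne_zero : ∀ᵐ κ ∂kap, κ.2 ≠ 0 := by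
  have h : kap (univ ×ˢ {(0 : E3)}) = 0 := by
    unfold kap
    rw [Measure.prod_prod]; simp
  rw [ae_iff]
  refine measure_mono_null (fun κ hκ => ?_) h
  simpa using hκ

/-- Fubini: the modulus of the integrand integrates in s to at most |A| |ξ|^{-2}, which is
integrable by hypothesis. Used with r = `sig` for the time integral from 0, and with r = |ξ|² for
the tails. -/
lemma integral_Ioi_exp_kap {A r : ℤ × E3 → ℂ} (hA : Measurable A) (hr : Measurable r)
    (hre : ∀ κ, (r κ).re = ‖κ.2‖ ^ 2) (hi : Integrable (fun κ => ‖A κ‖ * (‖κ.2‖ ^ 2)⁻¹) kap)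
    {c : ℝ} (hc : 0 ≤ c) :
    ∫ s in Ioi c, (∫ κ, A κ * Complex.exp (-r κ * s) ∂kap) =
      ∫ κ, A κ * (Complex.exp (-r κ * c) / r κ) ∂kap := by
  have hm : Measurable (fun z : ℝ × (ℤ × E3) => A z.2 * Complex.exp (-r z.2 * z.1)) := by fun_prop
  have hneg : ∀ κ : ℤ × E3, κ.2 ≠ 0 → (-r κ).re < 0 := fun κ hκ => by
    rw [Complex.neg_re, hre]
    have : 0 < ‖κ.2‖ := norm_pos_iff.2 hκ
    have : 0 < ‖κ.2‖ ^ 2 := by positivity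
    linarith
  have hprod : Integrable (fun z : ℝ × (ℤ × E3) => A z.2 * Complex.exp (-r z.2 * z.1))
      ((volume.restrict (Ioi c)).prod kap) := by
    rw [integrable_prod_iff' hm.aestronglyMeasurable]
    constructor
    · filter_upwards [ae_kap_ne_zero] with κ hκ
      exact (integrableOn_exp_mul_complex_Ioi (hneg κ hκ) c).const_mul (A κ)
    · refine hi.mono' ((hm.norm.stronglyMeasurable).integral_prod_left').aestronglyMeasurable ?_
      filter_upwards [ae_kap_ne_zero] with κ hκ
      have h0 : 0 < ‖κ.2‖ ^ 2 := by
        have : 0 < ‖κ.2‖ := norm_pos_iff.2 hκ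
        positivity
      have e : ∀ s : ℝ, ‖A κ * Complex.exp (-r κ * s)‖ = ‖A κ‖ * Real.exp (-(‖κ.2‖ ^ 2) * s) := fun s => by
        rw [norm_mul, Complex.norm_exp]; simp [hre]
      simp_rw [e]
      rw [integral_const_mul, integral_exp_mul_Ioi (by linarith), norm_mul, norm_norm]
      gcongr
      rw [Real.norm_of_nonneg (by rw [neg_div_neg_eq]; positivity), neg_div_neg_eq, div_eq_mul_inv]
      have h1 : Real.exp (-‖κ.2‖ ^ 2 * c) ≤ 1 := Real.exp_le_one_iff.2 (by nlinarith)
      have h2 : 0 ≤ (‖κ.2‖ ^ 2)⁻¹ := by positivity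
      nlinarith
  rw [integral_integral_swap hprod]
  refine integral_congr_ae ?_
  filter_upwards [ae_kap_ne_zero] with κ hκ
  rw [integral_const_mul, integral_exp_mul_complex_Ioi (hneg κ hκ), neg_div_neg_eq]

variable {T lam : ℝ}

/-- The symbol `|ξ|² + i ((2π/T) k - lam ξ₁)` of the parabolic operator. -/
def sig (T lam : ℝ) (κ : ℤ × E3) : ℂ :=
  ((‖κ.2‖ ^ 2 : ℝ) : ℂ) + Complex.I * ((2 * Real.pi / T * κ.1 - lam * κ.2 0 : ℝ) : ℂ)

lemma sig_re (κ : ℤ × E3) : (sig T lam κ).re = ‖κ.2‖ ^ 2 := by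
  simp [sig, -Complex.ofReal_pow]

lemma measurable_sig : Measurable (sig T lam) := by
  have : Measurable (fun κ : ℤ × E3 => (κ.1 : ℝ)) := measurable_from_top.comp measurable_fst
  unfold sig
  fun_prop

lemma sig_ne_zero {κ : ℤ × E3} (h : κ.2 ≠ 0) : sig T lam κ ≠ 0 := fun h0 => by
  have := sig_re (T := T) (lam := lam) κ
  rw [h0, Complex.zero_re] at this
  have h1 : 0 < ‖κ.2‖ := norm_pos_iff.2 h
  have : 0 < ‖κ.2‖ ^ 2 := by positivity
  linarith

lemma norm_sig_inv_le {κ : ℤ × E3} (h : κ.2 ≠ 0) : ‖(sig T lam κ)⁻¹‖ ≤ (‖κ.2‖ ^ 2)⁻¹ := by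
  rw [norm_inv]
  have : 0 < ‖κ.2‖ := norm_pos_iff.2 h
  refine inv_anti₀ (by positivity) ?_
  rw [← sig_re (T := T) (lam := lam)]
  exact (le_abs_self _).trans (Complex.abs_re_le_norm _)

lemma heatSymbol_diag (t : ℝ) (κ : ℤ × E3) :
    heatSymbol (T := T) lam t t κ = Complex.exp (-sig T lam κ * t) := by
  unfold heatSymbol sig
  rw [fourier_coe_apply, ← Complex.exp_add]
  congr 1
  push_cast
  ring

lemma heatSymbol_eq (t s : ℝ) (κ : ℤ × E3) :
    heatSymbol (T := T) lam t s κ = heatSymbol (T := T) lam t 0 κ *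
      Complex.exp (-((‖κ.2‖ ^ 2 : ℝ) : ℂ) * s) := by
  unfold heatSymbol
  rw [mul_assoc (fourier (-κ.1) (t : AddCircle T) : ℂ), ← Complex.exp_add]
  congr 2
  push_cast
  ring

lemma measurable_heatSymbol (t s : ℝ) : Measurable (heatSymbol (T := T) lam t s) := by
  have : Measurable (fun κ : ℤ × E3 => (κ.1 : ℂ)) := measurable_from_top.comp measurable_fst
  unfold heatSymbol
  simp_rw [fourier_coe_apply]
  push_cast
  fun_prop

variable [hT : Fact (0 < T)]

lemma integrable_ft_mul {φ : G T → ℝ} (h : IsTestG T φ) {M : ℤ × E3 → ℂ} (hM : Measurable M)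
    (hb : ∀ᵐ κ ∂kap, ‖M κ‖ ≤ (‖κ.2‖ ^ 2)⁻¹) : Integrable (fun κ => ft φ κ * M κ) kap := by
  refine (integrable_ft_div h).mono' ((stronglyMeasurable_ft h.continuous).measurable.mul hM).aestronglyMeasurable ?_
  filter_upwards [hb] with κ hκ
  rw [norm_mul]
  gcongr

/-- When kernel time and drift time coincide, the symbol is e^{-t·`sig`} by `heatSymbol_diag`, and
its integral over t > 0 is 1/`sig`. All modes are covered, the steady one included. -/
lemma integral_per_heat_mul (hlam : 0 < lam) {φ : G T → ℝ} (h : IsTestG T φ) :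
    ((∫ p, per T lam heat p * φ p ∂(muG T) : ℝ) : ℂ) =
      invConst * ∫ κ, ft φ κ * (sig T lam κ)⁻¹ ∂kap := by
  rw [kern_heat.integral_per_mul hlam h.continuous h.2, ← integral_complex_ofReal]
  have e : ∀ t ∈ Ioi (0 : ℝ), ((∫ x, trn lam heat t x * φ ((t : AddCircle T), x) : ℝ) : ℂ) =
      invConst * ∫ κ, ft φ κ * Complex.exp (-sig T lam κ * t) ∂kap := by
    intro t ht
    have := integral_heat_mul_test h lam t (s := t) ht
    simp_rw [heatSymbol_diag] at this
    exact this
  rw [setIntegral_congr_fun measurableSet_Ioi e, integral_const_mul, integral_Ioi_exp_kap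
    (stronglyMeasurable_ft h.continuous).measurable measurable_sig sig_re (integrable_ft_div h) le_rfl]
  simp

lemma continuous_heatD1 (j : Fin 3) (s : ℝ) : Continuous (heatD1 j s) := by
  unfold heatD1 heat; fun_prop

lemma continuous_heatD2 (j l : Fin 3) (s : ℝ) : Continuous (heatD2 j l s) := by
  unfold heatD2 heat; fun_prop

lemma integral_mul_pd_of_continuous {f f' : E3 → ℝ} (hf : Continuous f) (hf' : Continuous f') {j : Fin 3}
    (hd : ∀ y, HasLineDerivAt ℝ f (f' y) y (unitVec j)) (a : E3) {χ : E3 → ℝ} (hχ : IsTestE χ) :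
    ∫ x, f (x + a) * pd j χ x = - ∫ x, f' (x + a) * χ x := by
  have hi : ∀ {g χ : E3 → ℝ}, Continuous g → IsTestE χ → Integrable (fun x => g (x + a) * χ x) :=
    fun hg hχ => LocallyIntegrable.mul_test (hg.comp (by fun_prop)).locallyIntegrable hχ.1.continuous hχ.2
  refine integral_bilinear_hasLineDerivAt_right_eq_neg_left_of_integrable (B := ContinuousLinearMap.mul ℝ ℝ)
    (v := unitVec j) (hi hf' hχ) (hi hf (hχ.pd j)) (hi hf hχ) (fun x _ => ?_)
    (fun x _ => hχ.hasLineDerivAt j x)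
  have := hd (x + a)
  unfold HasLineDerivAt at *
  simpa [add_right_comm] using this

lemma integral_heatD2_mul {χ : E3 → ℝ} (hχ : IsTestE χ) (j l : Fin 3) {s : ℝ} (hs : 0 < s) (a : E3) :
    ∫ x, heatD2 j l s (x + a) * χ x = ∫ x, heat s (x + a) * pd l (pd j χ) x := by
  rw [integral_mul_pd_of_continuous (continuous_heat s) (continuous_heatD1 l s)
    (fun y => hasLineDerivAt_heat l hs y) a (hχ.pd j), integral_mul_pd_of_continuous (continuous_heatD1 l s)
    (continuous_heatD2 j l s) (fun y => hasLineDerivAt_heatD1 j l hs y) a hχ, neg_neg]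

/-- The multiplier `ξ_j ξ_l / |ξ|²`. -/
def riesz (j l : Fin 3) (κ : ℤ × E3) : ℂ := ((κ.2 j * κ.2 l / ‖κ.2‖ ^ 2 : ℝ) : ℂ)

lemma measurable_riesz (j l : Fin 3) : Measurable (riesz j l) := by
  unfold riesz; fun_prop

lemma abs_coord_le (x : E3) (j : Fin 3) : |x j| ≤ ‖x‖ := by
  simpa using PiLp.norm_apply_le x j

lemma abs_coord_mul_le (x : E3) (j l : Fin 3) : |x j * x l| ≤ ‖x‖ ^ 2 := by
  rw [abs_mul, sq]
  exact mul_le_mul (abs_coord_le x j) (abs_coord_le x l) (abs_nonneg _) (norm_nonneg _)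

lemma norm_riesz_le (j l : Fin 3) (κ : ℤ × E3) : ‖riesz j l κ‖ ≤ 1 := by
  unfold riesz
  rw [Complex.norm_real, Real.norm_eq_abs, abs_div, abs_of_nonneg (sq_nonneg ‖κ.2‖)]
  exact div_le_one_of_le₀ (abs_coord_mul_le _ _ _) (sq_nonneg _)

/-- The two derivatives contribute -ξ_jξ_l and the tail integral of e^{-s|ξ|²} contributes
|ξ|^{-2}e^{-t|ξ|²}. Together they form minus the Riesz multiplier, which is why `theta` realizes the
pressure part of the kernel. -/
lemma integral_theta_slice {φ : G T → ℝ} (h : IsTestG T φ) (j l : Fin 3) {t : ℝ} (ht : 0 < t) :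
    ((∫ x, trn lam (theta j l) t x * φ ((t : AddCircle T), x) : ℝ) : ℂ) =
      invConst * ∫ κ, (ft φ κ * -riesz j l κ) * Complex.exp (-sig T lam κ * t) ∂kap := by
  set a : E3 := (lam * t) • unitVec 0 with ha
  have hχ := h.slice (t : AddCircle T)
  have hprod : Integrable (fun z : E3 × ℝ => heatD2 j l z.2 (z.1 + a) * φ ((t : AddCircle T), z.1))
      ((volume : Measure E3).prod (volume.restrict (Ioi t))) := by
    have hb : IntegrableOn (fun s : ℝ => (20 ^ 6 * s ^ (-(5 / 2) : ℝ) : ℝ)) (Ioi t) :=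
      (integrableOn_Ioi_rpow_of_lt (by norm_num) ht).const_mul _
    have h1 := hχ.integrable.norm.mul_prod hb
    refine h1.mono' ?_ ?_
    · have m1 : Measurable fun z : E3 × ℝ => heatD2 j l z.2 (z.1 + a) :=
        (measurable_heatD2 j l).comp (by fun_prop : Measurable fun z : E3 × ℝ => (z.2, z.1 + a))
      have m2 : Measurable fun z : E3 × ℝ => φ ((t : AddCircle T), z.1) :=
        hχ.1.continuous.measurable.comp measurable_fst
      exact (m1.mul m2).aestronglyMeasurable
    · have : ∀ᵐ z ∂((volume : Measure E3).prod (volume.restrict (Ioi t))), t < z.2 := by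
        have h2 : ∀ᵐ s ∂(volume.restrict (Ioi t)), t < s := ae_restrict_mem measurableSet_Ioi
        exact Measure.quasiMeasurePreserving_snd.ae h2
      filter_upwards [this] with z hz
      have hz0 : 0 < z.2 := ht.trans hz
      rw [norm_mul, mul_comm]
      gcongr
      refine (abs_heatD2_le j l hz0 _).trans ?_
      gcongr ?_ * ?_
      exact Real.rpow_le_rpow_of_nonpos hz0 (by nlinarith [sq_nonneg ‖z.1 + a‖]) (by norm_num)
  have e1 : ∫ x, trn lam (theta j l) t x * φ ((t : AddCircle T), x) =
      ∫ s in Ioi t, ∫ x, heatD2 j l s (x + a) * φ ((t : AddCircle T), x) := by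
    rw [← integral_integral_swap hprod]
    congr 1; ext x
    rw [integral_mul_const]; rfl
  -- The derivatives are first moved to φ, so only the pairing with the heat kernel itself is
  -- needed.
  have e2 : ∀ s ∈ Ioi t, ((∫ x, heatD2 j l s (x + a) * φ ((t : AddCircle T), x) : ℝ) : ℂ) =
      invConst * ∫ κ, (ft φ κ * -((κ.2 j * κ.2 l : ℝ) : ℂ) * heatSymbol (T := T) lam t 0 κ) *
        Complex.exp (-((‖κ.2‖ ^ 2 : ℝ) : ℂ) * s) ∂kap := by
    intro s hs
    have hs0 : 0 < s := ht.trans hs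
    rw [integral_heatD2_mul hχ j l hs0]
    have := integral_heat_mul_test ((h.pdx j).pdx l) lam t hs0
    refine this.trans ?_
    congr 2; ext κ
    rw [ft_pdx (h.pdx j), ft_pdx h, heatSymbol_eq]
    push_cast
    linear_combination (κ.2 l * κ.2 j * ft φ κ * heatSymbol (T := T) lam t 0 κ * Complex.exp (-(‖κ.2‖ ^ 2) * s)) * Complex.I_sq
  rw [e1, ← integral_complex_ofReal, setIntegral_congr_fun measurableSet_Ioi e2, integral_const_mul,
    integral_Ioi_exp_kap]
  · congr 1
    refine integral_congr_ae ?_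
    filter_upwards [ae_kap_ne_zero] with κ hκ
    have h0 : (‖κ.2‖ : ℂ) ≠ 0 := by simpa using hκ
    rw [← heatSymbol_diag, heatSymbol_eq t t]
    unfold riesz
    push_cast
    field_simp
  · exact (((stronglyMeasurable_ft h.continuous).measurable).mul (by fun_prop)).mul (measurable_heatSymbol t 0)
  · fun_prop
  · intro κ; exact Complex.ofReal_re _
  · refine (integrable_ft h).norm.mono' ?_ (Eventually.of_forall fun κ => ?_)
    · have m := (((stronglyMeasurable_ft h.continuous).measurable).mul
        (by fun_prop : Measurable fun κ : ℤ × E3 => -((κ.2 j * κ.2 l : ℝ) : ℂ))).mul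
          (measurable_heatSymbol (T := T) (lam := lam) t 0)
      exact (m.norm.mul (by fun_prop)).aestronglyMeasurable
    · rw [norm_mul, norm_norm, norm_mul, norm_mul, norm_heatSymbol, norm_neg, Complex.norm_real,
        Real.norm_eq_abs]
      have h1 := abs_coord_mul_le κ.2 j l
      have h2 : |κ.2 j * κ.2 l| * (‖κ.2‖ ^ 2)⁻¹ ≤ 1 := by
        rw [← div_eq_mul_inv]; exact div_le_one_of_le₀ h1 (sq_nonneg _)
      rw [Real.norm_of_nonneg (by positivity)]
      simp only [zero_mul, neg_zero, Real.exp_zero, mul_one]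
      rw [mul_assoc]
      exact mul_le_of_le_one_right (norm_nonneg _) h2
  · exact ht.le

lemma integral_per_theta_mul (hlam : 0 < lam) {φ : G T → ℝ} (h : IsTestG T φ) (j l : Fin 3) :
    ((∫ p, per T lam (theta j l) p * φ p ∂(muG T) : ℝ) : ℂ) =
      invConst * ∫ κ, ft φ κ * (-riesz j l κ * (sig T lam κ)⁻¹) ∂kap := by
  rw [(kern_theta j l).integral_per_mul hlam h.continuous h.2, ← integral_complex_ofReal]
  rw [setIntegral_congr_fun measurableSet_Ioi (fun t ht => integral_theta_slice (lam := lam) h j l ht),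
    integral_const_mul, integral_Ioi_exp_kap _ measurable_sig sig_re _ le_rfl]
  · simp [mul_assoc]
  · exact ((stronglyMeasurable_ft h.continuous).measurable).mul (measurable_riesz j l).neg
  · refine (integrable_ft_div h).mono' ?_ (Eventually.of_forall fun κ => ?_)
    · exact ((((stronglyMeasurable_ft h.continuous).measurable).mul (measurable_riesz j l).neg).norm.mul
        (by fun_prop)).aestronglyMeasurable
    · rw [Real.norm_of_nonneg (by positivity), norm_mul, norm_neg]
      gcongr
      exact mul_le_of_le_one_right (norm_nonneg _) (norm_riesz_le j l κ)

/-! ### The velocity kernel -/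

/-- The time-dependent kernel that generates the velocity fundamental solution. -/
def velKern (j l : Fin 3) (t : ℝ) (y : E3) : ℝ := kron j l * heat t y + theta j l t y

/-- The first spatial derivatives of `velKern`. -/
def velKernD (a j l : Fin 3) (t : ℝ) (y : E3) : ℝ := kron j l * heatD1 a t y + thetaD a j l t y

lemma kern_vel (j l : Fin 3) : Kern (velKern j l) := (kern_heat.const_mul _).add (kern_theta j l)

lemma kern_velD (a j l : Fin 3) : Kern (velKernD a j l) :=
  ((kern_heatD1 a).const_mul _).add (kern_thetaD a j l)

lemma hasLineDerivAt_velKern (a j l : Fin 3) {t : ℝ} (ht : 0 < t) (y : E3) :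
    HasLineDerivAt ℝ (velKern j l t) (velKernD a j l t y) y (unitVec a) := by
  have h1 := hasLineDerivAt_heat a ht y
  have h2 := hasLineDerivAt_theta a j l ht y
  unfold HasLineDerivAt at *
  exact (h1.const_mul (kron j l)).add h2

/-- The symbol of the velocity fundamental solution. -/
def velMult (T lam : ℝ) (j l : Fin 3) (κ : ℤ × E3) : ℂ := ((kron j l : ℝ) - riesz j l κ) * (sig T lam κ)⁻¹

lemma measurable_velMult (j l : Fin 3) : Measurable (velMult T lam j l) :=
  ((measurable_riesz j l).const_sub _).mul measurable_sig.inv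

lemma integral_per_vel_mul (hlam : 0 < lam) {φ : G T → ℝ} (h : IsTestG T φ) (j l : Fin 3) :
    ((∫ p, per T lam (velKern j l) p * φ p ∂(muG T) : ℝ) : ℂ) =
      invConst * ∫ κ, ft φ κ * velMult T lam j l κ ∂kap := by
  have e : ∀ t ∈ Ioi (0 : ℝ), ∫ x, trn lam (velKern j l) t x * φ ((t : AddCircle T), x) =
      kron j l * (∫ x, trn lam heat t x * φ ((t : AddCircle T), x)) +
        ∫ x, trn lam (theta j l) t x * φ ((t : AddCircle T), x) := by
    intro t ht
    have hχ := h.slice (t : AddCircle T)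
    unfold trn
    rw [← integral_const_mul, ← integral_add
      ((kern_heat.integrable_mul_test ht _ hχ.1.continuous hχ.2).const_mul _)
      ((kern_theta j l).integrable_mul_test ht _ hχ.1.continuous hχ.2)]
    congr 1; ext x
    simp only [velKern]; ring
  have i1 := (kern_heat.integrable_unfold (T := T) hlam h.continuous h.2).integral_prod_left
  have i2 := ((kern_theta j l).integrable_unfold (T := T) hlam h.continuous h.2).integral_prod_left
  rw [(kern_vel j l).integral_per_mul hlam h.continuous h.2, setIntegral_congr_fun measurableSet_Ioi e,
    integral_add (i1.const_mul _) i2, integral_const_mul, ← kern_heat.integral_per_mul hlam h.continuous h.2,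
    ← (kern_theta j l).integral_per_mul hlam h.continuous h.2, Complex.ofReal_add, Complex.ofReal_mul,
    integral_per_heat_mul hlam h, integral_per_theta_mul hlam h, mul_left_comm, ← mul_add,
    ← integral_const_mul, ← integral_add]
  · congr 2; ext κ
    unfold velMult; ring
  · refine (integrable_ft_mul h measurable_sig.inv (ae_kap_ne_zero.mono fun κ hκ => norm_sig_inv_le hκ)).const_mul _
  · refine integrable_ft_mul h ((measurable_riesz j l).neg.mul measurable_sig.inv)
      (ae_kap_ne_zero.mono fun κ hκ => ?_)
    rw [norm_mul, norm_neg]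
    exact (mul_le_of_le_one_left (norm_nonneg _) (norm_riesz_le j l κ)).trans (norm_sig_inv_le hκ)

/-- The formal adjoint of `∂_t - Δ - lam ∂₁`. -/
def adjOp (lam : ℝ) (g : G T → ℝ) (p : G T) : ℝ := -pdt g p - lapG g p + lam * pdx 0 g p

lemma IsTestG.adjOp {g : G T → ℝ} (h : IsTestG T g) (lam : ℝ) : IsTestG T (adjOp lam g) := by
  have := ((h.pdt.const_mul (-1)).sub h.lapG).add ((h.pdx 0).const_mul lam)
  have e : TPNS.adjOp lam g = fun p => (-1 * TPNS.pdt g p - TPNS.lapG g p) + lam * TPNS.pdx 0 g p := by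
    ext p; simp [TPNS.adjOp]
  rw [e]; exact this

/-- As `ft` integrates against the character of frequency κ itself, the adjoint operator produces
the symbol of ∂_t - Δ - λ∂_1 at κ, with no reflection. -/
lemma ft_adjOp {g : G T → ℝ} (h : IsTestG T g) (κ : ℤ × E3) :
    ft (adjOp lam g) κ = sig T lam κ * ft g κ := by
  have e : adjOp lam g = fun p => ((-1) * pdt g p - lapG g p) + lam * pdx 0 g p := by
    ext p; simp [adjOp]
  rw [e, ft_add ((h.pdt.const_mul (-1)).sub h.lapG).integrable ((h.pdx 0).const_mul lam).integrable,
    ft_sub (h.pdt.const_mul (-1)).integrable h.lapG.integrable, ft_const_mul, ft_const_mul, ft_pdt h,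
    ft_lapG h, ft_pdx h]
  unfold sig
  push_cast
  ring

/-- This expresses that the kernel is a fundamental solution. The adjoint operator cancels 1/`sig`,
the extra Laplacian clears the denominator |ξ|² of the Helmholtz projection, and inversion at 0
leaves local terms only, with no pressure. -/
lemma integral_per_vel_adj (hlam : 0 < lam) {g : G T → ℝ} (h : IsTestG T g) (j l : Fin 3) :
    ∫ p, per T lam (velKern j l) p * lapG (adjOp lam g) p ∂(muG T) =
      kron j l * lapG g 0 - pdx j (pdx l g) 0 := by
  have ht : IsTestG T (fun p => kron j l * lapG g p - pdx j (pdx l g) p) :=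
    (h.lapG.const_mul _).sub ((h.pdx l).pdx j)
  have h1 := integral_per_vel_mul hlam (h.adjOp lam).lapG j l
  have h2 := ft_inversion ht 0
  have : ((∫ p, per T lam (velKern j l) p * lapG (adjOp lam g) p ∂(muG T) : ℝ) : ℂ) =
      ((kron j l * lapG g 0 - pdx j (pdx l g) 0 : ℝ) : ℂ) := by
    rw [h1, h2]
    congr 1
    refine integral_congr_ae ?_
    filter_upwards [ae_kap_ne_zero] with κ hκ
    have e1 : charInv κ (0 : G T) = 1 := by simp [charInv, fourier_apply]
    rw [e1, mul_one, ft_lapG (h.adjOp lam), ft_adjOp h,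
      ft_sub (h.lapG.const_mul _).integrable ((h.pdx l).pdx j).integrable, ft_const_mul, ft_lapG h,
      ft_pdx (h.pdx l), ft_pdx h]
    have h0 : (‖κ.2‖ : ℂ) ≠ 0 := by simpa using hκ
    have hs := sig_ne_zero (T := T) (lam := lam) hκ
    unfold velMult riesz
    push_cast
    field_simp
    linear_combination ((κ.2 j : ℂ) * κ.2 l * ft g κ) * Complex.I_sq
  exact_mod_cast this

end FourierKernels


/-! ### Uniqueness on `G` -/

section Uniqueness

variable {T : ℝ} [hT : Fact (0 < T)]

lemma integral_mul_eq_zero_of_modes {g : AddCircle T → ℂ} (hg : Integrable g AddCircle.haarAddCircle)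
    (h0 : ∀ k : ℤ, ∫ τ, g τ * fourier k τ ∂AddCircle.haarAddCircle = 0) (h : C(AddCircle T, ℂ)) :
    ∫ τ, g τ * h τ ∂AddCircle.haarAddCircle = 0 := by
  have hi : ∀ h : C(AddCircle T, ℂ), Integrable (fun τ => g τ * h τ) AddCircle.haarAddCircle := fun h =>
    hg.mul_bdd (c := ‖h‖) h.continuous.aestronglyMeasurable (Eventually.of_forall fun τ => h.norm_coe_le_norm τ)
  let L : C(AddCircle T, ℂ) →ₗ[ℂ] ℂ :=
    { toFun := fun h => ∫ τ, g τ * h τ ∂AddCircle.haarAddCircle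
      map_add' := fun a b => by
        rw [← integral_add (hi a) (hi b)]
        congr 1; ext τ; simp [mul_add]
      map_smul' := fun c a => by
        simp only [RingHom.id_apply, smul_eq_mul]
        rw [← integral_const_mul]
        congr 1; ext τ
        simp only [ContinuousMap.coe_smul, Pi.smul_apply, smul_eq_mul]; ring }
  let L' := L.mkContinuous (∫ τ, ‖g τ‖ ∂AddCircle.haarAddCircle) fun h => by
    calc ‖∫ τ, g τ * h τ ∂AddCircle.haarAddCircle‖ ≤ ∫ τ, ‖g τ‖ * ‖h‖ ∂AddCircle.haarAddCircle := by
          refine norm_integral_le_of_norm_le (hg.norm.mul_const _) (Eventually.of_forall fun τ => ?_)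
          rw [norm_mul]
          gcongr
          exact h.norm_coe_le_norm τ
      _ = _ := integral_mul_const _ _
  have hker : (Submodule.span ℂ (range (@fourier T))).topologicalClosure ≤ L'.ker := by
    refine Submodule.topologicalClosure_minimal _ (Submodule.span_le.2 ?_) L'.isClosed_ker
    rintro _ ⟨k, rfl⟩
    exact h0 k
  rw [span_fourier_closure_eq_top] at hker
  exact hker (Submodule.mem_top : h ∈ ⊤)

/-- Trigonometric polynomials are uniformly dense, so g is orthogonal to every continuous function.
Thickened indicators of closed sets then show that all its integrals over closed sets vanish. -/
lemma ae_eq_zero_of_modes_circle {g : AddCircle T → ℝ} (hg : Integrable g AddCircle.haarAddCircle)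
    (h0 : ∀ k : ℤ, ∫ τ, (g τ : ℂ) * fourier k τ ∂AddCircle.haarAddCircle = 0) :
    g =ᵐ[AddCircle.haarAddCircle] 0 := by
  refine ae_eq_zero_of_forall_setIntegral_isClosed_eq_zero hg fun F hF => ?_
  set δ : ℕ → ℝ := fun n => 1 / ((n : ℝ) + 1)
  have hδ : ∀ n, 0 < δ n := fun n => by positivity
  have hδ0 : Tendsto δ atTop (𝓝 0) := tendsto_one_div_add_atTop_nhds_zero_nat
  have hz : ∀ n, ∫ τ, g τ * (thickenedIndicator (hδ n) F τ : ℝ) ∂AddCircle.haarAddCircle = 0 := by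
    intro n
    have := integral_mul_eq_zero_of_modes hg.ofReal h0
      ⟨fun τ => ((thickenedIndicator (hδ n) F τ : ℝ) : ℂ), by
        have := (thickenedIndicator (hδ n) F).continuous
        fun_prop⟩
    have e : ∫ τ, ((g τ : ℝ) : ℂ) * ((thickenedIndicator (hδ n) F τ : ℝ) : ℂ) ∂AddCircle.haarAddCircle =
        ((∫ τ, g τ * (thickenedIndicator (hδ n) F τ : ℝ) ∂AddCircle.haarAddCircle : ℝ) : ℂ) := by
      rw [← integral_complex_ofReal]; congr 1; ext τ; push_cast; rfl
    have h2 : ∫ τ, ((g τ : ℝ) : ℂ) * ((thickenedIndicator (hδ n) F τ : ℝ) : ℂ) ∂AddCircle.haarAddCircle = 0 := this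
    rw [e] at h2
    exact_mod_cast h2
  have hlim : Tendsto (fun n => ∫ τ, g τ * (thickenedIndicator (hδ n) F τ : ℝ) ∂AddCircle.haarAddCircle) atTop
      (𝓝 (∫ τ, F.indicator g τ ∂AddCircle.haarAddCircle)) := by
    refine tendsto_integral_of_dominated_convergence (fun τ => ‖g τ‖) (fun n => ?_) hg.norm
      (fun n => Eventually.of_forall fun τ => ?_) (Eventually.of_forall fun τ => ?_)
    · have := (thickenedIndicator (hδ n) F).continuous
      exact hg.1.mul (by fun_prop : Continuous fun τ => ((thickenedIndicator (hδ n) F τ : ℝ≥0) : ℝ)).aestronglyMeasurable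
    · rw [norm_mul]
      refine mul_le_of_le_one_right (norm_nonneg _) ?_
      rw [Real.norm_of_nonneg NNReal.zero_le_coe]
      exact_mod_cast thickenedIndicator_le_one (hδ n) F τ
    · have h1 := thickenedIndicator_tendsto_indicator_closure hδ hδ0 F
      rw [tendsto_pi_nhds] at h1
      have h2 := (NNReal.tendsto_coe.2 (h1 τ)).const_mul (g τ)
      rw [hF.closure_eq] at h2
      convert h2 using 2
      by_cases hτ : τ ∈ F <;> simp [hτ]
  simp_rw [hz] at hlim
  rw [← integral_indicator hF.measurableSet]
  exact (tendsto_nhds_unique hlim tendsto_const_nhds)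

/-- The real part of a character of the circle. -/
def cosMode (k : ℤ) (τ : AddCircle T) : ℝ := (fourier k τ : ℂ).re

/-- The imaginary part of a character of the circle. -/
def sinMode (k : ℤ) (τ : AddCircle T) : ℝ := (fourier k τ : ℂ).im

lemma fourier_eq_modes (k : ℤ) (τ : AddCircle T) :
    (fourier k τ : ℂ) = cosMode k τ + sinMode k τ * Complex.I := (Complex.re_add_im _).symm

lemma continuous_cosMode (k : ℤ) : Continuous (cosMode (T := T) k) :=
  Complex.continuous_re.comp (fourier k).continuous

lemma continuous_sinMode (k : ℤ) : Continuous (sinMode (T := T) k) :=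
  Complex.continuous_im.comp (fourier k).continuous

lemma contDiff_fourier (k : ℤ) : ContDiff ℝ ∞ (fun s : ℝ => (fourier k (s : AddCircle T) : ℂ)) := by
  simp_rw [fourier_coe_apply]
  have : ContDiff ℝ ∞ (fun s : ℝ => (s : ℂ)) := Complex.ofRealCLM.contDiff
  fun_prop

lemma contDiff_cosMode (k : ℤ) : ContDiff ℝ ∞ (fun s : ℝ => cosMode k (s : AddCircle T)) :=
  Complex.reCLM.contDiff.comp (contDiff_fourier k)

lemma contDiff_sinMode (k : ℤ) : ContDiff ℝ ∞ (fun s : ℝ => sinMode k (s : AddCircle T)) :=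
  Complex.imCLM.contDiff.comp (contDiff_fourier k)

lemma abs_cosMode_le (k : ℤ) (τ : AddCircle T) : |cosMode k τ| ≤ 1 := by
  refine (Complex.abs_re_le_norm _).trans ?_
  rw [fourier_apply, Circle.norm_coe]

lemma abs_sinMode_le (k : ℤ) (τ : AddCircle T) : |sinMode k τ| ≤ 1 := by
  refine (Complex.abs_im_le_norm _).trans ?_
  rw [fourier_apply, Circle.norm_coe]

lemma LocallyIntegrable.mul_bdd_continuous {f θ : G T → ℝ} (hf : LocallyIntegrable f (muG T))
    (hθ : Continuous θ) : LocallyIntegrable (fun p => f p * θ p) (muG T) := by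
  rw [locallyIntegrable_iff]
  intro K hK
  exact (hf.integrableOn_isCompact hK).mul_continuousOn hθ.continuousOn hK

/-- There are countably many modes, so for almost every x all of them vanish at once and the
statement on the circle applies to f(·, x). -/
lemma ae_eq_zero_of_modes {f : G T → ℝ} (hf : LocallyIntegrable f (muG T))
    (hc : ∀ k, mean (fun p => f p * cosMode k p.1) =ᵐ[volume] 0)
    (hs : ∀ k, mean (fun p => f p * sinMode k p.1) =ᵐ[volume] 0) : f =ᵐ[muG T] 0 := by
  have hc' := ae_all_iff.2 hc
  have hs' := ae_all_iff.2 hs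
  have key : ∀ᵐ x : E3, (fun τ : AddCircle T => f (τ, x)) =ᵐ[AddCircle.haarAddCircle] 0 := by
    filter_upwards [hc', hs', ae_integrable_time hf] with x h1 h2 h3
    refine ae_eq_zero_of_modes_circle h3 fun k => ?_
    have i1 : Integrable (fun τ => f (τ, x) * cosMode k τ) AddCircle.haarAddCircle :=
      h3.mul_bdd (c := 1) (continuous_cosMode k).aestronglyMeasurable (Eventually.of_forall (abs_cosMode_le k))
    have i2 : Integrable (fun τ => f (τ, x) * sinMode k τ) AddCircle.haarAddCircle :=
      h3.mul_bdd (c := 1) (continuous_sinMode k).aestronglyMeasurable (Eventually.of_forall (abs_sinMode_le k))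
    have e : ∀ τ, (f (τ, x) : ℂ) * fourier k τ = ((f (τ, x) * cosMode k τ : ℝ) : ℂ) +
        ((f (τ, x) * sinMode k τ : ℝ) : ℂ) * Complex.I := by
      intro τ; rw [fourier_eq_modes]; push_cast; ring
    simp_rw [e]
    rw [integral_add i1.ofReal (i2.ofReal.mul_const _), integral_mul_const, integral_complex_ofReal,
      integral_complex_ofReal]
    have h1' := h1 k
    have h2' := h2 k
    simp only [mean, Pi.zero_apply] at h1' h2'
    rw [h1', h2']; simp
  have h0 : ∫⁻ p, ‖f p‖ₑ ∂(muG T) = 0 := by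
    rw [lintegral_muG hf.aestronglyMeasurable.enorm]
    rw [lintegral_eq_zero_of_ae_eq_zero]
    filter_upwards [key] with x hx
    exact lintegral_eq_zero_of_ae_eq_zero (hx.mono fun τ hτ => by simp [hτ])
  rw [lintegral_eq_zero_iff' hf.aestronglyMeasurable.enorm] at h0
  exact h0.mono fun p hp => by simpa using hp

lemma ae_eq_zero_of_tests_E {g : E3 → ℝ} (hg : LocallyIntegrable g)
    (h : ∀ χ, IsTestE χ → ∫ x, g x * χ x = 0) : g =ᵐ[volume] 0 := by
  refine ae_eq_zero_of_integral_contDiff_smul_eq_zero hg fun χ h1 h2 => ?_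
  have := h χ ⟨h1, h2⟩
  simpa [mul_comm] using this

/-- Product tests θ(t)χ(x), with θ a real trigonometric mode, already suffice: they reduce the claim
to the corresponding fact on ℝ³ for each mode. -/
lemma ae_eq_zero_of_tests_G {f : G T → ℝ} (hf : LocallyIntegrable f (muG T))
    (h : ∀ φ, IsTestG T φ → ∫ p, f p * φ p ∂(muG T) = 0) : f =ᵐ[muG T] 0 := by
  have key : ∀ θ : AddCircle T → ℝ, Continuous θ → ContDiff ℝ ∞ (fun s : ℝ => θ s) →
      mean (fun p => f p * θ p.1) =ᵐ[volume] 0 := by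
    intro θ hc hθ
    have hl : LocallyIntegrable (fun p => f p * θ p.1) (muG T) :=
      LocallyIntegrable.mul_bdd_continuous hf (hc.comp continuous_fst)
    refine ae_eq_zero_of_tests_E (locallyIntegrable_mean hl) fun χ hχ => ?_
    rw [← integral_mul_comp_snd hl hχ.1.continuous hχ.2]
    have := h _ (isTestG_mul hθ hχ)
    simpa [mul_assoc] using this
  exact ae_eq_zero_of_modes hf (fun k => key _ (continuous_cosMode k) (contDiff_cosMode k))
    (fun k => key _ (continuous_sinMode k) (contDiff_sinMode k))

lemma ae_eq_of_tests_G {f g : G T → ℝ} (hf : LocallyIntegrable f (muG T)) (hg : LocallyIntegrable g (muG T))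
    (h : ∀ φ, IsTestG T φ → ∫ p, f p * φ p ∂(muG T) = ∫ p, g p * φ p ∂(muG T)) : f =ᵐ[muG T] g := by
  have := ae_eq_zero_of_tests_G (hf.sub hg) fun φ hφ => by
    simp only [Pi.sub_apply, sub_mul]
    rw [integral_sub (LocallyIntegrable.mul_test hf hφ.continuous hφ.2)
      (LocallyIntegrable.mul_test hg hφ.continuous hφ.2), h φ hφ, sub_self]
  exact this.mono fun p hp => by simpa [sub_eq_zero] using hp

lemma ae_eq_of_tests_E {f g : E3 → ℝ} (hf : LocallyIntegrable f) (hg : LocallyIntegrable g)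
    (h : ∀ φ, IsTestE φ → ∫ p, f p * φ p = ∫ p, g p * φ p) : f =ᵐ[volume] g := by
  have := ae_eq_zero_of_tests_E (hf.sub hg) fun φ hφ => by
    simp only [Pi.sub_apply, sub_mul]
    rw [integral_sub (LocallyIntegrable.mul_test hf hφ.1.continuous hφ.2)
      (LocallyIntegrable.mul_test hg hφ.1.continuous hφ.2), h φ hφ, sub_self]
  exact this.mono fun p hp => by simpa [sub_eq_zero] using hp

/-- Test functions determine a locally integrable function up to a null set. So the representative
selected by choice agrees almost everywhere with any weak derivative exhibited by hand.
`IsInvFourierG.invFourierG_eq` plays the same role for inverse transforms. -/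
lemma IsWeakPartialG.wpdG_eq {j : Fin 3} {g h : G T → ℝ} (hw : IsWeakPartialG T j g h) :
    IsWeakPartialG T j g (wpdG T j g) ∧ wpdG T j g =ᵐ[muG T] h := by
  have hex : ∃ k, IsWeakPartialG T j g k := ⟨h, hw⟩
  have h1 : IsWeakPartialG T j g (wpdG T j g) := by
    unfold wpdG; rw [dif_pos hex]; exact hex.choose_spec
  refine ⟨h1, ae_eq_of_tests_G h1.2.1 hw.2.1 fun φ hφ => ?_⟩
  have := (h1.2.2 φ hφ).symm.trans (hw.2.2 φ hφ)
  linarith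

lemma IsWeakPartialE.wpdE_eq {j : Fin 3} {g h : E3 → ℝ} (hw : IsWeakPartialE j g h) :
    IsWeakPartialE j g (wpdE j g) ∧ wpdE j g =ᵐ[volume] h := by
  have hex : ∃ k, IsWeakPartialE j g k := ⟨h, hw⟩
  have h1 : IsWeakPartialE j g (wpdE j g) := by
    unfold wpdE; rw [dif_pos hex]; exact hex.choose_spec
  refine ⟨h1, ae_eq_of_tests_E h1.2.1 hw.2.1 fun φ hφ => ?_⟩
  have := (h1.2.2 φ hφ).symm.trans (hw.2.2 φ hφ)
  linarith

lemma IsInvFourierG.invFourierG_eq {m : ℤ → E3 → ℂ} {K : G T → ℝ} (hK : IsInvFourierG T m K) :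
    IsInvFourierG T m (invFourierG T m) ∧ invFourierG T m =ᵐ[muG T] K := by
  have hex : ∃ K, IsInvFourierG T m K := ⟨K, hK⟩
  have h1 : IsInvFourierG T m (invFourierG T m) := by
    unfold invFourierG; rw [dif_pos hex]; exact hex.choose_spec
  refine ⟨h1, ae_eq_of_tests_G h1.1 hK.1 fun φ hφ => ?_⟩
  have := (h1.2 φ hφ).2.unique (hK.2 φ hφ).2
  exact_mod_cast this

end Uniqueness

/-! ### Purely periodic parts of kernels -/

section PurelyPeriodic

variable {T : ℝ} [hT : Fact (0 < T)]

lemma integral_fourier (k : ℤ) :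
    ∫ τ, (fourier k τ : ℂ) ∂(AddCircle.haarAddCircle (T := T)) = if k = 0 then 1 else 0 := by
  have h := (orthonormal_iff_ite.1 (orthonormal_fourier (T := T))) 0 k
  rw [ContinuousMap.inner_toLp (AddCircle.haarAddCircle (T := T)) (fourier 0) (fourier k)] at h
  simp only [eq_comm (a := (0 : ℤ))] at h
  rw [← h]
  congr 1; ext τ
  simp

lemma ft_comp_add_time (φ : G T → ℝ) (τ : AddCircle T) (κ : ℤ × E3) :
    ft (fun p => φ (p + (τ, 0))) κ = fourier (-κ.1) τ * ft φ κ := by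
  unfold ft
  rw [← integral_const_mul, ← integral_add_right_eq_self (μ := muG T)
    (fun p => (fourier (-κ.1) τ : ℂ) * ((φ p : ℂ) * charG κ p)) (τ, 0)]
  congr 1; ext p
  have : (fourier (-κ.1) τ : ℂ) * charG κ (p + (τ, 0)) = charG κ p := by
    simp only [charG, Prod.fst_add, Prod.snd_add, add_zero]
    have h1 : (fourier κ.1 (p.1 + τ) : ℂ) = fourier κ.1 p.1 * fourier κ.1 τ := by
      simp [fourier_apply, smul_add, AddCircle.toCircle_add]
    have h2 : (fourier (-κ.1) τ : ℂ) * fourier κ.1 τ = 1 := by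
      rw [← fourier_add]; simp
    rw [h1]
    linear_combination (fourier κ.1 p.1 * Complex.exp (Complex.I * (inner ℝ p.2 κ.2 : ℝ))) * h2
  rw [mul_left_comm, this]

/-- Averaging over time translations is self-adjoint: applied to the test function it has the same
effect as replacing K by its time mean. -/
lemma integral_mean_mul {K : G T → ℝ} (hK : LocallyIntegrable K (muG T)) {φ : G T → ℝ} (hφ : IsTestG T φ) :
    ∫ τ, ∫ p, K p * φ (p + (τ, 0)) ∂(muG T) ∂(AddCircle.haarAddCircle (T := T)) =
      ∫ p, mean K p.2 * φ p ∂(muG T) := by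
  obtain ⟨M, S, hS, hM⟩ := exists_bound_of_compactSupport hφ.continuous hφ.2
  have hind : Integrable ((univ ×ˢ S).indicator K) (muG T) :=
    (hK.integrableOn_isCompact (isCompact_univ.prod hS)).integrable_indicator
      (MeasurableSet.univ.prod hS.measurableSet)
  have hprod : Integrable (fun z : AddCircle T × G T => K z.2 * φ (z.2 + (z.1, 0)))
      ((AddCircle.haarAddCircle (T := T)).prod (muG T)) := by
    have h1 : Integrable (fun z : AddCircle T × G T => (univ ×ˢ S).indicator K z.2)
      ((AddCircle.haarAddCircle (T := T)).prod (muG T)) := hind.comp_snd _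
    have hcont : Continuous fun z : AddCircle T × G T => φ (z.2 + (z.1, 0)) :=
      hφ.continuous.comp (by fun_prop)
    have h2 := h1.mul_bdd (c := M) (g := fun z => φ (z.2 + (z.1, 0)))
      hcont.aestronglyMeasurable (Eventually.of_forall fun z => by
        have := (hM (z.2 + (z.1, 0))).trans (indicator_le_self' (by simp) _)
        rw [← ofReal_norm, ← ENNReal.ofReal_coe_nnreal, ENNReal.ofReal_le_ofReal_iff (by simp)] at this
        exact this)
    refine h2.congr (Eventually.of_forall fun z => ?_)
    simp only
    by_cases hz : z.2.2 ∈ S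
    · rw [indicator_of_mem (by simpa using hz)]
    · have : φ (z.2 + (z.1, 0)) = 0 := by
        have := hM (z.2 + (z.1, 0))
        rw [indicator_of_notMem (by simpa using hz)] at this
        simpa using this
      rw [this]; simp
  have e : ∀ p : G T, ∫ τ, K p * φ (p + (τ, 0)) ∂(AddCircle.haarAddCircle (T := T)) = K p * mean φ p.2 := by
    intro p
    rw [integral_const_mul]
    congr 1
    have := integral_add_left_eq_self (μ := AddCircle.haarAddCircle (T := T)) (fun τ => φ (τ, p.2)) p.1
    unfold mean
    rw [← this]
    congr 1; ext τ
    congr 1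
    ext <;> simp
  have hi2 : Integrable (fun p : G T => K p * mean φ p.2) (muG T) := by
    have := hprod.integral_prod_right
    exact this.congr (Eventually.of_forall fun p => e p)
  have hi3 := LocallyIntegrable.mul_test (locallyIntegrable_comp_snd (T := T) (locallyIntegrable_mean hK))
    hφ.continuous hφ.2
  rw [integral_integral_swap hprod]
  simp_rw [e]
  unfold muG at hi2 hi3 ⊢
  rw [integral_prod_symm _ hi2, integral_prod_symm _ hi3]
  congr 1; ext x
  simp only [integral_mul_const, integral_const_mul]
  rfl

lemma continuous_fourier_fst : Continuous fun z : AddCircle T × (ℤ × E3) => (fourier (-z.2.1) z.1 : ℂ) := by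
  have h2 : Continuous fun z : AddCircle T × (ℤ × E3) => charInv z.2 ((z.1, 0) : G T) :=
    (continuous_charInv_uncurry (T := T)).comp (g := fun z : (ℤ × E3) × G T => charInv z.1 z.2)
      (f := fun z : AddCircle T × (ℤ × E3) => (z.2, ((z.1, 0) : G T)))
      (continuous_snd.prodMk (continuous_fst.prodMk continuous_const))
  refine h2.congr fun z => ?_
  simp [charInv]

/-- Translating the test function in time multiplies its transform by a character of frequency -k,
whose average over the circle is 0 unless k = 0. -/
lemma integral_mean_mul_eq {K : G T → ℝ} (hK : LocallyIntegrable K (muG T)) {M : ℤ × E3 → ℂ}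
    (hi : ∀ φ, IsTestG T φ → Integrable (fun κ => ft φ κ * M κ) kap)
    (hpair : ∀ φ, IsTestG T φ → ((∫ p, K p * φ p ∂(muG T) : ℝ) : ℂ) = invConst * ∫ κ, ft φ κ * M κ ∂kap)
    {φ : G T → ℝ} (hφ : IsTestG T φ) :
    ((∫ p, mean K p.2 * φ p ∂(muG T) : ℝ) : ℂ) =
      invConst * ∫ κ, (if κ.1 = 0 then 1 else 0 : ℂ) * (ft φ κ * M κ) ∂kap := by
  have e1 : ∀ τ : AddCircle T, ((∫ p, K p * φ (p + (τ, 0)) ∂(muG T) : ℝ) : ℂ) =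
      invConst * ∫ κ, (fourier (-κ.1) τ : ℂ) * (ft φ κ * M κ) ∂kap := by
    intro τ
    rw [hpair _ (hφ.comp_add (τ, 0))]
    congr 2; ext κ
    rw [ft_comp_add_time]; ring
  have h1 : Integrable (fun z : AddCircle T × (ℤ × E3) => ft φ z.2 * M z.2)
    ((AddCircle.haarAddCircle (T := T)).prod kap) := (hi φ hφ).comp_snd _
  have h2 : Integrable (fun z : AddCircle T × (ℤ × E3) => (fourier (-z.2.1) z.1 : ℂ) * (ft φ z.2 * M z.2))
      ((AddCircle.haarAddCircle (T := T)).prod kap) :=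
    h1.bdd_mul (c := 1) continuous_fourier_fst.aestronglyMeasurable
      (Eventually.of_forall fun z => by rw [fourier_apply, Circle.norm_coe])
  rw [← integral_mean_mul hK hφ, ← integral_complex_ofReal]
  simp_rw [e1]
  rw [integral_const_mul, integral_integral_swap h2]
  congr 2; ext κ
  rw [integral_mul_const, integral_fourier]
  simp

/-- Removing the time mean from K removes exactly the mode k = 0 from its multiplier. This turns the
kernels with full symbol into Γ_⊥ and φ_⊥. -/
lemma isInvFourierG_sub_mean {K : G T → ℝ} (hK : LocallyIntegrable K (muG T)) {M : ℤ × E3 → ℂ}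
    (hi : ∀ φ, IsTestG T φ → Integrable (fun κ => ft φ κ * M κ) kap)
    (hpair : ∀ φ, IsTestG T φ → ((∫ p, K p * φ p ∂(muG T) : ℝ) : ℂ) = invConst * ∫ κ, ft φ κ * M κ ∂kap) :
    IsInvFourierG T (fun k ξ => if k = 0 then 0 else M (k, ξ)) (fun p => K p - mean K p.2) := by
  have hK' := locallyIntegrable_comp_snd (T := T) (locallyIntegrable_mean hK)
  refine ⟨hK.sub hK', fun φ hφ => ?_⟩
  set g : ℤ × E3 → ℂ := fun κ => (if κ.1 = 0 then 0 else 1) * (ft φ κ * M κ) with hg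
  have hm0 : Measurable fun κ : ℤ × E3 => (if κ.1 = 0 then 1 else 0 : ℂ) :=
    (measurable_from_top (f := fun k : ℤ => (if k = 0 then 1 else 0 : ℂ))).comp measurable_fst
  have hm1 : Measurable fun κ : ℤ × E3 => (if κ.1 = 0 then 0 else 1 : ℂ) :=
    (measurable_from_top (f := fun k : ℤ => (if k = 0 then 0 else 1 : ℂ))).comp measurable_fst
  have hig0 : Integrable (fun κ : ℤ × E3 => (if κ.1 = 0 then 1 else 0 : ℂ) * (ft φ κ * M κ)) kap :=
    (hi φ hφ).bdd_mul (c := 1) hm0.aestronglyMeasurable (Eventually.of_forall fun κ => by split_ifs <;> simp)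
  have hig : Integrable g kap :=
    (hi φ hφ).bdd_mul (c := 1) hm1.aestronglyMeasurable (Eventually.of_forall fun κ => by split_ifs <;> simp)
  have eg : ∀ k ξ, (if k = 0 then 0 else M (k, ξ)) * fourierG T φ (-k) (-ξ) = g (k, ξ) := by
    intro k ξ
    rw [fourierG_neg, hg]
    split_ifs <;> simp_all [mul_comm]
  simp_rw [eg]
  refine ⟨fun k => integrable_slice hig k, ?_⟩
  have hs := (hasSum_integral_kap hig).mul_left invConst
  have e : ((∫ p, (K p - mean K p.2) * φ p ∂(muG T) : ℝ) : ℂ) = invConst * ∫ κ, g κ ∂kap := by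
    simp_rw [sub_mul]
    rw [integral_sub (LocallyIntegrable.mul_test hK hφ.continuous hφ.2)
      (LocallyIntegrable.mul_test hK' hφ.continuous hφ.2), Complex.ofReal_sub, hpair φ hφ,
      integral_mean_mul_eq hK hi hpair hφ, ← mul_sub, ← integral_sub (hi φ hφ) hig0]
    congr 2; ext κ
    rw [hg]
    split_ifs <;> simp_all
  rw [e]
  exact hs

lemma isInvFourierG_congr {m : ℤ → E3 → ℂ} {K K' : G T → ℝ} (h : IsInvFourierG T m K)
    (hK : K =ᵐ[muG T] K') : IsInvFourierG T m K' := by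
  refine ⟨h.1.congr hK, fun φ hφ => ⟨(h.2 φ hφ).1, ?_⟩⟩
  have e : (fun p => K' p * φ p) =ᵐ[muG T] fun p => K p * φ p := hK.mono fun p hp => by simp only [hp]
  rw [integral_congr_ae e]
  exact (h.2 φ hφ).2

variable {lam : ℝ}

lemma ae_snd {P : E3 → Prop} (h : ∀ᵐ x : E3, P x) : ∀ᵐ p ∂(muG T), P p.2 := by
  unfold muG; exact Measure.quasiMeasurePreserving_snd.ae h

lemma isInvFourierG_vort (hlam : 0 < lam) :
    IsInvFourierG T (vortSymbol T lam) (fun p => per T lam heat p - stat lam heat p.2) := by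
  have h := isInvFourierG_sub_mean (kern_heat.locallyIntegrable_per (T := T) hlam)
    (M := fun κ => (sig T lam κ)⁻¹) (fun φ hφ => integrable_ft_mul hφ measurable_sig.inv
      (ae_kap_ne_zero.mono fun κ hκ => norm_sig_inv_le hκ)) fun φ hφ => integral_per_heat_mul hlam hφ
  have e : (fun (k : ℤ) (ξ : E3) => if k = 0 then 0 else (sig T lam (k, ξ))⁻¹) = vortSymbol T lam := by
    ext k ξ
    unfold vortSymbol sig
    split_ifs <;> simp
  have h' : IsInvFourierG T (vortSymbol T lam) _ := e ▸ h
  refine isInvFourierG_congr h' ?_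
  filter_upwards [ae_snd (T := T) (kern_heat.mean_per (T := T) hlam)] with p hp
  rw [hp]

lemma norm_velMult_le {κ : ℤ × E3} (hκ : κ.2 ≠ 0) (j l : Fin 3) : ‖velMult T lam j l κ‖ ≤ 2 * (‖κ.2‖ ^ 2)⁻¹ := by
  unfold velMult
  rw [norm_mul]
  gcongr
  · refine (norm_sub_le _ _).trans ?_
    have h1 := norm_riesz_le j l κ
    have h2 : ‖((kron j l : ℝ) : ℂ)‖ ≤ 1 := by rw [Complex.norm_real]; exact abs_kron_le j l
    linarith
  · exact norm_sig_inv_le hκ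

lemma integrable_ft_mul_velMult {φ : G T → ℝ} (h : IsTestG T φ) (j l : Fin 3) :
    Integrable (fun κ => ft φ κ * velMult T lam j l κ) kap := by
  refine ((integrable_ft_div h).const_mul 2).mono' ((stronglyMeasurable_ft h.continuous).measurable.mul
    (measurable_velMult j l)).aestronglyMeasurable ?_
  filter_upwards [ae_kap_ne_zero] with κ hκ
  rw [norm_mul, mul_left_comm]
  gcongr
  exact norm_velMult_le hκ j l

lemma isInvFourierG_vel (hlam : 0 < lam) (j l : Fin 3) :
    IsInvFourierG T (velSymbol T lam j l)
      (fun p => per T lam (velKern j l) p - stat lam (velKern j l) p.2) := by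
  have h := isInvFourierG_sub_mean ((kern_vel j l).locallyIntegrable_per (T := T) hlam)
    (fun φ hφ => integrable_ft_mul_velMult hφ j l) fun φ hφ => integral_per_vel_mul hlam hφ j l
  have e : (fun (k : ℤ) (ξ : E3) => if k = 0 then 0 else velMult T lam j l (k, ξ)) = velSymbol T lam j l := by
    ext k ξ
    unfold velSymbol vortSymbol velMult riesz sig kron
    by_cases hk : k = 0
    · simp [hk]
    · simp only [hk, if_false]
      push_cast
      rw [one_div, mul_comm]
  have h' : IsInvFourierG T (velSymbol T lam j l) _ := e ▸ h
  refine isInvFourierG_congr h' ?_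
  filter_upwards [ae_snd (T := T) ((kern_vel j l).mean_per (T := T) hlam)] with p hp
  rw [hp]

end PurelyPeriodic


/-! ### A Liouville theorem -/

section Liouville

open SchwartzMap FourierTransform LineDeriv

/-- The Laplacian on Schwartz functions. -/
def lapS (g : 𝓢(E3, ℂ)) : 𝓢(E3, ℂ) := ∑ m : Fin 3, ∂_{unitVec m} (∂_{unitVec m} g)

/-- The operator `Δ (-i c - Δ + lam ∂₁)` on Schwartz functions. -/
def opS (c lam : ℝ) (g : 𝓢(E3, ℂ)) : 𝓢(E3, ℂ) :=
  lapS ((-(Complex.I * c)) • g + (-1 : ℂ) • lapS g + (lam : ℂ) • ∂_{unitVec 0} g)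

lemma continuous_lapS : Continuous lapS :=
  continuous_finsetSum _ fun m _ => (continuous_lineDerivOp (unitVec m)).comp (continuous_lineDerivOp (unitVec m))

lemma continuous_opS (c lam : ℝ) : Continuous (opS c lam) := by
  unfold opS
  have h1 := continuous_lapS
  have h2 : Continuous fun g : 𝓢(E3, ℂ) => ∂_{unitVec 0} g := continuous_lineDerivOp (unitVec 0)
  exact h1.comp (((continuous_const_smul _).add ((continuous_const_smul _).comp h1)).add
    ((continuous_const_smul _).comp h2))

/-- The symbol of `opS`. -/
def symS (c lam : ℝ) (x : E3) : ℂ :=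
  -(((2 * Real.pi) ^ 2 * ‖x‖ ^ 2 : ℝ) : ℂ) * ((((2 * Real.pi) ^ 2 * ‖x‖ ^ 2 : ℝ) : ℂ)
    + Complex.I * ((2 * Real.pi * lam * x 0 - c : ℝ) : ℂ))

/-- Both factors have nonzero real part away from the origin, regardless of c and λ, so steady and
oscillating modes are treated alike. -/
lemma symS_ne_zero {c lam : ℝ} {x : E3} (hx : x ≠ 0) : symS c lam x ≠ 0 := by
  have h0 : 0 < ‖x‖ := norm_pos_iff.2 hx
  have h1 : (0 : ℝ) < (2 * Real.pi) ^ 2 * ‖x‖ ^ 2 := by positivity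
  refine mul_ne_zero (neg_ne_zero.2 (by exact_mod_cast h1.ne')) fun h => ?_
  have := congrArg Complex.re h
  rw [Complex.add_re, Complex.ofReal_re] at this
  simp [-Complex.ofReal_mul, -Complex.ofReal_sub] at this
  exact hx this

lemma contDiff_symS (c lam : ℝ) : ContDiff ℝ ∞ (symS c lam) := by
  have h1 : ContDiff ℝ ∞ (fun x : E3 => ‖x‖ ^ 2) := contDiff_norm_sq ℝ
  have h2 : ContDiff ℝ ∞ (fun x : E3 => x 0) := (EuclideanSpace.proj (𝕜 := ℝ) (0 : Fin 3)).contDiff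
  have h3 : ContDiff ℝ ∞ (fun s : ℝ => (s : ℂ)) := Complex.ofRealCLM.contDiff
  unfold symS
  have h4 := h3.comp (contDiff_const (c := (2 * Real.pi) ^ 2) |>.mul h1)
  have h5 := h3.comp (((contDiff_const (c := 2 * Real.pi * lam)).mul h2).sub (contDiff_const (c := c)))
  exact h4.neg.mul (h4.add (contDiff_const.mul h5))

lemma lineDeriv_fourierInv (h : 𝓢(E3, ℂ)) (m : Fin 3) : ∃ k : 𝓢(E3, ℂ),
    ∂_{unitVec m} (𝓕⁻ h) = 𝓕⁻ k ∧ ∀ x, k x = 2 * Real.pi * Complex.I * x m * h x := by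
  refine ⟨_, lineDerivOp_fourierInv_eq h (unitVec m), fun x => ?_⟩
  have ht : (fun x : E3 => inner ℝ x (unitVec m)).HasTemperateGrowth := by fun_prop
  rw [_root_.smul_apply, smulLeftCLM_apply_apply ht]
  simp [unitVec, EuclideanSpace.inner_single_right]
  ring

lemma lapS_fourierInv (h : 𝓢(E3, ℂ)) : ∃ k : 𝓢(E3, ℂ),
    lapS (𝓕⁻ h) = 𝓕⁻ k ∧ ∀ x, k x = -(((2 * Real.pi) ^ 2 * ‖x‖ ^ 2 : ℝ) : ℂ) * h x := by
  choose k1 hk1 hk1' using lineDeriv_fourierInv h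
  choose k2 hk2 hk2' using fun m => lineDeriv_fourierInv (k1 m) m
  refine ⟨k2 0 + k2 1 + k2 2, ?_, fun x => ?_⟩
  · unfold lapS
    simp only [hk1, hk2, Fin.sum_univ_three]
    rw [FourierTransform.fourierInv_add, FourierTransform.fourierInv_add]
  · simp only [_root_.add_apply, hk2', hk1', normSq_eq]
    push_cast
    linear_combination ((2 * Real.pi) ^ 2 * ((x 0 : ℂ) ^ 2 + (x 1 : ℂ) ^ 2 + (x 2 : ℂ) ^ 2) * h x) * Complex.I_sq

lemma opS_fourierInv (c lam : ℝ) (h : 𝓢(E3, ℂ)) : ∃ k : 𝓢(E3, ℂ),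
    opS c lam (𝓕⁻ h) = 𝓕⁻ k ∧ ∀ x, k x = symS c lam x * h x := by
  obtain ⟨k1, h1, h1'⟩ := lapS_fourierInv h
  obtain ⟨k2, h2, h2'⟩ := lineDeriv_fourierInv h 0
  obtain ⟨k3, h3, h3'⟩ := lapS_fourierInv ((-(Complex.I * c)) • h + (-1 : ℂ) • k1 + (lam : ℂ) • k2)
  refine ⟨k3, ?_, fun x => ?_⟩
  · unfold opS
    rw [h1, h2, ← h3, FourierTransform.fourierInv_add, FourierTransform.fourierInv_add,
      FourierTransform.fourierInv_smul, FourierTransform.fourierInv_smul, FourierTransform.fourierInv_smul]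
  · rw [h3']
    simp only [_root_.add_apply, _root_.smul_apply, h1', h2', smul_eq_mul, symS]
    push_cast
    ring

/-! #### Cutoffs -/

/-- A fixed bump function on `ℝ³`. -/
def bumpE : ContDiffBump (0 : E3) := ⟨1, 2, one_pos, one_lt_two⟩

lemma bumpE_contDiff : ContDiff ℝ ∞ (bumpE : E3 → ℝ) := bumpE.contDiff

lemma exists_bound_iteratedFDeriv_bump (i : ℕ) :
    ∃ C : ℝ, 0 ≤ C ∧ ∀ z, ‖iteratedFDeriv ℝ i (fun z => bumpE z - 1) z‖ ≤ C := by
  have hc : Continuous (iteratedFDeriv ℝ i (fun z : E3 => bumpE z - 1)) :=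
    (bumpE_contDiff.sub contDiff_const).continuous_iteratedFDeriv (by exact_mod_cast le_top)
  obtain ⟨C, hC⟩ := (isCompact_closedBall (0 : E3) 2).exists_bound_of_continuousOn hc.continuousOn
  -- Outside the support the function is the constant -1, so order 0 requires the bound 1.
  refine ⟨max C 1, by positivity, fun z => ?_⟩
  by_cases hz : z ∈ Metric.closedBall (0 : E3) 2
  · exact (hC z hz).trans (le_max_left _ _)
  · have he : (fun z : E3 => bumpE z - 1) =ᶠ[𝓝 z] fun _ => (-1 : ℝ) := by
      filter_upwards [Metric.isClosed_closedBall.isOpen_compl.mem_nhds hz] with y hy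
      have : bumpE y = 0 := bumpE.zero_of_le_dist (by
        have : 2 < dist y 0 := by simpa using hy
        exact this.le)
      rw [this]; norm_num
    rw [he.iteratedFDeriv ℝ i |>.self_of_nhds]
    refine le_trans ?_ (le_max_right _ _)
    rcases Nat.eq_zero_or_pos i with rfl | hi
    · rw [norm_iteratedFDeriv_zero]; norm_num
    · rw [iteratedFDeriv_const_of_ne hi.ne']; simp

/-- The truncation of a Schwartz function. -/
def truncS (g : 𝓢(E3, ℂ)) (n : ℕ) : 𝓢(E3, ℂ) :=
  HasCompactSupport.toSchwartzMap (f := fun x => bumpE (((n : ℝ) + 1)⁻¹ • x) • g x)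
    (by
      have h := bumpE.hasCompactSupport.comp_smul (c := ((n : ℝ) + 1)⁻¹) (by positivity)
      exact h.smul_right)
    ((bumpE_contDiff.comp (contDiff_const_smul _)).smul (g.smooth ⊤))

lemma hasCompactSupport_truncS (g : 𝓢(E3, ℂ)) (n : ℕ) : HasCompactSupport (truncS g n) := by
  have h := bumpE.hasCompactSupport.comp_smul (c := ((n : ℝ) + 1)⁻¹) (by positivity)
  exact h.smul_right (f' := fun x => g x)

/-- The cutoff equals 1 for |x| < N, so its deviation from 1 lives where |x|/N ≥ 1. One power of |x|
is traded for the rate 1/N. -/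
lemma norm_iteratedFDeriv_cutoff {i : ℕ} {C : ℝ} (hC0 : 0 ≤ C)
    (hC : ∀ z, ‖iteratedFDeriv ℝ i (fun z => bumpE z - 1) z‖ ≤ C) {N : ℝ} (hN : 1 ≤ N) (x : E3) :
    ‖iteratedFDeriv ℝ i (fun x => bumpE (N⁻¹ • x) - 1) x‖ ≤ C * (N⁻¹ * ‖x‖) := by
  have h0 : 0 < N := by linarith
  have e := iteratedFDeriv_comp_const_smul (𝕜 := ℝ) (i := i) (f := fun z : E3 => bumpE z - 1) N⁻¹
    ((bumpE_contDiff.sub contDiff_const).of_le (by exact_mod_cast le_top))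
  rw [congrFun e x]
  by_cases hx : ‖x‖ < N
  · have hz : (fun z : E3 => bumpE z - 1) =ᶠ[𝓝 (N⁻¹ • x)] fun _ => (0 : ℝ) := by
      have hm : N⁻¹ • x ∈ Metric.ball (0 : E3) 1 := by
        rw [mem_ball_zero_iff, norm_smul, norm_inv, Real.norm_of_nonneg h0.le, inv_mul_lt_iff₀ h0, mul_one]
        exact hx
      filter_upwards [Metric.isOpen_ball.mem_nhds hm] with y hy
      rw [bumpE.one_of_mem_closedBall (Metric.ball_subset_closedBall hy), sub_self]
    rw [hz.iteratedFDeriv ℝ i |>.self_of_nhds]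
    have : iteratedFDeriv ℝ i (fun _ : E3 => (0 : ℝ)) (N⁻¹ • x) = 0 := by
      simp
    rw [this]; simp; positivity
  · push Not at hx
    rw [norm_smul, norm_pow, norm_inv, Real.norm_of_nonneg h0.le]
    have h1 : N⁻¹ ^ i ≤ 1 := pow_le_one₀ (by positivity) (inv_le_one_of_one_le₀ hN)
    have h2 : 1 ≤ N⁻¹ * ‖x‖ := by rw [inv_mul_eq_div, one_le_div h0]; exact hx
    calc N⁻¹ ^ i * ‖iteratedFDeriv ℝ i (fun z => bumpE z - 1) (N⁻¹ • x)‖ ≤ 1 * C := by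
          gcongr; exact hC _
      _ ≤ C * (N⁻¹ * ‖x‖) := by nlinarith

/-- By the Leibniz rule, the power of |x| lost in `norm_iteratedFDeriv_cutoff` is absorbed by
raising the weight of the Schwartz seminorm from k to k + 1, and the factor 1/N remains. -/
lemma tendsto_truncS (g : 𝓢(E3, ℂ)) : Tendsto (truncS g) atTop (𝓝 g) := by
  rw [(schwartz_withSeminorms ℂ E3 ℂ).tendsto_nhds]
  rintro ⟨k, m⟩ ε hε
  choose C hC0 hC using exists_bound_iteratedFDeriv_bump
  set A : ℝ := ∑ i ∈ Finset.range (m + 1), (m.choose i : ℝ) * C i * SchwartzMap.seminorm ℂ (k + 1) (m - i) g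
  have hA : 0 ≤ A := Finset.sum_nonneg fun i _ => by
    have := hC0 i
    positivity
  have hb : ∀ n : ℕ, SchwartzMap.seminorm ℂ k m (truncS g n - g) ≤ ((n : ℝ) + 1)⁻¹ * A := by
    intro n
    set N : ℝ := (n : ℝ) + 1
    have hN : 1 ≤ N := by simp [N]
    refine SchwartzMap.seminorm_le_bound ℂ k m _ (by positivity) fun x => ?_
    have e : ((truncS g n - g : 𝓢(E3, ℂ)) : E3 → ℂ) = fun x => (bumpE (N⁻¹ • x) - 1) • g x := by
      ext x
      simp [truncS, sub_smul, N]
    rw [e]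
    have h1 := norm_iteratedFDeriv_smul_le (𝕜 := ℝ) (N := ∞) (f := fun x : E3 => bumpE (N⁻¹ • x) - 1)
      (g := (g : E3 → ℂ)) ((bumpE_contDiff.comp (contDiff_const_smul _)).sub contDiff_const) (g.smooth ⊤) x
      (n := m) (by exact_mod_cast le_top)
    calc _ ≤ ‖x‖ ^ k * _ := mul_le_mul_of_nonneg_left h1 (by positivity)
      _ ≤ N⁻¹ * A := by
        rw [Finset.mul_sum, Finset.mul_sum]
        refine Finset.sum_le_sum fun i hi => ?_
        have h2 := norm_iteratedFDeriv_cutoff (hC0 i) (hC i) hN x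
        have h3 := SchwartzMap.le_seminorm ℂ (k + 1) (m - i) g x
        calc ‖x‖ ^ k * ((m.choose i : ℝ) * ‖iteratedFDeriv ℝ i (fun x => bumpE (N⁻¹ • x) - 1) x‖ *
              ‖iteratedFDeriv ℝ (m - i) g x‖)
            ≤ ‖x‖ ^ k * ((m.choose i : ℝ) * (C i * (N⁻¹ * ‖x‖)) * ‖iteratedFDeriv ℝ (m - i) g x‖) := by
              gcongr
          _ = N⁻¹ * ((m.choose i : ℝ) * C i * (‖x‖ ^ (k + 1) * ‖iteratedFDeriv ℝ (m - i) g x‖)) := by ring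
          _ ≤ _ := by
              have := hC0 i
              gcongr
  have hlim : Tendsto (fun n : ℕ => ((n : ℝ) + 1)⁻¹ * A) atTop (𝓝 0) := by
    have := (tendsto_one_div_add_atTop_nhds_zero_nat (𝕜 := ℝ)).mul_const A
    simpa using this
  filter_upwards [hlim.eventually (gt_mem_nhds hε)] with n hn
  exact (hb n).trans_lt hn

end Liouville

section Liouville

open SchwartzMap FourierTransform LineDeriv

/-! #### Frequency truncation -/

/-- A real test function as a complex Schwartz function. -/
def testS (χ : E3 → ℝ) (h : IsTestE χ) : 𝓢(E3, ℂ) :=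
  HasCompactSupport.toSchwartzMap (f := fun x => (χ x : ℂ))
    (h.2.comp_left (g := fun s : ℝ => (s : ℂ)) Complex.ofReal_zero) (Complex.ofRealCLM.contDiff.comp h.1)

lemma isTestE_bump : IsTestE (bumpE : E3 → ℝ) := ⟨bumpE_contDiff, bumpE.hasCompactSupport⟩

/-- The Fourier transform of the bump function. -/
def bumpHat : 𝓢(E3, ℂ) := 𝓕 (testS bumpE isTestE_bump)

lemma hasCompactSupport_bump_smul {R : ℝ} (hR : 0 < R) : HasCompactSupport (fun x : E3 => bumpE (R • x)) :=
  bumpE.hasCompactSupport.comp_smul (c := R) hR.ne'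

/-- A frequency truncation of a test function, in Fourier variables. -/
def freqCut (χ : E3 → ℝ) (h : IsTestE χ) {R : ℝ} (hR : 0 < R) : 𝓢(E3, ℂ) :=
  HasCompactSupport.toSchwartzMap (f := fun ξ => (bumpE (R • ξ)) • (𝓕 (testS χ h) : 𝓢(E3, ℂ)) ξ)
    (hasCompactSupport_bump_smul hR).smul_right
    (ContDiff.smul (f := fun ξ : E3 => bumpE (R • ξ)) (bumpE_contDiff.comp (contDiff_const_smul _))
      ((𝓕 (testS χ h) : 𝓢(E3, ℂ)).smooth ⊤))

lemma fourier_modulated_bump {R : ℝ} (hR : 0 < R) (x y : E3) :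
    ∫ v, Complex.exp (((-2 * Real.pi * inner ℝ v y : ℝ) : ℂ) * Complex.I) •
      (Complex.exp (((2 * Real.pi * inner ℝ v x : ℝ) : ℂ) * Complex.I) * ((bumpE (R • v) : ℝ) : ℂ)) =
      ((R ^ 3)⁻¹ : ℝ) • bumpHat (R⁻¹ • (y - x)) := by
  have h := Measure.integral_comp_smul (volume : Measure E3)
    (fun w => Complex.exp (((-2 * Real.pi * inner ℝ w (R⁻¹ • (y - x)) : ℝ) : ℂ) * Complex.I) •
      ((bumpE w : ℝ) : ℂ)) R
  rw [show |(R ^ Module.finrank ℝ E3)⁻¹| = (R ^ 3)⁻¹ by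
    simp only [finrank_euclideanSpace, Fintype.card_fin]
    exact abs_of_pos (by positivity)] at h
  have e : bumpHat (R⁻¹ • (y - x)) =
      ∫ w, Complex.exp (((-2 * Real.pi * inner ℝ w (R⁻¹ • (y - x)) : ℝ) : ℂ) * Complex.I) • ((bumpE w : ℝ) : ℂ) := by
    unfold bumpHat
    rw [SchwartzMap.fourier_coe, Real.fourier_eq']
    rfl
  rw [e, ← h]
  congr 1; ext v
  rw [smul_eq_mul, smul_eq_mul, ← mul_assoc, ← Complex.exp_add]
  congr 2
  rw [inner_smul_left, inner_smul_right, inner_sub_right]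
  have : (R : ℂ) ≠ 0 := by exact_mod_cast hR.ne'
  simp
  field_simp
  ring

/-- The multiplication formula moves the transform from χ to the modulated bump, whose transform is
a rescaled and translated `bumpHat`. The truncation is therefore an averaging of χ at the spatial
scale R. -/
lemma fourierInv_freqCut {χ : E3 → ℝ} (h : IsTestE χ) {R : ℝ} (hR : 0 < R) (x : E3) :
    (𝓕⁻ (freqCut χ h hR)) x = ((R ^ 3)⁻¹ : ℝ) • ∫ y, (χ y : ℂ) * bumpHat (R⁻¹ • (y - x)) := by
  have hc : ContDiff ℝ ∞ (fun v : E3 => Complex.exp (((2 * Real.pi * inner ℝ v x : ℝ) : ℂ) * Complex.I) *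
      ((bumpE (R • v) : ℝ) : ℂ)) := by
    have h3 : ContDiff ℝ ∞ (fun s : ℝ => (s : ℂ)) := Complex.ofRealCLM.contDiff
    have h4 : ContDiff ℝ ∞ (fun v : E3 => 2 * Real.pi * inner ℝ v x) :=
      contDiff_const.mul (contDiff_id.inner ℝ contDiff_const)
    have h5 := h3.comp h4
    have h6 := h3.comp (bumpE_contDiff.comp (contDiff_const_smul (𝕜 := ℝ) R))
    exact ((h5.mul contDiff_const).cexp).mul h6
  have hs : HasCompactSupport (fun v : E3 => Complex.exp (((2 * Real.pi * inner ℝ v x : ℝ) : ℂ) * Complex.I) *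
      ((bumpE (R • v) : ℝ) : ℂ)) :=
    ((hasCompactSupport_bump_smul hR).comp_left (g := fun s : ℝ => (s : ℂ)) Complex.ofReal_zero).mul_left
  have hm := SchwartzMap.integral_fourier_mul_eq (testS χ h) (hs.toSchwartzMap hc)
  rw [SchwartzMap.fourierInv_coe, Real.fourierInv_eq']
  have e1 : ∀ v : E3, Complex.exp (((2 * Real.pi * inner ℝ v x : ℝ) : ℂ) * Complex.I) • (freqCut χ h hR) v =
      (𝓕 (testS χ h)) v * (hs.toSchwartzMap hc) v := by
    intro v
    simp only [freqCut, HasCompactSupport.toSchwartzMap_toFun, smul_eq_mul, Complex.real_smul]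
    ring
  have e2 : ∀ y : E3, (𝓕 (hs.toSchwartzMap hc)) y = ((R ^ 3)⁻¹ : ℝ) • bumpHat (R⁻¹ • (y - x)) := by
    intro y
    rw [SchwartzMap.fourier_coe, Real.fourier_eq', ← fourier_modulated_bump hR x y]
    rfl
  simp_rw [e1]
  rw [hm, ← integral_smul]
  congr 1; ext y
  rw [e2]
  change (χ y : ℂ) * _ = _
  simp only [Complex.real_smul]; ring

lemma fourierInv_freqCut' {χ : E3 → ℝ} (h : IsTestE χ) {R : ℝ} (hR : 0 < R) (x : E3) :
    (𝓕⁻ (freqCut χ h hR)) x = ∫ z, (χ (x + R • z) : ℂ) * bumpHat z := by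
  rw [fourierInv_freqCut]
  have h1 := Measure.integral_comp_smul (volume : Measure E3)
    (fun w => (χ (x + w) : ℂ) * bumpHat (R⁻¹ • w)) R
  rw [show |(R ^ Module.finrank ℝ E3)⁻¹| = (R ^ 3)⁻¹ by
    simp only [finrank_euclideanSpace, Fintype.card_fin]
    exact abs_of_pos (by positivity)] at h1
  have h2 := integral_add_left_eq_self (μ := (volume : Measure E3))
    (fun y => (χ y : ℂ) * bumpHat (R⁻¹ • (y - x))) x
  rw [← h2]
  simp only [add_sub_cancel_left]
  rw [← h1]
  congr 1; ext z
  rw [smul_smul, inv_mul_cancel₀ hR.ne', one_smul]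

lemma integral_bumpHat : ∫ z, bumpHat z = 1 := by
  have h : (𝓕⁻ bumpHat) 0 = (testS bumpE isTestE_bump) 0 := by
    unfold bumpHat; rw [FourierTransform.fourierInv_fourier_eq]
  rw [SchwartzMap.fourierInv_coe, Real.fourierInv_eq'] at h
  have e : (testS bumpE isTestE_bump) 0 = 1 := by
    change ((bumpE 0 : ℝ) : ℂ) = 1
    rw [bumpE.one_of_mem_closedBall (Metric.mem_closedBall_self (by exact zero_le_one))]; simp
  rw [e] at h
  simpa using h

lemma exists_decay_schwartz (g : 𝓢(E3, ℂ)) (k : ℕ) : ∃ C : ℝ, 0 ≤ C ∧ ∀ z, (1 + ‖z‖) ^ k * ‖g z‖ ≤ C := by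
  refine ⟨2 ^ k * (Finset.Iic (k, 0)).sup (fun m => SchwartzMap.seminorm ℂ m.1 m.2) g, by positivity, fun z => ?_⟩
  have := SchwartzMap.one_add_le_sup_seminorm_apply (𝕜 := ℂ) (m := (k, 0)) (k := k) (n := 0) le_rfl le_rfl g z
  simpa using this

lemma exists_ball_tsupport {χ : E3 → ℝ} (h : IsTestE χ) : ∃ B M : ℝ, 0 ≤ B ∧ 0 ≤ M ∧ (∀ x, |χ x| ≤ M) ∧
    ∀ x, χ x ≠ 0 → ‖x‖ ≤ B := by
  obtain ⟨M, hM⟩ := h.2.exists_bound_of_continuous h.1.continuous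
  obtain ⟨B, hB⟩ := h.2.isCompact.isBounded.exists_norm_le
  refine ⟨max B 0, M, le_max_right _ _, (norm_nonneg _).trans (hM 0), hM, fun x hx => ?_⟩
  exact (hB x (subset_tsupport _ hx)).trans (le_max_left _ _)

/-- For y in the support of χ and R ≥ 1 the point y/R stays bounded, so the rapid decay of `bumpHat`
at (y - x)/R is decay in x/R. This is precisely the averaging weight. -/
lemma smooth_bound_large {χ : E3 → ℝ} (h : IsTestE χ) : ∃ C : ℝ≥0, ∀ R : ℝ, ∀ hR : 0 < R, 1 ≤ R → ∀ x,
    ‖(𝓕⁻ (freqCut χ h hR)) x‖ₑ ≤ C * wt R x := by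
  obtain ⟨B, M, hB0, hM0, hM, hB⟩ := exists_ball_tsupport h
  obtain ⟨C, hC0, hC⟩ := exists_decay_schwartz bumpHat 4
  have hint : Integrable (fun y => |χ y|) := h.integrable.abs
  set A : ℝ := (∫ y, |χ y|) * (C * (1 + B) ^ 4) with hA
  have hA0 : 0 ≤ A := by positivity
  refine ⟨A.toNNReal, fun R hR hR1 x => ?_⟩
  have key : ∀ y, ‖(χ y : ℂ) * bumpHat (R⁻¹ • (y - x))‖ ≤ |χ y| * ((C * (1 + B) ^ 4) * ((1 + ‖R⁻¹ • x‖) ^ 4)⁻¹) := by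
    intro y
    rw [norm_mul, Complex.norm_real, Real.norm_eq_abs]
    by_cases hy : χ y = 0
    · simp [hy]
    gcongr
    have hyB := hB y hy
    have h1 := hC (R⁻¹ • (y - x))
    have h2 : 1 + ‖R⁻¹ • x‖ ≤ (1 + B) * (1 + ‖R⁻¹ • (y - x)‖) := by
      have e : R⁻¹ • x = R⁻¹ • y - R⁻¹ • (y - x) := by rw [← smul_sub]; congr 1; abel
      have h3 : ‖R⁻¹ • x‖ ≤ ‖R⁻¹ • y‖ + ‖R⁻¹ • (y - x)‖ := by
        rw [e]; exact norm_sub_le _ _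
      have h4 : ‖R⁻¹ • y‖ ≤ B := by
        rw [norm_smul, norm_inv, Real.norm_of_nonneg hR.le]
        calc R⁻¹ * ‖y‖ ≤ 1 * ‖y‖ := by gcongr; exact inv_le_one_of_one_le₀ hR1
          _ ≤ B := by linarith
      nlinarith [norm_nonneg (R⁻¹ • (y - x))]
    have h5 : (1 + ‖R⁻¹ • x‖) ^ 4 ≤ (1 + B) ^ 4 * (1 + ‖R⁻¹ • (y - x)‖) ^ 4 := by
      rw [← mul_pow]; gcongr
    rw [le_mul_inv_iff₀ (by positivity)]
    calc ‖bumpHat (R⁻¹ • (y - x))‖ * (1 + ‖R⁻¹ • x‖) ^ 4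
        ≤ ‖bumpHat (R⁻¹ • (y - x))‖ * ((1 + B) ^ 4 * (1 + ‖R⁻¹ • (y - x)‖) ^ 4) := by gcongr
      _ = (1 + B) ^ 4 * ((1 + ‖R⁻¹ • (y - x)‖) ^ 4 * ‖bumpHat (R⁻¹ • (y - x))‖) := by ring
      _ ≤ (1 + B) ^ 4 * C := by gcongr
      _ = _ := by ring
  have h1 : ‖(𝓕⁻ (freqCut χ h hR)) x‖ ≤ A * ((R ^ 3)⁻¹ * ((1 + ‖R⁻¹ • x‖) ^ 4)⁻¹) := by
    rw [fourierInv_freqCut, norm_smul, Real.norm_of_nonneg (by positivity)]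
    calc (R ^ 3)⁻¹ * ‖∫ y, (χ y : ℂ) * bumpHat (R⁻¹ • (y - x))‖
        ≤ (R ^ 3)⁻¹ * ∫ y, |χ y| * ((C * (1 + B) ^ 4) * ((1 + ‖R⁻¹ • x‖) ^ 4)⁻¹) := by
          gcongr
          exact norm_integral_le_of_norm_le (hint.mul_const _) (Eventually.of_forall key)
      _ = _ := by rw [integral_mul_const, hA]; ring
  rw [wt, ← ofReal_norm, ← ENNReal.ofReal_coe_nnreal, ← ENNReal.ofReal_mul (by simp), Real.coe_toNNReal _ hA0]
  refine ENNReal.ofReal_le_ofReal (h1.trans (le_of_eq ?_))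
  rw [show (-4 : ℝ) = -((4 : ℕ) : ℝ) by norm_num, Real.rpow_neg (by positivity), Real.rpow_natCast]

/-- Of the eight powers of decay of `bumpHat`, four make the integral over z converge and four are
exchanged for decay in x, since x + Rz lies in the support of χ and R ≤ 1. The bound is uniform in R
and serves as a majorant. -/
lemma smooth_bound_small {χ : E3 → ℝ} (h : IsTestE χ) : ∃ C : ℝ, 0 ≤ C ∧ ∀ R : ℝ, ∀ hR : 0 < R, R ≤ 1 → ∀ x,
    ‖(𝓕⁻ (freqCut χ h hR)) x‖ ≤ C * ((1 + ‖x‖) ^ 4)⁻¹ := by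
  obtain ⟨B, M, hB0, hM0, hM, hB⟩ := exists_ball_tsupport h
  obtain ⟨C, hC0, hC⟩ := exists_decay_schwartz bumpHat 8
  have hint : Integrable (fun z : E3 => ((1 + ‖z‖ ^ 2) ^ 2)⁻¹) := integrable_space_bound
  refine ⟨(∫ z : E3, ((1 + ‖z‖ ^ 2) ^ 2)⁻¹) * (M * C * (1 + B) ^ 4), by positivity, fun R hR hR1 x => ?_⟩
  rw [fourierInv_freqCut', mul_assoc, ← integral_mul_const]
  refine norm_integral_le_of_norm_le (hint.mul_const _) (Eventually.of_forall fun z => ?_)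
  rw [norm_mul, Complex.norm_real, Real.norm_eq_abs]
  by_cases hy : χ (x + R • z) = 0
  · rw [hy]; simp; positivity
  have hyB := hB _ hy
  have h1 := hC z
  have hz : ‖R • z‖ ≤ ‖z‖ := by
    rw [norm_smul, Real.norm_of_nonneg hR.le]
    exact mul_le_of_le_one_left (norm_nonneg _) hR1
  have h2 : 1 + ‖x‖ ≤ (1 + B) * (1 + ‖z‖) := by
    have h3 : ‖x‖ ≤ ‖x + R • z‖ + ‖R • z‖ := by
      calc ‖x‖ = ‖(x + R • z) - R • z‖ := by rw [add_sub_cancel_right]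
        _ ≤ _ := norm_sub_le _ _
    nlinarith [norm_nonneg z]
  have h5 : (1 + ‖x‖) ^ 4 ≤ (1 + B) ^ 4 * (1 + ‖z‖) ^ 4 := by rw [← mul_pow]; gcongr
  have h6 : (1 + ‖z‖ ^ 2) ^ 2 ≤ (1 + ‖z‖) ^ 4 := by
    rw [show (1 + ‖z‖) ^ 4 = ((1 + ‖z‖) ^ 2) ^ 2 by ring]
    gcongr
    nlinarith [norm_nonneg z]
  have h7 : ‖bumpHat z‖ * ((1 + ‖z‖ ^ 2) ^ 2 * (1 + ‖x‖) ^ 4) ≤ C * (1 + B) ^ 4 := by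
    calc ‖bumpHat z‖ * ((1 + ‖z‖ ^ 2) ^ 2 * (1 + ‖x‖) ^ 4)
        ≤ ‖bumpHat z‖ * ((1 + ‖z‖) ^ 4 * ((1 + B) ^ 4 * (1 + ‖z‖) ^ 4)) := by gcongr
      _ = ((1 + ‖z‖) ^ 8 * ‖bumpHat z‖) * (1 + B) ^ 4 := by ring
      _ ≤ _ := by gcongr
  calc |χ (x + R • z)| * ‖bumpHat z‖ ≤ M * (C * (1 + B) ^ 4 * ((1 + ‖z‖ ^ 2) ^ 2 * (1 + ‖x‖) ^ 4)⁻¹) := by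
        refine mul_le_mul (hM _) ?_ (norm_nonneg _) hM0
        rw [le_mul_inv_iff₀ (by positivity)]; exact h7
    _ = _ := by rw [mul_inv]; ring

/-- As R → 0 the truncation is an approximate identity: `bumpHat` has integral 1 because the bump
equals 1 at the origin. -/
lemma tendsto_smooth {χ : E3 → ℝ} (h : IsTestE χ) (x : E3) :
    Tendsto (fun n : ℕ => (𝓕⁻ (freqCut χ h (R := ((n : ℝ) + 1)⁻¹) (by positivity))) x) atTop (𝓝 (χ x : ℂ)) := by
  simp_rw [fourierInv_freqCut']
  obtain ⟨B, M, hB0, hM0, hM, hB⟩ := exists_ball_tsupport h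
  have h1 : (χ x : ℂ) = ∫ z, (χ x : ℂ) * bumpHat z := by rw [integral_const_mul, integral_bumpHat, mul_one]
  rw [h1]
  have hc := h.1.continuous
  have hi : Integrable bumpHat := bumpHat.integrable
  have hr : Tendsto (fun n : ℕ => ((n : ℝ) + 1)⁻¹) atTop (𝓝 0) := by
    simpa using tendsto_one_div_add_atTop_nhds_zero_nat (𝕜 := ℝ)
  refine tendsto_integral_of_dominated_convergence (fun z => M * ‖bumpHat z‖) (fun n => ?_)
    (hi.norm.const_mul M) (fun n => Eventually.of_forall fun z => ?_) (Eventually.of_forall fun z => ?_)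
  · have : Continuous fun z : E3 => (χ (x + ((n : ℝ) + 1)⁻¹ • z) : ℂ) * bumpHat z := by
      have := bumpHat.continuous
      fun_prop
    exact this.aestronglyMeasurable
  · rw [norm_mul, Complex.norm_real]
    gcongr
    exact hM _
  · have h2 : Tendsto (fun n : ℕ => x + ((n : ℝ) + 1)⁻¹ • z) atTop (𝓝 (x + (0 : ℝ) • z)) :=
      (hr.smul_const z).const_add x
    rw [zero_smul, add_zero] at h2
    have h3 : Tendsto (fun n : ℕ => (χ (x + ((n : ℝ) + 1)⁻¹ • z) : ℂ)) atTop (𝓝 (χ x : ℂ)) :=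
      (Complex.continuous_ofReal.tendsto _).comp ((hc.tendsto x).comp h2)
    exact h3.mul_const _

end Liouville

/-! ### Pairing with Schwartz functions and the Liouville theorem. -/

section Liouville

open SchwartzMap FourierTransform LineDeriv

/-- Finiteness of the average at a single scale R ≥ 1 is enough, since R³ `wt R` dominates (1 +
|x|)^{-4}. Hence d defines a tempered distribution. -/
lemma integrable_weight_of_vanishAvg {d : E3 → ℂ} (hd : AEStronglyMeasurable d volume)
    (hv : VanishAvg fun x => ‖d x‖ₑ) : Integrable (fun x => ‖d x‖ * ((1 + ‖x‖) ^ 4)⁻¹) := by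
  obtain ⟨R, hR1, hR⟩ := ((eventually_ge_atTop (1 : ℝ)).and
    (hv.eventually (gt_mem_nhds (show (0 : ℝ≥0∞) < 1 by simp)))).exists
  have hR0 : 0 < R := by linarith
  have hm : Measurable fun x : E3 => ((1 + ‖x‖) ^ 4)⁻¹ := by fun_prop
  refine ⟨hd.norm.mul hm.aestronglyMeasurable, ?_⟩
  rw [hasFiniteIntegral_iff_enorm]
  calc _ ≤ ∫⁻ x, ENNReal.ofReal (R ^ 3) * (wt R x * ‖d x‖ₑ) := by
        refine lintegral_mono fun x => ?_
        rw [enorm_mul, enorm_norm, ← mul_assoc, mul_comm]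
        gcongr
        rw [wt, ← ENNReal.ofReal_mul (by positivity), ← ofReal_norm, Real.norm_of_nonneg (by positivity)]
        refine ENNReal.ofReal_le_ofReal ?_
        rw [← mul_assoc, mul_inv_cancel₀ (by positivity), one_mul,
          show (-4 : ℝ) = -((4 : ℕ) : ℝ) by norm_num, Real.rpow_neg (by positivity), Real.rpow_natCast]
        refine inv_anti₀ (by positivity) ?_
        gcongr
        rw [norm_smul, norm_inv, Real.norm_of_nonneg hR0.le]
        exact mul_le_of_le_one_left (norm_nonneg _) (inv_le_one_of_one_le₀ hR1)
    _ < ⊤ := by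
        rw [lintegral_const_mul' _ _ ENNReal.ofReal_ne_top]
        exact ENNReal.mul_lt_top ENNReal.ofReal_lt_top (hR.trans_le le_top)

lemma integrable_mul_schwartz {d : E3 → ℂ} (hd : AEStronglyMeasurable d volume)
    (hv : VanishAvg fun x => ‖d x‖ₑ) (g : 𝓢(E3, ℂ)) : Integrable (fun x => d x * g x) := by
  obtain ⟨C, hC0, hC⟩ := exists_decay_schwartz g 4
  refine ((integrable_weight_of_vanishAvg hd hv).mul_const C).mono'
    (hd.mul g.continuous.aestronglyMeasurable) (Eventually.of_forall fun x => ?_)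
  rw [norm_mul, mul_assoc]
  gcongr
  rw [inv_mul_eq_div, le_div_iff₀ (by positivity), mul_comm]
  exact hC x

/-- Integration against a function with vanishing averages. -/
def pairS {d : E3 → ℂ} (hd : AEStronglyMeasurable d volume) (hv : VanishAvg fun x => ‖d x‖ₑ) :
    𝓢(E3, ℂ) →L[ℂ] ℂ :=
  SchwartzMap.mkCLMtoNormedSpace (σ := RingHom.id ℂ) (fun g => ∫ x, d x * g x)
    (fun f g => by
      rw [← integral_add (integrable_mul_schwartz hd hv f) (integrable_mul_schwartz hd hv g)]
      congr 1; ext x; simp [mul_add])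
    (fun a f => by
      rw [RingHom.id_apply, smul_eq_mul, ← integral_const_mul]
      congr 1; ext x; simp only [_root_.smul_apply, smul_eq_mul]; ring)
    ⟨Finset.Iic (4, 0), (∫ x, ‖d x‖ * ((1 + ‖x‖) ^ 4)⁻¹) * 2 ^ 4, by positivity, fun f => by
      rw [mul_assoc, ← integral_mul_const]
      refine norm_integral_le_of_norm_le ((integrable_weight_of_vanishAvg hd hv).mul_const _)
        (Eventually.of_forall fun x => ?_)
      have := SchwartzMap.one_add_le_sup_seminorm_apply (𝕜 := ℂ) (m := (4, 0)) (k := 4) (n := 0) le_rfl le_rfl f x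
      rw [norm_iteratedFDeriv_zero] at this
      rw [norm_mul, mul_assoc]
      gcongr
      rw [inv_mul_eq_div, le_div_iff₀ (by positivity), mul_comm]
      exact this⟩

lemma pairS_apply {d : E3 → ℂ} (hd : AEStronglyMeasurable d volume) (hv : VanishAvg fun x => ‖d x‖ₑ)
    (g : 𝓢(E3, ℂ)) : pairS hd hv g = ∫ x, d x * g x := rfl

/-- The equation is known on compactly supported functions; these are dense, and both the operator
and the pairing are continuous on Schwartz space. -/
lemma pairS_opS_eq_zero {d : E3 → ℂ} (hd : AEStronglyMeasurable d volume) (hv : VanishAvg fun x => ‖d x‖ₑ)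
    {c lam : ℝ} (H : ∀ g : 𝓢(E3, ℂ), HasCompactSupport g → ∫ x, d x * opS c lam g x = 0) (g : 𝓢(E3, ℂ)) :
    pairS hd hv (opS c lam g) = 0 := by
  have h1 : Tendsto (fun n => pairS hd hv (opS c lam (truncS g n))) atTop (𝓝 (pairS hd hv (opS c lam g))) :=
    ((pairS hd hv).continuous.tendsto _).comp (((continuous_opS c lam).tendsto _).comp (tendsto_truncS g))
  have h2 : ∀ n, pairS hd hv (opS c lam (truncS g n)) = 0 := fun n => H _ (hasCompactSupport_truncS g n)
  simp_rw [h2] at h1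
  exact (tendsto_nhds_unique h1 tendsto_const_nhds)

/-- The difference of two frequency truncations vanishes near ξ = 0, because both bumps equal 1
there. It can be divided by the symbol, so its inverse transform lies in the range of `opS`, where
the pairing is zero. -/
lemma pairS_annulus_eq_zero {d : E3 → ℂ} (hd : AEStronglyMeasurable d volume) (hv : VanishAvg fun x => ‖d x‖ₑ)
    {c lam : ℝ} (H : ∀ g : 𝓢(E3, ℂ), HasCompactSupport g → ∫ x, d x * opS c lam g x = 0)
    {χ : E3 → ℝ} (h : IsTestE χ) {ε R : ℝ} (hε : 0 < ε) (hR : 0 < R) :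
    pairS hd hv (𝓕⁻ (freqCut χ h hε)) = pairS hd hv (𝓕⁻ (freqCut χ h hR)) := by
  set b : E3 → ℂ := fun ξ => freqCut χ h hε ξ - freqCut χ h hR ξ with hb
  have hbc : ContDiff ℝ ∞ b := (smooth (freqCut χ h hε) ⊤).sub (smooth (freqCut χ h hR) ⊤)
  have hbs : HasCompactSupport b := by
    have h1 : HasCompactSupport (freqCut χ h hε) := (hasCompactSupport_bump_smul hε).smul_right
    have h2 : HasCompactSupport (freqCut χ h hR) := (hasCompactSupport_bump_smul hR).smul_right
    exact h1.sub h2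
  have hb0 : b =ᶠ[𝓝 0] fun _ => 0 := by
    have hone : ∀ r : ℝ, 0 < r → ∀ᶠ ξ : E3 in 𝓝 0, bumpE (r • ξ) = 1 := fun r hr => by
      have h1 : Tendsto (fun ξ : E3 => r • ξ) (𝓝 0) (𝓝 (r • 0)) := (continuous_const_smul r).tendsto 0
      rw [smul_zero] at h1
      exact h1.eventually bumpE.eventuallyEq_one
    filter_upwards [hone ε hε, hone R hR] with ξ h1 h2
    change bumpE (ε • ξ) • _ - bumpE (R • ξ) • _ = (0 : ℂ)
    rw [h1, h2, sub_self]
  have hqc : ContDiff ℝ ∞ (fun ξ => b ξ * (symS c lam ξ)⁻¹) := by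
    rw [contDiff_iff_contDiffAt]
    intro ξ
    by_cases hξ : ξ = 0
    · subst hξ
      have : (fun ξ => b ξ * (symS c lam ξ)⁻¹) =ᶠ[𝓝 0] fun _ => 0 := hb0.mono fun ξ h => by simp [h]
      exact contDiffAt_const.congr_of_eventuallyEq this
    · exact hbc.contDiffAt.mul ((contDiff_symS c lam).contDiffAt.inv (symS_ne_zero hξ))
  have hqs : HasCompactSupport (fun ξ => b ξ * (symS c lam ξ)⁻¹) := hbs.mul_right
  obtain ⟨k, hk, hk'⟩ := opS_fourierInv c lam (hqs.toSchwartzMap hqc)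
  have hkb : k = freqCut χ h hε - freqCut χ h hR := by
    ext ξ
    rw [hk']
    change symS c lam ξ * (b ξ * (symS c lam ξ)⁻¹) = b ξ
    by_cases hξ : ξ = 0
    · subst hξ; rw [hb0.self_of_nhds]; simp
    · have := symS_ne_zero (c := c) (lam := lam) hξ
      field_simp
  have h0 := pairS_opS_eq_zero hd hv H (𝓕⁻ (hqs.toSchwartzMap hqc))
  rw [hk, hkb] at h0
  have e : (𝓕⁻ (freqCut χ h hε - freqCut χ h hR) : 𝓢(E3, ℂ)) = 𝓕⁻ (freqCut χ h hε) - 𝓕⁻ (freqCut χ h hR) :=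
    (fourierInvCLM ℂ 𝓢(E3, ℂ)).map_sub _ _
  rw [e, map_sub, sub_eq_zero] at h0
  exact h0

/-- The pairing of d with the truncation of χ is the same at every scale R. As R → ∞ it is bounded
by weighted averages of d and tends to 0, so it is 0 throughout; as R → 0 it tends to the integral
of d against χ. -/
theorem liouville {d : E3 → ℂ} (hd : LocallyIntegrable d) (hv : VanishAvg fun x => ‖d x‖ₑ) (c lam : ℝ)
    (H : ∀ g : 𝓢(E3, ℂ), HasCompactSupport g → ∫ x, d x * opS c lam g x = 0) : d =ᵐ[volume] 0 := by
  have hm := hd.aestronglyMeasurable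
  refine ae_eq_zero_of_integral_contDiff_smul_eq_zero hd fun χ h1 h2 => ?_
  have h : IsTestE χ := ⟨h1, h2⟩
  have hzero : ∀ R : ℝ, ∀ hR : 0 < R, pairS hm hv (𝓕⁻ (freqCut χ h hR)) = 0 := by
    intro R₀ hR₀
    obtain ⟨C, hC⟩ := smooth_bound_large h
    have hlim : Tendsto (fun R : ℝ => C * ∫⁻ x, wt R x * ‖d x‖ₑ) atTop (𝓝 0) := by
      have := ENNReal.Tendsto.const_mul hv (a := C) (Or.inr ENNReal.coe_ne_top)
      rwa [mul_zero] at this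
    have hle : ∀ᶠ R : ℝ in atTop, ‖pairS hm hv (𝓕⁻ (freqCut χ h hR₀))‖ₑ ≤ C * ∫⁻ x, wt R x * ‖d x‖ₑ := by
      filter_upwards [eventually_ge_atTop (1 : ℝ)] with R hR
      have hR0 : 0 < R := by linarith
      -- The fixed scale is replaced by the running one, where the averaging bound is available.
      rw [pairS_annulus_eq_zero hm hv H h hR₀ hR0, pairS_apply]
      refine (enorm_integral_le_lintegral_enorm _).trans ?_
      rw [← lintegral_const_mul' _ _ ENNReal.coe_ne_top]
      refine lintegral_mono fun x => ?_
      rw [enorm_mul, mul_comm, ← mul_assoc]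
      gcongr
      exact hC R hR0 hR x
    have := le_of_tendsto_of_tendsto tendsto_const_nhds hlim hle
    simpa using this
  obtain ⟨C, hC0, hC⟩ := smooth_bound_small h
  have hlim : Tendsto (fun n : ℕ => pairS hm hv (𝓕⁻ (freqCut χ h (R := ((n : ℝ) + 1)⁻¹) (by positivity)))) atTop
      (𝓝 (∫ x, d x * (χ x : ℂ))) := by
    refine tendsto_integral_of_dominated_convergence (fun x => (‖d x‖ * ((1 + ‖x‖) ^ 4)⁻¹) * C) (fun n => ?_)
      ((integrable_weight_of_vanishAvg hm hv).mul_const C) (fun n => Eventually.of_forall fun x => ?_)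
      (Eventually.of_forall fun x => (tendsto_smooth h x).const_mul (d x))
    · exact hm.mul (SchwartzMap.continuous _).aestronglyMeasurable
    · rw [norm_mul, mul_assoc]
      gcongr
      rw [mul_comm]
      exact hC _ _ (inv_le_one_of_one_le₀ (by simp)) x
  simp_rw [hzero] at hlim
  rw [← tendsto_nhds_unique hlim tendsto_const_nhds]
  congr 1; ext x
  rw [Complex.real_smul, mul_comm]

/-! #### Complexification -/

/-- The Laplacian on `ℝ³`. -/
def lapE (χ : E3 → ℝ) (x : E3) : ℝ := ∑ m, pd m (pd m χ) x

/-- The operator `-Δ + lam ∂₁` on `ℝ³`. -/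
def driftE (lam : ℝ) (χ : E3 → ℝ) (x : E3) : ℝ := -lapE χ x + lam * pd 0 χ x

lemma IsTestE.add {φ ψ : E3 → ℝ} (h : IsTestE φ) (h' : IsTestE ψ) : IsTestE (fun x => φ x + ψ x) :=
  ⟨h.1.add h'.1, h.2.add h'.2⟩

lemma IsTestE.const_mul {φ : E3 → ℝ} (h : IsTestE φ) (c : ℝ) : IsTestE (fun x => c * φ x) :=
  ⟨contDiff_const.mul h.1, h.2.mul_left⟩

lemma IsTestE.lapE {χ : E3 → ℝ} (h : IsTestE χ) : IsTestE (lapE χ) := by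
  have e : TPNS.lapE χ = fun x => (TPNS.pd 0 (TPNS.pd 0 χ) x + TPNS.pd 1 (TPNS.pd 1 χ) x) + TPNS.pd 2 (TPNS.pd 2 χ) x := by
    ext x; simp [TPNS.lapE, Fin.sum_univ_three]
  rw [e]
  exact (((h.pd 0).pd 0).add ((h.pd 1).pd 1)).add ((h.pd 2).pd 2)

lemma IsTestE.driftE {χ : E3 → ℝ} (h : IsTestE χ) (lam : ℝ) : IsTestE (driftE lam χ) := by
  have := (h.lapE.const_mul (-1)).add ((h.pd 0).const_mul lam)
  have e : TPNS.driftE lam χ = fun x => -1 * TPNS.lapE χ x + lam * TPNS.pd 0 χ x := by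
    ext x; simp [TPNS.driftE]
  rw [e]; exact this

lemma pd_add {φ ψ : E3 → ℝ} (h : IsTestE φ) (h' : IsTestE ψ) (j : Fin 3) :
    pd j (fun x => φ x + ψ x) = fun x => pd j φ x + pd j ψ x := by
  ext x
  have h1 := (h.1.differentiable (by simp)) x
  have h2 := (h'.1.differentiable (by simp)) x
  simp only [pd]
  rw [fderiv_fun_add h1 h2]; rfl

lemma pd_const_mul {φ : E3 → ℝ} (h : IsTestE φ) (c : ℝ) (j : Fin 3) :
    pd j (fun x => c * φ x) = fun x => c * pd j φ x := by
  ext x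
  have h1 := (h.1.differentiable (by simp)) x
  simp only [pd]
  rw [fderiv_const_mul h1]; rfl

lemma lapE_add {φ ψ : E3 → ℝ} (h : IsTestE φ) (h' : IsTestE ψ) (x : E3) :
    lapE (fun x => φ x + ψ x) x = lapE φ x + lapE ψ x := by
  simp only [lapE]
  rw [← Finset.sum_add_distrib]
  refine Finset.sum_congr rfl fun m _ => ?_
  rw [pd_add h h', pd_add (h.pd m) (h'.pd m)]

lemma lapE_const_mul {φ : E3 → ℝ} (h : IsTestE φ) (c : ℝ) (x : E3) :
    lapE (fun x => c * φ x) x = c * lapE φ x := by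
  simp only [lapE]
  rw [Finset.mul_sum]
  refine Finset.sum_congr rfl fun m _ => ?_
  rw [pd_const_mul h, pd_const_mul (h.pd m)]

lemma lineDeriv_complex {g : 𝓢(E3, ℂ)} {g1 g2 : E3 → ℝ} (h1 : IsTestE g1) (h2 : IsTestE g2)
    (h : ∀ x, g x = g1 x + Complex.I * g2 x) (m : Fin 3) (x : E3) :
    (∂_{unitVec m} g) x = pd m g1 x + Complex.I * pd m g2 x := by
  rw [lineDerivOp_apply_eq_fderiv]
  have d1 := ((h1.1.differentiable (by simp)) x).hasFDerivAt
  have d2 := ((h2.1.differentiable (by simp)) x).hasFDerivAt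
  have e1 := Complex.ofRealCLM.hasFDerivAt.comp x d1
  have e2 := (Complex.ofRealCLM.hasFDerivAt.comp x d2).const_mul Complex.I
  have e3 := e1.add e2
  have e4 : HasFDerivAt (g : E3 → ℂ) _ x := e3.congr_of_eventuallyEq (Eventually.of_forall fun y => h y)
  rw [e4.fderiv]
  simp [pd]

lemma lapS_complex {g : 𝓢(E3, ℂ)} {g1 g2 : E3 → ℝ} (h1 : IsTestE g1) (h2 : IsTestE g2)
    (h : ∀ x, g x = g1 x + Complex.I * g2 x) (x : E3) :
    lapS g x = lapE g1 x + Complex.I * lapE g2 x := by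
  have e := fun m => lineDeriv_complex (h1.pd m) (h2.pd m) (lineDeriv_complex h1 h2 h m) m x
  unfold lapS lapE
  rw [Fin.sum_univ_three, Fin.sum_univ_three, Fin.sum_univ_three, _root_.add_apply, _root_.add_apply, e, e, e]
  push_cast
  ring

/-- Real test functions are what the weak formulations offer, whereas the oscillating modes need a
complex operator. The term -ic couples real and imaginary part. -/
lemma opS_complex {g : 𝓢(E3, ℂ)} {g1 g2 : E3 → ℝ} (h1 : IsTestE g1) (h2 : IsTestE g2)
    (h : ∀ x, g x = g1 x + Complex.I * g2 x) (c lam : ℝ) (x : E3) :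
    opS c lam g x = ((c * lapE g2 x + lapE (driftE lam g1) x : ℝ) : ℂ) +
      Complex.I * ((-c * lapE g1 x + lapE (driftE lam g2) x : ℝ) : ℂ) := by
  unfold opS
  rw [lapS_complex ((h2.const_mul c).add (h1.driftE lam)) ((h1.const_mul (-c)).add (h2.driftE lam)),
    lapE_add (h2.const_mul c) (h1.driftE lam), lapE_add (h1.const_mul (-c)) (h2.driftE lam), lapE_const_mul h2,
    lapE_const_mul h1]
  intro y
  simp only [_root_.add_apply, _root_.smul_apply, smul_eq_mul, h y, lapS_complex h1 h2 h y,
    lineDeriv_complex h1 h2 h 0 y, driftE]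
  push_cast
  linear_combination (-(c : ℂ) * g2 y) * Complex.I_sq

lemma schwartz_parts {g : 𝓢(E3, ℂ)} (hg : HasCompactSupport g) : ∃ g1 g2 : E3 → ℝ, IsTestE g1 ∧ IsTestE g2 ∧
    ∀ x, g x = g1 x + Complex.I * g2 x := by
  refine ⟨fun x => (g x).re, fun x => (g x).im, ⟨Complex.reCLM.contDiff.comp (g.smooth ⊤),
    hg.comp_left (g := Complex.re) rfl⟩, ⟨Complex.imCLM.contDiff.comp (g.smooth ⊤),
    hg.comp_left (g := Complex.im) rfl⟩, fun x => ?_⟩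
  rw [mul_comm]; exact (Complex.re_add_im _).symm

lemma locallyIntegrable_ofReal {d : E3 → ℝ} (hd : LocallyIntegrable d) :
    LocallyIntegrable (fun x => (d x : ℂ)) := fun x =>
  let ⟨s, hs, h⟩ := hd x
  ⟨s, hs, Integrable.ofReal h⟩

/-- The steady Liouville theorem. -/
theorem liouvilleE {d : E3 → ℝ} (hd : LocallyIntegrable d) (hv : VanishAvg fun x => ‖d x‖ₑ) (lam : ℝ)
    (H : ∀ χ, IsTestE χ → ∫ x, d x * lapE (driftE lam χ) x = 0) : d =ᵐ[volume] 0 := by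
  have hdc := locallyIntegrable_ofReal hd
  have hen : ∀ x, ‖(d x : ℂ)‖ₑ = ‖d x‖ₑ := fun x => by simp [← ofReal_norm]
  have := liouville hdc (by simpa only [hen] using hv) 0 lam fun g hg => by
    obtain ⟨g1, g2, h1, h2, h⟩ := schwartz_parts hg
    have i : ∀ {χ : E3 → ℝ}, IsTestE χ → Integrable (fun x => d x * lapE (driftE lam χ) x) := fun hχ =>
      LocallyIntegrable.mul_test hd (hχ.driftE lam).lapE.1.continuous (hχ.driftE lam).lapE.2
    have e : ∀ x, (d x : ℂ) * opS 0 lam g x = ((d x * lapE (driftE lam g1) x : ℝ) : ℂ) +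
        Complex.I * ((d x * lapE (driftE lam g2) x : ℝ) : ℂ) := by
      intro x
      rw [opS_complex h1 h2 h]; push_cast; ring
    simp_rw [e]
    rw [integral_add (i h1).ofReal ((i h2).ofReal.const_mul _), integral_const_mul, integral_complex_ofReal,
      integral_complex_ofReal, H g1 h1, H g2 h2]
    simp
  exact this.mono fun x hx => by simpa using hx

end Liouville

/-! ### Uniqueness for the linear problem on `G` -/

section LiouvilleG

variable {T : ℝ} [hT : Fact (0 < T)] {lam : ℝ}

lemma pdt_modes (k : ℤ) (χ : E3 → ℝ) (p : G T) :
    pdt (fun q : G T => cosMode k q.1 * χ q.2) p = -(2 * Real.pi / T * k) * (sinMode k p.1 * χ p.2) ∧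
    pdt (fun q : G T => sinMode k q.1 * χ q.2) p = (2 * Real.pi / T * k) * (cosMode k p.1 * χ p.2) := by
  have hT0 : (T : ℂ) ≠ 0 := by exact_mod_cast hT.out.ne'
  have hd : HasDerivAt (fun s : ℝ => (fourier k (p.1 + (s : AddCircle T)) : ℂ))
      (Complex.I * ((2 * Real.pi / T * k : ℝ) : ℂ) * fourier k p.1) 0 := by
    have e : (fun s : ℝ => (fourier k (p.1 + (s : AddCircle T)) : ℂ)) =
        fun s : ℝ => (fourier k p.1 : ℂ) * Complex.exp (Complex.I * ((2 * Real.pi / T * k : ℝ) : ℂ) * s) := by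
      ext s
      have h1 : (fourier k (p.1 + (s : AddCircle T)) : ℂ) = fourier k p.1 * fourier k (s : AddCircle T) := by
        simp [fourier_apply, smul_add, AddCircle.toCircle_add]
      rw [h1, fourier_coe_apply]
      congr 2
      push_cast; ring
    rw [e]
    have h2 : HasDerivAt (fun s : ℝ => Complex.I * ((2 * Real.pi / T * k : ℝ) : ℂ) * (s : ℂ))
        (Complex.I * ((2 * Real.pi / T * k : ℝ) : ℂ) * 1) 0 :=
      (Complex.ofRealCLM.hasDerivAt (x := (0 : ℝ))).const_mul _
    have h3 := (h2.cexp).const_mul (fourier k p.1 : ℂ)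
    refine HasDerivAt.congr_deriv h3 ?_
    rw [Complex.ofReal_zero, mul_zero, Complex.exp_zero]; ring
  constructor
  · have h1 : HasDerivAt (fun s : ℝ => cosMode k (p.1 + (s : AddCircle T))) _ 0 :=
      Complex.reCLM.hasFDerivAt.comp_hasDerivAt (0 : ℝ) hd
    have h2 := (h1.mul_const (χ p.2)).deriv
    unfold pdt
    rw [h2]
    simp [sinMode]
    ring
  · have h1 : HasDerivAt (fun s : ℝ => sinMode k (p.1 + (s : AddCircle T))) _ 0 :=
      Complex.imCLM.hasFDerivAt.comp_hasDerivAt (0 : ℝ) hd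
    have h2 := (h1.mul_const (χ p.2)).deriv
    unfold pdt
    rw [h2]
    simp [cosMode]
    ring

lemma lapG_mul_fst (θ : AddCircle T → ℝ) {χ : E3 → ℝ} (h : IsTestE χ) (p : G T) :
    lapG (fun q : G T => θ q.1 * χ q.2) p = θ p.1 * lapE χ p.2 := by
  unfold lapG lapE
  rw [Finset.mul_sum]
  refine Finset.sum_congr rfl fun m _ => ?_
  rw [pdx_mul_fst θ (h.1.differentiable (by simp)), pdx_mul_fst θ ((h.pd m).1.differentiable (by simp))]

lemma lapG_add {φ ψ : G T → ℝ} (h : IsTestG T φ) (h' : IsTestG T ψ) (p : G T) :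
    lapG (fun q => φ q + ψ q) p = lapG φ p + lapG ψ p := by
  unfold lapG
  rw [← Finset.sum_add_distrib]
  refine Finset.sum_congr rfl fun m _ => ?_
  rw [pdx_add h h', pdx_add (h.pdx m) (h'.pdx m)]

lemma lapG_adjOp_cos (k : ℤ) {χ : E3 → ℝ} (h : IsTestE χ) (p : G T) :
    lapG (adjOp lam (fun q : G T => cosMode k q.1 * χ q.2)) p =
      sinMode k p.1 * (2 * Real.pi / T * k * lapE χ p.2) + cosMode k p.1 * lapE (driftE lam χ) p.2 := by
  have e : adjOp lam (fun q : G T => cosMode k q.1 * χ q.2) = fun q =>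
      sinMode k q.1 * (2 * Real.pi / T * k * χ q.2) + cosMode k q.1 * driftE lam χ q.2 := by
    ext q
    unfold adjOp
    rw [(pdt_modes k χ q).1, lapG_mul_fst _ h, pdx_mul_fst _ (h.1.differentiable (by simp)), driftE]
    ring
  rw [e, lapG_add (isTestG_mul (contDiff_sinMode k) (h.const_mul _))
    (isTestG_mul (contDiff_cosMode k) (h.driftE lam)), lapG_mul_fst _ (h.const_mul _),
    lapG_mul_fst _ (h.driftE lam), lapE_const_mul h]

lemma lapG_adjOp_sin (k : ℤ) {χ : E3 → ℝ} (h : IsTestE χ) (p : G T) :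
    lapG (adjOp lam (fun q : G T => sinMode k q.1 * χ q.2)) p =
      cosMode k p.1 * (-(2 * Real.pi / T * k) * lapE χ p.2) + sinMode k p.1 * lapE (driftE lam χ) p.2 := by
  have e : adjOp lam (fun q : G T => sinMode k q.1 * χ q.2) = fun q =>
      cosMode k q.1 * (-(2 * Real.pi / T * k) * χ q.2) + sinMode k q.1 * driftE lam χ q.2 := by
    ext q
    unfold adjOp
    rw [(pdt_modes k χ q).2, lapG_mul_fst _ h, pdx_mul_fst _ (h.1.differentiable (by simp)), driftE]
    ring
  rw [e, lapG_add (isTestG_mul (contDiff_cosMode k) (h.const_mul _))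
    (isTestG_mul (contDiff_sinMode k) (h.driftE lam)), lapG_mul_fst _ (h.const_mul _),
    lapG_mul_fst _ (h.driftE lam), lapE_const_mul h]

/-- Testing with cos and sin modes times χ gives, for each k, a coupled real system for the two
Fourier coefficients of D. Combined into one complex function it is the equation of `liouville` with
c = 2πk/T. The coefficients inherit vanishing averages from D because the modes are bounded by 1. -/
theorem liouvilleG {D : G T → ℝ} (hD : LocallyIntegrable D (muG T))
    (hv : VanishAvg fun x => ∫⁻ τ, ‖D (τ, x)‖ₑ ∂(AddCircle.haarAddCircle (T := T)))
    (H : ∀ g, IsTestG T g → ∫ p, D p * lapG (adjOp lam g) p ∂(muG T) = 0) : D =ᵐ[muG T] 0 := by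
  have key : ∀ k : ℤ, mean (fun p => D p * cosMode k p.1) =ᵐ[volume] 0 ∧
      mean (fun p => D p * sinMode k p.1) =ᵐ[volume] 0 := by
    intro k
    have hlc : LocallyIntegrable (fun p => D p * cosMode k p.1) (muG T) :=
      LocallyIntegrable.mul_bdd_continuous hD ((continuous_cosMode k).comp continuous_fst)
    have hls : LocallyIntegrable (fun p => D p * sinMode k p.1) (muG T) :=
      LocallyIntegrable.mul_bdd_continuous hD ((continuous_sinMode k).comp continuous_fst)
    set C := mean (fun p => D p * cosMode k p.1) with hC
    set S := mean (fun p => D p * sinMode k p.1) with hS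
    have hCl : LocallyIntegrable C := locallyIntegrable_mean hlc
    have hSl : LocallyIntegrable S := locallyIntegrable_mean hls
    set c : ℝ := 2 * Real.pi / T * k with hc
    have iC : ∀ {χ : E3 → ℝ}, IsTestE χ → Integrable (fun x => C x * χ x) := fun hχ =>
      LocallyIntegrable.mul_test hCl hχ.1.continuous hχ.2
    have iS : ∀ {χ : E3 → ℝ}, IsTestE χ → Integrable (fun x => S x * χ x) := fun hχ =>
      LocallyIntegrable.mul_test hSl hχ.1.continuous hχ.2
    have jC : ∀ {χ : E3 → ℝ}, IsTestE χ → Integrable (fun p : G T => D p * cosMode k p.1 * χ p.2) (muG T) :=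
      fun hχ => LocallyIntegrable.mul_test hlc (hχ.isTestG (T := T)).continuous (hχ.isTestG (T := T)).2
    have jS : ∀ {χ : E3 → ℝ}, IsTestE χ → Integrable (fun p : G T => D p * sinMode k p.1 * χ p.2) (muG T) :=
      fun hχ => LocallyIntegrable.mul_test hls (hχ.isTestG (T := T)).continuous (hχ.isTestG (T := T)).2
    have Hcos : ∀ χ, IsTestE χ → c * (∫ x, S x * lapE χ x) + ∫ x, C x * lapE (driftE lam χ) x = 0 := by
      intro χ hχ
      rw [← integral_mul_comp_snd hls hχ.lapE.1.continuous hχ.lapE.2,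
        ← integral_mul_comp_snd hlc (hχ.driftE lam).lapE.1.continuous (hχ.driftE lam).lapE.2,
        ← integral_const_mul, ← integral_add ((jS hχ.lapE).const_mul c) (jC (hχ.driftE lam).lapE),
        ← H _ (isTestG_mul (contDiff_cosMode k) hχ)]
      congr 1; ext p
      rw [lapG_adjOp_cos k hχ]; ring
    have Hsin : ∀ χ, IsTestE χ → -c * (∫ x, C x * lapE χ x) + ∫ x, S x * lapE (driftE lam χ) x = 0 := by
      intro χ hχ
      rw [← integral_mul_comp_snd hlc hχ.lapE.1.continuous hχ.lapE.2,
        ← integral_mul_comp_snd hls (hχ.driftE lam).lapE.1.continuous (hχ.driftE lam).lapE.2,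
        ← integral_const_mul, ← integral_add ((jC hχ.lapE).const_mul (-c)) (jS (hχ.driftE lam).lapE),
        ← H _ (isTestG_mul (contDiff_sinMode k) hχ)]
      congr 1; ext p
      rw [lapG_adjOp_sin k hχ]; ring
    -- C + iS is the time mean of D times the character of frequency k.
    have hdl : LocallyIntegrable (fun x => (C x : ℂ) + Complex.I * S x) := by
      have h1 : LocallyIntegrable (fun x => (C x : ℂ)) := locallyIntegrable_ofReal hCl
      have h2 : LocallyIntegrable (fun x => Complex.I * (S x : ℂ)) :=
        LocallyIntegrable.smul (locallyIntegrable_ofReal hSl) Complex.I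
      exact h1.add h2
    have hbd : ∀ θ : AddCircle T → ℝ, (∀ τ, |θ τ| ≤ 1) → ∀ x, ‖mean (fun p => D p * θ p.1) x‖ₑ ≤
        ∫⁻ τ, ‖D (τ, x)‖ₑ ∂(AddCircle.haarAddCircle (T := T)) := by
      intro θ hθ x
      refine (enorm_integral_le_lintegral_enorm _).trans (lintegral_mono fun τ => ?_)
      rw [enorm_mul]
      refine mul_le_of_le_one_right (by simp) ?_
      rw [← ofReal_norm, ENNReal.ofReal_le_one]
      exact hθ τ
    have hvd : VanishAvg fun x => ‖(C x : ℂ) + Complex.I * S x‖ₑ := by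
      refine (hv.const_mul 2).mono (Eventually.of_forall fun x => ?_)
      refine (enorm_add_le _ _).trans ?_
      have h1 := hbd _ (abs_cosMode_le k) x
      have h2 := hbd _ (abs_sinMode_le k) x
      have h3 : ‖(C x : ℂ)‖ₑ = ‖C x‖ₑ := by simp [← ofReal_norm]
      have h4 : ‖Complex.I * (S x : ℂ)‖ₑ = ‖S x‖ₑ := by simp [← ofReal_norm]
      rw [h3, h4, ENNReal.coe_ofNat, two_mul]
      exact add_le_add h1 h2
    have hz := liouville hdl hvd c lam fun g hg => by
      obtain ⟨g1, g2, h1, h2, h⟩ := schwartz_parts hg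
      have a1 := iC h1.lapE
      have a2 := iC h2.lapE
      have a3 := iC (h1.driftE lam).lapE
      have a4 := iC (h2.driftE lam).lapE
      have b1 := iS h1.lapE
      have b2 := iS h2.lapE
      have b3 := iS (h1.driftE lam).lapE
      have b4 := iS (h2.driftE lam).lapE
      have e : ∀ x, ((C x : ℂ) + Complex.I * S x) * opS c lam g x =
          (((c * (S x * lapE g1 x) + C x * lapE (driftE lam g1) x) -
            (-c * (C x * lapE g2 x) + S x * lapE (driftE lam g2) x) : ℝ) : ℂ) +
          Complex.I * (((c * (S x * lapE g2 x) + C x * lapE (driftE lam g2) x) +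
            (-c * (C x * lapE g1 x) + S x * lapE (driftE lam g1) x) : ℝ) : ℂ) := by
        intro x
        rw [opS_complex h1 h2 h]
        push_cast
        linear_combination (S x * (-c * lapE g1 x + lapE (driftE lam g2) x)) * Complex.I_sq
      simp_rw [e]
      have j1 : Integrable (fun x => c * (S x * lapE g1 x) + C x * lapE (driftE lam g1) x) :=
        (b1.const_mul c).add a3
      have j2 : Integrable (fun x => -c * (C x * lapE g2 x) + S x * lapE (driftE lam g2) x) :=
        (a2.const_mul (-c)).add b4
      have j3 : Integrable (fun x => c * (S x * lapE g2 x) + C x * lapE (driftE lam g2) x) :=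
        (b2.const_mul c).add a4
      have j4 : Integrable (fun x => -c * (C x * lapE g1 x) + S x * lapE (driftE lam g1) x) :=
        (a1.const_mul (-c)).add b3
      have i1 := j1.sub j2
      have i2 := j3.add j4
      rw [integral_add i1.ofReal (i2.ofReal.const_mul _), integral_const_mul, integral_complex_ofReal,
        integral_complex_ofReal]
      have z1 : ∫ x, ((c * (S x * lapE g1 x) + C x * lapE (driftE lam g1) x) -
            (-c * (C x * lapE g2 x) + S x * lapE (driftE lam g2) x)) = 0 := by
        rw [integral_sub j1 j2,
          integral_add (b1.const_mul c) a3, integral_add (a2.const_mul (-c)) b4, integral_const_mul,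
          integral_const_mul, Hcos g1 h1, Hsin g2 h2, sub_zero]
      have z2 : ∫ x, ((c * (S x * lapE g2 x) + C x * lapE (driftE lam g2) x) +
            (-c * (C x * lapE g1 x) + S x * lapE (driftE lam g1) x)) = 0 := by
        rw [integral_add j3 j4,
          integral_add (b2.const_mul c) a4, integral_add (a1.const_mul (-c)) b3, integral_const_mul,
          integral_const_mul, Hcos g2 h2, Hsin g1 h1, add_zero]
      rw [z1, z2]; simp
    constructor
    · filter_upwards [hz] with x hx
      have := congrArg Complex.re hx
      simpa using this
    · filter_upwards [hz] with x hx
      have := congrArg Complex.im hx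
      simpa using this
  exact ae_eq_zero_of_modes hD (fun k => (key k).1) (fun k => (key k).2)

end LiouvilleG


/-! ### The steady vorticity kernel -/

/-- The unnormalized error function. -/
def gaussInt (v : ℝ) : ℝ := ∫ s in (0 : ℝ)..v, Real.exp (-s ^ 2)

lemma hasDerivAt_gaussInt (v : ℝ) : HasDerivAt gaussInt (Real.exp (-v ^ 2)) v :=
  (by fun_prop : Continuous fun s : ℝ => Real.exp (-s ^ 2)).integral_hasStrictDerivAt 0 v |>.hasDerivAt

lemma tendsto_gaussInt_atTop : Tendsto gaussInt atTop (𝓝 (√Real.pi / 2)) := by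
  have h := intervalIntegral_tendsto_integral_Ioi (μ := volume) (0 : ℝ)
    (integrable_exp_neg_mul_sq (b := 1) one_pos).integrableOn tendsto_id
  rw [integral_gaussian_Ioi 1, div_one] at h
  exact h.congr fun v => by simp [gaussInt]

lemma gaussInt_neg (v : ℝ) : gaussInt (-v) = -gaussInt v := by
  unfold gaussInt
  have := intervalIntegral.integral_comp_neg (a := (0 : ℝ)) (b := v) (fun s => Real.exp (-s ^ 2))
  simp only [neg_sq, neg_zero] at this
  rw [intervalIntegral.integral_symm, this]

lemma tendsto_gaussInt_atBot : Tendsto gaussInt atBot (𝓝 (-(√Real.pi / 2))) := by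
  have h := (tendsto_gaussInt_atTop.comp tendsto_neg_atBot_atTop).neg
  refine h.congr fun v => ?_
  simp [gaussInt_neg]

/-- Since (a/√t ∓ b√t)² = a²/t + b²t ∓ 2ab, the two error-function terms weighted by e^{∓2ab} have
derivatives with one common exponential. In the sum the contributions of b√t cancel, leaving the
integrand. -/
lemma integral_inv_gauss {a b : ℝ} (ha : 0 < a) (hb : 0 < b) :
    ∫ t in Ioi (0 : ℝ), a / (t * √t) * Real.exp (-(a ^ 2 / t) - b ^ 2 * t) = √Real.pi * Real.exp (-(2 * a * b)) := by
  set W : ℝ → ℝ := fun t => -(Real.exp (-(2 * a * b)) * gaussInt (a / √t - b * √t) +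
    Real.exp (2 * a * b) * gaussInt (a / √t + b * √t)) with hW
  have hd : ∀ t ∈ Ioi (0 : ℝ), HasDerivAt W (a / (t * √t) * Real.exp (-(a ^ 2 / t) - b ^ 2 * t)) t := by
    intro t ht
    have ht : 0 < t := ht
    have hr : 0 < √t := Real.sqrt_pos.2 ht
    have hs := Real.hasDerivAt_sqrt ht.ne'
    have h1 := (hasDerivAt_const t a).div hs hr.ne'
    have h2 := hs.const_mul b
    have h3 := (hasDerivAt_gaussInt _).comp t (h1.sub h2)
    have h4 := (hasDerivAt_gaussInt _).comp t (h1.add h2)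
    have h5 := ((h3.const_mul (Real.exp (-(2 * a * b)))).add (h4.const_mul (Real.exp (2 * a * b)))).neg
    refine h5.congr_deriv ?_
    have hsq : √t ^ 2 = t := Real.sq_sqrt ht.le
    have e1 : Real.exp (-(2 * a * b)) * Real.exp (-(a / √t - b * √t) ^ 2) =
        Real.exp (-(a ^ 2 / t) - b ^ 2 * t) := by
      rw [← Real.exp_add]; congr 1
      rw [← hsq]; simp only [Real.sqrt_sq hr.le]; field_simp; ring
    have e2 : Real.exp (2 * a * b) * Real.exp (-(a / √t + b * √t) ^ 2) =
        Real.exp (-(a ^ 2 / t) - b ^ 2 * t) := by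
      rw [← Real.exp_add]; congr 1
      rw [← hsq]; simp only [Real.sqrt_sq hr.le]; field_simp; ring
    simp only [Pi.div_apply, Pi.add_apply, Pi.sub_apply, ← mul_assoc]
    rw [e1, e2, hsq]
    field_simp
    ring
  have hinv : Tendsto (fun t => a / √t) atTop (𝓝 0) := Real.tendsto_sqrt_atTop.const_div_atTop a
  have hsqt : Tendsto (fun t => b * √t) atTop atTop := Real.tendsto_sqrt_atTop.const_mul_atTop hb
  have htop : Tendsto W atTop (𝓝 (-(Real.exp (-(2 * a * b)) * (-(√Real.pi / 2)) +
      Real.exp (2 * a * b) * (√Real.pi / 2)))) := by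
    refine (((tendsto_gaussInt_atBot.comp ?_).const_mul _).add
      ((tendsto_gaussInt_atTop.comp ?_).const_mul _)).neg
    · simp_rw [sub_eq_add_neg]
      exact hinv.add_atBot (tendsto_neg_atTop_atBot.comp hsqt)
    · exact hinv.add_atTop hsqt
  have hs0 : Tendsto (fun t => √t) (𝓝[>] 0) (𝓝[>] 0) := by
    refine tendsto_nhdsWithin_iff.2 ⟨?_, eventually_nhdsWithin_of_forall fun t ht => Real.sqrt_pos.2 ht⟩
    have := Real.continuous_sqrt.tendsto 0
    rw [Real.sqrt_zero] at this
    exact this.mono_left nhdsWithin_le_nhds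
  have hi0 : Tendsto (fun t => a / √t) (𝓝[>] 0) atTop := by
    simp_rw [div_eq_mul_inv]
    exact (tendsto_inv_nhdsGT_zero.comp hs0).const_mul_atTop ha
  have hb0 : Tendsto (fun t => b * √t) (𝓝[>] 0) (𝓝 0) := by
    simpa using (hs0.mono_right nhdsWithin_le_nhds).const_mul b
  have hzero : Tendsto W (𝓝[>] 0) (𝓝 (-(Real.exp (-(2 * a * b)) * (√Real.pi / 2) +
      Real.exp (2 * a * b) * (√Real.pi / 2)))) := by
    refine (((tendsto_gaussInt_atTop.comp ?_).const_mul _).add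
      ((tendsto_gaussInt_atTop.comp ?_).const_mul _)).neg
    · simp_rw [sub_eq_add_neg]
      exact hi0.atTop_add hb0.neg
    · exact hi0.atTop_add hb0
  -- The formula for W at t = 0 divides by zero, so its value there is replaced by the right limit.
  set m := -(Real.exp (-(2 * a * b)) * (√Real.pi / 2) + Real.exp (2 * a * b) * (√Real.pi / 2))
  have hne : ∀ t ∈ Ioi (0 : ℝ), Function.update W 0 m =ᶠ[𝓝 t] W := fun t ht =>
    (eventually_ne_nhds (ne_of_gt ht)).mono fun s hs => Function.update_of_ne hs _ _
  have := integral_Ioi_of_hasDerivAt_of_nonneg (a := 0) (g := Function.update W 0 m)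
    (by rw [continuousWithinAt_update_same]; simpa using hzero)
    (fun t ht => (hd t ht).congr_of_eventuallyEq (hne t ht))
    (fun t ht => by have : (0 : ℝ) < t := ht; positivity)
    (htop.congr' ((eventually_gt_atTop 0).mono fun t ht => (Function.update_of_ne (ne_of_gt ht) _ _).symm))
  rw [this, Function.update_self]
  ring

lemma normSq_add_smul (lam t : ℝ) (x : E3) :
    ‖x + (lam * t) • unitVec 0‖ ^ 2 = ‖x‖ ^ 2 + 2 * (lam * t) * x 0 + (lam * t) ^ 2 := by
  rw [normSq_eq, normSq_eq]
  simp [unitVec_apply, kron]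
  ring

/-- Expanding |x + λt e_1|², the cross term gives the factor e^{-λx_0/2}, free of t; the rest is
`integral_inv_gauss` with a = |x|/2 and b = λ/2, whose e^{-2ab} completes the wake function. -/
lemma vortSteady_eq_stat {lam : ℝ} (hlam : 0 < lam) {x : E3} (hx : x ≠ 0) :
    vortSteady lam x = stat lam heat x := by
  have hx' : 0 < ‖x‖ := norm_pos_iff.2 hx
  have e : ∀ t ∈ Ioi (0 : ℝ), trn lam heat t x = ((4 * Real.pi) ^ (-(3 / 2) : ℝ) * (2 / ‖x‖) *
      Real.exp (-(lam * x 0 / 2))) *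
      (‖x‖ / 2 / (t * √t) * Real.exp (-((‖x‖ / 2) ^ 2 / t) - (lam / 2) ^ 2 * t)) := by
    intro t ht
    have ht : 0 < t := ht
    unfold trn heat
    rw [normSq_add_smul, Real.mul_rpow (by positivity) ht.le]
    have e1 : t ^ (-(3 / 2) : ℝ) = (t * √t)⁻¹ := by
      rw [Real.rpow_neg ht.le, show (3 / 2 : ℝ) = 1 + 1 / 2 by norm_num, Real.rpow_add ht, Real.rpow_one,
        ← Real.sqrt_eq_rpow]
    have e2 : Real.exp (-((‖x‖ ^ 2 + 2 * (lam * t) * x 0 + (lam * t) ^ 2) / (4 * t))) =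
        Real.exp (-(lam * x 0 / 2)) * Real.exp (-((‖x‖ / 2) ^ 2 / t) - (lam / 2) ^ 2 * t) := by
      rw [← Real.exp_add]; congr 1; field_simp; ring
    rw [e1, e2]
    field_simp
  unfold stat
  rw [setIntegral_congr_fun measurableSet_Ioi e, integral_const_mul, integral_inv_gauss (by positivity) (by positivity)]
  have e3 : (4 * Real.pi) ^ (-(3 / 2) : ℝ) = (8 * Real.pi * √Real.pi)⁻¹ := by
    rw [Real.rpow_neg (by positivity), show (3 / 2 : ℝ) = 1 + 1 / 2 by norm_num,
      Real.rpow_add (by positivity), Real.rpow_one, ← Real.sqrt_eq_rpow, Real.sqrt_mul (by norm_num),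
      show (4 : ℝ) = 2 ^ 2 by norm_num, Real.sqrt_sq (by norm_num)]
    congr 1; ring
  have e4 : Real.exp (-(wake (lam • x) / 2)) =
      Real.exp (-(lam * x 0 / 2)) * Real.exp (-(2 * (‖x‖ / 2) * (lam / 2))) := by
    rw [← Real.exp_add]; congr 1
    unfold wake
    rw [norm_smul, Real.norm_of_nonneg hlam.le]
    simp
    ring
  have hpi : √Real.pi ≠ 0 := (Real.sqrt_pos.2 Real.pi_pos).ne'
  unfold vortSteady
  rw [e3, e4]
  field_simp
  ring


/-! ### Weak derivatives of functions with a point singularity -/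

lemma ae_ne_zero : ∀ᵐ x : E3, x ≠ 0 := by simp [ae_iff]

lemma locallyIntegrable_inv_norm : LocallyIntegrable (fun x : E3 => ‖x‖⁻¹) := by
  rw [locallyIntegrable_iff]
  intro K hK
  obtain ⟨r, hr⟩ := hK.isBounded.subset_ball 0
  refine IntegrableOn.mono_set ?_ hr
  simpa [Real.rpow_neg_one] using integrableOn_norm_rpow (a := -1) (by norm_num) r

lemma aestronglyMeasurable_of_punctured {h : E3 → ℝ} (hc : ContinuousOn h {0}ᶜ) :
    AEStronglyMeasurable h volume := by
  have := hc.aestronglyMeasurable (μ := volume) (measurableSet_singleton (0 : E3)).compl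
  rwa [Measure.restrict_eq_self_of_ae_mem] at this
  exact ae_ne_zero

lemma locallyIntegrable_of_punctured {h : E3 → ℝ} (hc : ContinuousOn h {0}ᶜ) {C : ℝ}
    (hC : ∀ x, x ≠ 0 → |h x| ≤ C * ‖x‖⁻¹) : LocallyIntegrable h := by
  refine LocallyIntegrable.mono (locallyIntegrable_inv_norm.smul C) (aestronglyMeasurable_of_punctured hc) ?_
  filter_upwards [ae_ne_zero] with x hx
  exact (hC x hx).trans (le_abs_self _)

/-- A neighbourhood of the origin of radius of order 1/n is cut out. The derivative of the cutoff is
bounded by a multiple of |x|^{-1} uniformly in n, which is locally integrable, and it tends to 0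
pointwise. As g is bounded near 0, dominated convergence removes the error. -/
lemma isWeakPartialE_of_punctured {g h : E3 → ℝ} {j : Fin 3} (hgc : ContinuousOn g {0}ᶜ)
    (hhc : ContinuousOn h {0}ᶜ) (hd : ∀ x, x ≠ 0 → HasLineDerivAt ℝ g (h x) x (unitVec j))
    (hg : LocallyIntegrable g) (hh : LocallyIntegrable h) {C : ℝ} (hC0 : 0 ≤ C) (hC : ∀ x, ‖x‖ ≤ 2 → |g x| ≤ C) :
    IsWeakPartialE j g h := by
  refine ⟨hg, hh, fun χ hχ => ?_⟩
  have hb : IsTestE (bumpE : E3 → ℝ) := ⟨bumpE_contDiff, bumpE.hasCompactSupport⟩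
  set b' := pd j (bumpE : E3 → ℝ)
  obtain ⟨D, hD⟩ := (hb.pd j).2.exists_bound_of_continuous (hb.pd j).1.continuous
  have hD0 : 0 ≤ D := (norm_nonneg _).trans (hD 0)
  have hb'0 : ∀ z : E3, 2 < ‖z‖ → b' z = 0 := by
    intro z hz
    have he : (bumpE : E3 → ℝ) =ᶠ[𝓝 z] fun _ => 0 := by
      filter_upwards [(isOpen_lt continuous_const continuous_norm).mem_nhds hz] with y hy
      exact bumpE.zero_of_le_dist (by simpa [bumpE] using (le_of_lt hy))
    simp only [b', pd]
    rw [he.fderiv_eq]; simp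
  set η : ℕ → E3 → ℝ := fun n x => 1 - bumpE (((n : ℝ) + 1) • x) with hη
  set η' : ℕ → E3 → ℝ := fun n x => -(((n : ℝ) + 1) * b' (((n : ℝ) + 1) • x)) with hη'
  have hηc : ∀ n, Continuous (η n) := fun n => continuous_const.sub (bumpE_contDiff.continuous.comp (continuous_const_smul _))
  have hη'c : ∀ n, Continuous (η' n) := fun n =>
    ((hb.pd j).1.continuous.comp (continuous_const_smul _)).const_smul ((n : ℝ) + 1) |>.neg
  have hη1 : ∀ n x, |η n x| ≤ 1 := fun n x => by
    have h1 := bumpE.nonneg (x := ((n : ℝ) + 1) • x)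
    have h2 := bumpE.le_one (x := ((n : ℝ) + 1) • x)
    rw [abs_le]; constructor <;> simp only [hη] <;> linarith
  have hη'1 : ∀ n x, |g x * η' n x| ≤ C * (2 * D) * ‖x‖⁻¹ := by
    intro n x
    by_cases hx : x = 0
    · have : b' 0 = 0 := by
        have he : (bumpE : E3 → ℝ) =ᶠ[𝓝 0] fun _ => 1 := bumpE.eventuallyEq_one
        simp only [b', pd]
        rw [he.fderiv_eq]; simp
      simp [hη', hx, this]
    have hx' : 0 < ‖x‖ := norm_pos_iff.2 hx
    have hn : (0 : ℝ) < (n : ℝ) + 1 := by positivity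
    by_cases h2 : ((n : ℝ) + 1) * ‖x‖ ≤ 2
    · have hx2 : ‖x‖ ≤ 2 := by nlinarith [(Nat.cast_nonneg n : (0 : ℝ) ≤ n)]
      rw [abs_mul, mul_assoc]
      refine mul_le_mul (hC x hx2) ?_ (abs_nonneg _) hC0
      simp only [hη', abs_neg, abs_mul, abs_of_pos hn]
      have h3 : (n : ℝ) + 1 ≤ 2 * ‖x‖⁻¹ := by
        rw [← div_eq_mul_inv, le_div_iff₀ hx']; exact h2
      calc ((n : ℝ) + 1) * |b' (((n : ℝ) + 1) • x)| ≤ (2 * ‖x‖⁻¹) * D :=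
            mul_le_mul h3 (hD _) (abs_nonneg _) (by positivity)
        _ = _ := by ring
    · have : b' (((n : ℝ) + 1) • x) = 0 := hb'0 _ (by
        rw [norm_smul, Real.norm_of_nonneg hn.le]; exact not_le.1 h2)
      simp only [hη', this, mul_zero, neg_zero, abs_zero]
      positivity
  have hηd : ∀ n x, HasLineDerivAt ℝ (η n) (η' n x) x (unitVec j) := by
    intro n x
    have h1 := (hb.1.differentiable (by simp) (((n : ℝ) + 1) • x)).hasFDerivAt.comp x
      ((ContinuousLinearMap.id ℝ E3).hasFDerivAt.const_smul ((n : ℝ) + 1))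
    have h2 := (h1.const_sub 1).hasLineDerivAt (unitVec j)
    convert! h2 using 1
    simp [hη', b', pd]
  have hη0 : ∀ n, ∀ᶠ y in 𝓝 (0 : E3), η n y = 0 ∧ η' n y = 0 := by
    intro n
    have ht : Tendsto (fun y : E3 => ((n : ℝ) + 1) • y) (𝓝 0) (𝓝 0) := by
      have := (continuous_const_smul ((n : ℝ) + 1)).tendsto (0 : E3)
      rwa [smul_zero] at this
    have he : (bumpE : E3 → ℝ) =ᶠ[𝓝 0] fun _ => 1 := bumpE.eventuallyEq_one
    have he' := he.eventuallyEq_nhds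
    filter_upwards [ht.eventually he, ht.eventually he'] with y hy hy'
    refine ⟨by simp [hη, hy], ?_⟩
    simp only [hη', b', pd]
    rw [hy'.fderiv_eq]; simp
  have hη0' : ∀ n, η n 0 = 0 := fun n => (hη0 n).self_of_nhds.1
  have hη'0' : ∀ n, η' n 0 = 0 := fun n => (hη0 n).self_of_nhds.2
  have hlim : ∀ x : E3, x ≠ 0 → ∀ᶠ n in atTop, η n x = 1 ∧ η' n x = 0 := by
    intro x hx
    have ht : Tendsto (fun n : ℕ => ((n : ℝ) + 1) * ‖x‖) atTop atTop :=
      (tendsto_natCast_atTop_atTop.atTop_add tendsto_const_nhds).atTop_mul_const (norm_pos_iff.2 hx)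
    filter_upwards [ht.eventually_gt_atTop 2] with n hn
    have hn' : 2 < ‖((n : ℝ) + 1) • x‖ := by
      rwa [norm_smul, Real.norm_of_nonneg (by positivity)]
    refine ⟨?_, by simp [hη', hb'0 _ hn']⟩
    have : bumpE (((n : ℝ) + 1) • x) = 0 := bumpE.zero_of_le_dist (by simpa [bumpE] using hn'.le)
    simp [hη, this]
  have hcm : ∀ {f ζ : E3 → ℝ}, ContinuousOn f {0}ᶜ → Continuous ζ → (∀ᶠ y in 𝓝 (0 : E3), ζ y = 0) →
      Continuous fun x => f x * ζ x := by
    intro f ζ hf hζ h0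
    refine continuous_iff_continuousAt.2 fun x => ?_
    by_cases hx : x = 0
    · subst hx
      refine (continuousAt_const (y := (0 : ℝ))).congr ?_
      filter_upwards [h0] with y hy
      rw [hy, mul_zero]
    · exact (hf.continuousAt (isOpen_compl_singleton.mem_nhds hx)).mul hζ.continuousAt
  have hibp : ∀ n, ∫ x, (g x * η n x) * pd j χ x = - ∫ x, (h x * η n x + g x * η' n x) * χ x := by
    intro n
    have := integral_mul_pd_of_continuous (j := j) (hcm hgc (hηc n) ((hη0 n).mono fun _ h => h.1))
      ((hcm hhc (hηc n) ((hη0 n).mono fun _ h => h.1)).add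
        (hcm hgc (hη'c n) ((hη0 n).mono fun _ h => h.2))) (fun y => ?_) 0 hχ
    · simpa using this
    by_cases hy : y = 0
    · subst hy
      simp only [Pi.add_apply]
      rw [hη0' n, hη'0' n, mul_zero, mul_zero, add_zero]
      have he : (fun x => g x * η n x) =ᶠ[𝓝 0] fun _ => 0 :=
        (hη0 n).mono fun y hy => by simp only [hy.1, mul_zero]
      have := ((hasFDerivAt_const (𝕜 := ℝ) (0 : ℝ) (0 : E3)).congr_of_eventuallyEq he).hasLineDerivAt (unitVec j)
      simpa using this
    · have h1 := hd y hy
      have h2 := hηd n y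
      unfold HasLineDerivAt at *
      refine (h1.mul h2).congr_deriv ?_
      simp
  have l1 : Tendsto (fun n => ∫ x, (g x * η n x) * pd j χ x) atTop (𝓝 (∫ x, g x * pd j χ x)) := by
    refine tendsto_integral_of_dominated_convergence (fun x => |g x * pd j χ x|) (fun n => ?_) ?_ ?_ ?_
    · exact (hg.aestronglyMeasurable.mul (hηc n).aestronglyMeasurable).mul (hχ.pd j).1.continuous.aestronglyMeasurable
    · exact (LocallyIntegrable.mul_test hg (hχ.pd j).1.continuous (hχ.pd j).2).abs
    · refine fun n => Eventually.of_forall fun x => ?_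
      rw [Real.norm_eq_abs, mul_right_comm, abs_mul _ (η n x)]
      exact mul_le_of_le_one_right (abs_nonneg _) (hη1 n x)
    · filter_upwards [ae_ne_zero] with x hx
      exact tendsto_const_nhds.congr' ((hlim x hx).mono fun n hn => by simp only [hn.1, mul_one])
  have l2 : Tendsto (fun n => ∫ x, (h x * η n x + g x * η' n x) * χ x) atTop (𝓝 (∫ x, h x * χ x)) := by
    refine tendsto_integral_of_dominated_convergence
      (fun x => |h x * χ x| + |(C * (2 * D)) * (‖x‖⁻¹ * χ x)|) (fun n => ?_) ?_ ?_ ?_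
    · exact ((hh.aestronglyMeasurable.mul (hηc n).aestronglyMeasurable).add
        (hg.aestronglyMeasurable.mul (hη'c n).aestronglyMeasurable)).mul hχ.1.continuous.aestronglyMeasurable
    · exact (LocallyIntegrable.mul_test hh hχ.1.continuous hχ.2).abs.add
        ((LocallyIntegrable.mul_test locallyIntegrable_inv_norm hχ.1.continuous hχ.2).const_mul _).abs
    · refine fun n => Eventually.of_forall fun x => ?_
      rw [add_mul]
      refine (norm_add_le _ _).trans (add_le_add ?_ ?_)
      · rw [Real.norm_eq_abs, mul_right_comm, abs_mul _ (η n x)]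
        exact mul_le_of_le_one_right (abs_nonneg _) (hη1 n x)
      · rw [Real.norm_eq_abs, abs_mul, ← mul_assoc, abs_mul _ (χ x)]
        exact mul_le_mul_of_nonneg_right ((hη'1 n x).trans (le_abs_self _)) (abs_nonneg _)
    · filter_upwards [ae_ne_zero] with x hx
      exact tendsto_const_nhds.congr' ((hlim x hx).mono fun n hn => by simp [hn.1, hn.2])
  exact tendsto_nhds_unique (l1.congr hibp) l2.neg


/-! ### The Oseen potential -/

/-- The smooth function `(1 - e^{-σ}) / σ`. -/
def expMean (σ : ℝ) : ℝ := ∫ r in (0 : ℝ)..1, Real.exp (-(σ * r))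

/-- The derivative of `expMean`. -/
def expMeanD (σ : ℝ) : ℝ := ∫ r in (0 : ℝ)..1, -r * Real.exp (-(σ * r))

lemma hasDerivAt_expMean (σ : ℝ) : HasDerivAt expMean (expMeanD σ) σ := by
  refine (intervalIntegral.hasDerivAt_integral_of_dominated_loc_of_deriv_le (s := Metric.ball σ 1)
    (F := fun σ r => Real.exp (-(σ * r))) (F' := fun σ r => -r * Real.exp (-(σ * r)))
    (bound := fun _ => Real.exp (|σ| + 1)) (Metric.ball_mem_nhds σ one_pos) ?_ ?_ ?_ ?_ ?_ ?_).2
  · exact Eventually.of_forall fun y => (by fun_prop : Continuous fun r : ℝ => Real.exp (-(y * r))).aestronglyMeasurable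
  · exact (by fun_prop : Continuous fun r : ℝ => Real.exp (-(σ * r))).intervalIntegrable _ _
  · exact (by fun_prop : Continuous fun r : ℝ => -r * Real.exp (-(σ * r))).aestronglyMeasurable
  · refine Eventually.of_forall fun r hr y hy => ?_
    rw [uIoc_of_le zero_le_one] at hr
    have hy' : |y| ≤ |σ| + 1 := by
      have h1 : |y - σ| < 1 := hy
      have := abs_sub_abs_le_abs_sub y σ
      linarith
    rw [Real.norm_eq_abs, abs_mul, abs_neg, abs_of_pos hr.1, Real.abs_exp]
    have h2 : Real.exp (-(y * r)) ≤ Real.exp (|σ| + 1) := by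
      refine Real.exp_le_exp.2 ?_
      have h3 : -(y * r) ≤ |y| * r := by
        rw [← neg_mul]; exact mul_le_mul_of_nonneg_right (neg_le_abs y) hr.1.le
      have h4 : |y| * r ≤ |y| := mul_le_of_le_one_right (abs_nonneg y) hr.2
      linarith
    calc r * Real.exp (-(y * r)) ≤ 1 * Real.exp (|σ| + 1) := by
          gcongr
          exact hr.2
      _ = _ := one_mul _
  · exact intervalIntegrable_const
  · refine Eventually.of_forall fun r _ y _ => ?_
    have h := (((hasDerivAt_id y).mul_const r).neg.exp)
    refine h.congr_deriv ?_
    simp; ring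

lemma continuous_expMean : Continuous expMean :=
  continuous_iff_continuousAt.2 fun σ => (hasDerivAt_expMean σ).continuousAt

lemma continuous_expMeanD : Continuous expMeanD :=
  intervalIntegral.continuous_parametric_intervalIntegral_of_continuous' (by fun_prop) _ _

lemma mul_expMean (σ : ℝ) : σ * expMean σ = 1 - Real.exp (-σ) := by
  unfold expMean
  rw [← intervalIntegral.integral_const_mul,
    intervalIntegral.integral_eq_sub_of_hasDerivAt (f := fun r => -Real.exp (-(σ * r))) (fun r _ => ?_)
      ((by fun_prop : Continuous fun r : ℝ => σ * Real.exp (-(σ * r))).intervalIntegrable _ _)]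
  · simp; ring
  · have h := (((hasDerivAt_id r).const_mul σ).neg.exp).neg
    refine h.congr_deriv ?_
    simp; ring

/-- Both sides are the derivative of σ·`expMean` σ = 1 - e^{-σ}. This identity collapses the
Laplacian of the Oseen potential to a single exponential. -/
lemma expMean_add (σ : ℝ) : expMean σ + σ * expMeanD σ = Real.exp (-σ) := by
  have h1 := (hasDerivAt_id σ).mul (hasDerivAt_expMean σ)
  have h2 : HasDerivAt (fun σ => 1 - Real.exp (-σ)) (Real.exp (-σ)) σ := by
    have := ((hasDerivAt_id σ).neg.exp).const_sub 1
    refine this.congr_deriv ?_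
    simp
  have e : (id * expMean) = fun σ => 1 - Real.exp (-σ) := by ext σ; simp [mul_expMean]
  rw [e] at h1
  simpa using h1.unique h2

lemma expMean_mem {σ : ℝ} (hσ : 0 ≤ σ) : 0 ≤ expMean σ ∧ expMean σ ≤ 1 := by
  constructor
  · exact intervalIntegral.integral_nonneg zero_le_one fun r _ => (Real.exp_pos _).le
  · have := intervalIntegral.integral_mono_on (μ := volume) (a := 0) (b := 1) zero_le_one
      ((by fun_prop : Continuous fun r : ℝ => Real.exp (-(σ * r))).intervalIntegrable _ _)
      (intervalIntegrable_const (c := (1 : ℝ))) (fun r hr => Real.exp_le_one_iff.2 (by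
        have := mul_nonneg hσ hr.1; linarith))
    simpa [expMean] using this

lemma abs_mul_expMeanD_le {σ : ℝ} (hσ : 0 ≤ σ) : |σ * expMeanD σ| ≤ 1 := by
  have h := expMean_add σ
  have h1 := expMean_mem hσ
  have h2 := Real.exp_pos (-σ)
  have h3 : Real.exp (-σ) ≤ 1 := Real.exp_le_one_iff.2 (by linarith)
  rw [abs_le]; constructor <;> linarith

/-- The argument of the Oseen potential. -/
def wk (lam : ℝ) (x : E3) : ℝ := lam / 2 * (‖x‖ + x 0)

/-- The derivatives of `wk`. -/
def wkD (lam : ℝ) (l : Fin 3) (x : E3) : ℝ := lam / 2 * (x l * ‖x‖⁻¹ + kron l 0)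

/-- The second derivatives of `wk`. -/
def wkDD (lam : ℝ) (j l : Fin 3) (x : E3) : ℝ :=
  lam / 2 * (kron l j * ‖x‖⁻¹ - x j * x l * (‖x‖⁻¹) ^ 3)

variable {lam : ℝ}

lemma wake_eq_wk (hlam : 0 < lam) (x : E3) : wake (lam • x) / 2 = wk lam x := by
  unfold wake wk
  rw [norm_smul, Real.norm_of_nonneg hlam.le]; simp; ring

lemma wk_nonneg (hlam : 0 < lam) (x : E3) : 0 ≤ wk lam x := by
  have := neg_le_of_abs_le (abs_coord_le x 0)
  unfold wk
  have h : 0 ≤ ‖x‖ + x 0 := by linarith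
  positivity

lemma continuous_wk : Continuous (wk lam) := by unfold wk; fun_prop

lemma continuousOn_inv_norm : ContinuousOn (fun x : E3 => ‖x‖⁻¹) {0}ᶜ :=
  continuous_norm.continuousOn.inv₀ fun _ hx => norm_ne_zero_iff.2 hx

lemma continuousOn_wkD (l : Fin 3) : ContinuousOn (wkD lam l) {0}ᶜ := by
  have := continuousOn_inv_norm
  unfold wkD; fun_prop

lemma continuousOn_wkDD (j l : Fin 3) : ContinuousOn (wkDD lam j l) {0}ᶜ := by
  have := continuousOn_inv_norm
  unfold wkDD; fun_prop

lemma differentiableAt_norm' {x : E3} (hx : x ≠ 0) : DifferentiableAt ℝ (fun y : E3 => ‖y‖) x :=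
  differentiableAt_id.norm ℝ hx

lemma hasLineDerivAt_norm {x : E3} (hx : x ≠ 0) (l : Fin 3) :
    HasLineDerivAt ℝ (fun y : E3 => ‖y‖) (x l * ‖x‖⁻¹) x (unitVec l) := by
  have hx' : 0 < ‖x‖ := norm_pos_iff.2 hx
  have h := hasLineDerivAt_normSq l x
  unfold HasLineDerivAt at *
  have h2 := h.sqrt (by simpa using hx)
  simp only [Real.sqrt_sq (norm_nonneg _), zero_smul, add_zero] at h2
  refine h2.congr_deriv ?_
  field_simp

lemma hasLineDerivAt_wk {x : E3} (hx : x ≠ 0) (l : Fin 3) :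
    HasLineDerivAt ℝ (wk lam) (wkD lam l x) x (unitVec l) := by
  have h1 := hasLineDerivAt_norm hx l
  have h2 := hasLineDerivAt_coord 0 l x
  unfold HasLineDerivAt at *
  refine ((h1.add h2).const_mul (lam / 2)).congr_deriv ?_
  rw [wkD, kron_comm]

lemma hasLineDerivAt_wkD {x : E3} (hx : x ≠ 0) (j l : Fin 3) :
    HasLineDerivAt ℝ (wkD lam l) (wkDD lam j l x) x (unitVec j) := by
  have hx' : ‖x‖ ≠ 0 := norm_ne_zero_iff.2 hx
  have h1 := hasLineDerivAt_norm hx j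
  have h2 := hasLineDerivAt_coord l j x
  unfold HasLineDerivAt at *
  have h3 := ((h2.mul (h1.inv (by simpa using hx))).add_const (kron l 0)).const_mul (lam / 2)
  refine h3.congr_deriv ?_
  simp only [Pi.inv_apply, zero_smul, add_zero, wkDD]
  field_simp
  ring

lemma differentiableAt_wk {x : E3} (hx : x ≠ 0) : DifferentiableAt ℝ (wk lam) x := by
  have := differentiableAt_norm' hx
  have := (hasFDerivAt_coord 0 x).differentiableAt
  unfold wk; fun_prop

lemma differentiableAt_wkD {x : E3} (hx : x ≠ 0) (l : Fin 3) : DifferentiableAt ℝ (wkD lam l) x := by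
  have h1 := (differentiableAt_norm' hx).inv (norm_ne_zero_iff.2 hx)
  have h2 := (hasFDerivAt_coord l x).differentiableAt
  exact ((h2.mul h1).add_const _).const_mul _

lemma pd_eq_of_hasLineDerivAt {g : E3 → ℝ} {c : ℝ} {x : E3} {j : Fin 3} (hd : DifferentiableAt ℝ g x)
    (h : HasLineDerivAt ℝ g c x (unitVec j)) : pd j g x = c :=
  (hd.hasFDerivAt.hasLineDerivAt (unitVec j)).unique h

lemma sum_wkD_sq {x : E3} (hx : x ≠ 0) : ∑ m, wkD lam m x ^ 2 = lam * wk lam x * ‖x‖⁻¹ := by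
  have hx' : ‖x‖ ≠ 0 := norm_ne_zero_iff.2 hx
  have h := normSq_eq x
  simp only [Fin.sum_univ_three, wkD, wk, kron]
  simp only [if_true, Fin.isValue, one_ne_zero, if_false, add_zero, Fin.reduceEq]
  field_simp
  linear_combination (-lam ^ 2) * h

lemma sum_wkDD {x : E3} (hx : x ≠ 0) : ∑ m, wkDD lam m m x = lam * ‖x‖⁻¹ := by
  have hx' : ‖x‖ ≠ 0 := norm_ne_zero_iff.2 hx
  have h := normSq_eq x
  simp only [Fin.sum_univ_three, wkDD, kron, if_true]
  field_simp
  linear_combination lam * h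

/-- The factor `wk` on the right, which comes from `sum_wkD_sq`, is what compensates `expMeanD`: of
the latter only σ·`expMeanD` σ is bounded by 1 directly. -/
lemma abs_wkD_mul_le {x : E3} (hx : x ≠ 0) (j l : Fin 3) :
    |wkD lam j x * wkD lam l x| ≤ lam * wk lam x * ‖x‖⁻¹ := by
  rw [← sum_wkD_sq hx]
  have h := fun m => Finset.single_le_sum (f := fun m => wkD lam m x ^ 2) (fun i _ => sq_nonneg _) (Finset.mem_univ m)
  have h1 := h j
  have h2 := h l
  rw [abs_mul]
  nlinarith [sq_abs (wkD lam j x), sq_abs (wkD lam l x), sq_nonneg (|wkD lam j x| - |wkD lam l x|)]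

lemma abs_wkDD_le (hlam : 0 < lam) {x : E3} (hx : x ≠ 0) (j l : Fin 3) : |wkDD lam j l x| ≤ lam * ‖x‖⁻¹ := by
  have hx' : 0 < ‖x‖ := norm_pos_iff.2 hx
  unfold wkDD
  have h1 := abs_kron_le l j
  have h2 : |x j * x l * (‖x‖⁻¹) ^ 3| ≤ ‖x‖⁻¹ := by
    rw [abs_mul, abs_of_nonneg (by positivity : 0 ≤ (‖x‖⁻¹) ^ 3)]
    calc |x j * x l| * (‖x‖⁻¹) ^ 3 ≤ ‖x‖ ^ 2 * (‖x‖⁻¹) ^ 3 :=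
          mul_le_mul_of_nonneg_right (abs_coord_mul_le x j l) (by positivity)
      _ = _ := by field_simp
  have h3 : |kron l j * ‖x‖⁻¹| ≤ ‖x‖⁻¹ := by
    rw [abs_mul, abs_of_pos (inv_pos.2 hx')]
    exact mul_le_of_le_one_left (by positivity) h1
  rw [abs_mul, abs_of_pos (by positivity : 0 < lam / 2)]
  calc lam / 2 * |kron l j * ‖x‖⁻¹ - x j * x l * (‖x‖⁻¹) ^ 3| ≤ lam / 2 * (‖x‖⁻¹ + ‖x‖⁻¹) := by
        refine mul_le_mul_of_nonneg_left ?_ (by positivity)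
        exact (abs_sub _ _).trans (add_le_add h3 h2)
    _ = _ := by ring

lemma abs_wkD_le (hlam : 0 < lam) (x : E3) (l : Fin 3) : |wkD lam l x| ≤ lam := by
  unfold wkD
  rw [abs_mul, abs_of_pos (by positivity : 0 < lam / 2)]
  have h1 : |x l * ‖x‖⁻¹| ≤ 1 := by
    rw [abs_mul, abs_inv, abs_norm, ← div_eq_mul_inv]
    exact div_le_one_of_le₀ (abs_coord_le x l) (norm_nonneg _)
  have h2 := abs_kron_le l 0
  nlinarith [abs_add_le (x l * ‖x‖⁻¹) (kron l 0)]

/-- The first derivatives of the Oseen potential. -/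
def oseenD (lam : ℝ) (l : Fin 3) (x : E3) : ℝ := expMean (wk lam x) * wkD lam l x

/-- The second derivatives of the Oseen potential. -/
def oseenDD (lam : ℝ) (j l : Fin 3) (x : E3) : ℝ :=
  expMeanD (wk lam x) * wkD lam j x * wkD lam l x + expMean (wk lam x) * wkDD lam j l x

lemma oseenPotential_eq (hlam : 0 < lam) (x : E3) :
    oseenPotential lam x = ∫ τ in (0 : ℝ)..wk lam x, expMean τ := by
  unfold oseenPotential
  rw [wake_eq_wk hlam]
  refine intervalIntegral.integral_congr_ae ?_
  have : ∀ᵐ τ : ℝ, τ ≠ 0 := by simp [ae_iff]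
  filter_upwards [this] with τ hτ _
  rw [← mul_expMean]; field_simp

lemma hasDerivAt_int_expMean (σ : ℝ) : HasDerivAt (fun σ => ∫ τ in (0 : ℝ)..σ, expMean τ) (expMean σ) σ :=
  (continuous_expMean.integral_hasStrictDerivAt 0 σ).hasDerivAt

lemma continuous_oseenPotential (hlam : 0 < lam) : Continuous (oseenPotential lam) := by
  rw [funext (oseenPotential_eq hlam)]
  exact (continuous_iff_continuousAt.2 fun σ => (hasDerivAt_int_expMean σ).continuousAt).comp continuous_wk

lemma hasLineDerivAt_oseenPotential (hlam : 0 < lam) {x : E3} (hx : x ≠ 0) (l : Fin 3) :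
    HasLineDerivAt ℝ (oseenPotential lam) (oseenD lam l x) x (unitVec l) := by
  rw [funext (oseenPotential_eq hlam)]
  have h := hasLineDerivAt_wk (lam := lam) hx l
  unfold HasLineDerivAt at *
  have := HasDerivAt.comp (0 : ℝ) (hasDerivAt_int_expMean _) h
  exact this.congr_deriv (by simp [oseenD])

lemma hasLineDerivAt_oseenD {x : E3} (hx : x ≠ 0) (j l : Fin 3) :
    HasLineDerivAt ℝ (oseenD lam l) (oseenDD lam j l x) x (unitVec j) := by
  have h := hasLineDerivAt_wk (lam := lam) hx j
  have h' := hasLineDerivAt_wkD (lam := lam) hx j l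
  unfold HasLineDerivAt at *
  have := (HasDerivAt.comp (0 : ℝ) (hasDerivAt_expMean _) h).mul h'
  exact this.congr_deriv (by simp [oseenDD])

lemma pd_oseenPotential (hlam : 0 < lam) {x : E3} (hx : x ≠ 0) (l : Fin 3) :
    pd l (oseenPotential lam) x = oseenD lam l x := by
  refine pd_eq_of_hasLineDerivAt ?_ (hasLineDerivAt_oseenPotential hlam hx l)
  rw [funext (oseenPotential_eq hlam)]
  exact (hasDerivAt_int_expMean _).differentiableAt.comp x (differentiableAt_wk hx)

lemma pd_pd_oseenPotential (hlam : 0 < lam) {x : E3} (hx : x ≠ 0) (j l : Fin 3) :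
    pd j (pd l (oseenPotential lam)) x = oseenDD lam j l x := by
  have he : pd l (oseenPotential lam) =ᶠ[𝓝 x] oseenD lam l :=
    (eventually_ne_nhds hx).mono fun y hy => pd_oseenPotential hlam hy l
  have h1 : pd j (pd l (oseenPotential lam)) x = pd j (oseenD lam l) x := by
    unfold pd at he ⊢; rw [he.fderiv_eq]
  rw [h1]
  refine pd_eq_of_hasLineDerivAt ?_ (hasLineDerivAt_oseenD hx j l)
  exact ((hasDerivAt_expMean _).differentiableAt.comp x (differentiableAt_wk hx)).mul (differentiableAt_wkD hx l)

lemma continuousOn_oseenD (l : Fin 3) : ContinuousOn (oseenD lam l) {0}ᶜ :=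
  (continuous_expMean.comp continuous_wk).continuousOn.mul (continuousOn_wkD l)

lemma continuousOn_oseenDD (j l : Fin 3) : ContinuousOn (oseenDD lam j l) {0}ᶜ :=
  (((continuous_expMeanD.comp continuous_wk).continuousOn.mul (continuousOn_wkD j)).mul (continuousOn_wkD l)).add
    ((continuous_expMean.comp continuous_wk).continuousOn.mul (continuousOn_wkDD j l))

lemma abs_oseenD_le (hlam : 0 < lam) (l : Fin 3) (x : E3) : |oseenD lam l x| ≤ lam := by
  have h := expMean_mem (wk_nonneg hlam x)
  unfold oseenD
  rw [abs_mul, abs_of_nonneg h.1]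
  exact (mul_le_of_le_one_left (abs_nonneg _) h.2).trans (abs_wkD_le hlam x l)

lemma abs_oseenDD_le (hlam : 0 < lam) (j l : Fin 3) {x : E3} (hx : x ≠ 0) :
    |oseenDD lam j l x| ≤ 2 * lam * ‖x‖⁻¹ := by
  have h := expMean_mem (wk_nonneg hlam x)
  unfold oseenDD
  have h1 : |expMean (wk lam x) * wkDD lam j l x| ≤ lam * ‖x‖⁻¹ := by
    rw [abs_mul, abs_of_nonneg h.1]
    exact (mul_le_of_le_one_left (abs_nonneg _) h.2).trans (abs_wkDD_le hlam hx j l)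
  have h2 : |expMeanD (wk lam x) * wkD lam j x * wkD lam l x| ≤ lam * ‖x‖⁻¹ := by
    rw [mul_assoc, abs_mul]
    have h3 := abs_mul_expMeanD_le (wk_nonneg hlam x)
    rw [abs_mul, abs_of_nonneg (wk_nonneg hlam x)] at h3
    calc |expMeanD (wk lam x)| * |wkD lam j x * wkD lam l x|
        ≤ |expMeanD (wk lam x)| * (lam * wk lam x * ‖x‖⁻¹) :=
          mul_le_mul_of_nonneg_left (abs_wkD_mul_le hx j l) (abs_nonneg _)
      _ = (wk lam x * |expMeanD (wk lam x)|) * (lam * ‖x‖⁻¹) := by ring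
      _ ≤ _ := mul_le_of_le_one_left (by positivity) h3
  calc _ ≤ lam * ‖x‖⁻¹ + lam * ‖x‖⁻¹ := (abs_add_le _ _).trans (add_le_add h2 h1)
    _ = _ := by ring

/-- With σ = `wk`, the chain rule gives the Laplacian `expMeanD` σ·|∇σ|² + `expMean` σ·Δσ. As |∇σ|²
= λσ/|x| and Δσ = λ/|x|, this is λe^{-σ}/|x| by `expMean_add`. -/
lemma sum_oseenDD (hlam : 0 < lam) {x : E3} (hx : x ≠ 0) :
    ∑ m, oseenDD lam m m x = 4 * Real.pi * lam * vortSteady lam x := by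
  have hx' : ‖x‖ ≠ 0 := norm_ne_zero_iff.2 hx
  have e : ∑ m, oseenDD lam m m x = expMeanD (wk lam x) * ∑ m, wkD lam m x ^ 2 +
      expMean (wk lam x) * ∑ m, wkDD lam m m x := by
    simp only [oseenDD, Finset.sum_add_distrib, Finset.mul_sum]
    congr 1
    exact Finset.sum_congr rfl fun m _ => by ring
  rw [e, sum_wkD_sq hx, sum_wkDD hx, vortSteady, wake_eq_wk hlam, ← expMean_add]
  have := Real.pi_ne_zero
  field_simp
  ring

lemma isWeakPartialE_oseenPotential (hlam : 0 < lam) (l : Fin 3) :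
    IsWeakPartialE l (oseenPotential lam) (oseenD lam l) := by
  obtain ⟨C, hC⟩ := (isCompact_closedBall (0 : E3) 2).exists_bound_of_continuousOn
    (continuous_oseenPotential hlam).continuousOn
  refine isWeakPartialE_of_punctured (C := C) (continuous_oseenPotential hlam).continuousOn (continuousOn_oseenD l)
    (fun x hx => hasLineDerivAt_oseenPotential hlam hx l) (continuous_oseenPotential hlam).locallyIntegrable
    ?_ ((norm_nonneg _).trans (hC 0 (by simp))) (fun x hx => hC x (by simpa using hx))
  refine LocallyIntegrable.mono (locallyIntegrable_const lam) (aestronglyMeasurable_of_punctured (continuousOn_oseenD l))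
    (Eventually.of_forall fun x => ?_)
  exact (abs_oseenD_le hlam l x).trans (le_abs_self _)

lemma isWeakPartialE_oseenD (hlam : 0 < lam) (j l : Fin 3) :
    IsWeakPartialE j (oseenD lam l) (oseenDD lam j l) :=
  isWeakPartialE_of_punctured (C := lam) (continuousOn_oseenD l) (continuousOn_oseenDD j l)
    (fun _ hx => hasLineDerivAt_oseenD hx j l) (isWeakPartialE_oseenPotential hlam l).2.1
    (locallyIntegrable_of_punctured (continuousOn_oseenDD j l) fun _ hx => abs_oseenDD_le hlam j l hx)
    hlam.le (fun x _ => abs_oseenD_le hlam l x)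


/-! ### Identification of the steady velocity kernel -/

section SteadyVelocity

variable {T : ℝ} [hT : Fact (0 < T)] {lam : ℝ}

lemma pd_comm {χ : E3 → ℝ} (h : IsTestE χ) (j l : Fin 3) : pd j (pd l χ) = pd l (pd j χ) := by
  have : Fact ((0 : ℝ) < 1) := ⟨one_pos⟩
  ext x
  exact congrFun (pdx_comm (T := 1) h.isTestG j l) (0, x)

lemma IsTestE.sum {ι : Type*} (s : Finset ι) {φ : ι → E3 → ℝ} (h : ∀ i, IsTestE (φ i)) :
    IsTestE (fun x => ∑ i ∈ s, φ i x) := by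
  classical
  induction s using Finset.induction_on with
  | empty => exact ⟨by simpa using contDiff_const, HasCompactSupport.zero (α := E3) (β := ℝ)⟩
  | insert a s ha ih => simpa only [Finset.sum_insert ha] using (h a).add ih

lemma pd_sum {ι : Type*} (s : Finset ι) {φ : ι → E3 → ℝ} (h : ∀ i, IsTestE (φ i)) (j : Fin 3) :
    pd j (fun x => ∑ i ∈ s, φ i x) = fun x => ∑ i ∈ s, pd j (φ i) x := by
  classical
  induction s using Finset.induction_on with
  | empty => ext x; simp [pd]
  | insert a s ha ih =>
    simp only [Finset.sum_insert ha]
    rw [pd_add (h a) (IsTestE.sum s h), ih]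

lemma pd_lapE {χ : E3 → ℝ} (h : IsTestE χ) (j : Fin 3) : pd j (lapE χ) = lapE (pd j χ) := by
  have := pd_sum Finset.univ (fun m => (h.pd m).pd m) j
  unfold lapE
  rw [this]
  ext x
  exact Finset.sum_congr rfl fun m _ => by rw [pd_comm (h.pd m) j m, pd_comm h j m]

lemma driftE_eq (χ : E3 → ℝ) : driftE lam χ = fun x => -1 * lapE χ x + lam * pd 0 χ x := by
  ext x; simp [driftE]

lemma pd_driftE {χ : E3 → ℝ} (h : IsTestE χ) (j : Fin 3) : pd j (driftE lam χ) = driftE lam (pd j χ) := by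
  rw [driftE_eq, driftE_eq, pd_add (h.lapE.const_mul _) ((h.pd 0).const_mul _), pd_const_mul h.lapE,
    pd_const_mul (h.pd 0), pd_lapE h, pd_comm h j 0]

lemma lapE_driftE {χ : E3 → ℝ} (h : IsTestE χ) : lapE (driftE lam χ) = driftE lam (lapE χ) := by
  ext x
  rw [driftE_eq, driftE_eq, lapE_add (h.lapE.const_mul _) ((h.pd 0).const_mul _), lapE_const_mul h.lapE,
    lapE_const_mul (h.pd 0), pd_lapE h]

lemma driftE_add {φ ψ : E3 → ℝ} (h : IsTestE φ) (h' : IsTestE ψ) :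
    driftE lam (fun x => φ x + ψ x) = fun x => driftE lam φ x + driftE lam ψ x := by
  ext x
  simp only [driftE, lapE_add h h', pd_add h h']; ring

lemma driftE_const_mul {φ : E3 → ℝ} (h : IsTestE φ) (c : ℝ) :
    driftE lam (fun x => c * φ x) = fun x => c * driftE lam φ x := by
  ext x
  simp only [driftE, lapE_const_mul h, pd_const_mul h]; ring

lemma adjOp_comp_snd (χ : E3 → ℝ) (p : G T) : adjOp lam (fun q : G T => χ q.2) p = driftE lam χ p.2 := by
  have h : pdt (fun q : G T => χ q.2) p = 0 := by simp [pdt]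
  unfold adjOp driftE
  rw [h, neg_zero, zero_sub]; rfl

lemma integral_per_heat_adj (hlam : 0 < lam) {g : G T → ℝ} (h : IsTestG T g) :
    ∫ p, per T lam heat p * adjOp lam g p ∂(muG T) = g 0 := by
  have h1 := integral_per_heat_mul hlam (h.adjOp lam)
  have h2 := ft_inversion h 0
  have : ((∫ p, per T lam heat p * adjOp lam g p ∂(muG T) : ℝ) : ℂ) = ((g 0 : ℝ) : ℂ) := by
    rw [h1, h2]
    congr 1
    refine integral_congr_ae ?_
    filter_upwards [ae_kap_ne_zero] with κ hκ
    have e1 : charInv κ (0 : G T) = 1 := by simp [charInv, fourier_apply]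
    have hs := sig_ne_zero (T := T) (lam := lam) hκ
    rw [e1, mul_one, ft_adjOp h]
    field_simp
  exact_mod_cast this

lemma Kern.integral_stat_mul {k : ℝ → E3 → ℝ} (h : Kern k) (hlam : 0 < lam) {χ : E3 → ℝ} (hχ : IsTestE χ) :
    ∫ x, stat lam k x * χ x = ∫ p, per T lam k p * χ p.2 ∂(muG T) := by
  rw [integral_mul_comp_snd (h.locallyIntegrable_per hlam) hχ.1.continuous hχ.2]
  refine integral_congr_ae ((h.mean_per (T := T) hlam).mono fun x hx => ?_)
  simp only [hx]

lemma Kern.locallyIntegrable_stat {k : ℝ → E3 → ℝ} (h : Kern k) (hlam : 0 < lam) :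
    LocallyIntegrable (stat lam k) := by
  -- The steady kernel involves no period, so its properties are read off from the periodization
  -- with period 1.
  have : Fact ((0 : ℝ) < 1) := ⟨one_pos⟩
  exact (locallyIntegrable_mean (h.locallyIntegrable_per (T := 1) hlam)).congr (h.mean_per hlam)

lemma Kern.enorm_stat_le {k : ℝ → E3 → ℝ} (h : Kern k) (hlam : 0 < lam) :
    ∃ C : ℝ≥0, ∀ x, x ≠ 0 → ‖stat lam k x‖ₑ ≤ C * maj x := by
  have : Fact ((0 : ℝ) < 1) := ⟨one_pos⟩
  obtain ⟨C, hC⟩ := h.lintegral_per_le (T := 1) hlam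
  refine ⟨C, fun x hx => ?_⟩
  rw [← (h.integral_per (T := 1) hlam hx).2]
  exact (enorm_integral_le_lintegral_enorm _).trans (hC x)

lemma integral_stat_heat (hlam : 0 < lam) {χ : E3 → ℝ} (hχ : IsTestE χ) :
    ∫ x, stat lam heat x * driftE lam χ x = χ 0 := by
  have : Fact ((0 : ℝ) < 1) := ⟨one_pos⟩
  rw [kern_heat.integral_stat_mul (T := 1) hlam (hχ.driftE lam)]
  have := integral_per_heat_adj (T := 1) hlam (hχ.isTestG)
  simp_rw [adjOp_comp_snd] at this
  exact this

lemma integral_stat_vel (hlam : 0 < lam) {χ : E3 → ℝ} (hχ : IsTestE χ) (j l : Fin 3) :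
    ∫ x, stat lam (velKern j l) x * lapE (driftE lam χ) x = kron j l * lapE χ 0 - pd j (pd l χ) 0 := by
  have : Fact ((0 : ℝ) < 1) := ⟨one_pos⟩
  rw [(kern_vel j l).integral_stat_mul (T := 1) hlam (hχ.driftE lam).lapE]
  have := integral_per_vel_adj (T := 1) hlam (hχ.isTestG) j l
  rw [funext (adjOp_comp_snd χ)] at this
  exact this

lemma integral_oseenDD (hlam : 0 < lam) (j l : Fin 3) {ψ : E3 → ℝ} (hψ : IsTestE ψ) :
    ∫ x, oseenDD lam j l x * ψ x = ∫ x, oseenPotential lam x * pd l (pd j ψ) x := by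
  rw [(isWeakPartialE_oseenPotential hlam l).2.2 _ (hψ.pd j), (isWeakPartialE_oseenD hlam j l).2.2 _ hψ, neg_neg]

lemma integral_potential_lap (hlam : 0 < lam) {ψ : E3 → ℝ} (hψ : IsTestE ψ) :
    ∫ x, oseenPotential lam x * lapE ψ x = 4 * Real.pi * lam * ∫ x, stat lam heat x * ψ x := by
  have hc := continuous_oseenPotential hlam
  unfold lapE
  simp_rw [Finset.mul_sum]
  rw [integral_finsetSum _ fun m _ => LocallyIntegrable.mul_test hc.locallyIntegrable
    ((hψ.pd m).pd m).1.continuous ((hψ.pd m).pd m).2]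
  simp_rw [← integral_oseenDD hlam _ _ hψ]
  rw [← integral_finsetSum _ fun m _ => LocallyIntegrable.mul_test (isWeakPartialE_oseenD hlam m m).2.1
    hψ.1.continuous hψ.2, ← integral_const_mul]
  refine integral_congr_ae ?_
  filter_upwards [ae_ne_zero] with x hx
  rw [← Finset.sum_mul, sum_oseenDD hlam hx, vortSteady_eq_stat hlam hx]; ring

lemma velSteady_eq (hlam : 0 < lam) (j l : Fin 3) {x : E3} (hx : x ≠ 0) :
    velSteady lam x j l = 1 / (4 * Real.pi * lam) *
      (kron j l * ∑ m, oseenDD lam m m x - oseenDD lam j l x) := by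
  simp only [velSteady, Matrix.of_apply, pd_pd_oseenPotential hlam hx, kron]
  split_ifs <;> simp

/-- Tested with Δ(-Δ + λ∂_1)χ, both functions give δ_jl Δχ(0) - ∂_j∂_lχ(0). For the Oseen tensor all
derivatives are moved to χ; the Laplacian of the potential is 4πλφ_0, and φ_0 is the fundamental
solution of -Δ - λ∂_1. The difference is bounded by multiples of |x|^{-1} and `maj`, so `liouvilleE`
applies. -/
lemma velSteady_ae_eq_stat (hlam : 0 < lam) (j l : Fin 3) :
    (fun x => velSteady lam x j l) =ᵐ[volume] stat lam (velKern j l) := by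
  set V : E3 → ℝ := fun x => 1 / (4 * Real.pi * lam) *
      (kron j l * ∑ m, oseenDD lam m m x - oseenDD lam j l x) with hV
  have hVe : (fun x => velSteady lam x j l) =ᵐ[volume] V := by
    filter_upwards [ae_ne_zero] with x hx using velSteady_eq hlam j l hx
  refine hVe.trans ?_
  have hVc : ContinuousOn V {0}ᶜ :=
    continuousOn_const.mul ((continuousOn_const.mul (continuousOn_finsetSum _ fun m _ => continuousOn_oseenDD m m)).sub
      (continuousOn_oseenDD j l))
  have hVb : ∀ x, x ≠ 0 → |V x| ≤ (1 / (4 * Real.pi * lam) * (8 * lam)) * ‖x‖⁻¹ := by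
    intro x hx
    have hp := Real.pi_pos
    simp only [hV]
    rw [abs_mul, abs_of_nonneg (by positivity : 0 ≤ 1 / (4 * Real.pi * lam)), mul_assoc (1 / (4 * Real.pi * lam))]
    refine mul_le_mul_of_nonneg_left ?_ (by positivity)
    have h1 : |∑ m, oseenDD lam m m x| ≤ ∑ m : Fin 3, 2 * lam * ‖x‖⁻¹ :=
      (Finset.abs_sum_le_sum_abs _ _).trans (Finset.sum_le_sum fun m _ => abs_oseenDD_le hlam m m hx)
    have h2 := abs_oseenDD_le hlam j l hx
    have h3 : |kron j l * ∑ m, oseenDD lam m m x| ≤ |∑ m, oseenDD lam m m x| := by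
      rw [abs_mul]; exact mul_le_of_le_one_left (abs_nonneg _) (abs_kron_le j l)
    simp only [Finset.sum_const, Finset.card_univ, Fintype.card_fin, nsmul_eq_mul] at h1
    refine (abs_sub _ _).trans ?_
    push_cast at h1
    linarith
  have hVl := locallyIntegrable_of_punctured hVc hVb
  have hSl := (kern_vel j l).locallyIntegrable_stat hlam
  obtain ⟨C, hC⟩ := (kern_vel j l).enorm_stat_le hlam
  have hint : ∀ {ψ : E3 → ℝ}, IsTestE ψ → ∫ x, V x * ψ x = 1 / (4 * Real.pi * lam) *
      ∫ x, oseenPotential lam x * (kron j l * lapE ψ x + -1 * pd l (pd j ψ) x) := by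
    intro ψ hψ
    have i1 : ∀ a b, Integrable fun x => oseenDD lam a b x * ψ x := fun a b =>
      LocallyIntegrable.mul_test (isWeakPartialE_oseenD hlam a b).2.1 hψ.1.continuous hψ.2
    have hc := (continuous_oseenPotential hlam).locallyIntegrable (μ := (volume : Measure E3))
    have i2 : ∀ {g : E3 → ℝ}, IsTestE g → Integrable fun x => oseenPotential lam x * g x := fun hg =>
      LocallyIntegrable.mul_test hc hg.1.continuous hg.2
    have e1 : ∀ x, V x * ψ x = 1 / (4 * Real.pi * lam) *
        (kron j l * ∑ m, oseenDD lam m m x * ψ x - oseenDD lam j l x * ψ x) := by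
      intro x; simp only [hV, ← Finset.sum_mul]; ring
    have e2 : ∀ x, oseenPotential lam x * (kron j l * lapE ψ x + -1 * pd l (pd j ψ) x) =
        kron j l * (∑ m, oseenPotential lam x * pd m (pd m ψ) x) - oseenPotential lam x * pd l (pd j ψ) x := by
      intro x; simp only [lapE, ← Finset.mul_sum]; ring
    simp_rw [e1, e2]
    rw [integral_const_mul, integral_sub ((integrable_finsetSum _ fun m _ => i1 m m).const_mul _) (i1 j l),
      integral_sub ((integrable_finsetSum _ fun m _ => i2 ((hψ.pd m).pd m)).const_mul _) (i2 ((hψ.pd j).pd l)),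
      integral_const_mul, integral_const_mul, integral_finsetSum _ fun m _ => i1 m m,
      integral_finsetSum _ fun m _ => i2 ((hψ.pd m).pd m)]
    simp_rw [integral_oseenDD hlam _ _ hψ]
  have hz := liouvilleE (d := fun x => V x - stat lam (velKern j l) x) (hVl.sub hSl) ?_ lam ?_
  · exact hz.mono fun x hx => sub_eq_zero.1 hx
  · have h1 := vanishAvg_inv_norm.const_mul (1 / (4 * Real.pi * lam) * (8 * lam)).toNNReal
    have h2 := vanishAvg_maj.const_mul C
    refine (h1.add h2 (by fun_prop)).mono ?_
    filter_upwards [ae_ne_zero] with x hx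
    refine (enorm_sub_le).trans (add_le_add ?_ (hC x hx))
    rw [← ofReal_norm, Real.norm_eq_abs]
    refine (ENNReal.ofReal_le_ofReal (hVb x hx)).trans ?_
    rw [ENNReal.ofReal_mul (by have := Real.pi_pos; positivity)]
    rfl
  · intro χ hχ
    have h0 := (hχ.driftE lam).lapE
    simp_rw [sub_mul]
    rw [integral_sub (LocallyIntegrable.mul_test hVl h0.1.continuous h0.2)
      (LocallyIntegrable.mul_test hSl h0.1.continuous h0.2), integral_stat_vel hlam hχ, hint h0]
    have t1 := hχ.lapE.const_mul (kron j l)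
    have t2 := ((hχ.pd j).pd l).const_mul (-1)
    -- All these constant-coefficient operators commute, so one Laplacian can be placed outermost,
    -- where it meets the potential.
    have e : ∀ x, kron j l * lapE (lapE (driftE lam χ)) x + -1 * pd l (pd j (lapE (driftE lam χ))) x =
        lapE (driftE lam (fun x => kron j l * lapE χ x + -1 * pd l (pd j χ) x)) x := by
      intro x
      rw [driftE_add t1 t2, driftE_const_mul hχ.lapE, driftE_const_mul ((hχ.pd j).pd l),
        lapE_add ((hχ.lapE.driftE lam).const_mul _) ((((hχ.pd j).pd l).driftE lam).const_mul _),
        lapE_const_mul (hχ.lapE.driftE lam), lapE_const_mul (((hχ.pd j).pd l).driftE lam), ← lapE_driftE hχ,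
        pd_lapE (hχ.driftE lam), pd_driftE hχ, pd_lapE ((hχ.pd j).driftE lam), pd_driftE (hχ.pd j)]
    simp_rw [e]
    rw [integral_potential_lap hlam ((t1.add t2).driftE lam), integral_stat_heat hlam (t1.add t2),
      pd_comm hχ j l]
    have := Real.pi_ne_zero
    field_simp
    ring

end SteadyVelocity


/-! ### The product rule for weak derivatives -/

section ProductRule

variable {T : ℝ} [hT : Fact (0 < T)] {i : Fin 3}

/-- The element of `G` that translates by `s` in the direction `i`. -/
def shf (T : ℝ) (i : Fin 3) (s : ℝ) : G T := (0, s • unitVec i)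

lemma continuous_shf : Continuous (shf T i) := by unfold shf; fun_prop

lemma shf_zero : shf T i 0 = 0 := by simp [shf]

lemma shf_neg (s : ℝ) : shf T i (-s) = -shf T i s := by simp [shf]

lemma norm_unitVec (i : Fin 3) : ‖unitVec i‖ = 1 := by simp [unitVec]

lemma exists_ball_support {φ : G T → ℝ} (hs : HasCompactSupport φ) :
    ∃ R, 0 ≤ R ∧ ∀ (p : G T), R < ‖p.2‖ → φ p = 0 := by
  obtain ⟨R, hR⟩ := (hs.isCompact.image continuous_snd).isBounded.subset_closedBall 0
  refine ⟨max R 0, le_max_right _ _, fun p hp => ?_⟩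
  by_contra h
  have := hR ⟨p, subset_tsupport _ h, rfl⟩
  rw [mem_closedBall_zero_iff] at this
  exact absurd hp (not_lt.2 (this.trans (le_max_left _ _)))

/-- A cylinder in `G`. -/
def cyl (T R : ℝ) : Set (G T) := univ ×ˢ Metric.closedBall 0 R

lemma isCompact_cyl (R : ℝ) : IsCompact (cyl T R) := isCompact_univ.prod (isCompact_closedBall _ _)

lemma exists_shift_bound {φ : G T → ℝ} (hc : Continuous φ) (hs : HasCompactSupport φ) :
    ∃ M R, 0 ≤ M ∧ ∀ s r : ℝ, |s| ≤ r → ∀ p, |φ (p + shf T i s)| ≤ (cyl T (R + r)).indicator (fun _ => M) p := by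
  obtain ⟨R, hR0, hR⟩ := exists_ball_support hs
  obtain ⟨M, hM⟩ := hs.exists_bound_of_continuous hc
  refine ⟨M, R, (norm_nonneg _).trans (hM 0), fun s r hsr p => ?_⟩
  by_cases hp : p ∈ cyl T (R + r)
  · rw [indicator_of_mem hp]; exact hM _
  · rw [indicator_of_notMem hp, hR _ ?_, abs_zero]
    have h1 : R + r < ‖p.2‖ := by
      by_contra h
      exact hp ⟨trivial, by simpa using not_lt.1 h⟩
    have h2 : ‖p.2‖ - ‖s • unitVec i‖ ≤ ‖p.2 + s • unitVec i‖ := by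
      have := norm_sub_norm_le p.2 (-(s • unitVec i))
      simpa using this
    rw [norm_smul, norm_unitVec, mul_one, Real.norm_eq_abs] at h2
    have : ‖(p + shf T i s).2‖ = ‖p.2 + s • unitVec i‖ := rfl
    rw [this]; linarith

lemma integrable_indicator_cyl {g : G T → ℝ} (hg : LocallyIntegrable g (muG T)) (R M : ℝ) :
    Integrable (fun p => ‖g p‖ * (cyl T R).indicator (fun _ => M) p) (muG T) := by
  have h := (hg.integrableOn_isCompact (isCompact_cyl R)).norm.mul_const M
  rw [← IntegrableOn, ← integrable_indicator_iff (isCompact_cyl R).measurableSet] at h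
  refine h.congr (Eventually.of_forall fun p => ?_)
  by_cases hp : p ∈ cyl T R <;> simp [hp]

lemma hasDerivAt_shift_test {φ : G T → ℝ} (hφ : IsTestG T φ) (p : G T) (s : ℝ) :
    HasDerivAt (fun s => φ (p + shf T i s)) (pdx i φ (p + shf T i s)) s := by
  have h1 := ((hφ.slice p.1).1.differentiable (by simp) (p.2 + s • unitVec i)).hasFDerivAt
  have h2 : HasDerivAt (fun s : ℝ => p.2 + s • unitVec i) (unitVec i) s := by
    simpa using ((hasDerivAt_id s).smul_const (unitVec i)).const_add p.2
  have h3 := h1.comp_hasDerivAt s h2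
  have e : ∀ r : ℝ, p + shf T i r = (p.1, p.2 + r • unitVec i) := fun r => by
    ext1 <;> simp [shf]
  simp_rw [e]
  exact h3

lemma hasDerivAt_integral_shift {g φ : G T → ℝ} (hg : LocallyIntegrable g (muG T)) (hφ : IsTestG T φ) (s : ℝ) :
    HasDerivAt (fun s => ∫ p, g p * φ (p + shf T i s) ∂(muG T))
      (∫ p, g p * pdx i φ (p + shf T i s) ∂(muG T)) s := by
  obtain ⟨M, R, hM, hb⟩ := exists_shift_bound (i := i) (hφ.pdx i).continuous (hφ.pdx i).2
  refine (hasDerivAt_integral_of_dominated_loc_of_deriv_le (s := Metric.ball s 1)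
    (F' := fun s p => g p * pdx i φ (p + shf T i s))
    (bound := fun p => ‖g p‖ * (cyl T (R + (|s| + 1))).indicator (fun _ => M) p)
    (Metric.ball_mem_nhds s one_pos) ?_ ?_ ?_ ?_ ?_ ?_).2
  · exact Eventually.of_forall fun r => hg.aestronglyMeasurable.mul
      (hφ.comp_add _).continuous.aestronglyMeasurable
  · exact LocallyIntegrable.mul_test hg (hφ.comp_add _).continuous (hφ.comp_add _).2
  · exact hg.aestronglyMeasurable.mul ((hφ.pdx i).comp_add _).continuous.aestronglyMeasurable
  · refine Eventually.of_forall fun p r hr => ?_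
    have hr' : |r| ≤ |s| + 1 := by
      have h1 : |r - s| < 1 := hr
      have := abs_sub_abs_le_abs_sub r s
      linarith
    rw [norm_mul]
    exact mul_le_mul_of_nonneg_left (hb r _ hr' p) (norm_nonneg _)
  · exact integrable_indicator_cyl hg _ _
  · exact Eventually.of_forall fun p r _ => (hasDerivAt_shift_test hφ p r).const_mul _

lemma integral_shift (h φ : G T → ℝ) (q : G T) :
    ∫ p, h (p + q) * φ p ∂(muG T) = ∫ p, h p * φ (p + -q) ∂(muG T) := by
  rw [← integral_add_right_eq_self (fun p => h p * φ (p + -q)) q]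
  simp

lemma LocallyIntegrable.shift {h : G T → ℝ} (hh : LocallyIntegrable h (muG T)) (q : G T) :
    LocallyIntegrable (fun p => h (p + q)) (muG T) := by
  rw [locallyIntegrable_iff] at hh ⊢
  intro K hK
  have := (measurePreserving_add_right (muG T) q).integrableOn_image (f := h)
    (MeasurableEquiv.addRight q).measurableEmbedding (s := K)
  exact this.1 (hh _ (hK.image (continuous_add_const q)))

/-- Joint integrability of translates against a continuous function of compact support. -/
lemma integrable_shift_prod {h φ : G T → ℝ} (hh : LocallyIntegrable h (muG T)) (hm : StronglyMeasurable h)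
    (hc : Continuous φ) (hs : HasCompactSupport φ) (ε : ℝ) :
    Integrable (fun z : G T × ℝ => h (z.1 + shf T i z.2) * φ z.1) ((muG T).prod (volume.restrict (Ioc 0 ε))) := by
  obtain ⟨M, R, hM, hb⟩ := exists_shift_bound (i := i) hc hs
  have hms : StronglyMeasurable (fun z : G T × ℝ => h (z.1 + shf T i z.2) * φ z.1) := by
    refine (hm.comp_measurable ?_).mul (hc.comp continuous_fst).stronglyMeasurable
    exact (continuous_fst.add (continuous_shf.comp continuous_snd)).measurable
  refine (integrable_prod_iff' hms.aestronglyMeasurable).2 ⟨Eventually.of_forall fun s =>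
    LocallyIntegrable.mul_test (LocallyIntegrable.shift hh (shf T i s)) hc hs, ?_⟩
  refine Integrable.of_bound hms.norm.integral_prod_left'.aestronglyMeasurable
    (∫ p, ‖h p‖ * (cyl T (R + ε)).indicator (fun _ => M) p ∂(muG T)) ?_
  refine (ae_restrict_iff' measurableSet_Ioc).2 (Eventually.of_forall fun s hs' => ?_)
  rw [Real.norm_of_nonneg (integral_nonneg fun _ => norm_nonneg _)]
  simp only [norm_mul]
  rw [integral_shift (fun p => ‖h p‖) (fun p => ‖φ p‖) (shf T i s)]
  refine integral_mono_of_nonneg (Eventually.of_forall fun p => by positivity) (integrable_indicator_cyl hh _ _)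
    (Eventually.of_forall fun p => mul_le_mul_of_nonneg_left ?_ (norm_nonneg _))
  rw [← shf_neg]
  exact hb (-s) ε (by rw [abs_neg, abs_of_pos hs'.1]; exact hs'.2) p

/-- The increment of a function is the integral of its weak derivative. -/
lemma IsWeakPartialG.ae_sub_eq {g h : G T → ℝ} (hw : IsWeakPartialG T i g h) (hm : StronglyMeasurable h)
    {ε : ℝ} (hε : 0 ≤ ε) :
    (fun p => g (p + shf T i ε) - g p) =ᵐ[muG T] fun p => ∫ s in Ioc 0 ε, h (p + shf T i s) := by
  have hI : ∀ {φ : G T → ℝ}, IsTestG T φ → Integrable (fun z : G T × ℝ => h (z.1 + shf T i z.2) * φ z.1)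
      ((muG T).prod (volume.restrict (Ioc 0 ε))) :=
    fun hφ => integrable_shift_prod hw.2.1 hm hφ.continuous hφ.2 ε
  have hms : StronglyMeasurable (fun z : G T × ℝ => h (z.1 + shf T i z.2)) :=
    hm.comp_measurable (continuous_fst.add (continuous_shf.comp continuous_snd)).measurable
  have hHl : LocallyIntegrable (fun p => ∫ s in Ioc 0 ε, h (p + shf T i s)) (muG T) := by
    rw [locallyIntegrable_iff]
    intro K hK
    -- A continuous cutoff equal to 1 on K reduces local integrability to the joint integrability
    -- against compactly supported functions.
    obtain ⟨χ, h1, -, h3, -⟩ := exists_continuous_one_zero_of_isCompact hK isClosed_empty (disjoint_empty _)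
    have h4 := (integrable_shift_prod (i := i) hw.2.1 hm χ.continuous h3 ε).integral_prod_left
    refine h4.integrableOn.congr_fun (fun p hp => ?_) hK.measurableSet
    simp [h1 hp]
  refine ae_eq_of_tests_G ((LocallyIntegrable.shift hw.1 _).sub hw.1) hHl fun φ hφ => ?_
  have e1 : ∫ p, (g (p + shf T i ε) - g p) * φ p ∂(muG T) =
      ∫ p, g p * φ (p + shf T i (-ε)) ∂(muG T) - ∫ p, g p * φ (p + shf T i (-0)) ∂(muG T) := by
    simp_rw [sub_mul]
    rw [integral_sub (LocallyIntegrable.mul_test (LocallyIntegrable.shift hw.1 _) hφ.continuous hφ.2)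
      (LocallyIntegrable.mul_test hw.1 hφ.continuous hφ.2), integral_shift, shf_neg, neg_zero, shf_zero]
    simp
  -- By duality the translation acts on φ, where it is differentiable classically; the weak
  -- derivative then transfers the result to h.
  have hder : ∀ s, HasDerivAt (fun s => ∫ p, g p * φ (p + shf T i (-s)) ∂(muG T))
      (∫ p, h p * φ (p + shf T i (-s)) ∂(muG T)) s := by
    intro s
    have h1 := (hasDerivAt_integral_shift (i := i) hw.1 hφ (-s)).scomp s (hasDerivAt_neg s)
    refine h1.congr_deriv ?_
    have h2 := hw.2.2 _ (hφ.comp_add (shf T i (-s)))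
    rw [pdx_comp_add] at h2
    rw [h2]; simp
  have hcont : Continuous fun s => ∫ p, h p * φ (p + shf T i (-s)) ∂(muG T) :=
    (continuous_iff_continuousAt.2 fun s =>
      (hasDerivAt_integral_shift (i := i) hw.2.1 hφ s).continuousAt).comp continuous_neg
  have e2 := intervalIntegral.integral_eq_sub_of_hasDerivAt (a := 0) (b := ε) (fun s _ => hder s)
    (hcont.intervalIntegrable _ _)
  rw [e1, ← e2, intervalIntegral.integral_of_le hε]
  have e3 : ∀ p, (∫ s in Ioc 0 ε, h (p + shf T i s)) * φ p = ∫ s in Ioc 0 ε, h (p + shf T i s) * φ p :=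
    fun p => (integral_mul_const _ _).symm
  simp_rw [e3]
  refine Eq.symm ((integral_integral_swap (hI hφ)).trans ?_)
  refine integral_congr_ae (Eventually.of_forall fun s => ?_)
  simp only
  rw [integral_shift, shf_neg]

lemma sq_lintegral_mul_le {X : Type*} [MeasurableSpace X] {μ : Measure X} {f g : X → ℝ≥0∞}
    (hf : AEMeasurable f μ) (hg : AEMeasurable g μ) :
    (∫⁻ x, f x * g x ∂μ) ^ 2 ≤ (∫⁻ x, f x ^ 2 ∂μ) * ∫⁻ x, g x ^ 2 ∂μ := by
  have h := ENNReal.lintegral_mul_le_Lp_mul_Lq μ Real.HolderConjugate.two_two hf hg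
  simp only [Pi.mul_apply, ENNReal.rpow_two] at h
  calc (∫⁻ x, f x * g x ∂μ) ^ 2
      ≤ ((∫⁻ x, f x ^ 2 ∂μ) ^ (1 / 2 : ℝ) * (∫⁻ x, g x ^ 2 ∂μ) ^ (1 / 2 : ℝ)) ^ 2 := by gcongr
    _ = _ := by
      rw [mul_pow, ← ENNReal.rpow_natCast, ← ENNReal.rpow_natCast, ← ENNReal.rpow_mul, ← ENNReal.rpow_mul]
      norm_num

/-- The product rule for squares. -/
theorem IsWeakPartialG.integral_mul_self {g h : G T → ℝ} (hw : IsWeakPartialG T i g h)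
    (hm : StronglyMeasurable h) (hg2 : LocallyIntegrable (fun p => g p ^ 2) (muG T))
    (hh2 : LocallyIntegrable (fun p => h p ^ 2) (muG T)) (hgm : StronglyMeasurable g)
    {φ : G T → ℝ} (hφ : IsTestG T φ) :
    ∫ p, g p ^ 2 * pdx i φ p ∂(muG T) = -(2 * ∫ p, g p * h p * φ p ∂(muG T)) := by
  have hφc := hφ.continuous
  have hφs := hφ.2
  have hgh : LocallyIntegrable (fun p => g p * h p) (muG T) := by
    refine LocallyIntegrable.mono (hg2.add hh2) (hgm.mul hm).aestronglyMeasurable (Eventually.of_forall fun p => ?_)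
    simp only [Pi.add_apply, Real.norm_eq_abs, abs_mul]
    rw [abs_of_nonneg (by positivity : 0 ≤ g p ^ 2 + h p ^ 2)]
    nlinarith [sq_abs (g p), sq_abs (h p), sq_nonneg (|g p| - |h p|), sq_nonneg (g p), sq_nonneg (h p)]
  have habs : Continuous fun p => |φ p| := hφc.abs
  have habss : HasCompactSupport fun p => |φ p| := hφs.comp_left (g := fun x => |x|) abs_zero
  obtain ⟨M, R, hM, hb⟩ := exists_shift_bound (i := i) hφc hφs
  set N : ℝ := ∫ p, ‖h p ^ 2‖ * (cyl T (R + 1)).indicator (fun _ => M) p ∂(muG T) with hN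
  have hN0 : 0 ≤ N := integral_nonneg fun p => mul_nonneg (norm_nonneg _) (indicator_nonneg (fun _ _ => hM) _)
  have ih2 : ∀ s, Integrable (fun p => h (p + shf T i s) ^ 2 * |φ p|) (muG T) := fun s =>
    LocallyIntegrable.mul_test (LocallyIntegrable.shift hh2 (shf T i s)) habs habss
  have hhb : ∀ s, 0 ≤ s → s ≤ 1 → ∫ p, h (p + shf T i s) ^ 2 * |φ p| ∂(muG T) ≤ N := by
    intro s hs0 hs1
    rw [integral_shift (fun p => h p ^ 2) (fun p => |φ p|) (shf T i s)]
    refine integral_mono_of_nonneg (Eventually.of_forall fun p => by positivity) (integrable_indicator_cyl hh2 _ _)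
      (Eventually.of_forall fun p => ?_)
    simp only
    rw [Real.norm_of_nonneg (sq_nonneg (h p)), ← shf_neg]
    exact mul_le_mul_of_nonneg_left (hb (-s) 1 (by rwa [abs_neg, abs_of_nonneg hs0]) p) (sq_nonneg _)
  have hdl : ∀ s, LocallyIntegrable (fun p => (g (p + shf T i s) - g p) ^ 2) (muG T) := by
    intro s
    refine LocallyIntegrable.mono (((LocallyIntegrable.shift hg2 (shf T i s)).add hg2).smul (2 : ℝ)) ?_
      (Eventually.of_forall fun p => ?_)
    · exact (((hgm.comp_measurable (measurable_add_const _)).sub hgm).pow 2).aestronglyMeasurable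
    · simp only [Pi.smul_apply, Pi.add_apply, smul_eq_mul, Real.norm_eq_abs]
      rw [abs_of_nonneg (by positivity), abs_of_nonneg (by positivity)]
      nlinarith [sq_nonneg (g (p + shf T i s) + g p)]
  have id2 : ∀ s, Integrable (fun p => (g (p + shf T i s) - g p) ^ 2 * |φ p|) (muG T) := fun s =>
    LocallyIntegrable.mul_test (hdl s) habs habss
  -- The increment over a step s is the integral of h along the step, so Cauchy–Schwarz gives a
  -- locally square-integrable increment of size s.
  have hE1 : ∀ s, 0 ≤ s → s ≤ 1 → ∫ p, (g (p + shf T i s) - g p) ^ 2 * |φ p| ∂(muG T) ≤ s ^ 2 * N := by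
    intro s hs0 hs1
    have hms : Measurable (fun z : G T × ℝ => ‖h (z.1 + shf T i z.2)‖ₑ) :=
      (hm.comp_measurable (continuous_fst.add (continuous_shf.comp continuous_snd)).measurable).enorm
    rw [← ENNReal.ofReal_le_ofReal_iff (by positivity),
      ofReal_integral_eq_lintegral_ofReal (id2 s) (Eventually.of_forall fun p => by positivity)]
    calc ∫⁻ p, ENNReal.ofReal ((g (p + shf T i s) - g p) ^ 2 * |φ p|) ∂(muG T)
        ≤ ∫⁻ p, (ENNReal.ofReal s * ∫⁻ r in Ioc 0 s, ‖h (p + shf T i r)‖ₑ ^ 2 * ENNReal.ofReal |φ p|) ∂(muG T) := by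
          refine lintegral_mono_ae ((hw.ae_sub_eq hm hs0).mono fun p hp => ?_)
          simp only at hp
          have hmp : Measurable fun r : ℝ => ‖h (p + shf T i r)‖ₑ := hms.comp (measurable_const.prodMk measurable_id)
          rw [ENNReal.ofReal_mul (sq_nonneg _), lintegral_mul_const _ (hmp.pow_const 2), ← mul_assoc]
          gcongr
          rw [← sq_abs (g _ - g _), ENNReal.ofReal_pow (abs_nonneg _), ← Real.norm_eq_abs (g _ - g _), ofReal_norm, hp]
          calc ‖∫ r in Ioc 0 s, h (p + shf T i r)‖ₑ ^ 2 ≤ (∫⁻ r in Ioc 0 s, 1 * ‖h (p + shf T i r)‖ₑ) ^ 2 := by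
                gcongr
                simpa using enorm_integral_le_lintegral_enorm _
            _ ≤ (∫⁻ r in Ioc 0 s, 1 ^ 2) * ∫⁻ r in Ioc 0 s, ‖h (p + shf T i r)‖ₑ ^ 2 :=
                sq_lintegral_mul_le aemeasurable_const hmp.aemeasurable
            _ = _ := by simp
      _ = ENNReal.ofReal s * ∫⁻ r in Ioc 0 s, ∫⁻ p, ‖h (p + shf T i r)‖ₑ ^ 2 * ENNReal.ofReal |φ p| ∂(muG T) := by
          have hm2 : Measurable (Function.uncurry fun (p : G T) (r : ℝ) =>
              ‖h (p + shf T i r)‖ₑ ^ 2 * ENNReal.ofReal |φ p|) :=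
            (hms.pow_const 2).mul (habs.measurable.comp measurable_fst).ennreal_ofReal
          rw [lintegral_const_mul _ hm2.lintegral_prod_right, lintegral_lintegral_swap hm2.aemeasurable]
      _ ≤ ENNReal.ofReal s * ∫⁻ r in Ioc 0 s, ENNReal.ofReal N := by
          gcongr ENNReal.ofReal s * ?_
          refine setLIntegral_mono measurable_const fun r hr => ?_
          refine le_trans (le_of_eq ?_) (ENNReal.ofReal_le_ofReal (hhb r hr.1.le (hr.2.trans hs1)))
          rw [ofReal_integral_eq_lintegral_ofReal (ih2 r) (Eventually.of_forall fun p => by positivity)]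
          refine lintegral_congr fun p => ?_
          rw [ENNReal.ofReal_mul (sq_nonneg _), ← sq_abs (h _), ENNReal.ofReal_pow (abs_nonneg _),
            ← Real.norm_eq_abs (h _), ofReal_norm]
      _ = ENNReal.ofReal (s ^ 2 * N) := by
          rw [setLIntegral_const, Real.volume_Ioc, sub_zero, mul_comm (ENNReal.ofReal N), ← mul_assoc,
            ← ENNReal.ofReal_mul hs0, ← ENNReal.ofReal_mul (by positivity), sq]
  set a : ℝ → ℝ := fun s => ∫ p, g p * h p * φ (p + shf T i (-s)) ∂(muG T) with ha
  have hac : Continuous a := (continuous_iff_continuousAt.2 fun s =>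
      (hasDerivAt_integral_shift (i := i) hgh hφ s).continuousAt).comp continuous_neg
  set I : ℝ → ℝ := fun s => ∫ p, g p ^ 2 * φ (p + shf T i (-s)) ∂(muG T) with hI
  have hId : HasDerivAt I (-∫ p, g p ^ 2 * pdx i φ p ∂(muG T)) 0 := by
    have h1 := (hasDerivAt_integral_shift (i := i) hg2 hφ (-0)).scomp (0 : ℝ) (hasDerivAt_neg (0 : ℝ))
    refine h1.congr_deriv ?_
    simp [shf_zero]
  have hAd : HasDerivAt (fun ε => ∫ s in (0 : ℝ)..ε, a s) (a 0) 0 :=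
    (hac.integral_hasStrictDerivAt 0 0).hasDerivAt
  have hprod : ∀ ε, Integrable (fun z : G T × ℝ => h (z.1 + shf T i z.2) * (g z.1 * φ z.1))
      ((muG T).prod (volume.restrict (Ioc 0 ε))) := by
    intro ε
    have hm2 : StronglyMeasurable fun p => h p ^ 2 := hm.pow 2
    have hg2' : Integrable (fun z : G T × ℝ => g z.1 ^ 2 * |φ z.1|) ((muG T).prod (volume.restrict (Ioc 0 ε))) :=
      (LocallyIntegrable.mul_test hg2 habs habss).comp_fst _
    refine ((integrable_shift_prod (i := i) hh2 hm2 habs habss ε).add hg2').mono' ?_ (Eventually.of_forall fun z => ?_)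
    · exact ((hm.comp_measurable (continuous_fst.add (continuous_shf.comp continuous_snd)).measurable).mul
        ((hgm.mul hφc.stronglyMeasurable).comp_measurable measurable_fst)).aestronglyMeasurable
    · simp only [Real.norm_eq_abs, abs_mul, Pi.add_apply]
      rw [← add_mul, ← mul_assoc]
      refine mul_le_mul_of_nonneg_right ?_ (abs_nonneg _)
      nlinarith [sq_abs (g z.1), sq_abs (h (z.1 + shf T i z.2)), sq_nonneg (|g z.1| - |h (z.1 + shf T i z.2)|),
        sq_nonneg (g z.1), sq_nonneg (h (z.1 + shf T i z.2))]
  -- Write the increment of g² as (δg)² + 2gδg. The first term is of order ε². In the second, δg is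
  -- the integral of translates of h, and replacing g by its translate by s costs order ε at each s.
  -- Dividing by ε and letting ε → 0 gives the product rule.
  have key : ∀ ε, 0 < ε → ε ≤ 1 → |I ε - I 0 - 2 * ∫ s in (0 : ℝ)..ε, a s| ≤ 3 * N * ε ^ 2 := by
    intro ε h0 h1
    have igg : ∀ s, Integrable (fun p => g (p + shf T i s) ^ 2 * φ p) (muG T) := fun s =>
      LocallyIntegrable.mul_test (LocallyIntegrable.shift hg2 (shf T i s)) hφc hφs
    have ig : Integrable (fun p => g p ^ 2 * φ p) (muG T) := LocallyIntegrable.mul_test hg2 hφc hφs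
    have id : Integrable (fun p => (g (p + shf T i ε) - g p) ^ 2 * φ p) (muG T) :=
      LocallyIntegrable.mul_test (hdl ε) hφc hφs
    have igd : Integrable (fun p => (g (p + shf T i ε) - g p) * (g p * φ p)) (muG T) := by
      have := (((igg ε).sub ig).sub id).const_mul (1 / 2)
      refine this.congr (Eventually.of_forall fun p => ?_)
      simp only [Pi.sub_apply]; ring
    have eI : I ε - I 0 = ∫ p, (g (p + shf T i ε) - g p) ^ 2 * φ p ∂(muG T) +
        2 * ∫ p, (g (p + shf T i ε) - g p) * (g p * φ p) ∂(muG T) := by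
      have e1 : I ε = ∫ p, g (p + shf T i ε) ^ 2 * φ p ∂(muG T) := by
        rw [integral_shift (fun p => g p ^ 2), ← shf_neg]
      have e0 : I 0 = ∫ p, g p ^ 2 * φ p ∂(muG T) := by simp [hI, shf_zero]
      rw [e1, e0, ← integral_sub (igg ε) ig, ← integral_const_mul, ← integral_add id (igd.const_mul 2)]
      congr 1; ext p; ring
    set b : ℝ → ℝ := fun s => ∫ p, h (p + shf T i s) * (g p * φ p) ∂(muG T) with hb'
    have eb : ∫ p, (g (p + shf T i ε) - g p) * (g p * φ p) ∂(muG T) = ∫ s in Ioc 0 ε, b s := by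
      rw [hb', ← integral_integral_swap (hprod ε)]
      refine integral_congr_ae ((hw.ae_sub_eq hm h0.le).mono fun p hp => ?_)
      simp only at hp ⊢
      rw [hp, integral_mul_const]
    have hbi : IntegrableOn b (Ioc 0 ε) := (hprod ε).integral_prod_right
    have hba : ∀ s ∈ Ioc 0 ε, ‖b s - a s‖ ≤ ε * N := by
      intro s hs
      have hs1 : s ≤ 1 := hs.2.trans h1
      have ia : Integrable (fun p => g (p + shf T i s) * h (p + shf T i s) * φ p) (muG T) :=
        LocallyIntegrable.mul_test (LocallyIntegrable.shift hgh (shf T i s)) hφc hφs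
      have ea : a s = ∫ p, g (p + shf T i s) * h (p + shf T i s) * φ p ∂(muG T) := by
        rw [integral_shift (fun p => g p * h p), ← shf_neg]
      -- Young's inequality weighted by ε, so that the increment squared, of size ε², and h², of
      -- size 1, contribute equally.
      have hbnd : ∀ p, |h (p + shf T i s) * (g p * φ p) - g (p + shf T i s) * h (p + shf T i s) * φ p| ≤
          1 / 2 * (ε⁻¹ * ((g (p + shf T i s) - g p) ^ 2 * |φ p|) + ε * (h (p + shf T i s) ^ 2 * |φ p|)) := by
        intro p
        set x := g (p + shf T i s) - g p with hx
        set y := h (p + shf T i s)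
        have e : y * (g p * φ p) - g (p + shf T i s) * y * φ p = -(x * y) * φ p := by rw [hx]; ring
        rw [e, abs_mul, abs_neg, abs_mul]
        have : |x| * |y| ≤ 1 / 2 * (ε⁻¹ * x ^ 2 + ε * y ^ 2) := by
          have h3 : ε⁻¹ * x ^ 2 + ε * y ^ 2 - 2 * (|x| * |y|) = ε⁻¹ * (|x| - ε * |y|) ^ 2 := by
            rw [← sq_abs x, ← sq_abs y]; field_simp; ring
          have h4 : 0 ≤ ε⁻¹ * (|x| - ε * |y|) ^ 2 := by positivity
          linarith
        calc |x| * |y| * |φ p| ≤ 1 / 2 * (ε⁻¹ * x ^ 2 + ε * y ^ 2) * |φ p| :=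
              mul_le_mul_of_nonneg_right this (abs_nonneg _)
          _ = _ := by ring
      have ibnd : Integrable (fun p => 1 / 2 * (ε⁻¹ * ((g (p + shf T i s) - g p) ^ 2 * |φ p|) +
          ε * (h (p + shf T i s) ^ 2 * |φ p|))) (muG T) :=
        (((id2 s).const_mul _).add ((ih2 s).const_mul _)).const_mul _
      have idiff : Integrable (fun p => h (p + shf T i s) * (g p * φ p) -
          g (p + shf T i s) * h (p + shf T i s) * φ p) (muG T) := by
        refine ibnd.mono' ?_ (Eventually.of_forall hbnd)
        have m1 : StronglyMeasurable fun p => h (p + shf T i s) := hm.comp_measurable (measurable_add_const _)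
        have m2 : StronglyMeasurable fun p => g (p + shf T i s) := hgm.comp_measurable (measurable_add_const _)
        exact ((m1.mul (hgm.mul hφc.stronglyMeasurable)).sub ((m2.mul m1).mul
          hφc.stronglyMeasurable)).aestronglyMeasurable
      have ib : Integrable (fun p => h (p + shf T i s) * (g p * φ p)) (muG T) := by
        refine (idiff.add ia).congr (Eventually.of_forall fun p => ?_)
        simp
      rw [ea, hb', ← integral_sub ib ia]
      refine (norm_integral_le_of_norm_le ibnd (Eventually.of_forall hbnd)).trans ?_
      rw [integral_const_mul, integral_add ((id2 s).const_mul _) ((ih2 s).const_mul _), integral_const_mul,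
        integral_const_mul]
      have h5 := hE1 s hs.1.le hs1
      have h6 := hhb s hs.1.le hs1
      have h7 : ε⁻¹ * ∫ p, (g (p + shf T i s) - g p) ^ 2 * |φ p| ∂(muG T) ≤ ε * N := by
        rw [inv_mul_le_iff₀ h0]
        refine h5.trans ?_
        have : s ^ 2 ≤ ε ^ 2 := pow_le_pow_left₀ hs.1.le hs.2 2
        nlinarith
      have h8 : ε * ∫ p, h (p + shf T i s) ^ 2 * |φ p| ∂(muG T) ≤ ε * N := mul_le_mul_of_nonneg_left h6 h0.le
      linarith
    have hJ1 : |∫ p, (g (p + shf T i ε) - g p) ^ 2 * φ p ∂(muG T)| ≤ ε ^ 2 * N := by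
      rw [← Real.norm_eq_abs]
      refine (norm_integral_le_integral_norm _).trans (le_trans (le_of_eq ?_) (hE1 ε h0.le h1))
      congr 1; ext p
      rw [norm_mul, Real.norm_of_nonneg (sq_nonneg _), Real.norm_eq_abs]
    have hJ2 : |∫ s in Ioc 0 ε, (b s - a s)| ≤ ε * N * ε := by
      have := norm_setIntegral_le_of_norm_le_const (μ := volume) (s := Ioc 0 ε) (C := ε * N) (by simp) hba
      simpa [h0.le] using this
    have hai : IntegrableOn a (Ioc 0 ε) := (hac.integrableOn_Icc (a := 0) (b := ε)).mono_set Ioc_subset_Icc_self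
    rw [integral_sub hbi hai] at hJ2
    rw [eI, eb, intervalIntegral.integral_of_le h0.le]
    have e9 : ∀ x y z : ℝ, x + 2 * y - 2 * z = x + 2 * (y - z) := fun x y z => by ring
    rw [e9]
    refine (abs_add_le _ _).trans ?_
    rw [abs_mul, abs_two]
    linarith
  have hlim : Tendsto (fun ε => ε⁻¹ * (I ε - I 0 - 2 * ∫ s in (0 : ℝ)..ε, a s)) (𝓝[>] 0)
      (𝓝 ((-∫ p, g p ^ 2 * pdx i φ p ∂(muG T)) - 2 * a 0)) := by
    have h1 := (hId.sub (hAd.const_mul 2)).tendsto_slope_zero_right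
    refine h1.congr fun ε => ?_
    simp only [Pi.sub_apply, zero_add, intervalIntegral.integral_same, mul_zero, sub_zero, smul_eq_mul]
    ring
  have hlim0 : Tendsto (fun ε => ε⁻¹ * (I ε - I 0 - 2 * ∫ s in (0 : ℝ)..ε, a s)) (𝓝[>] 0) (𝓝 0) := by
    refine squeeze_zero_norm' (a := fun ε => 3 * N * ε) ?_ ?_
    · filter_upwards [self_mem_nhdsWithin, nhdsWithin_le_nhds (Iic_mem_nhds (one_pos : (0 : ℝ) < 1))] with ε h0 h1
      have h0 : 0 < ε := h0
      rw [norm_mul, Real.norm_eq_abs, Real.norm_eq_abs, abs_inv, abs_of_pos h0, inv_mul_le_iff₀ h0]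
      refine (key ε h0 h1).trans (le_of_eq (by ring))
    · have : Tendsto (fun ε : ℝ => 3 * N * ε) (𝓝 0) (𝓝 (3 * N * 0)) := tendsto_id.const_mul _
      rw [mul_zero] at this
      exact this.mono_left nhdsWithin_le_nhds
  have := tendsto_nhds_unique hlim hlim0
  have ha0 : a 0 = ∫ p, g p * h p * φ p ∂(muG T) := by simp [ha, shf_zero]
  rw [ha0] at this
  linarith

end ProductRule


/-! ### Mixed integrability -/

section MixedNorms

variable {T : ℝ} [hT : Fact (0 < T)]

lemma IsWeakPartialG.integral_mul_self' {i : Fin 3} {g h : G T → ℝ} (hw : IsWeakPartialG T i g h)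
    (hg2 : LocallyIntegrable (fun p => g p ^ 2) (muG T)) (hh2 : LocallyIntegrable (fun p => h p ^ 2) (muG T))
    {φ : G T → ℝ} (hφ : IsTestG T φ) :
    ∫ p, g p ^ 2 * pdx i φ p ∂(muG T) = -(2 * ∫ p, g p * h p * φ p ∂(muG T)) := by
  have hg := hw.1.aestronglyMeasurable.ae_eq_mk
  have hh := hw.2.1.aestronglyMeasurable.ae_eq_mk
  have := (hw.congr hg hh).integral_mul_self hw.2.1.aestronglyMeasurable.stronglyMeasurable_mk
    (hg2.congr (hg.mono fun p hp => by simp only [hp])) (hh2.congr (hh.mono fun p hp => by simp only [hp]))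
    hw.1.aestronglyMeasurable.stronglyMeasurable_mk hφ
  convert! this using 1
  · exact integral_congr_ae (hg.mono fun p hp => by simp only [hp])
  · rw [integral_congr_ae]
    filter_upwards [hg, hh] with p h1 h2
    rw [h1, h2]

lemma aemeasurable_time {F : G T → ℝ≥0∞} (hF : AEMeasurable F (muG T)) :
    AEMeasurable (fun x => ∫⁻ τ, F (τ, x) ∂(AddCircle.haarAddCircle (T := T))) volume := by
  unfold muG at hF
  exact hF.lintegral_prod_left'

lemma ae_time_of_ae {P : G T → Prop} (h : ∀ᵐ p ∂(muG T), P p) :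
    ∀ᵐ x : E3, ∀ᵐ τ ∂(AddCircle.haarAddCircle (T := T)), P (τ, x) := by
  unfold muG at h
  have h' : ∀ᵐ z ∂((volume : Measure E3).prod (AddCircle.haarAddCircle (T := T))), P z.swap :=
    Measure.measurePreserving_swap.quasiMeasurePreserving.ae h
  exact Measure.ae_ae_of_ae_prod h'

lemma ae_aemeasurable_time {F : G T → ℝ≥0∞} (hF : AEMeasurable F (muG T)) :
    ∀ᵐ x : E3, AEMeasurable (fun τ => F (τ, x)) (AddCircle.haarAddCircle (T := T)) :=
  (ae_time_of_ae hF.ae_eq_mk).mono fun x hx =>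
    ⟨fun τ => hF.mk F (τ, x), hF.measurable_mk.comp (by fun_prop), hx⟩

lemma ae_aemeasurable_space {F : G T → ℝ≥0∞} (hF : AEMeasurable F (muG T)) :
    ∀ᵐ t ∂(AddCircle.haarAddCircle (T := T)), AEMeasurable (fun x => F (t, x)) volume :=
  (Measure.ae_ae_of_ae_prod hF.ae_eq_mk).mono fun t ht =>
    ⟨fun x => hF.mk F (t, x), hF.measurable_mk.comp (by fun_prop), ht⟩

/-- Functions in `L^{3/2}(ℝ³; L¹(𝕋))`. -/
structure MemF (F : G T → ℝ) : Prop where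
  meas : AEStronglyMeasurable F (muG T)
  bound : ∫⁻ x, (∫⁻ τ, ‖F (τ, x)‖ₑ ∂(AddCircle.haarAddCircle (T := T))) ^ (3 / 2 : ℝ) < ⊤

lemma MemF.mono {F H : G T → ℝ} (hF : MemF F) (hH : AEStronglyMeasurable H (muG T))
    (h : ∀ᵐ p ∂(muG T), ‖H p‖ₑ ≤ ‖F p‖ₑ) : MemF H := by
  refine ⟨hH, lt_of_le_of_lt (lintegral_mono_ae ((ae_time_of_ae h).mono fun x hx => ?_)) hF.bound⟩
  exact ENNReal.rpow_le_rpow (lintegral_mono_ae hx) (by norm_num)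

lemma MemF.congr {F H : G T → ℝ} (hF : MemF F) (h : F =ᵐ[muG T] H) : MemF H :=
  hF.mono (hF.meas.congr h) (h.mono fun p hp => by rw [hp])

lemma MemF.add {F H : G T → ℝ} (hF : MemF F) (hH : MemF H) : MemF (fun p => F p + H p) := by
  refine ⟨hF.meas.add hH.meas, ?_⟩
  have hm := (aemeasurable_time hF.meas.enorm).pow_const (3 / 2 : ℝ)
  calc ∫⁻ x, (∫⁻ τ, ‖F (τ, x) + H (τ, x)‖ₑ ∂(AddCircle.haarAddCircle (T := T))) ^ (3 / 2 : ℝ)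
      ≤ ∫⁻ x, 2 ^ ((3 / 2 : ℝ) - 1) * ((∫⁻ τ, ‖F (τ, x)‖ₑ ∂(AddCircle.haarAddCircle (T := T))) ^ (3 / 2 : ℝ) +
        (∫⁻ τ, ‖H (τ, x)‖ₑ ∂(AddCircle.haarAddCircle (T := T))) ^ (3 / 2 : ℝ)) := by
        refine lintegral_mono_ae ((ae_aemeasurable_time hF.meas.enorm).mono fun x hx => ?_)
        refine le_trans (ENNReal.rpow_le_rpow ?_ (by norm_num)) (ENNReal.rpow_add_le_mul_rpow_add_rpow _ _ (by norm_num))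
        rw [← lintegral_add_left' hx]
        exact lintegral_mono fun τ => enorm_add_le _ _
    _ < ⊤ := by
        rw [lintegral_const_mul' (2 ^ ((3 / 2 : ℝ) - 1)) _ (by simp), lintegral_add_left' hm]
        exact ENNReal.mul_lt_top (ENNReal.rpow_lt_top_of_nonneg (by norm_num) (by simp)) (ENNReal.add_lt_top.2 ⟨hF.bound, hH.bound⟩)

lemma MemF.neg {F : G T → ℝ} (hF : MemF F) : MemF (fun p => -F p) :=
  hF.mono hF.meas.neg (Eventually.of_forall fun p => by simp)

lemma MemF.sub {F H : G T → ℝ} (hF : MemF F) (hH : MemF H) : MemF (fun p => F p - H p) := by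
  simpa only [sub_eq_add_neg] using hF.add hH.neg

lemma MemF.zero : MemF (fun _ : G T => (0 : ℝ)) := ⟨aestronglyMeasurable_const, by simp⟩

lemma MemF.sum {ι : Type*} (s : Finset ι) {F : ι → G T → ℝ} (hF : ∀ j, MemF (F j)) :
    MemF (fun p => ∑ j ∈ s, F j p) := by
  classical
  induction s using Finset.induction_on with
  | empty => simpa using MemF.zero (T := T)
  | insert a s ha ih => simpa only [Finset.sum_insert ha] using (hF a).add ih

lemma setLIntegral_lt_top_of_rpow {d : E3 → ℝ≥0∞} {p : ℝ} (hp : 1 < p) (hm : AEMeasurable d)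
    (hd : ∫⁻ x, d x ^ p < ⊤) {K : Set E3} (hK : IsCompact K) : ∫⁻ x in K, d x < ⊤ :=
  VanishAvg.setLIntegral_lt_top (VanishAvg.of_rpow hp hm hd) hK

lemma MemF.locallyIntegrable {F : G T → ℝ} (hF : MemF F) : LocallyIntegrable F (muG T) :=
  locallyIntegrable_of_mean_le hF.meas (Eventually.of_forall fun _ => le_rfl) fun _ hK =>
    setLIntegral_lt_top_of_rpow (by norm_num) (aemeasurable_time hF.meas.enorm) hF.bound hK

lemma memF_mean {F : G T → ℝ} (hF : MemF F) : MemF (fun p : G T => mean F p.2) := by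
  refine ⟨(locallyIntegrable_mean hF.locallyIntegrable).aestronglyMeasurable.comp_snd,
    lt_of_le_of_lt (lintegral_mono fun x => ENNReal.rpow_le_rpow ?_ (by norm_num)) hF.bound⟩
  simp only [lintegral_const, measure_univ, mul_one]
  exact enorm_integral_le_lintegral_enorm _

lemma lintegral_rpow_le_prob {X : Type*} [MeasurableSpace X] {μ : Measure X} [IsProbabilityMeasure μ]
    {f : X → ℝ≥0∞} (hf : AEMeasurable f μ) {p : ℝ} (hp : 1 < p) : (∫⁻ x, f x ∂μ) ^ p ≤ ∫⁻ x, f x ^ p ∂μ := by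
  have h := ENNReal.lintegral_mul_le_Lp_mul_Lq μ (Real.HolderConjugate.conjExponent hp) hf
    (aemeasurable_const (b := (1 : ℝ≥0∞)))
  simp only [Pi.mul_apply, mul_one, ENNReal.one_rpow, lintegral_const, measure_univ] at h
  have h2 := ENNReal.rpow_le_rpow h (by linarith : (0 : ℝ) ≤ p)
  rwa [← ENNReal.rpow_mul, one_div_mul_cancel (by linarith), ENNReal.rpow_one] at h2

lemma memF_of_memLp {F : G T → ℝ} (hF : MemLp F (3 / 2 : ℝ≥0∞) (muG T)) : MemF F := by
  refine ⟨hF.1, ?_⟩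
  have h := lintegral_rpow_enorm_lt_top_of_eLpNorm_lt_top (by norm_num)
    (ENNReal.div_ne_top (by norm_num) (by norm_num)) hF.2
  have e : (3 / 2 : ℝ≥0∞).toReal = 3 / 2 := by simp
  rw [e, lintegral_muG (hF.1.enorm.pow_const _)] at h
  refine lt_of_le_of_lt (lintegral_mono_ae ((ae_aemeasurable_time hF.1.enorm).mono fun x hx => ?_)) h
  exact lintegral_rpow_le_prob hx (by norm_num)

/-- Functions in `L⁶(ℝ³; L²(𝕋))`. -/
structure MemA (g : G T → ℝ) : Prop where
  meas : AEStronglyMeasurable g (muG T)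
  bound : ∫⁻ x, (∫⁻ τ, ‖g (τ, x)‖ₑ ^ 2 ∂(AddCircle.haarAddCircle (T := T))) ^ (3 : ℝ) < ⊤

/-- Hölder with exponents 3 and 3/2 for a = (a n^{-2/3}) n^{2/3}; the lower bound on n excludes
division by zero. -/
lemma lintegral_weighted_cube {X : Type*} [MeasurableSpace X] {μ : Measure X} {a n : X → ℝ≥0∞}
    (ha : AEMeasurable a μ) (hn : AEMeasurable n μ) (hn1 : ∀ x, 1 ≤ n x) (hnt : ∀ᵐ x ∂μ, n x ≠ ⊤) :
    (∫⁻ x, a x ∂μ) ^ (3 : ℝ) ≤ (∫⁻ x, a x ^ (3 : ℝ) * n x ^ (-2 : ℝ) ∂μ) * (∫⁻ x, n x ∂μ) ^ (2 : ℝ) := by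
  have hpq : (3 : ℝ).HolderConjugate (3 / 2) := by
    rw [Real.holderConjugate_iff]; norm_num
  have h := ENNReal.lintegral_mul_le_Lp_mul_Lq μ hpq (ha.mul (hn.pow_const (-(2 / 3) : ℝ)))
    (hn.pow_const (2 / 3 : ℝ))
  have e1 : ∫⁻ x, ((a * fun x => n x ^ (-(2 / 3) : ℝ)) * fun x => n x ^ (2 / 3 : ℝ)) x ∂μ = ∫⁻ x, a x ∂μ := by
    refine lintegral_congr_ae (hnt.mono fun x hx => ?_)
    simp only [Pi.mul_apply]
    rw [mul_assoc, ← ENNReal.rpow_add _ _ (by have := hn1 x; positivity) hx]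
    simp
  rw [e1] at h
  have h2 := ENNReal.rpow_le_rpow h (by norm_num : (0 : ℝ) ≤ 3)
  refine h2.trans (le_of_eq ?_)
  rw [ENNReal.mul_rpow_of_nonneg _ _ (by norm_num), ← ENNReal.rpow_mul, ← ENNReal.rpow_mul,
    show (1 / 3 : ℝ) * 3 = 1 by norm_num, show (1 / (3 / 2) : ℝ) * 3 = 2 by norm_num, ENNReal.rpow_one]
  congr 1
  · refine lintegral_congr fun x => ?_
    rw [Pi.mul_apply, ENNReal.mul_rpow_of_nonneg _ _ (by norm_num), ← ENNReal.rpow_mul,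
      show (-(2 / 3) : ℝ) * 3 = -2 by norm_num]
  · congr 1
    refine lintegral_congr fun x => ?_
    rw [← ENNReal.rpow_mul]; norm_num

/-- The order of the mixed norm is exchanged, as in Minkowski's inequality for |g|². Taking for n
the L³ norm in space of |g(t, ·)|², plus 1, the weighted inequality turns the claim into Tonelli's
theorem, and everything is bounded by the cube of the integral of n. -/
lemma memA_of_L2L6 {g : G T → ℝ} (hm : AEStronglyMeasurable g (muG T))
    (hg : ∫⁻ t, (eLpNorm (fun x => g (t, x)) 6 volume) ^ 2 ∂(AddCircle.haarAddCircle (T := T)) < ⊤) : MemA g := by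
  refine ⟨hm, ?_⟩
  set N : AddCircle T → ℝ≥0∞ := fun t => ∫⁻ x, (‖g (t, x)‖ₑ ^ 2) ^ (3 : ℝ) with hN
  have hen : ∀ t, (eLpNorm (fun x => g (t, x)) 6 volume) ^ 2 = N t ^ (1 / 3 : ℝ) := by
    intro t
    rw [eLpNorm_eq_lintegral_rpow_enorm_toReal (by norm_num) (by norm_num), ← ENNReal.rpow_natCast,
      ← ENNReal.rpow_mul, hN]
    simp only [ENNReal.toReal_ofNat]
    rw [show (1 / 6 : ℝ) * (2 : ℕ) = 1 / 3 by norm_num]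
    congr 1
    refine lintegral_congr fun x => ?_
    rw [← ENNReal.rpow_two, ← ENNReal.rpow_mul]
    norm_num
  have ham : AEMeasurable (fun p : G T => ‖g p‖ₑ ^ 2) (muG T) := hm.enorm.pow_const 2
  have hNm : AEMeasurable N (AddCircle.haarAddCircle (T := T)) := by
    have := ham.pow_const (3 : ℝ)
    unfold muG at this
    exact this.lintegral_prod_right'
  simp_rw [hen] at hg
  -- The summand 1 keeps the weight away from zero; it is harmless since the circle has measure 1.
  set n : AddCircle T → ℝ≥0∞ := fun t => N t ^ (1 / 3 : ℝ) + 1 with hn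
  have hnm : AEMeasurable n (AddCircle.haarAddCircle (T := T)) := (hNm.pow_const _).add_const _
  have hnI : ∫⁻ t, n t ∂(AddCircle.haarAddCircle (T := T)) < ⊤ := by
    rw [lintegral_add_right _ measurable_const]
    simpa using hg
  have hnt : ∀ᵐ t ∂(AddCircle.haarAddCircle (T := T)), n t ≠ ⊤ := ae_lt_top' hnm hnI.ne |>.mono fun _ h => h.ne
  have hn1 : ∀ t, 1 ≤ n t := fun t => le_add_self
  have hnm' : AEMeasurable (fun p : G T => n p.1) (muG T) := hnm.comp_fst
  calc ∫⁻ x, (∫⁻ τ, ‖g (τ, x)‖ₑ ^ 2 ∂(AddCircle.haarAddCircle (T := T))) ^ (3 : ℝ)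
      ≤ ∫⁻ x, (∫⁻ τ, (‖g (τ, x)‖ₑ ^ 2) ^ (3 : ℝ) * n τ ^ (-2 : ℝ) ∂(AddCircle.haarAddCircle (T := T))) *
          (∫⁻ τ, n τ ∂(AddCircle.haarAddCircle (T := T))) ^ (2 : ℝ) :=
        lintegral_mono_ae ((ae_aemeasurable_time ham).mono fun x hx => lintegral_weighted_cube hx hnm hn1 hnt)
    _ = (∫⁻ p, (‖g p‖ₑ ^ 2) ^ (3 : ℝ) * n p.1 ^ (-2 : ℝ) ∂(muG T)) *
          (∫⁻ τ, n τ ∂(AddCircle.haarAddCircle (T := T))) ^ (2 : ℝ) := by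
        have hm3 := (ham.pow_const (3 : ℝ)).mul (hnm'.pow_const (-2 : ℝ))
        have e := lintegral_muG hm3
        simp only [Pi.mul_apply] at e
        rw [lintegral_mul_const' _ _ (ENNReal.rpow_lt_top_of_nonneg (by norm_num) hnI.ne).ne, e]
    _ ≤ (∫⁻ τ, n τ ∂(AddCircle.haarAddCircle (T := T))) *
          (∫⁻ τ, n τ ∂(AddCircle.haarAddCircle (T := T))) ^ (2 : ℝ) := by
        gcongr
        have hm3 := (ham.pow_const (3 : ℝ)).mul (hnm'.pow_const (-2 : ℝ))
        unfold muG at hm3 ⊢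
        have e := lintegral_prod _ hm3
        simp only [Pi.mul_apply] at e
        rw [e]
        have hsl := ae_aemeasurable_space (ham.pow_const (3 : ℝ))
        refine lintegral_mono_ae ?_
        filter_upwards [hsl, hnt] with t h1 h2
        rw [lintegral_mul_const'' _ h1]
        have h3 : N t ≤ n t ^ (3 : ℝ) := by
          calc N t = (N t ^ (1 / 3 : ℝ)) ^ (3 : ℝ) := by rw [← ENNReal.rpow_mul]; norm_num
            _ ≤ n t ^ (3 : ℝ) := ENNReal.rpow_le_rpow le_self_add (by norm_num)
        calc N t * n t ^ (-2 : ℝ) ≤ n t ^ (3 : ℝ) * n t ^ (-2 : ℝ) := by gcongr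
          _ = n t := by
            rw [← ENNReal.rpow_add _ _ (by have := hn1 t; positivity) h2]; norm_num
    _ < ⊤ := ENNReal.mul_lt_top hnI (ENNReal.rpow_lt_top_of_nonneg (by norm_num) hnI.ne)

variable {g : G T → ℝ}

lemma MemA.locallyIntegrable_sq (hg : MemA g) : LocallyIntegrable (fun p => g p ^ 2) (muG T) := by
  have ham : AEMeasurable (fun p : G T => ‖g p‖ₑ ^ 2) (muG T) := hg.meas.enorm.pow_const 2
  refine locallyIntegrable_of_mean_le (hg.meas.pow 2) (Eventually.of_forall fun x => ?_) fun K hK =>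
    setLIntegral_lt_top_of_rpow (by norm_num) (aemeasurable_time ham) hg.bound hK
  simp [enorm_pow]

lemma MemA.vanishAvg (hg : MemA g) :
    VanishAvg fun x => ∫⁻ τ, ‖g (τ, x)‖ₑ ∂(AddCircle.haarAddCircle (T := T)) := by
  refine VanishAvg.of_rpow (p := 6) (by norm_num) (aemeasurable_time hg.meas.enorm)
    (lt_of_le_of_lt (lintegral_mono_ae ((ae_aemeasurable_time hg.meas.enorm).mono fun x hx => ?_)) hg.bound)
  have := lintegral_rpow_le_prob hx (p := 2) (by norm_num)
  calc (∫⁻ τ, ‖g (τ, x)‖ₑ ∂(AddCircle.haarAddCircle (T := T))) ^ (6 : ℝ)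
      = ((∫⁻ τ, ‖g (τ, x)‖ₑ ∂(AddCircle.haarAddCircle (T := T))) ^ (2 : ℝ)) ^ (3 : ℝ) := by
        rw [← ENNReal.rpow_mul]; norm_num
    _ ≤ _ := by
        refine ENNReal.rpow_le_rpow (this.trans (le_of_eq ?_)) (by norm_num)
        simp

/-- Cauchy–Schwarz in time bounds the time mean by (AB)^{1/2} with A cubically integrable and B
integrable. Hölder in space with exponents 4 and 4/3, applied to A^{3/4} and B^{3/4}, gives the
power 3/2. This places the quadratic terms in the class that the kernels can be convolved with. -/
lemma MemA.mul_memF (hg : MemA g) {h : G T → ℝ} (hh : MemLp h 2 (muG T)) : MemF (fun p => g p * h p) := by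
  refine ⟨hg.meas.mul hh.1, ?_⟩
  have ham : AEMeasurable (fun p : G T => ‖g p‖ₑ ^ 2) (muG T) := hg.meas.enorm.pow_const 2
  have hbm : AEMeasurable (fun p : G T => ‖h p‖ₑ ^ 2) (muG T) := hh.1.enorm.pow_const 2
  have hB := lintegral_rpow_enorm_lt_top_of_eLpNorm_lt_top (by norm_num) (by norm_num) hh.2
  simp only [ENNReal.toReal_ofNat, ENNReal.rpow_two] at hB
  rw [lintegral_muG hbm] at hB
  set A : E3 → ℝ≥0∞ := fun x => ∫⁻ τ, ‖g (τ, x)‖ₑ ^ 2 ∂(AddCircle.haarAddCircle (T := T))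
  set B : E3 → ℝ≥0∞ := fun x => ∫⁻ τ, ‖h (τ, x)‖ₑ ^ 2 ∂(AddCircle.haarAddCircle (T := T))
  have hpq : (4 : ℝ).HolderConjugate (4 / 3) := by rw [Real.holderConjugate_iff]; norm_num
  have hH := ENNReal.lintegral_mul_le_Lp_mul_Lq volume hpq ((aemeasurable_time ham).pow_const (3 / 4 : ℝ))
    ((aemeasurable_time hbm).pow_const (3 / 4 : ℝ))
  refine lt_of_le_of_lt (le_trans (lintegral_mono_ae ?_) hH) ?_
  · filter_upwards [ae_aemeasurable_time hg.meas.enorm, ae_aemeasurable_time hh.1.enorm] with x h1 h2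
    have h3 := sq_lintegral_mul_le h1 h2
    simp only [Pi.mul_apply, enorm_mul]
    rw [← ENNReal.mul_rpow_of_nonneg _ _ (by norm_num)]
    refine le_trans (le_of_eq ?_) (ENNReal.rpow_le_rpow h3 (by norm_num : (0 : ℝ) ≤ 3 / 4))
    rw [← ENNReal.rpow_two, ← ENNReal.rpow_mul]; norm_num
  · refine ENNReal.mul_lt_top (ENNReal.rpow_lt_top_of_nonneg (by norm_num) (ne_of_lt ?_))
      (ENNReal.rpow_lt_top_of_nonneg (by norm_num) (ne_of_lt ?_))
    · refine lt_of_le_of_lt (le_of_eq (lintegral_congr fun x => ?_)) hg.bound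
      rw [← ENNReal.rpow_mul]; norm_num
    · refine lt_of_le_of_lt (le_of_eq (lintegral_congr fun x => ?_)) hB
      rw [← ENNReal.rpow_mul]; norm_num

end MixedNorms


/-! ### Convolutions on `G` -/

section Convolution

variable {T : ℝ} [hT : Fact (0 < T)]

/-- Kernels on `G` whose time means are dominated by `maj`. -/
structure PKern (k : G T → ℝ) : Prop where
  meas : StronglyMeasurable k
  bound : ∃ C : ℝ≥0, ∀ x, ∫⁻ τ, ‖k (τ, x)‖ₑ ∂(AddCircle.haarAddCircle (T := T)) ≤ C * maj x

/-- Convolution on `G`. -/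
def conv (k F : G T → ℝ) (p : G T) : ℝ := ∫ q, k (p - q) * F q ∂(muG T)

lemma Kern.pKern {k : ℝ → E3 → ℝ} (h : Kern k) {lam : ℝ} (hlam : 0 < lam) : PKern (per T lam k) :=
  ⟨h.stronglyMeasurable_per, h.lintegral_per_le hlam⟩

variable {k F : G T → ℝ}

lemma PKern.abs (hk : PKern k) : PKern (fun p => |k p|) :=
  ⟨hk.meas.norm, by simpa using hk.bound⟩

lemma PKern.add {k' : G T → ℝ} (hk : PKern k) (hk' : PKern k') : PKern (fun p => k p + k' p) := by
  obtain ⟨C, hC⟩ := hk.bound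
  obtain ⟨C', hC'⟩ := hk'.bound
  refine ⟨hk.meas.add hk'.meas, C + C', fun x => ?_⟩
  have hm : Measurable fun τ => ‖k (τ, x)‖ₑ := hk.meas.enorm.comp (by fun_prop)
  calc _ ≤ ∫⁻ τ, (‖k (τ, x)‖ₑ + ‖k' (τ, x)‖ₑ) ∂(AddCircle.haarAddCircle (T := T)) :=
        lintegral_mono fun τ => enorm_add_le _ _
    _ ≤ _ := by
        rw [lintegral_add_left hm, ENNReal.coe_add, add_mul]
        exact add_le_add (hC x) (hC' x)

lemma PKern.const_mul (hk : PKern k) (c : ℝ) : PKern (fun p => c * k p) := by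
  obtain ⟨C, hC⟩ := hk.bound
  refine ⟨hk.meas.const_mul c, ‖c‖₊ * C, fun x => ?_⟩
  simp only [enorm_mul]
  rw [lintegral_const_mul' _ _ (by simp), ENNReal.coe_mul, mul_assoc]
  exact mul_le_mul_right (hC x) _

lemma stronglyMeasurable_mean (hk : StronglyMeasurable k) : StronglyMeasurable (mean k) :=
  hk.integral_prod_left' (μ := AddCircle.haarAddCircle (T := T))

lemma MemF.abs (hF : MemF F) : MemF (fun p => |F p|) :=
  hF.mono hF.meas.norm (Eventually.of_forall fun p => by simp)

lemma measurable_conv_kernel (hk : StronglyMeasurable k) (hF : StronglyMeasurable F) :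
    StronglyMeasurable fun z : G T × G T => k (z.1 - z.2) * F z.2 :=
  (hk.comp_measurable (measurable_fst.sub measurable_snd)).mul (hF.comp_measurable measurable_snd)

lemma stronglyMeasurable_conv (hk : StronglyMeasurable k) (hF : StronglyMeasurable F) :
    StronglyMeasurable (conv k F) :=
  (measurable_conv_kernel hk hF).integral_prod_right'

/-- The time mean of the modulus. -/
def tmass (F : G T → ℝ) (x : E3) : ℝ≥0∞ := ∫⁻ τ, ‖F (τ, x)‖ₑ ∂(AddCircle.haarAddCircle (T := T))

lemma measurable_tmass (hF : StronglyMeasurable F) : Measurable (tmass F) :=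
  hF.enorm.lintegral_prod_left'

/-- By translation invariance on the circle, the time mean of the absolute convolution on G factors
into a convolution on ℝ³ of the two time masses. All convergence questions become questions about
`maj`. -/
lemma lintegral_conv_eq (hk : StronglyMeasurable k) (hF : StronglyMeasurable F) (x : E3) :
    ∫⁻ τ, ∫⁻ q, ‖k ((τ, x) - q) * F q‖ₑ ∂(muG T) ∂(AddCircle.haarAddCircle (T := T)) =
      ∫⁻ y, tmass k (x - y) * tmass F y := by
  have hm : Measurable fun z : AddCircle T × G T => ‖k ((z.1, x) - z.2) * F z.2‖ₑ :=
    (measurable_conv_kernel hk hF).enorm.comp (by fun_prop : Measurable fun z : AddCircle T × G T => ((z.1, x), z.2))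
  rw [lintegral_lintegral_swap hm.aemeasurable, lintegral_muG hm.lintegral_prod_left'.aemeasurable]
  refine lintegral_congr fun y => ?_
  have h1 : ∀ σ : AddCircle T, ∫⁻ τ, ‖k ((τ, x) - (σ, y)) * F (σ, y)‖ₑ ∂(AddCircle.haarAddCircle (T := T)) =
      tmass k (x - y) * ‖F (σ, y)‖ₑ := by
    intro σ
    have hmk : Measurable fun τ : AddCircle T => ‖k (τ, x - y)‖ₑ := hk.enorm.comp (by fun_prop)
    have hmk' : Measurable fun τ : AddCircle T => ‖k (τ - σ, x - y)‖ₑ := hmk.comp (measurable_sub_const σ)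
    simp only [enorm_mul, Prod.mk_sub_mk]
    rw [lintegral_mul_const _ hmk', lintegral_sub_right_eq_self (fun τ => ‖k (τ, x - y)‖ₑ) σ]
    rfl
  simp_rw [h1]
  have hmF : Measurable fun σ : AddCircle T => ‖F (σ, y)‖ₑ := hF.enorm.comp (by fun_prop)
  rw [lintegral_const_mul _ hmF]
  rfl

lemma PKern.vanishAvg_conv (hk : PKern k) (hF : MemF F) (hFm : StronglyMeasurable F) :
    VanishAvg fun x => ∫⁻ y, tmass k (x - y) * tmass F y := by
  obtain ⟨C, hC⟩ := hk.bound
  refine ((vanishAvg_maj_conv (measurable_tmass hFm) hF.bound).const_mul C).mono (Eventually.of_forall fun x => ?_)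
  rw [← lintegral_const_mul' _ _ ENNReal.coe_ne_top]
  refine lintegral_mono fun y => ?_
  rw [← mul_assoc]
  exact mul_le_mul_left (hC (x - y)) _

lemma VanishAvg.ae_lt_top {d : E3 → ℝ≥0∞} (h : VanishAvg d) (hm : Measurable d) : ∀ᵐ x, d x < ⊤ := by
  have h1 : ∀ n : ℕ, ∀ᵐ x : E3, x ∈ Metric.closedBall (0 : E3) n → d x < ⊤ := fun n =>
    (ae_restrict_iff' Metric.isClosed_closedBall.measurableSet).1
      (MeasureTheory.ae_lt_top hm (h.setLIntegral_lt_top (isCompact_closedBall _ _)).ne)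
  filter_upwards [ae_all_iff.2 h1] with x hx
  obtain ⟨n, hn⟩ := exists_nat_ge ‖x‖
  exact hx n (by simpa using hn)

lemma ae_of_ae_time {P : G T → Prop} (hP : MeasurableSet {p | P p})
    (h : ∀ᵐ x : E3, ∀ᵐ τ ∂(AddCircle.haarAddCircle (T := T)), P (τ, x)) : ∀ᵐ p ∂(muG T), P p := by
  have h' : ∀ᵐ z ∂((volume : Measure E3).prod (AddCircle.haarAddCircle (T := T))), P z.swap :=
    (Measure.ae_prod_iff_ae_ae (hP.preimage measurable_swap)).2 h
  have := (Measure.measurePreserving_swap (μ := AddCircle.haarAddCircle (T := T))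
    (ν := (volume : Measure E3))).quasiMeasurePreserving.ae h'
  simpa [muG] using this

lemma measurable_conv_mass (hk : StronglyMeasurable k) (hF : StronglyMeasurable F) :
    Measurable fun p => ∫⁻ q, ‖k (p - q) * F q‖ₑ ∂(muG T) :=
  (measurable_conv_kernel hk hF).enorm.lintegral_prod_right'

lemma PKern.ae_mass_lt_top (hk : PKern k) (hF : MemF F) (hFm : StronglyMeasurable F) :
    ∀ᵐ x : E3, ∫⁻ τ, ∫⁻ q, ‖k ((τ, x) - q) * F q‖ₑ ∂(muG T) ∂(AddCircle.haarAddCircle (T := T)) < ⊤ := by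
  simp_rw [lintegral_conv_eq hk.meas hFm]
  refine (hk.vanishAvg_conv hF hFm).ae_lt_top ?_
  have : Measurable fun z : E3 × E3 => tmass k (z.1 - z.2) * tmass F z.2 :=
    ((measurable_tmass hk.meas).comp (measurable_fst.sub measurable_snd)).mul
      ((measurable_tmass hFm).comp measurable_snd)
  exact this.lintegral_prod_right'

/-- Absolute convergence of the convolution. -/
lemma PKern.ae_integrable_conv (hk : PKern k) (hF : MemF F) (hFm : StronglyMeasurable F) :
    ∀ᵐ p ∂(muG T), Integrable (fun q => k (p - q) * F q) (muG T) := by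
  have hmm := measurable_conv_mass hk.meas hFm
  have h : ∀ᵐ p ∂(muG T), ∫⁻ q, ‖k (p - q) * F q‖ₑ ∂(muG T) < ⊤ := by
    refine ae_of_ae_time (measurableSet_lt hmm measurable_const) ((hk.ae_mass_lt_top hF hFm).mono fun x hx => ?_)
    exact MeasureTheory.ae_lt_top (hmm.comp (by fun_prop)) hx.ne
  refine h.mono fun p hp => ⟨?_, hp⟩
  exact ((measurable_conv_kernel hk.meas hFm).comp_measurable
    (by fun_prop : Measurable fun q : G T => (p, q))).aestronglyMeasurable

lemma lintegral_enorm_conv_le (hk : StronglyMeasurable k) (hF : StronglyMeasurable F) (x : E3) :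
    ∫⁻ τ, ‖conv k F (τ, x)‖ₑ ∂(AddCircle.haarAddCircle (T := T)) ≤ ∫⁻ y, tmass k (x - y) * tmass F y := by
  rw [← lintegral_conv_eq hk hF]
  exact lintegral_mono fun τ => enorm_integral_le_lintegral_enorm _

lemma PKern.vanishAvg (hk : PKern k) (hF : MemF F) (hFm : StronglyMeasurable F) :
    VanishAvg fun x => ∫⁻ τ, ‖conv k F (τ, x)‖ₑ ∂(AddCircle.haarAddCircle (T := T)) :=
  (hk.vanishAvg_conv hF hFm).mono (Eventually.of_forall fun x => lintegral_enorm_conv_le hk.meas hFm x)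

lemma PKern.locallyIntegrable_conv (hk : PKern k) (hF : MemF F) (hFm : StronglyMeasurable F) :
    LocallyIntegrable (conv k F) (muG T) :=
  locallyIntegrable_of_mean_le (stronglyMeasurable_conv hk.meas hFm).aestronglyMeasurable
    (Eventually.of_forall fun _ => le_rfl) fun _ hK => (hk.vanishAvg hF hFm).setLIntegral_lt_top hK

/-- Fubini passes from the convolution to the kernel paired with translated test functions. Any
distributional identity of the kernel is thereby inherited by the convolution. -/
lemma PKern.integral_conv_mul (hk : PKern k) (hF : MemF F) (hFm : StronglyMeasurable F) {ψ : G T → ℝ}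
    (hc : Continuous ψ) (hs : HasCompactSupport ψ) :
    ∫ p, conv k F p * ψ p ∂(muG T) = ∫ q, F q * ∫ p, k p * ψ (p + q) ∂(muG T) ∂(muG T) := by
  have hm : StronglyMeasurable fun z : G T × G T => k (z.1 - z.2) * F z.2 * ψ z.1 :=
    (measurable_conv_kernel hk.meas hFm).mul (hc.stronglyMeasurable.comp_measurable measurable_fst)
  have hi : Integrable (fun z : G T × G T => k (z.1 - z.2) * F z.2 * ψ z.1) ((muG T).prod (muG T)) := by
    refine (integrable_prod_iff hm.aestronglyMeasurable).2 ⟨(hk.ae_integrable_conv hF hFm).mono fun p hp =>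
      hp.mul_const (ψ p), ?_⟩
    have := LocallyIntegrable.mul_test (hk.abs.locallyIntegrable_conv hF.abs hFm.norm) hc.abs
      (hs.comp_left (g := fun x : ℝ => |x|) abs_zero)
    refine this.congr (Eventually.of_forall fun p => ?_)
    simp only [conv, norm_mul, integral_mul_const, Real.norm_eq_abs]
  have e1 : ∀ p, conv k F p * ψ p = ∫ q, k (p - q) * F q * ψ p ∂(muG T) := fun p =>
    (integral_mul_const _ _).symm
  simp_rw [e1]
  rw [integral_integral_swap hi]
  refine integral_congr_ae (Eventually.of_forall fun q => ?_)
  simp only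
  rw [← integral_const_mul, ← integral_add_right_eq_self _ q]
  refine integral_congr_ae (Eventually.of_forall fun p => ?_)
  simp only [add_sub_cancel_right]
  ring

/-- Weak derivatives of convolutions. -/
lemma PKern.isWeakPartialG_conv {k' : G T → ℝ} (hk : PKern k) (hk' : PKern k') {j : Fin 3}
    (hw : IsWeakPartialG T j k k') (hF : MemF F) (hFm : StronglyMeasurable F) :
    IsWeakPartialG T j (conv k F) (conv k' F) := by
  refine ⟨hk.locallyIntegrable_conv hF hFm, hk'.locallyIntegrable_conv hF hFm, fun φ hφ => ?_⟩
  rw [hk.integral_conv_mul hF hFm (hφ.pdx j).continuous (hφ.pdx j).2,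
    hk'.integral_conv_mul hF hFm hφ.continuous hφ.2, ← integral_neg]
  refine integral_congr_ae (Eventually.of_forall fun q => ?_)
  have := hw.2.2 _ (hφ.comp_add q)
  rw [pdx_comp_add] at this
  simp only [this, mul_neg]

/-- Time means of convolutions. -/
lemma PKern.ae_mean_conv (hk : PKern k) (hF : MemF F) (hFm : StronglyMeasurable F) :
    ∀ᵐ x : E3, Integrable (fun y => TPNS.mean k (x - y) * TPNS.mean F y) ∧
      TPNS.mean (conv k F) x = ∫ y, TPNS.mean k (x - y) * TPNS.mean F y ∧
      Integrable (fun q : G T => TPNS.mean k (x - q.2) * F q) (muG T) ∧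
      ∫ q : G T, TPNS.mean k (x - q.2) * F q ∂(muG T) = ∫ y, TPNS.mean k (x - y) * TPNS.mean F y := by
  filter_upwards [hk.ae_mass_lt_top hF hFm] with x hx
  have hm : StronglyMeasurable fun z : AddCircle T × G T => k ((z.1, x) - z.2) * F z.2 :=
    (measurable_conv_kernel hk.meas hFm).comp_measurable
      (by fun_prop : Measurable fun z : AddCircle T × G T => ((z.1, x), z.2))
  have hi : Integrable (fun z : AddCircle T × G T => k ((z.1, x) - z.2) * F z.2)
      ((AddCircle.haarAddCircle (T := T)).prod (muG T)) := by
    refine ⟨hm.aestronglyMeasurable, ?_⟩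
    rw [hasFiniteIntegral_iff_enorm, lintegral_prod _ hm.enorm.aemeasurable]
    exact hx
  have e : ∀ q : G T, ∫ τ, k ((τ, x) - q) * F q ∂(AddCircle.haarAddCircle (T := T)) =
      TPNS.mean k (x - q.2) * F q := by
    intro q
    rw [integral_mul_const]
    congr 1
    exact integral_sub_right_eq_self (fun τ => k (τ, x - q.2)) q.1
  have i1 : Integrable (fun q : G T => TPNS.mean k (x - q.2) * F q) (muG T) := by
    have := hi.integral_prod_right
    simpa only [e] using this
  have i1' : Integrable (fun q : G T => TPNS.mean k (x - q.2) * F q)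
      ((AddCircle.haarAddCircle (T := T)).prod (volume : Measure E3)) := i1
  have e2 : ∀ y : E3, ∫ σ, TPNS.mean k (x - y) * F (σ, y) ∂(AddCircle.haarAddCircle (T := T)) =
      TPNS.mean k (x - y) * TPNS.mean F y := fun y => integral_const_mul _ _
  have i2 : Integrable (fun y => TPNS.mean k (x - y) * TPNS.mean F y) := by
    have := i1'.integral_prod_right
    simpa only [e2] using this
  have e3 : ∫ q : G T, TPNS.mean k (x - q.2) * F q ∂(muG T) = ∫ y, TPNS.mean k (x - y) * TPNS.mean F y := by
    unfold muG
    rw [integral_prod_symm _ i1']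
    simp only [e2]
  refine ⟨i2, ?_, i1, e3⟩
  rw [← e3]
  have := integral_integral_swap (f := fun (τ : AddCircle T) (q : G T) => k ((τ, x) - q) * F q) hi
  simp only [e] at this
  exact this

/-- Convolution of the purely periodic parts. -/
lemma PKern.ae_conv_perp (hk : PKern k) (hF : MemF F) (hFm : StronglyMeasurable F) :
    ∀ᵐ p ∂(muG T), Integrable (fun q => (k (p - q) - TPNS.mean k (p - q).2) * (F q - TPNS.mean F q.2)) (muG T) ∧
      ∫ q, (k (p - q) - TPNS.mean k (p - q).2) * (F q - TPNS.mean F q.2) ∂(muG T) =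
        conv k F p - ∫ y, TPNS.mean k (p.2 - y) * TPNS.mean F y := by
  have hFm' : StronglyMeasurable fun q : G T => TPNS.mean F q.2 :=
    (stronglyMeasurable_mean hFm).comp_measurable measurable_snd
  filter_upwards [hk.ae_integrable_conv hF hFm, hk.ae_integrable_conv (memF_mean hF) hFm',
    ae_snd (T := T) (hk.ae_mean_conv hF hFm)] with p i1 i3 hx
  obtain ⟨i0, -, i2, e2⟩ := hx
  have i4 : Integrable (fun q : G T => TPNS.mean k (p.2 - q.2) * TPNS.mean F q.2) (muG T) := i0.comp_snd _
  have e4 : ∫ q : G T, TPNS.mean k (p.2 - q.2) * TPNS.mean F q.2 ∂(muG T) =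
      ∫ y, TPNS.mean k (p.2 - y) * TPNS.mean F y := by
    have i4' : Integrable (fun q : G T => TPNS.mean k (p.2 - q.2) * TPNS.mean F q.2)
      ((AddCircle.haarAddCircle (T := T)).prod (volume : Measure E3)) := i4
    unfold muG
    rw [integral_prod_symm _ i4']
    simp
  have e3 : ∫ q : G T, k (p - q) * TPNS.mean F q.2 ∂(muG T) = ∫ y, TPNS.mean k (p.2 - y) * TPNS.mean F y := by
    have i3' : Integrable (fun q : G T => k (p - q) * TPNS.mean F q.2)
      ((AddCircle.haarAddCircle (T := T)).prod (volume : Measure E3)) := i3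
    unfold muG
    rw [integral_prod_symm _ i3']
    refine integral_congr_ae (Eventually.of_forall fun y => ?_)
    simp only
    rw [integral_mul_const]
    congr 1
    exact integral_sub_left_eq_self (fun τ => k (τ, p.2 - y)) _ p.1
  have es : ∀ q : G T, (k (p - q) - TPNS.mean k (p - q).2) * (F q - TPNS.mean F q.2) =
      (k (p - q) * F q - TPNS.mean k (p.2 - q.2) * F q) -
        (k (p - q) * TPNS.mean F q.2 - TPNS.mean k (p.2 - q.2) * TPNS.mean F q.2) := by
    intro q; rw [Prod.snd_sub]; ring
  simp_rw [es]
  have i12 : Integrable (fun q : G T => k (p - q) * F q - TPNS.mean k (p.2 - q.2) * F q) (muG T) := i1.sub i2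
  have i34 : Integrable (fun q : G T => k (p - q) * TPNS.mean F q.2 -
      TPNS.mean k (p.2 - q.2) * TPNS.mean F q.2) (muG T) := i3.sub i4
  refine ⟨i12.sub i34, ?_⟩
  rw [integral_sub i12 i34, integral_sub i1 i2, integral_sub i3 i4, e2, e3, e4, sub_self, sub_zero]
  rfl

end Convolution


/-! ### Representation of weak solutions -/

section Representation

variable {T : ℝ} [hT : Fact (0 < T)] {lam : ℝ}

lemma pdx_lapG {g : G T → ℝ} (h : IsTestG T g) (j : Fin 3) : pdx j (lapG g) = lapG (pdx j g) := by
  have := pdx_sum Finset.univ (φ := fun l => pdx l (pdx l g)) (fun l _ => (h.pdx l).pdx l) j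
  refine this.trans ?_
  ext p
  refine Finset.sum_congr rfl fun l _ => ?_
  rw [pdx_comm (h.pdx l) j l, pdx_comm h j l]

lemma pdt_lapG {g : G T → ℝ} (h : IsTestG T g) : pdt (lapG g) = lapG (pdt g) := by
  have := pdt_sum Finset.univ (φ := fun l => pdx l (pdx l g)) (fun l _ => (h.pdx l).pdx l)
  refine this.trans ?_
  ext p
  refine Finset.sum_congr rfl fun l _ => ?_
  rw [pdt_pdx_comm (h.pdx l) l, pdt_pdx_comm h l]

lemma lapG_sub {φ ψ : G T → ℝ} (h : IsTestG T φ) (h' : IsTestG T ψ) :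
    lapG (fun q => φ q - ψ q) = fun p => lapG φ p - lapG ψ p := by
  ext p
  unfold lapG
  rw [← Finset.sum_sub_distrib]
  refine Finset.sum_congr rfl fun l _ => ?_
  rw [pdx_sub h h', pdx_sub (h.pdx l) (h'.pdx l)]

lemma lapG_const_mul {φ : G T → ℝ} (h : IsTestG T φ) (c : ℝ) :
    lapG (fun q => c * φ q) = fun p => c * lapG φ p := by
  ext p
  unfold lapG
  rw [Finset.mul_sum]
  refine Finset.sum_congr rfl fun l _ => ?_
  rw [pdx_const_mul h, pdx_const_mul (h.pdx l)]

lemma adjOp_sub {φ ψ : G T → ℝ} (h : IsTestG T φ) (h' : IsTestG T ψ) :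
    adjOp lam (fun q => φ q - ψ q) = fun p => adjOp lam φ p - adjOp lam ψ p := by
  ext p
  unfold adjOp
  rw [pdt_sub h h', pdx_sub h h', lapG_sub h h']
  ring

lemma adjOp_const_mul {φ : G T → ℝ} (h : IsTestG T φ) (c : ℝ) :
    adjOp lam (fun q => c * φ q) = fun p => c * adjOp lam φ p := by
  ext p
  unfold adjOp
  rw [pdt_const_mul h, pdx_const_mul h, lapG_const_mul h]
  ring

lemma pdx_adjOp {g : G T → ℝ} (h : IsTestG T g) (j : Fin 3) :
    pdx j (adjOp lam g) = adjOp lam (pdx j g) := by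
  have e : adjOp lam g = fun p => (lam * pdx 0 g p - lapG g p) - pdt g p := by
    ext p; unfold adjOp; ring
  rw [e, pdx_sub (((h.pdx 0).const_mul lam).sub h.lapG) h.pdt, pdx_sub ((h.pdx 0).const_mul lam) h.lapG,
    pdx_const_mul (h.pdx 0), pdx_lapG h, ← pdt_pdx_comm h, pdx_comm h j 0]
  ext p; unfold adjOp; ring

lemma adjOp_lapG {g : G T → ℝ} (h : IsTestG T g) : adjOp lam (lapG g) = lapG (adjOp lam g) := by
  have e : adjOp lam g = fun p => (lam * pdx 0 g p - lapG g p) - pdt g p := by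
    ext p; unfold adjOp; ring
  rw [e, lapG_sub (((h.pdx 0).const_mul lam).sub h.lapG) h.pdt, lapG_sub ((h.pdx 0).const_mul lam) h.lapG,
    lapG_const_mul (h.pdx 0), ← pdx_lapG h, ← pdt_lapG h]
  ext p; unfold adjOp; ring

lemma lapG_comp_add (φ : G T → ℝ) (q : G T) : lapG (fun p => φ (p + q)) = fun p => lapG φ (p + q) := by
  ext p
  unfold lapG
  refine Finset.sum_congr rfl fun l _ => ?_
  rw [pdx_comp_add, pdx_comp_add]

lemma adjOp_comp_add (φ : G T → ℝ) (q : G T) :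
    adjOp lam (fun p => φ (p + q)) = fun p => adjOp lam φ (p + q) := by
  ext p
  unfold adjOp
  rw [pdx_comp_add, pdt_comp_add, lapG_comp_add]

/-- The solenoidal test field with components `δ_{il} Δ g - ∂_i ∂_l g`. -/
def solTest (g : G T → ℝ) (i l : Fin 3) (p : G T) : ℝ := kron i l * lapG g p - pdx i (pdx l g) p

lemma IsTestG.solTest {g : G T → ℝ} (h : IsTestG T g) (i l : Fin 3) : IsTestG T (solTest g i l) :=
  (h.lapG.const_mul _).sub ((h.pdx l).pdx i)

lemma sum_kron_mul (i : Fin 3) (a : Fin 3 → ℝ) : ∑ l, kron i l * a l = a i := by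
  simp [kron]

lemma sum_pdx_solTest {g : G T → ℝ} (h : IsTestG T g) (i : Fin 3) (p : G T) :
    ∑ l, pdx l (solTest g i l) p = 0 := by
  have e : ∀ l, pdx l (solTest g i l) p = kron i l * pdx l (lapG g) p - pdx i (pdx l (pdx l g)) p := by
    intro l
    have := congrFun (pdx_sub (h.lapG.const_mul (kron i l)) ((h.pdx l).pdx i) l) p
    rw [pdx_const_mul h.lapG, pdx_comm (h.pdx l) l i] at this
    exact this
  simp_rw [e]
  rw [Finset.sum_sub_distrib, sum_kron_mul i fun l => pdx l (lapG g) p]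
  have := congrFun (pdx_sum Finset.univ (φ := fun l => pdx l (pdx l g)) (fun l _ => (h.pdx l).pdx l) i) p
  rw [← this]
  exact sub_self _

/-- The derivative ∂_l is brought outermost on purpose: summed over l against a solenoidal field,
that term vanishes by `WeakField.sum_integral_grad`. -/
lemma adjOp_solTest {g : G T → ℝ} (h : IsTestG T g) (i l : Fin 3) (p : G T) :
    adjOp lam (solTest g i l) p = kron i l * lapG (adjOp lam g) p - pdx l (pdx i (adjOp lam g)) p := by
  have := congrFun (adjOp_sub (lam := lam) (h.lapG.const_mul (kron i l)) ((h.pdx l).pdx i)) p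
  rw [adjOp_const_mul h.lapG, adjOp_lapG h, pdx_comm h i l, ← pdx_adjOp (h.pdx i), ← pdx_adjOp h,
    ← pdx_comm h i l] at this
  exact this

/-- The tensor `∂_j u_l` and the fields `u_l` of a weak solution, in components. -/
structure WeakField (lam : ℝ) (f U : Fin 3 → G T → ℝ) (D : Fin 3 → Fin 3 → G T → ℝ) : Prop where
  force : ∀ l, LocallyIntegrable (f l) (muG T)
  partial_eq : ∀ j l, IsWeakPartialG T j (U l) (D j l)
  memA : ∀ l, MemA (U l)
  memLp : ∀ j l, MemLp (D j l) 2 (muG T)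
  div_eq_zero : ∀ᵐ p ∂(muG T), ∑ j, D j j p = 0
  weak : ∀ φ : Fin 3 → G T → ℝ, (∀ l, IsTestG T (φ l)) → (∀ p, ∑ l, pdx l (φ l) p = 0) →
    ∫ p, (-(∑ l, U l p * pdt (φ l) p) + (∑ l, ∑ j, D j l p * pdx j (φ l) p)
        - lam * (∑ l, D 0 l p * φ l p) + ∑ l, (∑ j, U j p * D j l p) * φ l p) ∂(muG T)
      = ∫ p, ∑ l, f l p * φ l p ∂(muG T)

variable {f U : Fin 3 → G T → ℝ} {D : Fin 3 → Fin 3 → G T → ℝ}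

/-- The components of `f - curl u ∧ u`. -/
def rotForce (f U : Fin 3 → G T → ℝ) (D : Fin 3 → Fin 3 → G T → ℝ) (l : Fin 3) (p : G T) : ℝ :=
  f l p - ∑ j, U j p * (D j l p - D l j p)

lemma WeakField.locallyIntegrable (h : WeakField lam f U D) (l : Fin 3) : LocallyIntegrable (U l) (muG T) :=
  (h.partial_eq 0 l).1

lemma WeakField.locallyIntegrable_mul (h : WeakField lam f U D) (i j l : Fin 3) :
    LocallyIntegrable (fun p => U i p * D j l p) (muG T) :=
  ((h.memA i).mul_memF (h.memLp j l)).locallyIntegrable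

lemma WeakField.locallyIntegrable_sq (h : WeakField lam f U D) (j l : Fin 3) :
    LocallyIntegrable (fun p => D j l p ^ 2) (muG T) :=
  (h.memLp j l).integrable_sq.locallyIntegrable

lemma WeakField.sum_integral_grad (h : WeakField lam f U D) {ψ : G T → ℝ} (hψ : IsTestG T ψ) :
    ∑ l, ∫ p, U l p * pdx l ψ p ∂(muG T) = 0 := by
  have e : ∀ l, ∫ p, U l p * pdx l ψ p ∂(muG T) = -∫ p, D l l p * ψ p ∂(muG T) := fun l =>
    (h.partial_eq l l).2.2 ψ hψ
  simp_rw [e]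
  rw [Finset.sum_neg_distrib, ← integral_finsetSum _ fun l _ =>
    LocallyIntegrable.mul_test (h.partial_eq l l).2.1 hψ.continuous hψ.2]
  rw [integral_congr_ae (g := fun _ => 0), integral_zero, neg_zero]
  filter_upwards [h.div_eq_zero] with p hp
  rw [← Finset.sum_mul, hp, zero_mul]

/-- Here U_j ∂_l U_j is half of ∂_l(U_j²), so the sum over l and j is a gradient tested with a
solenoidal field. This is the difference between u·∇u and curl u ∧ u. -/
lemma WeakField.sum_integral_transport (h : WeakField lam f U D) {φ : Fin 3 → G T → ℝ}
    (hφ : ∀ l, IsTestG T (φ l)) (hdiv : ∀ p, ∑ l, pdx l (φ l) p = 0) :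
    ∑ l, ∑ j, ∫ p, U j p * D l j p * φ l p ∂(muG T) = 0 := by
  have e : ∀ l j, ∫ p, U j p * D l j p * φ l p ∂(muG T) = -(1 / 2) * ∫ p, U j p ^ 2 * pdx l (φ l) p ∂(muG T) := by
    intro l j
    rw [(h.partial_eq l j).integral_mul_self' (h.memA j).locallyIntegrable_sq (h.locallyIntegrable_sq l j) (hφ l)]
    ring
  simp_rw [e]
  rw [Finset.sum_comm]
  refine Finset.sum_eq_zero fun j _ => ?_
  rw [← Finset.mul_sum, ← integral_finsetSum _ fun l _ =>
    LocallyIntegrable.mul_test (h.memA j).locallyIntegrable_sq ((hφ l).pdx l).continuous ((hφ l).pdx l).2]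
  simp_rw [← Finset.mul_sum, hdiv, mul_zero, integral_zero, mul_zero]

lemma integral_mul_adjOp {g : G T → ℝ} (hg : LocallyIntegrable g (muG T)) {φ : G T → ℝ} (hφ : IsTestG T φ) :
    ∫ p, g p * adjOp lam φ p ∂(muG T) = -(∫ p, g p * pdt φ p ∂(muG T))
      - (∑ j, ∫ p, g p * pdx j (pdx j φ) p ∂(muG T)) + lam * ∫ p, g p * pdx 0 φ p ∂(muG T) := by
  have i1 := LocallyIntegrable.mul_test hg hφ.pdt.continuous hφ.pdt.2
  have i2 := fun j => LocallyIntegrable.mul_test hg ((hφ.pdx j).pdx j).continuous ((hφ.pdx j).pdx j).2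
  have i3 := LocallyIntegrable.mul_test hg (hφ.pdx 0).continuous (hφ.pdx 0).2
  have i1' : Integrable (fun p => -(g p * pdt φ p)) (muG T) := i1.neg
  have i2' : Integrable (fun p => ∑ j, g p * pdx j (pdx j φ) p) (muG T) := integrable_finsetSum _ fun j _ => i2 j
  have i3' : Integrable (fun p => lam * (g p * pdx 0 φ p)) (muG T) := i3.const_mul lam
  have i12 : Integrable (fun p => -(g p * pdt φ p) - ∑ j, g p * pdx j (pdx j φ) p) (muG T) := i1'.sub i2'
  have e : ∀ p, g p * adjOp lam φ p =
      -(g p * pdt φ p) - (∑ j, g p * pdx j (pdx j φ) p) + lam * (g p * pdx 0 φ p) := by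
    intro p
    unfold adjOp lapG
    rw [← Finset.mul_sum]
    ring
  simp_rw [e]
  rw [integral_add i12 i3', integral_sub i1' i2', integral_neg, integral_const_mul, integral_finsetSum _ fun j _ => i2 j]

/-- The weak formulation, with all derivatives on the test field. -/
lemma WeakField.sum_integral_adjOp (h : WeakField lam f U D) {φ : Fin 3 → G T → ℝ}
    (hφ : ∀ l, IsTestG T (φ l)) (hdiv : ∀ p, ∑ l, pdx l (φ l) p = 0) :
    ∑ l, ∫ p, U l p * adjOp lam (φ l) p ∂(muG T) = ∑ l, ∫ p, rotForce f U D l p * φ l p ∂(muG T) := by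
  have hw := h.weak φ hφ hdiv
  have ia := fun l => LocallyIntegrable.mul_test (h.locallyIntegrable l) (hφ l).pdt.continuous (hφ l).pdt.2
  have ib := fun l j => LocallyIntegrable.mul_test (h.partial_eq j l).2.1 ((hφ l).pdx j).continuous ((hφ l).pdx j).2
  have ic := fun l => LocallyIntegrable.mul_test (h.partial_eq 0 l).2.1 (hφ l).continuous (hφ l).2
  have inn := fun l j => LocallyIntegrable.mul_test (h.locallyIntegrable_mul j j l) (hφ l).continuous (hφ l).2
  have im := fun l j => LocallyIntegrable.mul_test (h.locallyIntegrable_mul j l j) (hφ l).continuous (hφ l).2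
  have iF := fun l => LocallyIntegrable.mul_test (h.force l) (hφ l).continuous (hφ l).2
  have ja : Integrable (fun p => -∑ l, U l p * pdt (φ l) p) (muG T) := (integrable_finsetSum _ fun l _ => ia l).neg
  have jb : Integrable (fun p => ∑ l, ∑ j, D j l p * pdx j (φ l) p) (muG T) :=
    integrable_finsetSum _ fun l _ => integrable_finsetSum _ fun j _ => ib l j
  have jc : Integrable (fun p => lam * ∑ l, D 0 l p * φ l p) (muG T) :=
    (integrable_finsetSum _ fun l _ => ic l).const_mul lam
  have jn : Integrable (fun p => ∑ l, ∑ j, U j p * D j l p * φ l p) (muG T) :=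
    integrable_finsetSum _ fun l _ => integrable_finsetSum _ fun j _ => inn l j
  have jab : Integrable (fun p => -(∑ l, U l p * pdt (φ l) p) + ∑ l, ∑ j, D j l p * pdx j (φ l) p) (muG T) :=
    ja.add jb
  have jabc : Integrable (fun p => -(∑ l, U l p * pdt (φ l) p) + (∑ l, ∑ j, D j l p * pdx j (φ l) p)
    - lam * ∑ l, D 0 l p * φ l p) (muG T) := jab.sub jc
  simp_rw [Finset.sum_mul] at hw
  rw [integral_add jabc jn, integral_sub jab jc, integral_add ja jb, integral_neg, integral_const_mul,
    integral_finsetSum _ fun l _ => ia l, integral_finsetSum _ fun l _ => ic l,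
    integral_finsetSum _ fun l _ => iF l,
    integral_finsetSum _ fun l _ => integrable_finsetSum _ fun j _ => ib l j,
    integral_finsetSum _ fun l _ => integrable_finsetSum _ fun j _ => inn l j] at hw
  simp_rw [integral_finsetSum _ fun j _ => ib _ j, integral_finsetSum _ fun j _ => inn _ j] at hw
  have eb : ∀ l j, ∫ p, D j l p * pdx j (φ l) p ∂(muG T) = -∫ p, U l p * pdx j (pdx j (φ l)) p ∂(muG T) :=
    fun l j => by rw [(h.partial_eq j l).2.2 _ ((hφ l).pdx j), neg_neg]
  have ec : ∀ l, ∫ p, D 0 l p * φ l p ∂(muG T) = -∫ p, U l p * pdx 0 (φ l) p ∂(muG T) :=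
    fun l => by rw [(h.partial_eq 0 l).2.2 _ (hφ l), neg_neg]
  simp_rw [eb, ec] at hw
  have er : ∀ l, ∫ p, rotForce f U D l p * φ l p ∂(muG T) = (∫ p, f l p * φ l p ∂(muG T)) -
      (∑ j, ∫ p, U j p * D j l p * φ l p ∂(muG T)) + ∑ j, ∫ p, U j p * D l j p * φ l p ∂(muG T) := by
    intro l
    have jn : Integrable (fun p => ∑ j, U j p * D j l p * φ l p) (muG T) := integrable_finsetSum _ fun j _ => inn l j
    have jm : Integrable (fun p => ∑ j, U j p * D l j p * φ l p) (muG T) := integrable_finsetSum _ fun j _ => im l j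
    have jfn : Integrable (fun p => f l p * φ l p - ∑ j, U j p * D j l p * φ l p) (muG T) := (iF l).sub jn
    rw [← integral_finsetSum _ fun j _ => inn l j, ← integral_finsetSum _ fun j _ => im l j,
      ← integral_sub (iF l) jn, ← integral_add jfn jm]
    refine integral_congr_ae (Eventually.of_forall fun p => ?_)
    simp only [rotForce, Fin.sum_univ_three]
    ring
  simp_rw [er, integral_mul_adjOp (h.locallyIntegrable _) (hφ _)]
  have ht := h.sum_integral_transport hφ hdiv
  simp only [Finset.sum_add_distrib, Finset.sum_sub_distrib, Finset.sum_neg_distrib, ← Finset.mul_sum, ht] at hw ⊢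
  linarith

/-- Apply the weak formulation to the solenoidal field with components (δ_il Δ - ∂_i∂_l)g. On the
left its second part is a gradient and disappears since div U = 0, so the single component U_i is
isolated. -/
lemma WeakField.integral_lapG_adjOp (h : WeakField lam f U D) {g : G T → ℝ} (hg : IsTestG T g) (i : Fin 3) :
    ∫ p, U i p * lapG (adjOp lam g) p ∂(muG T) = ∑ l, ∫ p, rotForce f U D l p * solTest g i l p ∂(muG T) := by
  rw [← h.sum_integral_adjOp (fun l => hg.solTest i l) (sum_pdx_solTest hg i)]
  have hψ := hg.adjOp lam
  have i1 := fun l => LocallyIntegrable.mul_test (h.locallyIntegrable l) hψ.lapG.continuous hψ.lapG.2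
  have i2 := fun l => LocallyIntegrable.mul_test (h.locallyIntegrable l) ((hψ.pdx i).pdx l).continuous ((hψ.pdx i).pdx l).2
  have e : ∀ l, ∫ p, U l p * adjOp lam (solTest g i l) p ∂(muG T) =
      kron i l * (∫ p, U l p * lapG (adjOp lam g) p ∂(muG T)) - ∫ p, U l p * pdx l (pdx i (adjOp lam g)) p ∂(muG T) := by
    intro l
    rw [← integral_const_mul, ← integral_sub ((i1 l).const_mul _) (i2 l)]
    refine integral_congr_ae (Eventually.of_forall fun p => ?_)
    simp only [adjOp_solTest hg]
    ring
  simp_rw [e]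
  rw [Finset.sum_sub_distrib, h.sum_integral_grad (hψ.pdx i), sub_zero,
    sum_kron_mul i fun l => ∫ p, U l p * lapG (adjOp lam g) p ∂(muG T)]

/-- The fundamental solution property `integral_per_vel_adj`, applied to every translate of g. The
right side matches that of `WeakField.integral_lapG_adjOp`. -/
lemma integral_conv_vel (hlam : 0 < lam) {F : G T → ℝ} (hF : MemF F) (hFm : StronglyMeasurable F)
    {g : G T → ℝ} (hg : IsTestG T g) (i l : Fin 3) :
    ∫ p, conv (per T lam (velKern i l)) F p * lapG (adjOp lam g) p ∂(muG T) =
      ∫ p, F p * solTest g i l p ∂(muG T) := by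
  have hψ := (hg.adjOp lam).lapG
  rw [((kern_vel i l).pKern hlam).integral_conv_mul hF hFm hψ.continuous hψ.2]
  refine integral_congr_ae (Eventually.of_forall fun q => ?_)
  simp only
  have := integral_per_vel_adj hlam (hg.comp_add q) i l
  rw [adjOp_comp_add, lapG_comp_add, lapG_comp_add, pdx_comp_add, pdx_comp_add] at this
  rw [this]
  simp [solTest]

/-- A weak solution is the convolution of the velocity fundamental solution with its rotational force. -/
theorem WeakField.ae_eq_sum_conv (hlam : 0 < lam) (h : WeakField lam f U D) {F : Fin 3 → G T → ℝ}
    (hF : ∀ l, MemF (F l)) (hFm : ∀ l, StronglyMeasurable (F l))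
    (he : ∀ l, rotForce f U D l =ᵐ[muG T] F l) (i : Fin 3) :
    U i =ᵐ[muG T] fun p => ∑ l, conv (per T lam (velKern i l)) (F l) p := by
  have hk := fun l => (kern_vel i l).pKern (T := T) hlam
  have hc := fun l => (hk l).locallyIntegrable_conv (hF l) (hFm l)
  have hcm := fun l => stronglyMeasurable_conv (hk l).meas (hFm l)
  have hS : LocallyIntegrable (fun p => ∑ l, conv (per T lam (velKern i l)) (F l) p) (muG T) := by
    simp only [Fin.sum_univ_three]
    exact ((hc 0).add (hc 1)).add (hc 2)
  have hD : LocallyIntegrable (fun p => U i p - ∑ l, conv (per T lam (velKern i l)) (F l) p) (muG T) :=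
    (h.locallyIntegrable i).sub hS
  have hmass := fun l => aemeasurable_time (T := T) (hcm l).aestronglyMeasurable.enorm
  -- The field vanishes on average by its L⁶ integrability in space, the convolutions by
  -- `PKern.vanishAvg`.
  have hv : VanishAvg fun x => ∫⁻ τ, ‖U i (τ, x) - ∑ l, conv (per T lam (velKern i l)) (F l) (τ, x)‖ₑ
      ∂(AddCircle.haarAddCircle (T := T)) := by
    have h0 := (hk 0).vanishAvg (hF 0) (hFm 0)
    have h1 := (hk 1).vanishAvg (hF 1) (hFm 1)
    have h2 := (hk 2).vanishAvg (hF 2) (hFm 2)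
    have hall := (((h.memA i).vanishAvg.add h0 (aemeasurable_time (h.memA i).meas.enorm)).add h1
      ((aemeasurable_time (h.memA i).meas.enorm).add (hmass 0))).add h2
      (((aemeasurable_time (h.memA i).meas.enorm).add (hmass 0)).add (hmass 1))
    refine hall.mono ?_
    filter_upwards [ae_aemeasurable_time (h.memA i).meas.enorm,
      ae_aemeasurable_time (T := T) (hcm 0).aestronglyMeasurable.enorm,
      ae_aemeasurable_time (T := T) (hcm 1).aestronglyMeasurable.enorm] with x m0 m1 m2
    have m01 : AEMeasurable (fun τ => ‖U i (τ, x)‖ₑ + ‖conv (per T lam (velKern i 0)) (F 0) (τ, x)‖ₑ)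
      (AddCircle.haarAddCircle (T := T)) := m0.add m1
    have m012 : AEMeasurable (fun τ => ‖U i (τ, x)‖ₑ + ‖conv (per T lam (velKern i 0)) (F 0) (τ, x)‖ₑ +
      ‖conv (per T lam (velKern i 1)) (F 1) (τ, x)‖ₑ) (AddCircle.haarAddCircle (T := T)) := m01.add m2
    rw [← lintegral_add_left' m0, ← lintegral_add_left' m01, ← lintegral_add_left' m012]
    refine lintegral_mono fun τ => ?_
    rw [Fin.sum_univ_three]
    calc _ ≤ ‖U i (τ, x)‖ₑ + ‖_ + _ + _‖ₑ := enorm_sub_le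
      _ ≤ ‖U i (τ, x)‖ₑ + (‖_‖ₑ + ‖_‖ₑ + ‖_‖ₑ) :=
        add_le_add le_rfl ((enorm_add_le _ _).trans (add_le_add (enorm_add_le _ _) le_rfl))
      _ = _ := by rw [← add_assoc, ← add_assoc]
  have := liouvilleG (lam := lam) hD hv fun g hg => by
    have hψ := (hg.adjOp lam).lapG
    have i1 := LocallyIntegrable.mul_test (h.locallyIntegrable i) hψ.continuous hψ.2
    have i2 := fun l => LocallyIntegrable.mul_test (hc l) hψ.continuous hψ.2
    simp_rw [sub_mul, Finset.sum_mul]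
    rw [integral_sub i1 (integrable_finsetSum _ fun l _ => i2 l), integral_finsetSum _ fun l _ => i2 l,
      h.integral_lapG_adjOp hg i, sub_eq_zero]
    refine Finset.sum_congr rfl fun l _ => ?_
    rw [integral_conv_vel hlam (hF l) (hFm l) hg]
    exact integral_congr_ae ((he l).mono fun p hp => by simp only [hp])
  filter_upwards [this] with p hp
  exact sub_eq_zero.1 hp

lemma WeakField.memF_rotForce (h : WeakField lam f U D) (hf : ∀ l, MemF (f l)) (l : Fin 3) :
    MemF (rotForce f U D l) :=
  (hf l).sub (MemF.sum Finset.univ fun j => (h.memA j).mul_memF ((h.memLp j l).sub (h.memLp l j)))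

lemma enorm_apply_le (x : E3) (i : Fin 3) : ‖x i‖ₑ ≤ ‖x‖ₑ := by
  rw [enorm_le_iff_norm_le]
  exact PiLp.norm_apply_le x i

lemma locallyIntegrable_apply {X : Type*} [TopologicalSpace X] [MeasurableSpace X] {μ : Measure X} {f : X → E3}
    (hf : LocallyIntegrable f μ) (l : Fin 3) : LocallyIntegrable (fun p => f p l) μ := fun x => by
  obtain ⟨s, hs, hi⟩ := hf x
  exact ⟨s, hs, (EuclideanSpace.proj l : E3 →L[ℝ] ℝ).integrable_comp hi⟩

/-- The components of a weak solution. -/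
lemma IsWeakSolution.weakField {f u : G T → E3} (hu : IsWeakSolution T lam f u) :
    WeakField lam (fun l p => f p l) (fun l p => u p l) (fun j l => wpdG T j fun p => u p l) where
  force l := locallyIntegrable_apply hu.locallyIntegrable_force l
  partial_eq j l := by
    obtain ⟨h, hh⟩ := hu.weaklyDiff l j
    exact hh.wpdG_eq.1
  memA l := by
    refine memA_of_L2L6 (((EuclideanSpace.proj l : E3 →L[ℝ] ℝ).continuous).comp_aestronglyMeasurable
      hu.locallyIntegrable.aestronglyMeasurable) (lt_of_le_of_lt (lintegral_mono fun t => ?_) hu.memLp_L2L6)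
    gcongr
    exact eLpNorm_mono_enorm fun x => enorm_apply_le _ _
  memLp j l := (hu.memLp_grad j).continuousLinearMap_comp (EuclideanSpace.proj l : E3 →L[ℝ] ℝ)
  div_eq_zero := hu.div_eq_zero
  weak φ hφ hdiv := hu.weak_formulation (fun p => WithLp.toLp 2 fun l => φ l p) ⟨hφ, hdiv⟩

end Representation


/-! ### Splitting into steady and purely periodic parts -/

section Splitting

variable {T : ℝ} [hT : Fact (0 < T)] {lam : ℝ}

lemma mean_congr {g h : G T → ℝ} (e : g =ᵐ[muG T] h) : mean g =ᵐ[volume] mean h :=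
  (ae_time_of_ae e).mono fun _ hx => integral_congr_ae hx

/-- `kf`, `ks`, `kp` are versions of `k`, of its time mean, and of its purely periodic part. -/
structure Split (k kf : G T → ℝ) (ks : E3 → ℝ) (kp : G T → ℝ) : Prop where
  loc : LocallyIntegrable k (muG T)
  full : kf =ᵐ[muG T] k
  steady : ks =ᵐ[volume] mean k
  periodic : kp =ᵐ[muG T] fun p => k p - mean k p.2

variable {k k' kf kf' kp kp' : G T → ℝ} {ks ks' : E3 → ℝ} {j : Fin 3}

lemma Split.weakPartial (s : Split k kf ks kp) (hw : IsWeakPartialG T j k k') :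
    IsWeakPartialG T j kf k' ∧ IsWeakPartialE j ks (mean k') ∧
      IsWeakPartialG T j kp (fun p => k' p - mean k' p.2) :=
  ⟨hw.congr s.full.symm .rfl, hw.mean.congr s.steady.symm .rfl,
    (hw.sub hw.mean.comp_snd).congr s.periodic.symm .rfl⟩

lemma Split.wpd (s : Split k kf ks kp) (hw : IsWeakPartialG T j k k') :
    Split k' (wpdG T j kf) (wpdE j ks) (wpdG T j kp) :=
  ⟨hw.2.1, (s.weakPartial hw).1.wpdG_eq.2, (s.weakPartial hw).2.1.wpdE_eq.2, (s.weakPartial hw).2.2.wpdG_eq.2⟩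

lemma Split.sub (s : Split k kf ks kp) (s' : Split k' kf' ks' kp') :
    Split (fun p => k p - k' p) (fun p => kf p - kf' p) (fun x => ks x - ks' x) (fun p => kp p - kp' p) := by
  have hm : mean (fun p => k p - k' p) =ᵐ[volume] fun x => mean k x - mean k' x := by
    filter_upwards [ae_integrable_time s.loc, ae_integrable_time s'.loc] with x h1 h2 using integral_sub h1 h2
  refine ⟨s.loc.sub s'.loc, s.full.sub s'.full, (s.steady.sub s'.steady).trans hm.symm, ?_⟩
  filter_upwards [s.periodic, s'.periodic, ae_snd (T := T) hm] with p h1 h2 h3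
  rw [h1, h2, h3]; ring

lemma Split.const_mul (s : Split k kf ks kp) (c : ℝ) :
    Split (fun p => c * k p) (fun p => c * kf p) (fun x => c * ks x) (fun p => c * kp p) := by
  have hm : mean (fun p => c * k p) = fun x => c * mean k x := funext fun x => integral_const_mul _ _
  refine ⟨s.loc.smul c, s.full.mono fun p hp => by simp only [hp],
    s.steady.mono fun x hx => by simp only [hx, hm], s.periodic.mono fun p hp => ?_⟩
  simp only [hp, hm]; ring

lemma Split.congr (s : Split k kf ks kp) (e : k =ᵐ[muG T] k') (ef : kf' =ᵐ[muG T] kf)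
    (es : ks' =ᵐ[volume] ks) (ep : kp' =ᵐ[muG T] kp) : Split k' kf' ks' kp' := by
  have hm := mean_congr e
  refine ⟨s.loc.congr e, (ef.trans s.full).trans e, (es.trans s.steady).trans hm, ?_⟩
  filter_upwards [ep, s.periodic, e, ae_snd (T := T) hm] with p h1 h2 h3 h4
  rw [h1, h2, h3, h4]

/-- At fixed x the means are constants, so the product of the purely periodic parts expands into
terms that are integrable in time as soon as the full product is. Cross terms between mean and
purely periodic part average to zero. -/
lemma Split.ae_mean_mul (s : Split k kf ks kp) (s' : Split k' kf' ks' kp')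
    (hl : LocallyIntegrable (fun p => k p * k' p) (muG T)) :
    ∀ᵐ x, Integrable (fun τ => kp (τ, x) * kp' (τ, x)) (AddCircle.haarAddCircle (T := T)) ∧
      mean (fun p => k p * k' p) x = ks x * ks' x + mean (fun p => kp p * kp' p) x := by
  filter_upwards [ae_integrable_time s.loc, ae_integrable_time s'.loc, ae_integrable_time hl, s.steady, s'.steady,
    ae_time_of_ae s.periodic, ae_time_of_ae s'.periodic] with x i1 i2 i3 e1 e2 e3 e4
  have e : (fun τ => kp (τ, x) * kp' (τ, x)) =ᵐ[AddCircle.haarAddCircle (T := T)]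
      fun τ => (k (τ, x) * k' (τ, x) - mean k x * k' (τ, x)) - (mean k' x * k (τ, x) - mean k x * mean k' x) := by
    filter_upwards [e3, e4] with τ h3 h4
    rw [h3, h4]; ring
  have j1 := i2.const_mul (mean k x)
  have j2 := i1.const_mul (mean k' x)
  have j3 : Integrable (fun _ : AddCircle T => mean k x * mean k' x) (AddCircle.haarAddCircle (T := T)) :=
    integrable_const _
  have j13 : Integrable (fun τ => k (τ, x) * k' (τ, x) - mean k x * k' (τ, x))
    (AddCircle.haarAddCircle (T := T)) := i3.sub j1
  have j23 : Integrable (fun τ => mean k' x * k (τ, x) - mean k x * mean k' x)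
    (AddCircle.haarAddCircle (T := T)) := j2.sub j3
  refine ⟨(j13.sub j23).congr e.symm, ?_⟩
  have : mean (fun p => kp p * kp' p) x = mean (fun p => k p * k' p) x - mean k x * mean k' x := by
    refine (integral_congr_ae e).trans ?_
    rw [integral_sub j13 j23, integral_sub i3 j1, integral_sub j2 j3, integral_const_mul, integral_const_mul]
    simp only [integral_const, probReal_univ, one_smul]
    unfold mean
    ring
  rw [this, e1, e2]; ring

lemma Split.mul (s : Split k kf ks kp) (s' : Split k' kf' ks' kp')
    (hl : LocallyIntegrable (fun p => k p * k' p) (muG T)) :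
    Split (fun p => k p * k' p) (fun p => kf p * kf' p) (fun x => ks x * ks' x + mean (fun p => kp p * kp' p) x)
      (fun p => ks p.2 * kp' p + kp p * ks' p.2 + (kp p * kp' p - mean (fun p => kp p * kp' p) p.2)) := by
  have hm := s.ae_mean_mul s' hl
  refine ⟨hl, s.full.mul s'.full, hm.mono fun x hx => hx.2.symm, ?_⟩
  filter_upwards [ae_snd (T := T) hm, s.periodic, s'.periodic, ae_snd (T := T) s.steady,
    ae_snd (T := T) s'.steady] with p h1 h2 h3 h4 h5
  rw [h1.2, h2, h3, h4, h5]; ring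

lemma steady_apply {g : G T → E3} {x : E3}
    (hg : ∀ i, Integrable (fun τ => g (τ, x) i) (AddCircle.haarAddCircle (T := T))) (i : Fin 3) :
    steady T g x i = mean (fun p => g p i) x := eval_integral_piLp hg i

lemma split_field {g : G T → E3} (hg : ∀ i, LocallyIntegrable (fun p => g p i) (muG T)) (i : Fin 3) :
    Split (fun p => g p i) (fun p => g p i) (fun x => steady T g x i) (fun p => periodic T g p i) := by
  have hs : (fun x => steady T g x i) =ᵐ[volume] mean fun p => g p i := by
    filter_upwards [ae_all_iff.2 fun l => ae_integrable_time (hg l)] with x hx using steady_apply hx i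
  refine ⟨hg i, .rfl, hs, ?_⟩
  filter_upwards [ae_snd (T := T) hs] with p hp
  rw [← hp]; rfl

/-! ### Convolution identities for the split functions -/

lemma eqConv_of_components {X : Type*} [AddGroup X] [MeasurableSpace X] {μ : Measure X}
    (hq : ∀ p : X, Measure.QuasiMeasurePreserving (fun q => p - q) μ μ) {h g : X → E3}
    {K : X → Matrix (Fin 3) (Fin 3) ℝ} {K' : Fin 3 → Fin 3 → X → ℝ} {g' : Fin 3 → X → ℝ}
    (hK : ∀ i l, (fun p => K p i l) =ᵐ[μ] K' i l) (hg : ∀ l, (fun p => g p l) =ᵐ[μ] g' l)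
    (H : ∀ᵐ p ∂μ, ∀ i, (∀ l, Integrable (fun q => K' i l (p - q) * g' l q) μ) ∧
      h p i = ∑ l, ∫ q, K' i l (p - q) * g' l q ∂μ) : EqConv μ h K g := by
  filter_upwards [H] with p hp
  have e : ∀ i l, (fun q => K (p - q) i l * g q l) =ᵐ[μ] fun q => K' i l (p - q) * g' l q := fun i l => by
    filter_upwards [(hq p).ae (hK i l), hg l] with q h1 h2
    rw [h1, h2]
  have hI : ∀ i l, Integrable (fun q => K (p - q) i l * g q l) μ := fun i l => ((hp i).1 l).congr (e i l).symm
  refine ⟨hI, ?_⟩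
  ext i
  have hI' : ∀ i, Integrable (fun q => (WithLp.toLp 2 ((K (p - q)).mulVec (g q).ofLp) : E3) i) μ := fun i =>
    integrable_finsetSum Finset.univ fun l _ => hI i l
  rw [eval_integral_piLp hI', (hp i).2]
  refine Eq.trans ?_ (integral_finsetSum Finset.univ fun l _ => hI i l).symm
  exact Finset.sum_congr rfl fun l _ => (integral_congr_ae (e i l)).symm

lemma quasiMeasurePreserving_sub_left_muG (p : G T) :
    Measure.QuasiMeasurePreserving (fun q => p - q) (muG T) (muG T) := by
  have : (muG T).IsAddLeftInvariant := by unfold muG; infer_instance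
  have : SFinite (muG T) := by unfold muG; infer_instance
  exact quasiMeasurePreserving_sub_left (muG T) p

/-- Taking the time mean of h = K ∗ F gives the steady identity, as means convolve to means;
subtracting it gives the purely periodic one. It is used for the fields, for each of their
derivatives and for the curl. -/
theorem eqConv_of_split {h F : Fin 3 → G T → ℝ} {K : Fin 3 → Fin 3 → G T → ℝ} (hK : ∀ i l, PKern (K i l))
    (hF : ∀ l, MemF (F l)) (hFm : ∀ l, StronglyMeasurable (F l))
    (hrep : ∀ i, h i =ᵐ[muG T] fun p => ∑ l, conv (K i l) (F l) p)
    {hf hp Ff Fp : G T → E3} {hs Fs : E3 → E3} {Kf Kp : G T → Matrix (Fin 3) (Fin 3) ℝ}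
    {Ks : E3 → Matrix (Fin 3) (Fin 3) ℝ}
    (sh : ∀ i, Split (h i) (fun p => hf p i) (fun x => hs x i) (fun p => hp p i))
    (sK : ∀ i l, Split (K i l) (fun p => Kf p i l) (fun x => Ks x i l) (fun p => Kp p i l))
    (sF : ∀ l, Split (F l) (fun p => Ff p l) (fun x => Fs x l) (fun p => Fp p l)) :
    EqConv (muG T) hf Kf Ff ∧ EqConv volume hs Ks Fs ∧ EqConv (muG T) hp Kp Fp := by
  have hc := fun i l => (hK i l).locallyIntegrable_conv (hF l) (hFm l)
  have hmean : ∀ᵐ x, ∀ i, mean (h i) x = ∑ l, ∫ y, mean (K i l) (x - y) * mean (F l) y := by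
    filter_upwards [ae_all_iff.2 fun i => mean_congr (hrep i),
      ae_all_iff.2 fun i => ae_all_iff.2 fun l => ae_integrable_time (hc i l),
      ae_all_iff.2 fun i => ae_all_iff.2 fun l => (hK i l).ae_mean_conv (hF l) (hFm l)] with x h1 h2 h3 i
    rw [h1 i]
    refine (integral_finsetSum Finset.univ fun l _ => h2 i l).trans ?_
    exact Finset.sum_congr rfl fun l _ => (h3 i l).2.1
  refine ⟨?_, ?_, ?_⟩
  · refine eqConv_of_components quasiMeasurePreserving_sub_left_muG (fun i l => (sK i l).full) (fun l => (sF l).full) ?_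
    filter_upwards [ae_all_iff.2 fun i => (sh i).full, ae_all_iff.2 hrep,
      ae_all_iff.2 fun i => ae_all_iff.2 fun l => (hK i l).ae_integrable_conv (hF l) (hFm l)] with p h1 h2 h3 i
    exact ⟨h3 i, (h1 i).trans (h2 i)⟩
  · refine eqConv_of_components (quasiMeasurePreserving_sub_left volume) (fun i l => (sK i l).steady)
      (fun l => (sF l).steady) ?_
    filter_upwards [ae_all_iff.2 fun i => (sh i).steady, hmean,
      ae_all_iff.2 fun i => ae_all_iff.2 fun l => (hK i l).ae_mean_conv (hF l) (hFm l)] with x h1 h2 h3 i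
    exact ⟨fun l => (h3 i l).1, (h1 i).trans (h2 i)⟩
  · refine eqConv_of_components quasiMeasurePreserving_sub_left_muG (fun i l => (sK i l).periodic)
      (fun l => (sF l).periodic) ?_
    filter_upwards [ae_all_iff.2 fun i => (sh i).periodic, ae_all_iff.2 hrep, ae_snd (T := T) hmean,
      ae_all_iff.2 fun i => ae_all_iff.2 fun l => (hK i l).ae_conv_perp (hF l) (hFm l)] with p h1 h2 h3 h4 i
    refine ⟨fun l => (h4 i l).1, ?_⟩
    rw [h1 i, h2 i, h3 i, ← Finset.sum_sub_distrib]
    exact Finset.sum_congr rfl fun l _ => (h4 i l).2.symm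

/-- The matrix of the linear map `b ↦ a ∧ b`. -/
def crossMat (a : E3) : Matrix (Fin 3) (Fin 3) ℝ :=
  Matrix.of fun i l => kron (i + 2) l * a (i + 1) - kron (i + 1) l * a (i + 2)

/-- Addition of indices in `Fin 3` is cyclic, so one formula covers all components; the curl is
written the same way. -/
lemma wedge_apply (a b : E3) (i : Fin 3) : wedge a b i = a (i + 1) * b (i + 2) - a (i + 2) * b (i + 1) := by
  fin_cases i <;> simp [wedge, cross_apply]

lemma wedge_eq_mulVec (a b : E3) : wedge a b = WithLp.toLp 2 ((crossMat a).mulVec b.ofLp) := by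
  ext i
  rw [wedge_apply]
  fin_cases i <;> simp [crossMat, Matrix.mulVec, dotProduct, Fin.sum_univ_three, kron] <;> ring

lemma EqConv.eqCrossConv {X : Type*} [AddGroup X] [MeasurableSpace X] {μ : Measure X} {h k g : X → E3}
    (H : EqConv μ h (fun p => crossMat (k p)) g) : EqCrossConv μ h k g := by
  filter_upwards [H] with p hp
  simp only [wedge_eq_mulVec]
  exact ⟨Integrable.of_eval_piLp fun i => integrable_finsetSum Finset.univ fun l _ => hp.1 i l, hp.2⟩

/-! ### The fundamental solutions -/

/-- The sum over periods need not converge at every point, so additivity is established by testing,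
where absolute convergence is available after unfolding. -/
lemma Kern.per_add {k k' : ℝ → E3 → ℝ} (h : Kern k) (h' : Kern k') (hlam : 0 < lam) :
    per T lam (fun t y => k t y + k' t y) =ᵐ[muG T] fun p => per T lam k p + per T lam k' p := by
  refine ae_eq_of_tests_G ((h.add h').locallyIntegrable_per hlam)
    ((h.locallyIntegrable_per hlam).add (h'.locallyIntegrable_per hlam)) fun φ hφ => ?_
  have i1 := LocallyIntegrable.mul_test (h.locallyIntegrable_per (T := T) hlam) hφ.continuous hφ.2
  have i2 := LocallyIntegrable.mul_test (h'.locallyIntegrable_per (T := T) hlam) hφ.continuous hφ.2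
  have j1 := h.integrable_unfold hlam hφ.continuous hφ.2
  have j2 := h'.integrable_unfold hlam hφ.continuous hφ.2
  have j3 := (h.add h').integrable_unfold hlam hφ.continuous hφ.2
  simp_rw [add_mul]
  rw [integral_add i1 i2, (h.add h').integral_per_mul hlam hφ.continuous hφ.2,
    h.integral_per_mul hlam hφ.continuous hφ.2, h'.integral_per_mul hlam hφ.continuous hφ.2,
    ← integral_prod _ j1, ← integral_prod _ j2, ← integral_prod _ j3, ← integral_add j1 j2]
  refine integral_congr_ae (Eventually.of_forall fun q => ?_)
  simp only [trn, add_mul]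

lemma per_velKernD (hlam : 0 < lam) (a j l : Fin 3) : per T lam (velKernD a j l) =ᵐ[muG T]
    fun p => kron j l * per T lam (heatD1 a) p + per T lam (thetaD a j l) p := by
  refine (((kern_heatD1 a).const_mul (kron j l)).per_add (kern_thetaD a j l) hlam).trans
    (Eventually.of_forall fun p => ?_)
  simp only [per, trn]
  rw [integral_const_mul]

/-- The symmetry of third derivatives of the heat kernel; it makes the pressure part of the velocity
kernel drop out of the curl. -/
lemma thetaD_swap (a j l : Fin 3) : thetaD a j l = thetaD j a l := by
  unfold thetaD
  congr 1
  ext s y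
  unfold heatD3 kron
  simp only [eq_comm (a := a) (b := j)]
  ring

/-- Here the three given fundamental solutions are recognized: Γ_⊥ by its Fourier multiplier, Γ_0 by
the Liouville argument, and their sum as the full periodized kernel. -/
lemma split_vel (hlam : 0 < lam) (j l : Fin 3) : Split (per T lam (velKern j l))
    (fun p => velFund T lam p j l) (fun x => velSteady lam x j l) (fun p => velPeriodic T lam p j l) := by
  have hm := (kern_vel j l).mean_per (T := T) hlam
  have hp : (fun p => velPeriodic T lam p j l) =ᵐ[muG T] _ := (isInvFourierG_vel hlam j l).invFourierG_eq.2
  have hs := velSteady_ae_eq_stat hlam j l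
  refine ⟨(kern_vel j l).locallyIntegrable_per hlam, ?_, hs.trans hm.symm, ?_⟩
  · filter_upwards [hp, ae_snd (T := T) hs] with p h1 h2
    simp only [velFund, Matrix.add_apply]
    rw [h1, h2]; ring
  · filter_upwards [hp, ae_snd (T := T) hm] with p h1 h2
    rw [h1, h2]

lemma split_vort (hlam : 0 < lam) :
    Split (per T lam heat) (vortFund T lam) (vortSteady lam) (vortPeriodic T lam) := by
  have hm := kern_heat.mean_per (T := T) hlam
  have hp : vortPeriodic T lam =ᵐ[muG T] _ := (isInvFourierG_vort hlam).invFourierG_eq.2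
  have hs : vortSteady lam =ᵐ[volume] stat lam heat := ae_ne_zero.mono fun x hx => vortSteady_eq_stat hlam hx
  refine ⟨kern_heat.locallyIntegrable_per hlam, ?_, hs.trans hm.symm, ?_⟩
  · filter_upwards [hp, ae_snd (T := T) hs] with p h1 h2
    simp only [vortFund]
    rw [h1, h2]; ring
  · filter_upwards [hp, ae_snd (T := T) hm] with p h1 h2
    rw [h1, h2]

lemma isWeakPartialG_per_vel (hlam : 0 < lam) (a j l : Fin 3) :
    IsWeakPartialG T a (per T lam (velKern j l)) (per T lam (velKernD a j l)) :=
  (kern_vel j l).isWeakPartialG (kern_velD a j l) hlam fun _ ht y => hasLineDerivAt_velKern a j l ht y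

lemma isWeakPartialG_per_heat (hlam : 0 < lam) (a : Fin 3) :
    IsWeakPartialG T a (per T lam heat) (per T lam (heatD1 a)) :=
  kern_heat.isWeakPartialG (kern_heatD1 a) hlam fun _ ht y => hasLineDerivAt_heat a ht y

lemma fundSolWellDefined (hlam : 0 < lam) : FundSolWellDefined T lam := by
  have h1 := fun j l a => (split_vel (T := T) hlam j l).weakPartial (isWeakPartialG_per_vel hlam a j l)
  have h2 := fun a => (split_vort (T := T) hlam).weakPartial (isWeakPartialG_per_heat hlam a)
  exact ⟨fun j l => (isInvFourierG_vel hlam j l).invFourierG_eq.1, (isInvFourierG_vort hlam).invFourierG_eq.1,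
    fun j l a => ⟨_, (h1 j l a).2.1⟩, fun j l a => ⟨_, (h1 j l a).2.2⟩, fun j l a => ⟨_, (h1 j l a).1⟩,
    fun a => ⟨_, (h2 a).2.1⟩, fun a => ⟨_, (h2 a).2.2⟩, fun a => ⟨_, (h2 a).1⟩⟩

/-! ### Weak solutions -/

lemma curlG_apply (u : G T → E3) (p : G T) (i : Fin 3) : curlG T u p i =
    wpdG T (i + 1) (fun q => u q (i + 2)) p - wpdG T (i + 2) (fun q => u q (i + 1)) p := by
  fin_cases i <;> rfl

lemma curlE_apply (v : E3 → E3) (x : E3) (i : Fin 3) : curlE v x i =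
    wpdE (i + 1) (fun q => v q (i + 2)) x - wpdE (i + 2) (fun q => v q (i + 1)) x := by
  fin_cases i <;> rfl

variable {f u : G T → E3}

/-- The components of `f - curl u ∧ u`. -/
abbrev IsWeakSolution.force (_ : IsWeakSolution T lam f u) : Fin 3 → G T → ℝ :=
  rotForce (fun l p => f p l) (fun l p => u p l) (fun j l => wpdG T j fun p => u p l)

lemma IsWeakSolution.force_eq (hu : IsWeakSolution T lam f u) (l : Fin 3) (p : G T) :
    hu.force l p = f p l - (curlG T u p (l + 1) * u p (l + 2) - curlG T u p (l + 2) * u p (l + 1)) := by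
  simp only [rotForce, Fin.sum_univ_three, curlG_apply]
  fin_cases l <;> simp <;> ring

lemma IsWeakSolution.split (hu : IsWeakSolution T lam f u) (i : Fin 3) : Split (fun p => u p i)
    (fun p => u p i) (fun x => steady T u x i) (fun p => periodic T u p i) :=
  split_field (locallyIntegrable_apply hu.locallyIntegrable) i

lemma IsWeakSolution.split_wpd (hu : IsWeakSolution T lam f u) (j i : Fin 3) :
    Split (wpdG T j fun p => u p i) (fun p => wpdVecG T j u p i) (fun x => wpdVecE j (steady T u) x i)
      (fun p => wpdVecG T j (periodic T u) p i) :=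
  (hu.split i).wpd (hu.weakField.partial_eq j i)

lemma IsWeakSolution.split_curl (hu : IsWeakSolution T lam f u) (i : Fin 3) : Split (fun p => curlG T u p i)
    (fun p => curlG T u p i) (fun x => curlE (steady T u) x i) (fun p => curlG T (periodic T u) p i) := by
  simp only [curlG_apply, curlE_apply]
  exact (hu.split_wpd (i + 1) (i + 2)).sub (hu.split_wpd (i + 2) (i + 1))

/-- Expanding curl u ∧ u with u = v + w, the products of a mean with a purely periodic field have no
mean, and curl w ∧ w contributes to both parts. This is the product rule `Split.mul`, componentwise.
-/
lemma IsWeakSolution.split_force (hu : IsWeakSolution T lam f u) (l : Fin 3) : Split (hu.force l)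
    (fun p => rhs T f u p l) (fun x => rhsSteady T f (steady T u) (periodic T u) x l)
    (fun p => rhsPeriodic T f (steady T u) (periodic T u) p l) := by
  have hmul : ∀ a b, LocallyIntegrable (fun p => curlG T u p a * u p b) (muG T) := by
    intro a b
    simp only [curlG_apply, mul_comm _ (u _ b)]
    exact ((hu.weakField.memA b).mul_memF ((hu.weakField.memLp _ _).sub (hu.weakField.memLp _ _))).locallyIntegrable
  -- The mean of a vector field is taken as one vector-valued integral; reading off a component
  -- needs integrability of all components at x.
  have hm : ∀ᵐ x, steady T (wedgeFun (curlG T (periodic T u)) (periodic T u)) x l =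
      mean (fun p => curlG T (periodic T u) p (l + 1) * periodic T u p (l + 2)) x -
      mean (fun p => curlG T (periodic T u) p (l + 2) * periodic T u p (l + 1)) x := by
    filter_upwards [ae_all_iff.2 fun a => ae_all_iff.2 fun b =>
      (hu.split_curl a).ae_mean_mul (hu.split b) (hmul a b)] with x hx
    rw [steady_apply fun i => ?_]
    · simp only [wedgeFun, wedge_apply]
      exact integral_sub (hx _ _).1 (hx _ _).1
    · simp only [wedgeFun, wedge_apply]
      exact (hx _ _).1.sub (hx _ _).1
  refine ((split_field (locallyIntegrable_apply hu.locallyIntegrable_force) l).sub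
    (((hu.split_curl (l + 1)).mul (hu.split (l + 2)) (hmul _ _)).sub
      ((hu.split_curl (l + 2)).mul (hu.split (l + 1)) (hmul _ _)))).congr
    (Eventually.of_forall fun p => (hu.force_eq l p).symm) (Eventually.of_forall fun p => ?_) ?_ ?_
  · simp [rhs, wedge_apply]
  · filter_upwards [hm] with x hx
    simp only [rhsSteady, PiLp.sub_apply, hx, wedge_apply]
    ring
  · filter_upwards [ae_snd (T := T) hm] with p hp
    rw [rhsPeriodic, show periodic T (wedgeFun (curlG T (periodic T u)) (periodic T u)) p =
      wedgeFun (curlG T (periodic T u)) (periodic T u) p -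
        steady T (wedgeFun (curlG T (periodic T u)) (periodic T u)) p.2 from rfl]
    simp only [PiLp.sub_apply, hp, wedge_apply, wedgeFun]
    ring

variable {F : Fin 3 → G T → ℝ}

lemma IsWeakSolution.wpd_eq_sum_conv (hlam : 0 < lam) (hu : IsWeakSolution T lam f u) (hF : ∀ l, MemF (F l))
    (hFm : ∀ l, StronglyMeasurable (F l)) (he : ∀ l, hu.force l =ᵐ[muG T] F l) (j i : Fin 3) :
    wpdG T j (fun p => u p i) =ᵐ[muG T] fun p => ∑ l, conv (per T lam (velKernD j i l)) (F l) p := by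
  have hw := fun l => ((kern_vel i l).pKern (T := T) hlam).isWeakPartialG_conv ((kern_velD j i l).pKern hlam)
    (isWeakPartialG_per_vel hlam j i l) (hF l) (hFm l)
  have hs : IsWeakPartialG T j (fun p => ∑ l, conv (per T lam (velKern i l)) (F l) p)
      (fun p => ∑ l, conv (per T lam (velKernD j i l)) (F l) p) := by
    simp only [Fin.sum_univ_three]
    exact ((hw 0).add (hw 1)).add (hw 2)
  exact (hs.congr (hu.weakField.ae_eq_sum_conv hlam hF hFm he i).symm .rfl).wpdG_eq.2

/-- The kernel `b ↦ ∇φ ∧ b` of the vorticity representation. -/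
def curlKern (T : ℝ) [Fact (0 < T)] (lam : ℝ) (i l : Fin 3) (p : G T) : ℝ :=
  kron (i + 2) l * per T lam (heatD1 (i + 1)) p - kron (i + 1) l * per T lam (heatD1 (i + 2)) p

lemma pKern_curlKern (hlam : 0 < lam) (i l : Fin 3) : PKern (curlKern T lam i l) := by
  have h := (((kern_heatD1 (i + 1)).pKern (T := T) hlam).const_mul (kron (i + 2) l)).add
    ((((kern_heatD1 (i + 2)).pKern (T := T) hlam).const_mul (kron (i + 1) l)).const_mul (-1))
  have e : curlKern T lam i l = fun p => kron (i + 2) l * per T lam (heatD1 (i + 1)) p +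
    -1 * (kron (i + 1) l * per T lam (heatD1 (i + 2)) p) := by ext p; unfold curlKern; ring
  rw [e]; exact h

/-- Antisymmetrizing the differentiated velocity kernel cancels the tails `thetaD` by `thetaD_swap`,
and only derivatives of the heat kernel remain. They form the matrix of b ↦ ∇φ ∧ b. -/
lemma IsWeakSolution.curl_eq_sum_conv (hlam : 0 < lam) (hu : IsWeakSolution T lam f u) (hF : ∀ l, MemF (F l))
    (hFm : ∀ l, StronglyMeasurable (F l)) (he : ∀ l, hu.force l =ᵐ[muG T] F l) (i : Fin 3) :
    (fun p => curlG T u p i) =ᵐ[muG T] fun p => ∑ l, conv (curlKern T lam i l) (F l) p := by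
  have hk := fun a j l => (kern_velD a j l).pKern (T := T) hlam
  filter_upwards [hu.wpd_eq_sum_conv hlam hF hFm he (i + 1) (i + 2), hu.wpd_eq_sum_conv hlam hF hFm he (i + 2) (i + 1),
    ae_all_iff.2 fun l => (hk (i + 1) (i + 2) l).ae_integrable_conv (hF l) (hFm l),
    ae_all_iff.2 fun l => (hk (i + 2) (i + 1) l).ae_integrable_conv (hF l) (hFm l)] with p h1 h2 i1 i2
  rw [curlG_apply, h1, h2, ← Finset.sum_sub_distrib]
  refine Finset.sum_congr rfl fun l _ => ?_
  unfold conv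
  rw [← integral_sub (i1 l) (i2 l)]
  have hq := quasiMeasurePreserving_sub_left_muG p
  refine integral_congr_ae ?_
  filter_upwards [hq.ae (per_velKernD hlam (i + 1) (i + 2) l), hq.ae (per_velKernD hlam (i + 2) (i + 1) l)] with q e1 e2
  rw [e1, e2, thetaD_swap (i + 2) (i + 1) l, curlKern]
  ring

end Splitting

end TPNS

end

/-! ### The representation formulas. -/

open TPNS
theorem proposition6p2 (T : ℝ) [Fact (0 < T)] (lam : ℝ) (hlam : 0 < lam)
    (f u : G T → E3)
    (hf : ∀ q : ENNReal, 1 < q → q < ⊤ → MemLp f q (muG T))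
    (hf_supp : ∃ K : Set (G T), IsCompact K ∧ ∀ᵐ p ∂(muG T), p ∉ K → f p = 0)
    (hu : IsWeakSolution T lam f u)
    (hu_int : ∃ r : ENNReal, 5 < r ∧ r < ⊤ ∧ MemLp (periodic T u) r (muG T))
    (v : E3 → E3) (hv : v = steady T u)
    (w : G T → E3) (hw : w = periodic T u) :
    -- all the objects in the formulas are well defined
    FundSolWellDefined T lam ∧
    (∀ i, WeaklyDiffE (fun x => v x i)) ∧
    (∀ i, WeaklyDiffG T (fun p => w p i)) ∧
    -- `D^α u`, `D^α v`, `D^α w` for `α = 0`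
    EqConv (muG T) u (velFund T lam) (rhs T f u) ∧
    EqConv volume v (velSteady lam) (rhsSteady T f v w) ∧
    EqConv (muG T) w (velPeriodic T lam) (rhsPeriodic T f v w) ∧
    -- `D^α u`, `D^α v`, `D^α w` for `α = e_j`
    (∀ j, EqConv (muG T) (wpdVecG T j u) (wpdMatG T j (velFund T lam)) (rhs T f u)) ∧
    (∀ j, EqConv volume (wpdVecE j v) (wpdMatE j (velSteady lam)) (rhsSteady T f v w)) ∧
    (∀ j, EqConv (muG T) (wpdVecG T j w) (wpdMatG T j (velPeriodic T lam))
      (rhsPeriodic T f v w)) ∧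
    -- the vorticity
    EqCrossConv (muG T) (curlG T u) (gradG T (vortFund T lam)) (rhs T f u) ∧
    EqCrossConv volume (curlE v) (gradE (vortSteady lam)) (rhsSteady T f v w) ∧
    EqCrossConv (muG T) (curlG T w) (gradG T (vortPeriodic T lam)) (rhsPeriodic T f v w) := by
  subst hv hw
  have hf' : ∀ l, MemF fun p => f p l := fun l => memF_of_memLp
    ((hf (3 / 2) (by norm_num [ENNReal.lt_div_iff_mul_lt]) (by finiteness)).continuousLinearMap_comp
      (EuclideanSpace.proj l : E3 →L[ℝ] ℝ))
  have hR := hu.weakField.memF_rotForce hf'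
  -- The force is replaced by a strongly measurable version, so that convolutions are measurable;
  -- the original returns through `Split.congr`.
  have he := fun l => (hR l).meas.ae_eq_mk
  have hF := fun l => (hR l).congr (he l)
  have hFm := fun l => (hR l).meas.stronglyMeasurable_mk
  have sF := fun l => (hu.split_force l).congr (he l) .rfl .rfl .rfl
  have h0 := eqConv_of_split (fun i l => (kern_vel i l).pKern hlam) hF hFm
    (hu.weakField.ae_eq_sum_conv hlam hF hFm he) hu.split (split_vel hlam) sF
  have h1 := fun j => eqConv_of_split (Kf := wpdMatG T j (velFund T lam)) (Ks := wpdMatE j (velSteady lam))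
    (Kp := wpdMatG T j (velPeriodic T lam)) (fun i l => (kern_velD j i l).pKern hlam) hF hFm
    (hu.wpd_eq_sum_conv hlam hF hFm he j) (hu.split_wpd j)
    (fun i l => (split_vel hlam i l).wpd (isWeakPartialG_per_vel hlam j i l)) sF
  have sφ := fun a => (split_vort (T := T) hlam).wpd (isWeakPartialG_per_heat hlam a)
  -- Written through `crossMat`, the vector product with ∇φ is a matrix kernel whose entries are the
  -- splitted combinations in `curlKern`, so the vorticity needs no separate argument.
  have h2 := eqConv_of_split (Kf := fun p => crossMat (gradG T (vortFund T lam) p))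
    (Ks := fun x => crossMat (gradE (vortSteady lam) x))
    (Kp := fun p => crossMat (gradG T (vortPeriodic T lam) p)) (pKern_curlKern hlam) hF hFm
    (hu.curl_eq_sum_conv hlam hF hFm he) hu.split_curl
    (fun i l => ((sφ (i + 1)).const_mul (kron (i + 2) l)).sub ((sφ (i + 2)).const_mul (kron (i + 1) l))) sF
  have hw := fun i j => (hu.split i).weakPartial (hu.weakField.partial_eq j i)
  exact ⟨fundSolWellDefined hlam, fun i j => ⟨_, (hw i j).2.1⟩, fun i j => ⟨_, (hw i j).2.2⟩, h0.1, h0.2.1, h0.2.2,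
    fun j => (h1 j).1, fun j => (h1 j).2.1, fun j => (h1 j).2.2, h2.1.eqCrossConv, h2.2.1.eqCrossConv,
    h2.2.2.eqCrossConv⟩
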